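/- We work over $\mathbb{C}$. A partition for $\mathrm{Gr}(k,n)$ is a weakly decreasing sequence of nonnegative integers with first part at most $n-k$ and at most $k$ nonzero parts. A Schubert problem in $\mathrm{Gr}(k,n)$ is a list $\lambda=(\lambda^1,\dots,\lambda^s)$ of partitions for $\mathrm{Gr}(k,n)$ (zero partitions allowed) with $|\lambda^1|+\dots+|\lambda^s|=k(n-k)$. An instance of $\lambda$ in $\mathrm{Gr}(k,V)$, $\dim V=n$, is an $s$-tuple $\mathcal F=(F^1_\bullet,\dots,F^s_\bullet)$ of complete flags in $V$; its set of solutions is $$\Omega_\lambda\mathcal F=\{H\in \mathrm{Gr}(k,V) : \dim(H\cap F^i_{n-k+j-\lambda^i_j})\ge j \text{ for all } i\le s,\ j\le k\}.$$ The Galois group $\mathrm{Gal}_\lambda$ is the Galois group of the Galois closure of $\mathbb{C}(X_\lambda)/\mathbb{C}(\mathbb{F}\ell_n^s)$, where $X_\lambda=\{(H,\mathcal F): H\in\Omega_\lambda\mathcal F\}\to \mathbb{F}\ell_n^s$ is the family of all instances; it is a permutation group of the solutions of the generic instance, taken over an algebraic closure of $\mathbb{C}(\mathbb{F}\ell_n^s)$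 (it is trivial when there are no solutions). "General" means: in some nonempty Zariski open set. Let $\lambda,\mu,\nu$ be Schubert problems in $\mathrm{Gr}(k+a,n+b)$, $\mathrm{Gr}(k,n)$, $\mathrm{Gr}(a,b)$. Then $\lambda$ is fibered over $\mu$ with fiber $\nu$ if to every $\mathcal F$ in a nonempty Zariski open set $U$ of instances of $\lambda$ one can attach a subspace $V\subset\mathbb{C}^{n+b}$ of dimension $n$, an instance $\mathcal E$ of $\mu$ in $\mathrm{Gr}(k,V)$ and, for each $h\in\Omega_\mu\mathcal E$, an instance $\mathcal G(h)$ of $\nu$ in $\mathrm{Gr}(a,\mathbb{C}^{n+b}/V)$, such that: 1. for all $H\in\Omega_\lambda\mathcal F$ we have $H\cap V\in\Omega_\mu\mathcal E$; 2. for all $H\in\Omega_\lambda\mathcal F$, with $h:=H\cap V$, we have $H/h\in\Omega_\nu\mathcal G(h)$, where $H/h$ is regarded as a subspace of $\mathbb{C}^{n+b}/V$; 3. $H\mapsto(h,H/h)$ is a bijection from $\Omega_\lambda\mathcal F$ onto $\{(h,K): h\in\Omega_\mu\mathcal E,\ K\in\Omega_\nu\mathcal G(h)\}$; 4. for every $V$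 of dimension $n$, all general instances $\mathcal E$ of $\mu$ in $\mathrm{Gr}(k,V)$ arise in this way from some $\mathcal F\in U$, and for general $\mathcal E$ and each $h\in\Omega_\mu\mathcal E$, all general instances of $\nu$ in $\mathrm{Gr}(a,\mathbb{C}^{n+b}/V)$ arise as $\mathcal G(h)$ from $\mathcal F\in U$ with this $V$ and $\mathcal E$. **Theorem.** Let $0\le a<b$, $s\ge4$, and let $\nu=(\nu^1,\dots,\nu^s)$ be a Schubert problem in $\mathrm{Gr}(a,b)$. Put $$\lambda=\bigl((b-a+1,\nu^1),\,(b-a+1,\nu^2),\,1^{a+1}+\nu^3,\,1^{a+1}+\nu^4,\,\nu^5,\dots,\nu^s\bigr),$$ where $(c,\nu^i)$ is $\nu^i$ with a first row of length $c$ put on top, $1^{a+1}$ is the partition with $a+1$ parts equal to $1$, and $+$ is the componentwise sum. Then $\lambda$ is a Schubert problem in $\mathrm{Gr}(2+a,4+b)$, and it is fibered over the problem of four lines $\square^4=((1),(1),(1),(1))$ in $\mathrm{Gr}(2,4)$ with fiber $\nu$. Moreover there is a bijection from the solutions of the generic instance of $\lambda$ to the product of the set of solutions of the generic instance of $\nu$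 and $\{1,2\}$ which identifies $\mathrm{Gal}_\lambda$ with a subgroup of the wreath product $\mathrm{Gal}_\nu\wr S_2$. If $\nu$ has a solution in its generic instance, then the projection $\mathrm{Gal}_\lambda\to S_2$ is surjective and its kernel, a subgroup of $\mathrm{Gal}_\nu\times\mathrm{Gal}_\nu$, projects onto each of the two factors. -/

import Mathlib

open Module

noncomputable section

/-! ### Partitions and Schubert problems -/

/-- A weakly decreasing sequence `p 0 ≥ p 1 ≥ ⋯` of natural numbers (the part usually written `p_j`
is `p (j - 1)`) is a partition for `Gr(k, n)` if its first part is at most `n - k` and it has at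
most `k` nonzero parts. -/
def IsPartitionFor (k n : ℕ) (p : ℕ → ℕ) : Prop :=
  Antitone p ∧ p 0 ≤ n - k ∧ p k = 0

/-- A Schubert problem in `Gr(k, n)`: a finite list of partitions for `Gr(k, n)` whose sizes add up
to `k (n - k)`, the dimension of the Grassmannian. Zero partitions are allowed. -/
def IsSchubertProblem (k n : ℕ) {s : ℕ} (lam : Fin s → ℕ → ℕ) : Prop :=
  k ≤ n ∧ (∀ i, IsPartitionFor k n (lam i)) ∧
    ∑ i, ∑ j ∈ Finset.range k, lam i j = k * (n - k)

/-- The partition `(c, p)` obtained by putting a first row of length `c` on top of `p` (for `c` at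
least the first part of `p` this is the decreasing rearrangement of the parts of `(c)` and `p`). -/
def prependRow (c : ℕ) (p : ℕ → ℕ) : ℕ → ℕ
  | 0 => c
  | j + 1 => p j

/-- The partition `1 ^ m = (1, …, 1)` with `m` parts equal to `1`. -/
def onePow (m : ℕ) : ℕ → ℕ := fun j => if j < m then 1 else 0

/-- The problem `□⁴` of four lines in `Gr(2, 4)`. -/
def fourLines : Fin 4 → ℕ → ℕ := fun _ => onePow 1

/-- The list
`((b-a+1, ν¹), (b-a+1, ν²), 1^(a+1) + ν³, 1^(a+1) + ν⁴, ν⁵, …, νˢ)`;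
the list index starts at `0` here. -/
def firstFamily (a b : ℕ) {s : ℕ} (ν : Fin s → ℕ → ℕ) : Fin s → ℕ → ℕ := fun i =>
  if i.val < 2 then prependRow (b - a + 1) (ν i)
  else if i.val < 4 then onePow (a + 1) + ν i
  else ν i

/-! ### Flags and Schubert varieties -/

section Flags

variable (K V : Type*) [Field K] [AddCommGroup V] [Module K V]

/-- A complete flag `F_1 ⊂ F_2 ⊂ ⋯ ⊂ F_n = V` in a vector space of dimension `n`. For convenience
the index runs over `ℕ`; the conditions force `F_0 = 0` and `F_j = V` for `j ≥ n`. -/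
@[ext] structure CompleteFlag where
  /-- the member `F_j` of the flag -/
  space : ℕ → Submodule K V
  mono : Monotone space
  finrank_space : ∀ j ≤ finrank K V, finrank K (space j) = j

variable {K V}

/-- The Schubert variety `Ω_p F ⊆ Gr(k, V)`: all `k`-planes `H` with
`dim (H ∩ F_{n - k + j - p_j}) ≥ j` for `j = 1, …, k` (below `j = i + 1`), where `n = dim V`. -/
def schubertVariety (k : ℕ) (p : ℕ → ℕ) (F : CompleteFlag K V) : Set (Submodule K V) :=
  {H | finrank K H = k ∧
    ∀ i < k, i + 1 ≤ finrank K ↥(H ⊓ F.space (finrank K V - k + (i + 1) - p i))}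

/-- The instance `Ω_λ F = Ω_{λ¹} F¹ ∩ ⋯ ∩ Ω_{λˢ} Fˢ` in `Gr(k, V)`, that is, the fibre over
`F = (F¹, …, Fˢ)` of the incidence variety `{(H, F) | H ∈ Ω_{λⁱ} Fⁱ for all i}`. -/
def schubertInstance (k : ℕ) {s : ℕ} (lam : Fin s → ℕ → ℕ) (F : Fin s → CompleteFlag K V) :
    Set (Submodule K V) :=
  {H | finrank K H = k ∧ ∀ i, H ∈ schubertVariety k (lam i) (F i)}

/-! ### Affine charts of the flag variety -/

/-- Positions strictly below the diagonal of an `m × m` matrix. -/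
abbrev BelowDiag (m : ℕ) : Type := {pq : Fin m × Fin m // pq.2 < pq.1}

/-- The lower unitriangular matrix with given entries below the diagonal. -/
def lowerUnipotent {m : ℕ} (x : BelowDiag m → K) : Matrix (Fin m) (Fin m) K :=
  Matrix.of fun p q => if h : q < p then x ⟨(p, q), h⟩ else if p = q then 1 else 0

/-- The vectors whose coordinates in the basis `e` are the columns of `lowerUnipotent x`. -/
def cellVector {m : ℕ} (e : Basis (Fin m) K V) (x : BelowDiag m → K) (q : Fin m) : V :=
  ∑ p, lowerUnipotent x p q • e p

lemma linearIndependent_cellVector {m : ℕ} (e : Basis (Fin m) K V) (x : BelowDiag m → K) :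
    LinearIndependent K (cellVector e x) := by
  have hM : e.toMatrix (cellVector e x) = lowerUnipotent x := by
    ext p q
    simp [Basis.toMatrix_apply, cellVector, Finsupp.single_apply]
  have hdet : (lowerUnipotent x).det = 1 := by
    rw [Matrix.det_of_isLowerTriangular]
    · simp [lowerUnipotent]
    · intro p q hpq
      have hpq' : p < q := hpq
      simp [lowerUnipotent, hpq'.not_gt, hpq'.ne]
  refine ((Basis.is_basis_iff_det e).2 ?_).1
  rw [Basis.det_apply, hM, hdet]
  exact isUnit_one

/-- The flag with unitriangular coordinates `x` relative to the basis `e`: its `j`-th member is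
spanned by the first `j` of the vectors `cellVector e x`. For fixed `e` this identifies the affine
space of dimension `m (m - 1) / 2` with a dense open cell of the flag variety of `V`, and
these cells, for all bases `e`, cover the flag variety. -/
def cellFlag {m : ℕ} (e : Basis (Fin m) K V) (x : BelowDiag m → K) : CompleteFlag K V where
  space j := Submodule.span K (cellVector e x '' {q | q.val < j})
  mono := fun i j hij => Submodule.span_mono
    (Set.image_mono fun q (hq : q.val < i) => lt_of_lt_of_le hq hij)
  finrank_space := by
    intro j hj
    rw [finrank_eq_card_basis e, Fintype.card_fin] at hj
    have hli := linearIndependent_cellVector e x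
    have hset : cellVector e x '' {q | q.val < j} =
        Set.range (cellVector e x ∘ Fin.castLE hj) := by
      ext v
      constructor
      · rintro ⟨q, hq, rfl⟩
        exact ⟨⟨q.val, hq⟩, rfl⟩
      · rintro ⟨q, rfl⟩
        exact ⟨Fin.castLE hj q, q.isLt, rfl⟩
    rw [hset, finrank_span_eq_card (hli.comp _ (Fin.castLE_injective hj)), Fintype.card_fin]

/-! ### Zariski topology on tuples of flags, and general tuples -/

/-- The principal open subset `p ≠ 0` of the affine chart of `Fℓ(V)^s` given by the bases `e`. -/
def principalOpen {s m : ℕ} (e : Fin s → Basis (Fin m) K V)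
    (p : MvPolynomial (Fin s × BelowDiag m) K) : Set (Fin s → CompleteFlag K V) :=
  {F | ∃ x : Fin s × BelowDiag m → K, MvPolynomial.eval x p ≠ 0 ∧
    F = fun i => cellFlag (e i) fun pq => x (i, pq)}

/-- Zariski open subsets of `Fℓ(V)^s`: unions of principal open subsets of affine charts. (Here
`m` is necessarily the dimension of `V`.) -/
def IsZariskiOpen {s : ℕ} (U : Set (Fin s → CompleteFlag K V)) : Prop :=
  ∀ F ∈ U, ∃ (m : ℕ) (e : Fin s → Basis (Fin m) K V) (p : MvPolynomial (Fin s × BelowDiag m) K),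
    F ∈ principalOpen e p ∧ principalOpen e p ⊆ U

/-- `P` holds for general `s`-tuples of flags: it holds on a nonempty (equivalently, dense) Zariski
open subset of the irreducible variety `Fℓ(V)^s`. -/
def ForGeneralFlags {s : ℕ} (P : (Fin s → CompleteFlag K V) → Prop) : Prop :=
  ∃ U : Set (Fin s → CompleteFlag K V), IsZariskiOpen U ∧ U.Nonempty ∧ ∀ F ∈ U, P F

/-! ### Fibrations of Schubert problems -/

variable (K V) in
/-- The objects attached to an instance of a fibered problem in a vector space `A`: a subspace `V`,
a `t`-tuple `E` of flags in `V`, and, for every subspace `h` of `V`, an `r`-tuple `G h` of flags in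
`A / V`. (Only the `h` which solve the instance given by `E` matter.) -/
structure FibrationDatum (t r : ℕ) where
  /-- the subspace -/
  sub : Submodule K V
  /-- the flags in the subspace -/
  E : Fin t → CompleteFlag K sub
  /-- the flags in the quotient -/
  G : Submodule K sub → Fin r → CompleteFlag K (V ⧸ sub)

/-- The map `H ↦ (h, H / h)` with `h = H ∩ V`; here `h` is regarded as a subspace of `V`, and
`H / h = H / (H ∩ V)` as a subspace of `A / V`. -/
def splitAlong (W : Submodule K V) (H : Submodule K V) : Submodule K W × Submodule K (V ⧸ W) :=
  (H.comap W.subtype, H.map W.mkQ)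

/-- The datum `D` exhibits the solutions of the instance `F` of `lam` as fibered over those of the
instance `D.E` of `mu` in `Gr(k, n)` with fibres the solutions of the instances `D.G h` of `nu` in
`Gr(a, b)`. -/
def FibrationDatum.Exhibits {s t r : ℕ} (k n a : ℕ)
    (lam : Fin s → ℕ → ℕ) (mu : Fin t → ℕ → ℕ) (nu : Fin r → ℕ → ℕ)
    (F : Fin s → CompleteFlag K V) (D : FibrationDatum K V t r) : Prop :=
  finrank K D.sub = n ∧
  (∀ H ∈ schubertInstance (k + a) lam F,
    (splitAlong D.sub H).1 ∈ schubertInstance k mu D.E) ∧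
  (∀ H ∈ schubertInstance (k + a) lam F,
    (splitAlong D.sub H).2 ∈ schubertInstance a nu (D.G (splitAlong D.sub H).1)) ∧
  Set.BijOn (splitAlong D.sub) (schubertInstance (k + a) lam F)
    {q | q.1 ∈ schubertInstance k mu D.E ∧ q.2 ∈ schubertInstance a nu (D.G q.1)}

end Flags

/-- The Schubert problem `lam` in `Gr(k + a, n + b)` is fibered over the Schubert problem `mu` in
`Gr(k, n)` with fibre the Schubert problem `nu` in `Gr(a, b)`: to every instance `F` in a nonempty
Zariski open set `U` is attached a datum `Φ F` which exhibits the fibration of its solutions, such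
that for every `n`-dimensional subspace `V` of `ℂ^(n+b)` general instances `E` of `mu` in
`Gr(k, V)` arise from some `F ∈ U`, and such that for general `E` and every solution `h` of `E`
general instances of `nu` in `Gr(a, ℂ^(n+b) / V)` arise as the instance attached to `h`. -/
def IsFiberedOver {s t r : ℕ} (k n a b : ℕ)
    (lam : Fin s → ℕ → ℕ) (mu : Fin t → ℕ → ℕ) (nu : Fin r → ℕ → ℕ) : Prop :=
  IsSchubertProblem (k + a) (n + b) lam ∧ IsSchubertProblem k n mu ∧ IsSchubertProblem a b nu ∧
  ∃ (U : Set (Fin s → CompleteFlag ℂ (Fin (n + b) → ℂ)))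
    (Φ : (Fin s → CompleteFlag ℂ (Fin (n + b) → ℂ)) →
      FibrationDatum ℂ (Fin (n + b) → ℂ) t r),
    IsZariskiOpen U ∧ U.Nonempty ∧
    (∀ F ∈ U, (Φ F).Exhibits k n a lam mu nu F) ∧
    ∀ V : Submodule ℂ (Fin (n + b) → ℂ), finrank ℂ V = n →
      ForGeneralFlags fun E : Fin t → CompleteFlag ℂ V =>
        (∃ F ∈ U, ∃ G, Φ F = ⟨V, E, G⟩) ∧
        ∀ h ∈ schubertInstance k mu E,
          ForGeneralFlags fun Gh : Fin r → CompleteFlag ℂ ((Fin (n + b) → ℂ) ⧸ V) =>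
            ∃ F ∈ U, ∃ G, Φ F = ⟨V, E, G⟩ ∧ G h = Gh

/-! ### Galois groups of Schubert problems -/

/-- The function field `ℂ(Fℓ_n ^ s)`: rational functions in the coordinates of the dense open cell
of `s`-tuples of flags with unitriangular coordinates relative to the standard basis. -/
abbrev FlagFunctionField (n s : ℕ) : Type :=
  FractionRing (MvPolynomial (Fin s × BelowDiag n) ℂ)

/-- An algebraic closure of the function field of `Fℓ_n ^ s`. -/
abbrev GeometricField (n s : ℕ) : Type := AlgebraicClosure (FlagFunctionField n s)

/-- The generic `s`-tuple of flags (the generic point of `Fℓ_n ^ s`): its unitriangular coordinates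
are the coordinate functions themselves. -/
def genericFlags (n s : ℕ) : Fin s → CompleteFlag (GeometricField n s) (Fin n → GeometricField n s) :=
  fun i => cellFlag (Pi.basisFun (GeometricField n s) (Fin n)) fun pq =>
    algebraMap (FlagFunctionField n s) (GeometricField n s)
      (algebraMap (MvPolynomial (Fin s × BelowDiag n) ℂ) (FlagFunctionField n s)
        (MvPolynomial.X (i, pq)))

/-- The solutions of the generic instance of a Schubert problem: the geometric generic fibre of the
branched cover `π : X_λ → Fℓ_n ^ s` of the Schubert problem. -/
def GenericSolution (k n : ℕ) {s : ℕ} (lam : Fin s → ℕ → ℕ) : Type :=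
  {H : Submodule (GeometricField n s) (Fin n → GeometricField n s) //
    H ∈ schubertInstance k lam (genericFlags n s)}

/-- Application of a field automorphism to the coordinates of the vectors of a subspace. -/
def conjSubspace {K L : Type*} [Field K] [Field L] [Algebra K L] {n : ℕ} (σ : L ≃ₐ[K] L)
    (H : Submodule L (Fin n → L)) : Submodule L (Fin n → L) where
  carrier := {v | (fun i => σ.symm (v i)) ∈ H}
  add_mem' := by
    intro v w hv hw
    have h := H.add_mem hv hw
    simp only [Set.mem_ofPred_eq, Pi.add_apply, map_add]
    exact h
  zero_mem' := by
    simp only [Set.mem_ofPred_eq, Pi.zero_apply, map_zero]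
    exact H.zero_mem
  smul_mem' := by
    intro c v hv
    have h := H.smul_mem (σ.symm c) hv
    simp only [Set.mem_ofPred_eq, Pi.smul_apply, smul_eq_mul, map_mul]
    exact h

/-- The Galois group `Gal_λ` of a Schubert problem, as a permutation group: the Galois group of the
Galois closure of the extension `ℂ(X_λ) / ℂ(Fℓ_n ^ s)`, acting on the solutions of the generic
instance. It consists of the permutations of these solutions that are induced by automorphisms of
an algebraic closure of `ℂ(Fℓ_n ^ s)` over `ℂ(Fℓ_n ^ s)`. Indeed `ℂ(X_λ)` is the field of
definition of a solution `H`, its Galois closure is generated by the fields of definition of the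
conjugates of `H`, which are all the solutions, and restriction of automorphisms to the Galois
closure is surjective. -/
def schubertGaloisGroup (k n : ℕ) {s : ℕ} (lam : Fin s → ℕ → ℕ) :
    Subgroup (Equiv.Perm (GenericSolution k n lam)) where
  carrier := {g | ∃ σ : GeometricField n s ≃ₐ[FlagFunctionField n s] GeometricField n s,
    ∀ H : GenericSolution k n lam, (g H).1 = conjSubspace σ H.1}
  one_mem' := ⟨1, fun _ => rfl⟩
  mul_mem' := by
    rintro g g' ⟨σ, hσ⟩ ⟨τ, hτ⟩
    refine ⟨σ * τ, fun H => ?_⟩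
    rw [Equiv.Perm.mul_apply, hσ, hτ]
    rfl
  inv_mem' := by
    rintro g ⟨σ, hσ⟩
    refine ⟨σ⁻¹, fun H => ?_⟩
    have h := hσ (g⁻¹ H)
    rw [show g (g⁻¹ H) = H from Equiv.apply_symm_apply g H] at h
    rw [h]
    ext v
    change _ ↔ (fun i => σ.symm (σ (v i))) ∈ (g⁻¹ H).1
    simp

/-! ### Wreath products -/

/-- The wreath product `G ≀ H` of permutation groups `G` of `α` and `H` of `β`, as a permutation
group of `α × β`: the elements `((g_y)_y, h)` with `g_y ∈ G`, `h ∈ H`, acting by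
`(x, y) ↦ (g_{h(y)}(x), h(y))`. -/
def wreathProduct {α β : Type*} (G : Subgroup (Equiv.Perm α)) (H : Subgroup (Equiv.Perm β)) :
    Subgroup (Equiv.Perm (α × β)) where
  carrier := {w | ∃ h ∈ H, ∃ g : β → Equiv.Perm α, (∀ y, g y ∈ G) ∧
    ∀ x y, w (x, y) = (g (h y) x, h y)}
  one_mem' := ⟨1, H.one_mem, fun _ => 1, fun _ => G.one_mem, fun _ _ => rfl⟩
  mul_mem' := by
    rintro w w' ⟨h, hh, g, hg, hw⟩ ⟨h', hh', g', hg', hw'⟩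
    refine ⟨h * h', H.mul_mem hh hh', fun y => g y * g' (h⁻¹ y),
      fun y => G.mul_mem (hg _) (hg' _), fun x y => ?_⟩
    simp [hw, hw']
  inv_mem' := by
    rintro w ⟨h, hh, g, hg, hw⟩
    refine ⟨h⁻¹, H.inv_mem hh, fun y => (g (h y))⁻¹, fun y => G.inv_mem (hg _), fun x y => ?_⟩
    rw [Equiv.Perm.inv_eq_iff_eq, hw]
    simp

end

/-! ### The numerical part -/

/-! Let A be the ambient space, of dimension 4 + b. The first rows of the first two partitions say
that H meets the planes F¹_2 and F²_2; row a + 1 of the next two says that H meets F³_{b+2} and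
F⁴_{b+2} in dimension at least a + 1. Put V = F¹_2 + F²_2. In general position V has dimension 4,
the spaces F³_{b+2} and F⁴_{b+2} cut it in planes, and h = H ∩ V is a plane which meets all four
planes: it solves a problem of four lines in V. Since H ∩ F³_{b+2} has codimension at most one in H
and h meets F³_{b+2} in dimension one, H lies in the hyperplane F³_{b+2} + h, and likewise for F⁴.
So H lies in the hull W of h, the intersection of these two hyperplanes. As dim W = b + 2 and V ∩ W
= h, the projection π identifies W / h with A / V, and H is W ∩ π⁻¹(K) for its image K. Each flag
induces on A / V the flag of the images of F_{d+c} ∩ W, with a shift c depending on the flag, and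
what is left of the conditions on H is exactly the condition of ν on K. This is carried by
`isLineSolution_of_mem` and `mem_schubertVariety_iff`.

The general position needed is expressed by one polynomial `genCond` in the vectors of bases adapted
to the flags. The transversals are parametrized by the roots θ of a monic quadratic polynomial, and
conditions at a transversal are made rational by taking their norm from the quadratic extension.
That general E and all G(h) occur is shown by construction: four lines with two transversals are put
in normal form (`exists_isNormalForm`), and flags in k⁴ × (A / V) which induce given flags at one
transversal are obtained by interleaving and shearing (`exists_isRealization`).

For the Galois groups let K be the function field of the tuples of flags in A and L its algebraic
closure. The map from H to the parameter θ of h is equivariant, and θ is not in K because the lines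
specialize to lines without a rational transversal (`transversalPoly_generic_ne_zero`); so the
solutions form two blocks which are exchanged. The flags induced at θ define an embedding κ into L
of the algebraic closure of the function field K₁ belonging to ν (`exists_generic_embedding`). The
solutions over θ correspond to the solutions of the induced instance, and a count of parameters
shows that these are all defined over the image of κ (`exists_isAlgebraic_of_mem_schubertInstance`).

It remains to see that the stabilizer of θ induces the full Galois group of K₁, that is, that K₁ is
algebraically closed in K(θ). The construction of flags with prescribed induced flags also works
over K₁; it gives a place of K(θ) with values in K₁, where the discriminant of θ does not vanish,
and the coordinates of the induced flags give a section of the residue map. An element of K(θ) which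
is algebraic over K₁ belongs to the local ring of this place, and its residue is a root in K₁ of its
minimal polynomial (`exists_algebraMap_eq_of_fixed`). The wreath product then follows formally
(`exists_equiv_of_blocks`). -/

lemma isSchubertProblem_fourLines : IsSchubertProblem 2 4 fourLines := by
  refine ⟨by norm_num, fun i => ⟨?_, by simp [fourLines, onePow], by simp [fourLines, onePow]⟩, ?_⟩
  · intro x y hxy
    simp only [fourLines, onePow]
    split_ifs <;> omega
  · simp [fourLines, onePow]

/-- The cells added to ν number 2 (b - a + 1) + 2 (a + 1) = 2 b + 4, which is (2 + a)(b - a + 2) - a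
(b - a). -/
lemma isSchubertProblem_firstFamily {a b s : ℕ} (hab : a < b) (hs : 4 ≤ s) {ν : Fin s → ℕ → ℕ}
    (hν : IsSchubertProblem a b ν) :
    IsSchubertProblem (2 + a) (4 + b) (firstFamily a b ν) := by
  obtain ⟨-, hp, hsum⟩ := hν
  have ha1 : ∀ i, ν i (a + 1) = 0 := fun i =>
    Nat.eq_zero_of_le_zero ((hp i).2.2 ▸ (hp i).1 (Nat.le_succ a))
  refine ⟨by omega, fun i => ?_, ?_⟩
  · obtain ⟨hm, h0, hk⟩ := hp i
    have hk2 : ν i (2 + a) = 0 := Nat.eq_zero_of_le_zero (hk ▸ hm (by omega))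
    unfold firstFamily
    split_ifs with h1 h2
    · refine ⟨antitone_nat_of_succ_le fun j => ?_, ?_, ?_⟩
      · cases j with
        | zero => simp only [prependRow]; omega
        | succ j => exact hm (Nat.le_succ j)
      · simp only [prependRow]; omega
      · rw [show 2 + a = (a + 1) + 1 by omega]
        exact ha1 i
    · refine ⟨antitone_nat_of_succ_le fun j => ?_, ?_, ?_⟩
      · have : ν i (j + 1) ≤ ν i j := hm (Nat.le_succ j)
        simp only [Pi.add_apply, onePow]
        split_ifs <;> omega
      · simp only [Pi.add_apply, onePow]
        split_ifs <;> omega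
      · simp only [Pi.add_apply, onePow]
        split_ifs <;> omega
    · exact ⟨hm, by omega, hk2⟩
  · have key : ∀ i : Fin s, ∑ j ∈ Finset.range (2 + a), firstFamily a b ν i j =
        ∑ j ∈ Finset.range a, ν i j +
          ((if i.val < 2 then b - a + 1 else 0) + if 2 ≤ i.val ∧ i.val < 4 then a + 1 else 0) := by
      intro i
      have e1 : ∑ j ∈ Finset.range (a + 1), ν i j = ∑ j ∈ Finset.range a, ν i j := by
        rw [Finset.sum_range_succ, (hp i).2.2, add_zero]
      have e2 : ∑ j ∈ Finset.range (2 + a), ν i j = ∑ j ∈ Finset.range a, ν i j := by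
        rw [show 2 + a = a + 1 + 1 by omega, Finset.sum_range_succ, ha1, add_zero, e1]
      unfold firstFamily
      split_ifs with h1 h2 h3 <;> first | omega | skip
      · rw [show 2 + a = a + 1 + 1 by omega, Finset.sum_range_succ']
        simp only [prependRow]
        rw [e1]
      · simp only [Pi.add_apply, Finset.sum_add_distrib, e2, onePow]
        rw [← Finset.sum_filter]
        have : (Finset.range (2 + a)).filter (· < a + 1) = Finset.range (a + 1) := by
          ext x; simp; omega
        rw [this]
        simp [add_comm]
    -- All the added cells sit at the first four indices, so the index set is split as 4 + t.
    obtain ⟨t, rfl⟩ := Nat.exists_eq_add_of_le hs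
    rw [Finset.sum_congr rfl fun i _ => key i, Finset.sum_add_distrib, hsum,
      Fin.sum_univ_add (f := fun i : Fin (4 + t) =>
        ((if i.val < 2 then b - a + 1 else 0) + if 2 ≤ i.val ∧ i.val < 4 then a + 1 else 0))]
    simp only [Fin.sum_univ_four]
    obtain ⟨c, rfl⟩ := Nat.exists_eq_add_of_lt hab
    have e3 : a + c + 1 - a = c + 1 := by omega
    have e4 : 4 + (a + c + 1) - (2 + a) = c + 3 := by omega
    have e5 : ∀ x : Fin t, ¬ (4 + x.val ≤ 1) := fun x => by omega
    simp [e3, e4, e5]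
    ring

/-! ### Complete flags -/

namespace CompleteFlag

variable {K V : Type*} [Field K] [AddCommGroup V] [Module K V]

lemma space_zero [FiniteDimensional K V] (F : CompleteFlag K V) : F.space 0 = ⊥ :=
  Submodule.finrank_eq_zero.1 (F.finrank_space 0 (Nat.zero_le _))

lemma space_top [FiniteDimensional K V] (F : CompleteFlag K V) {j : ℕ} (hj : finrank K V ≤ j) :
    F.space j = ⊤ := by
  refine top_le_iff.1 (le_trans (le_of_eq ?_) (F.mono hj))
  exact (Submodule.eq_top_of_finrank_eq (F.finrank_space _ le_rfl)).symm

lemma ext_of_lt [FiniteDimensional K V] {F F' : CompleteFlag K V}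
    (h : ∀ j < finrank K V, F.space j = F'.space j) : F = F' := by
  ext1
  funext j
  by_cases hj : j < finrank K V
  · exact h j hj
  · rw [F.space_top (not_lt.1 hj), F'.space_top (not_lt.1 hj)]

lemma ext_of_le [FiniteDimensional K V] {F F' : CompleteFlag K V}
    (h : ∀ j < finrank K V, F.space j ≤ F'.space j) : F = F' := by
  refine ext_of_lt fun j hj => Submodule.eq_of_le_of_finrank_eq (h j hj) ?_
  rw [F.finrank_space _ hj.le, F'.finrank_space _ hj.le]

/-- The image of a flag under a linear equivalence. -/
@[simps] def map {W : Type*} [AddCommGroup W] [Module K W] (g : V ≃ₗ[K] W) (F : CompleteFlag K V) :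
    CompleteFlag K W where
  space j := (F.space j).map g.toLinearMap
  mono _ _ h := Submodule.map_mono (F.mono h)
  finrank_space j hj := by
    rw [← g.finrank_eq] at hj
    rw [LinearEquiv.finrank_map_eq g]
    exact F.finrank_space j hj

/-- The flag spanned by the initial segments of a basis. -/
noncomputable def ofBasis {m : ℕ} (e : Basis (Fin m) K V) : CompleteFlag K V := cellFlag e 0

lemma cellVector_zero {m : ℕ} (e : Basis (Fin m) K V) : cellVector e 0 = e := by
  funext q
  have : ∀ p, lowerUnipotent (0 : BelowDiag m → K) p q = if p = q then 1 else 0 := by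
    intro p
    simp only [lowerUnipotent, Matrix.of_apply, Pi.zero_apply]
    split_ifs with h1 h2 <;> first | rfl | exact absurd h2 h1.ne'
  simp [cellVector, this]

lemma ofBasis_space {m : ℕ} (e : Basis (Fin m) K V) (j : ℕ) :
    (ofBasis e).space j = Submodule.span K (e '' {q | q.val < j}) := by
  simp only [ofBasis, cellFlag, cellVector_zero]

lemma mem_ofBasis_space {m : ℕ} (e : Basis (Fin m) K V) (j : ℕ) (x : V) :
    x ∈ (ofBasis e).space j ↔ ∀ q : Fin m, j ≤ q.val → e.repr x q = 0 := by
  rw [ofBasis_space, Basis.mem_span_image]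
  constructor
  · intro h q hq
    by_contra hne
    have := h (Finsupp.mem_support_iff.2 hne)
    simp at this
    omega
  · intro h q hq
    by_contra hne
    simp only [Set.mem_ofPred_eq, not_lt] at hne
    exact (Finsupp.mem_support_iff.1 hq) (h q hne)

/-- The basis consisting of the vectors `cellVector e x`. -/
noncomputable def cellBasis {m : ℕ} (e : Basis (Fin m) K V) (x : BelowDiag m → K) :
    Basis (Fin m) K V :=
  haveI := e.finiteDimensional_of_finite
  basisOfLinearIndependentOfCardEqFinrank' (cellVector e x) (linearIndependent_cellVector e x)
    (by rw [finrank_eq_card_basis e])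

@[simp] lemma coe_cellBasis {m : ℕ} (e : Basis (Fin m) K V) (x : BelowDiag m → K) :
    ⇑(cellBasis e x) = cellVector e x := by
  simp [cellBasis]

lemma cellFlag_eq_ofBasis {m : ℕ} (e : Basis (Fin m) K V) (x : BelowDiag m → K) :
    cellFlag e x = ofBasis (cellBasis e x) := by
  ext1
  funext j
  rw [ofBasis_space, coe_cellBasis]
  rfl

lemma span_eq_space [FiniteDimensional K V] (F : CompleteFlag K V) {m : ℕ} (hm : finrank K V = m)
    (v : Fin m → V) (hv : ∀ q : Fin m, v q ∈ F.space (q + 1)) (hv' : ∀ q : Fin m, v q ∉ F.space q) (j : ℕ)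
    (hj : j ≤ m) : Submodule.span K (v '' {q : Fin m | q.val < j}) = F.space j := by
  induction j with
  | zero => simp [F.space_zero]
  | succ j ih =>
    have hjm : j < m := hj
    have hle : Submodule.span K (v '' {q : Fin m | q.val < j + 1}) ≤ F.space (j + 1) := by
      rw [Submodule.span_le]
      rintro _ ⟨q, hq, rfl⟩
      exact F.mono (Nat.succ_le_of_lt hq) (hv q)
    refine Submodule.eq_of_le_of_finrank_le hle ?_
    rw [F.finrank_space _ (hm ▸ hj), Nat.succ_le_iff]
    have hlt : F.space j < Submodule.span K (v '' {q : Fin m | q.val < j + 1}) := by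
      rw [← ih hjm.le]
      refine lt_of_le_of_ne (Submodule.span_mono (Set.image_mono fun q hq => Nat.lt_succ_of_lt hq))
        fun h => hv' ⟨j, hjm⟩ ?_
      rw [← ih hjm.le, h]
      exact Submodule.subset_span ⟨⟨j, hjm⟩, Nat.lt_succ_self j, rfl⟩
    have := Submodule.finrank_lt_finrank_of_lt hlt
    rwa [F.finrank_space _ (hm ▸ hjm.le)] at this

/-- The adapted vectors can be prescribed one by one; this is what later allows some of them to be
kept off given subspaces. -/
lemma exists_eq_ofBasis_of_notMem [FiniteDimensional K V] (F : CompleteFlag K V) {m : ℕ}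
    (hm : finrank K V = m) (v : Fin m → V) (hv : ∀ q : Fin m, v q ∈ F.space (q + 1))
    (hv' : ∀ q : Fin m, v q ∉ F.space q) : ∃ e : Basis (Fin m) K V, ⇑e = v ∧ F = ofBasis e := by
  have htop : ⊤ ≤ Submodule.span K (Set.range v) := by
    rw [← F.space_top hm.le, ← F.span_eq_space hm v hv hv' m le_rfl]
    exact Submodule.span_mono (Set.image_subset_range _ _)
  refine ⟨basisOfTopLeSpanOfCardEqFinrank v htop (by simp [hm]), by simp, ?_⟩
  refine ext_of_lt fun j hj => ?_
  rw [ofBasis_space, coe_basisOfTopLeSpanOfCardEqFinrank,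
    F.span_eq_space hm v hv hv' j (hm ▸ hj.le)]

lemma exists_mem_notMem [FiniteDimensional K V] (F : CompleteFlag K V) {j : ℕ}
    (hj : j < finrank K V) : ∃ x ∈ F.space (j + 1), x ∉ F.space j := by
  apply SetLike.exists_of_lt
  refine lt_of_le_of_ne (F.mono (Nat.le_succ j)) fun h => ?_
  have := F.finrank_space j hj.le
  rw [h, F.finrank_space _ hj] at this
  omega

lemma exists_eq_ofBasis [FiniteDimensional K V] (F : CompleteFlag K V) {m : ℕ}
    (hm : finrank K V = m) : ∃ e : Basis (Fin m) K V, F = ofBasis e := by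
  choose v hv hv' using fun q : Fin m => F.exists_mem_notMem (q.isLt.trans_eq hm.symm)
  obtain ⟨e, -, he⟩ := F.exists_eq_ofBasis_of_notMem hm v hv hv'
  exact ⟨e, he⟩

lemma ofBasis_mem {m : ℕ} (e : Basis (Fin m) K V) {q : Fin m} {j : ℕ} (h : q.val < j) :
    e q ∈ (ofBasis e).space j := by
  rw [ofBasis_space]
  exact Submodule.subset_span ⟨q, h, rfl⟩

instance [FiniteDimensional K V] : Nonempty (CompleteFlag K V) :=
  ⟨ofBasis (finBasis K V)⟩

end CompleteFlag

/-! ### Dimension counts for subspaces and flags -/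

section Dimension

variable {K V : Type*} [Field K] [AddCommGroup V] [Module K V] [FiniteDimensional K V]

lemma finrank_add_le_finrank_inf (S T P : Submodule K V) (hS : S ≤ P) (hT : T ≤ P) :
    finrank K S + finrank K T ≤ finrank K ↥(S ⊓ T) + finrank K P := by
  rw [← Submodule.finrank_sup_add_finrank_inf_eq, add_comm]
  exact Nat.add_le_add_left (Submodule.finrank_mono (sup_le hS hT)) _

lemma finrank_add_le_finrank_inf' (S T : Submodule K V) :
    finrank K S + finrank K T ≤ finrank K ↥(S ⊓ T) + finrank K V := by
  have := finrank_add_le_finrank_inf S T ⊤ le_top le_top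
  rwa [finrank_top] at this

lemma finrank_map_add_finrank_ker_inf {W : Type*} [AddCommGroup W] [Module K W] (f : V →ₗ[K] W)
    (S : Submodule K V) :
    finrank K ↥(S.map f) + finrank K ↥(LinearMap.ker f ⊓ S) = finrank K S := by
  have h := (f.domRestrict S).finrank_range_add_finrank_ker
  rw [LinearMap.range_domRestrict] at h
  rw [← h]
  congr 1
  rw [LinearMap.ker_domRestrict]
  exact (LinearEquiv.finrank_eq (Submodule.comapSubtypeEquivOfLe (p := LinearMap.ker f ⊓ S) (q := S)
    inf_le_right)).symm.trans (by rw [Submodule.comap_inf,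
      Submodule.comap_subtype_self, inf_top_eq])

/-- F_i has codimension d in F_{i+d}, so passing from one to the other costs at most d dimensions of
the intersection. -/
lemma CompleteFlag.finrank_inf_add_le (F : CompleteFlag K V) (W : Submodule K V) (i d : ℕ)
    (h : i + d ≤ finrank K V) :
    finrank K ↥(F.space (i + d) ⊓ W) ≤ finrank K ↥(F.space i ⊓ W) + d := by
  have h1 := finrank_add_le_finrank_inf (F.space i) (F.space (i + d) ⊓ W) (F.space (i + d))
    (F.mono (Nat.le_add_right _ _)) inf_le_left
  rw [F.finrank_space _ h, F.finrank_space _ (by omega), ← inf_assoc,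
    inf_eq_left.2 (F.mono (Nat.le_add_right i d))] at h1
  omega

end Dimension

/-! ### The geometry of the fibration -/

section Geometry

variable {K A : Type*} [Field K] [AddCommGroup A] [Module K A]

lemma one_le_finrank_inf [FiniteDimensional K A] {S T : Submodule K A} (h : ¬Disjoint S T) :
    1 ≤ finrank K ↥(S ⊓ T) := by
  rw [Nat.one_le_iff_ne_zero, Ne, Submodule.finrank_eq_zero]
  exact fun h' => h (disjoint_iff.2 h')

lemma not_disjoint_of_one_le {S T : Submodule K A} (h : 1 ≤ finrank K ↥(S ⊓ T)) :
    ¬Disjoint S T := by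
  intro h'
  rw [disjoint_iff.1 h', finrank_bot] at h
  omega

lemma Disjoint.finrank_add_le [FiniteDimensional K A] {S T P : Submodule K A} (h : Disjoint S T)
    (hS : S ≤ P) (hT : T ≤ P) : finrank K S + finrank K T ≤ finrank K P := by
  have := finrank_add_le_finrank_inf S T P hS hT
  rwa [disjoint_iff.1 h, finrank_bot, zero_add] at this

lemma Disjoint.finrank_sup [FiniteDimensional K A] {S T : Submodule K A} (h : Disjoint S T) :
    finrank K ↥(S ⊔ T) = finrank K S + finrank K T := by
  rw [← Submodule.finrank_sup_add_finrank_inf_eq, disjoint_iff.1 h, finrank_bot, add_zero]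

variable {s : ℕ} (b : ℕ) (hs : 4 ≤ s) (F : Fin s → CompleteFlag K A)

/-- The span of the two-dimensional members of the first two flags. -/
def lineSpan : Submodule K A := (F (Fin.castLE hs 0)).space 2 ⊔ (F (Fin.castLE hs 1)).space 2

/-- The intersection of the two subspaces spanned by `h` and the `b + 2`-dimensional members of the
third and fourth flags. -/
def hull (h : Submodule K A) : Submodule K A :=
  ((F (Fin.castLE hs 2)).space (b + 2) ⊔ h) ⊓ ((F (Fin.castLE hs 3)).space (b + 2) ⊔ h)

/-- The members of the first four flags which define the problem of four lines are in general
position. -/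
structure IsTransversal : Prop where
  disj01 : Disjoint ((F (Fin.castLE hs 0)).space (b + 2)) ((F (Fin.castLE hs 1)).space 2)
  disj10 : Disjoint ((F (Fin.castLE hs 1)).space (b + 2)) ((F (Fin.castLE hs 0)).space 2)
  disj20 : Disjoint ((F (Fin.castLE hs 2)).space (b + 2)) ((F (Fin.castLE hs 0)).space 2)
  disj21 : Disjoint ((F (Fin.castLE hs 2)).space (b + 2)) ((F (Fin.castLE hs 1)).space 2)
  disj30 : Disjoint ((F (Fin.castLE hs 3)).space (b + 2)) ((F (Fin.castLE hs 0)).space 2)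
  disj31 : Disjoint ((F (Fin.castLE hs 3)).space (b + 2)) ((F (Fin.castLE hs 1)).space 2)
  disjSpan2 : Disjoint ((F (Fin.castLE hs 2)).space b) (lineSpan hs F)
  disjSpan3 : Disjoint ((F (Fin.castLE hs 3)).space b) (lineSpan hs F)

/-- The plane `h` solves the problem of four lines cut out by the first four flags. -/
structure IsLineSolution (h : Submodule K A) : Prop where
  le : h ≤ lineSpan hs F
  finrank_eq : finrank K h = 2
  meet0 : ¬Disjoint h ((F (Fin.castLE hs 0)).space 2)
  meet1 : ¬Disjoint h ((F (Fin.castLE hs 1)).space 2)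
  meet2 : ¬Disjoint h ((F (Fin.castLE hs 2)).space (b + 2))
  meet3 : ¬Disjoint h ((F (Fin.castLE hs 3)).space (b + 2))

/-- The flags are in general position with respect to `hull b hs F h`. -/
structure IsGoodAt (h : Submodule K A) : Prop where
  inf_le : lineSpan hs F ⊓ hull b hs F h ≤ h
  le_of_lt_two : ∀ i : Fin s, i.val < 2 → (F i).space 3 ⊓ hull b hs F h ≤ (F i).space 2
  disj_of_lt_four : ∀ i : Fin s, 2 ≤ i.val → i.val < 4 → Disjoint ((F i).space 1) (hull b hs F h)
  disj_of_four_le : ∀ i : Fin s, 4 ≤ i.val → Disjoint ((F i).space 2) (hull b hs F h)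
  disj_of_four_le' : ∀ i : Fin s, 4 ≤ i.val → Disjoint ((F i).space (b + 2)) h

/-- The shift between the indices of the flags in the total space and in the quotient. -/
def flagShift (i : ℕ) : ℕ := if i < 2 then 3 else if i < 4 then 1 else 2

variable {b hs F}

lemma le_hull (h : Submodule K A) : h ≤ hull b hs F h := le_inf le_sup_right le_sup_right

variable [FiniteDimensional K A] (hA : finrank K A = 4 + b)
include hA

lemma IsTransversal.finrank_lineSpan (hF : IsTransversal b hs F) :
    finrank K ↥(lineSpan hs F) = 4 := by
  have h : Disjoint ((F (Fin.castLE hs 0)).space 2) ((F (Fin.castLE hs 1)).space 2) :=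
    hF.disj01.mono_left ((F _).mono (by omega))
  rw [lineSpan, h.finrank_sup, CompleteFlag.finrank_space _ _ (by omega),
    CompleteFlag.finrank_space _ _ (by omega)]

/-- At least 2 by counting in the whole space. At most 2 because the intersection is disjoint from a
plane inside the four-dimensional span. -/
lemma IsTransversal.finrank_inf_two (hF : IsTransversal b hs F) :
    finrank K ↥((F (Fin.castLE hs 2)).space (b + 2) ⊓ lineSpan hs F) = 2 := by
  have h1 := (hF.disj20.mono_left (inf_le_left (b := lineSpan hs F))).finrank_add_le inf_le_right
    (P := lineSpan hs F) le_sup_left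
  have h2 := finrank_add_le_finrank_inf' ((F (Fin.castLE hs 2)).space (b + 2)) (lineSpan hs F)
  rw [hF.finrank_lineSpan hA, CompleteFlag.finrank_space _ _ (by omega)] at h1 h2
  omega

lemma IsTransversal.finrank_inf_three (hF : IsTransversal b hs F) :
    finrank K ↥((F (Fin.castLE hs 3)).space (b + 2) ⊓ lineSpan hs F) = 2 := by
  have h1 := (hF.disj30.mono_left (inf_le_left (b := lineSpan hs F))).finrank_add_le inf_le_right
    (P := lineSpan hs F) le_sup_left
  have h2 := finrank_add_le_finrank_inf' ((F (Fin.castLE hs 3)).space (b + 2)) (lineSpan hs F)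
  rw [hF.finrank_lineSpan hA, CompleteFlag.finrank_space _ _ (by omega)] at h1 h2
  omega

omit hA [FiniteDimensional K A] in
-- In a sum y + z of vectors of the two lines which lies in the large member of the first flag, z
-- lies there too, hence vanishes by transversality.
lemma IsTransversal.inf_lineSpan_zero (hF : IsTransversal b hs F) :
    (F (Fin.castLE hs 0)).space (b + 2) ⊓ lineSpan hs F ≤ (F (Fin.castLE hs 0)).space 2 := by
  rintro x ⟨hx, hx'⟩
  obtain ⟨y, hy, z, hz, rfl⟩ := Submodule.mem_sup.1 hx'
  have hz' : z ∈ (F (Fin.castLE hs 0)).space (b + 2) := by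
    have := Submodule.sub_mem _ hx ((F _).mono (show 2 ≤ b + 2 by omega) hy)
    rwa [add_sub_cancel_left] at this
  rw [Submodule.disjoint_def.1 hF.disj01 z hz' hz, add_zero]
  exact hy

omit hA [FiniteDimensional K A] in
lemma IsTransversal.inf_lineSpan_one (hF : IsTransversal b hs F) :
    (F (Fin.castLE hs 1)).space (b + 2) ⊓ lineSpan hs F ≤ (F (Fin.castLE hs 1)).space 2 := by
  rintro x ⟨hx, hx'⟩
  obtain ⟨y, hy, z, hz, rfl⟩ := Submodule.mem_sup.1 hx'
  have hy' : y ∈ (F (Fin.castLE hs 1)).space (b + 2) := by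
    have := Submodule.sub_mem _ hx ((F _).mono (show 2 ≤ b + 2 by omega) hz)
    rwa [add_sub_cancel_right] at this
  rw [Submodule.disjoint_def.1 hF.disj10 y hy' hy, zero_add]
  exact hz

omit hA in
lemma finrank_inf_eq_one {h L : Submodule K A} (h2 : finrank K h = 2) (hm : ¬Disjoint h L)
    (hL : ¬h ≤ L) : finrank K ↥(h ⊓ L) = 1 := by
  have h1 := one_le_finrank_inf hm
  have h3 := Submodule.finrank_lt_finrank_of_lt
    (lt_of_le_of_ne (inf_le_left : h ⊓ L ≤ h) fun e => hL (inf_eq_left.1 e))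
  omega

variable {h : Submodule K A}

omit hA in
lemma IsLineSolution.finrank_inf_zero (hF : IsTransversal b hs F) (hh : IsLineSolution b hs F h) :
    finrank K ↥(h ⊓ (F (Fin.castLE hs 0)).space 2) = 1 :=
  finrank_inf_eq_one hh.finrank_eq hh.meet0 fun hle =>
    hh.meet2 (hF.disj20.symm.mono_left hle)

omit hA in
lemma IsLineSolution.finrank_inf_one (hF : IsTransversal b hs F) (hh : IsLineSolution b hs F h) :
    finrank K ↥(h ⊓ (F (Fin.castLE hs 1)).space 2) = 1 :=
  finrank_inf_eq_one hh.finrank_eq hh.meet1 fun hle =>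
    hh.meet2 (hF.disj21.symm.mono_left hle)

omit hA in
lemma IsLineSolution.finrank_inf_two (hF : IsTransversal b hs F) (hh : IsLineSolution b hs F h) :
    finrank K ↥(h ⊓ (F (Fin.castLE hs 2)).space (b + 2)) = 1 :=
  finrank_inf_eq_one hh.finrank_eq hh.meet2 fun hle => hh.meet0 (hF.disj20.mono_left hle)

omit hA in
lemma IsLineSolution.finrank_inf_three (hF : IsTransversal b hs F) (hh : IsLineSolution b hs F h) :
    finrank K ↥(h ⊓ (F (Fin.castLE hs 3)).space (b + 2)) = 1 :=
  finrank_inf_eq_one hh.finrank_eq hh.meet3 fun hle => hh.meet0 (hF.disj30.mono_left hle)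

lemma IsLineSolution.finrank_sup_two (hF : IsTransversal b hs F) (hh : IsLineSolution b hs F h) :
    finrank K ↥((F (Fin.castLE hs 2)).space (b + 2) ⊔ h) = b + 3 := by
  have h1 := Submodule.finrank_sup_add_finrank_inf_eq ((F (Fin.castLE hs 2)).space (b + 2)) h
  rw [inf_comm, hh.finrank_inf_two hF, hh.finrank_eq,
    CompleteFlag.finrank_space _ _ (by omega)] at h1
  omega

lemma IsLineSolution.finrank_sup_three (hF : IsTransversal b hs F)
    (hh : IsLineSolution b hs F h) :
    finrank K ↥((F (Fin.castLE hs 3)).space (b + 2) ⊔ h) = b + 3 := by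
  have h1 := Submodule.finrank_sup_add_finrank_inf_eq ((F (Fin.castLE hs 3)).space (b + 2)) h
  rw [inf_comm, hh.finrank_inf_three hF, hh.finrank_eq,
    CompleteFlag.finrank_space _ _ (by omega)] at h1
  omega

/-- The hull is the intersection of two subspaces of dimension b + 3, so it has dimension at least b
+ 2. It cannot be larger, since it meets the four-dimensional span only in the plane h. -/
lemma IsGoodAt.finrank_hull (hF : IsTransversal b hs F) (hh : IsLineSolution b hs F h)
    (hg : IsGoodAt b hs F h) : finrank K ↥(hull b hs F h) = b + 2 := by
  have h1 := finrank_add_le_finrank_inf' ((F (Fin.castLE hs 2)).space (b + 2) ⊔ h)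
    ((F (Fin.castLE hs 3)).space (b + 2) ⊔ h)
  rw [hh.finrank_sup_two hA hF, hh.finrank_sup_three hA hF] at h1
  have h2 := finrank_add_le_finrank_inf' (lineSpan hs F) (hull b hs F h)
  have h3 := Submodule.finrank_mono hg.inf_le
  rw [hF.finrank_lineSpan hA] at h2
  rw [hh.finrank_eq] at h3
  change b + 3 + (b + 3) ≤ finrank K ↥(hull b hs F h) + _ at h1
  omega

omit hA [FiniteDimensional K A] in
lemma IsGoodAt.inf_eq (hh : IsLineSolution b hs F h) (hg : IsGoodAt b hs F h) :
    lineSpan hs F ⊓ hull b hs F h = h :=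
  le_antisymm hg.inf_le (le_inf hh.le (le_hull h))

omit hA in
/-- The members of the flags with the relevant indices meet `h` as expected. -/
lemma IsGoodAt.finrank_inf_flag (hF : IsTransversal b hs F) (hh : IsLineSolution b hs F h)
    (hg : IsGoodAt b hs F h) (i : Fin s) {d : ℕ} (hd : d < b) :
    finrank K ↥(h ⊓ (F i).space (d + flagShift i)) = if i.val < 2 then 1 else 0 := by
  by_cases hi0 : i.val < 2
  · rw [if_pos hi0]
    have hval : i = Fin.castLE hs 0 ∨ i = Fin.castLE hs 1 := by
      simp only [Fin.ext_iff, Fin.val_castLE]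
      have : ((1 : Fin 4) : ℕ) = 1 := rfl
      simp only [this, Fin.val_zero]
      omega
    have hsh : flagShift i = 3 := by simp [flagShift, hi0]
    rw [hsh]
    rcases hval with rfl | rfl
    · rw [← hh.finrank_inf_zero hF]
      refine congrArg (fun T : Submodule K A => finrank K T) ?_
      refine le_antisymm (le_inf inf_le_left ?_) (inf_le_inf_left _ ((F _).mono (by omega)))
      exact (le_inf (inf_le_right.trans ((F _).mono (by omega)))
        (inf_le_left.trans hh.le)).trans hF.inf_lineSpan_zero
    · rw [← hh.finrank_inf_one hF]
      refine congrArg (fun T : Submodule K A => finrank K T) ?_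
      refine le_antisymm (le_inf inf_le_left ?_) (inf_le_inf_left _ ((F _).mono (by omega)))
      exact (le_inf (inf_le_right.trans ((F _).mono (by omega)))
        (inf_le_left.trans hh.le)).trans hF.inf_lineSpan_one
  · rw [if_neg hi0, Submodule.finrank_eq_zero, ← disjoint_iff]
    by_cases hi1 : i.val < 4
    · have hsh : flagShift i = 1 := by simp [flagShift, hi0, hi1]
      rw [hsh]
      have hval : i = Fin.castLE hs 2 ∨ i = Fin.castLE hs 3 := by
        simp only [Fin.ext_iff, Fin.val_castLE]
        have : ((2 : Fin 4) : ℕ) = 2 := rfl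
        have : ((3 : Fin 4) : ℕ) = 3 := rfl
        omega
      rcases hval with rfl | rfl
      · exact (hF.disjSpan2.mono ((F _).mono (by omega)) hh.le).symm
      · exact (hF.disjSpan3.mono ((F _).mono (by omega)) hh.le).symm
    · have hsh : flagShift i = 2 := by simp [flagShift, hi0, hi1]
      rw [hsh]
      exact ((hg.disj_of_four_le' i (by omega)).mono_left ((F _).mono (by omega))).symm

/-- The members of the flags with the relevant indices meet the hull of `h` as expected. -/
lemma IsGoodAt.finrank_flag_inf_hull (hF : IsTransversal b hs F) (hh : IsLineSolution b hs F h)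
    (hg : IsGoodAt b hs F h) (i : Fin s) {d : ℕ} (hd : d < b) :
    finrank K ↥((F i).space (d + flagShift i) ⊓ hull b hs F h) =
      d + if i.val < 2 then 1 else 0 := by
  have hW := hg.finrank_hull hA hF hh
  have hup := (F i).finrank_inf_add_le (hull b hs F h) (flagShift i) d
    (by rw [hA]; unfold flagShift; split_ifs <;> omega)
  rw [add_comm (flagShift i) d] at hup
  have hlo := finrank_add_le_finrank_inf' ((F i).space (d + flagShift i)) (hull b hs F h)
  rw [(F i).finrank_space _ (by rw [hA]; unfold flagShift; split_ifs <;> omega), hW, hA] at hlo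
  by_cases hi0 : i.val < 2
  · have hsh : flagShift i = 3 := by simp [flagShift, hi0]
    have h0 := hg.finrank_inf_flag hF hh i (show 0 < b by omega)
    rw [if_pos hi0, zero_add, hsh] at h0
    rw [if_pos hi0]
    -- For the first two flags the member of index 3 meets the hull inside the line, hence inside h.
    -- This gives the starting value 1 from which the dimension climbs.
    have hle : (F i).space 3 ⊓ hull b hs F h ≤ h ⊓ (F i).space 3 := by
      refine le_inf (le_trans (le_inf ?_ inf_le_right) hg.inf_le) inf_le_left
      refine (hg.le_of_lt_two i hi0).trans ?_
      have hval : i = Fin.castLE hs 0 ∨ i = Fin.castLE hs 1 := by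
        simp only [Fin.ext_iff, Fin.val_castLE]
        have : ((1 : Fin 4) : ℕ) = 1 := rfl
        simp only [this, Fin.val_zero]
        omega
      rcases hval with rfl | rfl
      · exact le_sup_left
      · exact le_sup_right
    have := Submodule.finrank_mono hle
    rw [hsh] at hup hlo ⊢
    omega
  · rw [if_neg hi0]
    by_cases hi1 : i.val < 4
    · have hsh : flagShift i = 1 := by simp [flagShift, hi0, hi1]
      rw [hsh] at hup hlo ⊢
      rw [disjoint_iff.1 (hg.disj_of_lt_four i (by omega) hi1), finrank_bot] at hup
      have hval : i = Fin.castLE hs 2 ∨ i = Fin.castLE hs 3 := by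
        simp only [Fin.ext_iff, Fin.val_castLE]
        have : ((2 : Fin 4) : ℕ) = 2 := rfl
        have : ((3 : Fin 4) : ℕ) = 3 := rfl
        omega
      rcases hval with rfl | rfl
      -- Counting in the whole space would lose one dimension. The count takes place in the sum of h
      -- and the large member, of dimension b + 3, in which the hull has codimension one.
      · have h3 := finrank_add_le_finrank_inf ((F (Fin.castLE hs 2)).space (d + 1))
          (hull b hs F h) _ (((F _).mono (by omega)).trans (le_sup_left (b := h))) inf_le_left
        rw [(F _).finrank_space _ (by omega), hW, hh.finrank_sup_two hA hF] at h3
        omega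
      · have h3 := finrank_add_le_finrank_inf ((F (Fin.castLE hs 3)).space (d + 1))
          (hull b hs F h) _ (((F _).mono (by omega)).trans (le_sup_left (b := h))) inf_le_right
        rw [(F _).finrank_space _ (by omega), hW, hh.finrank_sup_three hA hF] at h3
        omega
    · have hsh : flagShift i = 2 := by simp [flagShift, hi0, hi1]
      rw [hsh] at hup hlo ⊢
      rw [disjoint_iff.1 (hg.disj_of_four_le i (by omega)), finrank_bot] at hup
      omega

end Geometry

section Sdim

variable {K V : Type*} [Field K] [AddCommGroup V] [Module K V]

/-- The dimension of a subspace. -/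
noncomputable def sdim (S : Submodule K V) : ℕ := finrank K S

lemma mem_schubertVariety_iff_sdim {n k : ℕ} (hn : finrank K V = n) {p : ℕ → ℕ}
    {F : CompleteFlag K V} {H : Submodule K V} : H ∈ schubertVariety k p F ↔
      sdim H = k ∧ ∀ i < k, i + 1 ≤ sdim (H ⊓ F.space (n - k + (i + 1) - p i)) := by
  subst hn
  rfl

end Sdim

/-! ### Solutions as pairs of a transversal and a subspace of the quotient -/

section Splitting

variable {K A Q : Type*} [Field K] [AddCommGroup A] [Module K A] [AddCommGroup Q] [Module K Q]
  [FiniteDimensional K A]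

/-- Since H contains the kernel of π on W, a vector of S ∩ W whose image lies in the image of H is
itself in H. So the intersection of images is the image of H ∩ S, and the kernel there is h ∩ S. -/
lemma finrank_map_inf_map_inf (π : A →ₗ[K] Q) {h W H : Submodule K A}
    (hW : LinearMap.ker π ⊓ W = h) (hH : h ≤ H) (hHW : H ≤ W) (S : Submodule K A) :
    finrank K ↥(H.map π ⊓ (S ⊓ W).map π) + finrank K ↥(h ⊓ S) = finrank K ↥(H ⊓ S) := by
  have h1 : H.map π ⊓ (S ⊓ W).map π = (H ⊓ S).map π := by
    refine le_antisymm ?_ (le_inf (Submodule.map_mono inf_le_left)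
      (Submodule.map_mono (le_inf inf_le_right (inf_le_left.trans hHW))))
    rintro _ ⟨⟨x, hx, rfl⟩, y, ⟨hyS, hyW⟩, hxy⟩
    refine ⟨y, ⟨?_, hyS⟩, hxy⟩
    have : y - x ∈ h := by
      rw [← hW]
      exact ⟨by simp [hxy], W.sub_mem hyW (hHW hx)⟩
    simpa using H.add_mem (hH this) hx
  have h2 : LinearMap.ker π ⊓ (H ⊓ S) = h ⊓ S := by
    rw [← inf_assoc, ← hW]
    refine le_antisymm (inf_le_inf_right _ (inf_le_inf_left _ hHW)) (le_inf (le_inf ?_ ?_) ?_)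
    · exact inf_le_left.trans inf_le_left
    · rw [hW]; exact inf_le_left.trans hH
    · exact inf_le_right
  rw [h1, ← h2, finrank_map_add_finrank_ker_inf]

variable {a b s : ℕ} {hs : 4 ≤ s} {F : Fin s → CompleteFlag K A} {h : Submodule K A}
  {ν : Fin s → ℕ → ℕ}

/-- `G` is the flag which `F i` induces on the image of `hull b hs F h` under `π`. -/
def IsInducedFlag (b : ℕ) (hs : 4 ≤ s) (F : Fin s → CompleteFlag K A) (π : A →ₗ[K] Q)
    (h : Submodule K A) (i : Fin s) (G : CompleteFlag K Q) : Prop :=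
  ∀ d < b, G.space d = ((F i).space (d + flagShift i) ⊓ hull b hs F h).map π

omit [FiniteDimensional K A] in
lemma IsInducedFlag.unique [FiniteDimensional K Q] {π : A →ₗ[K] Q} (hQ : finrank K Q = b)
    {i : Fin s} {G G' : CompleteFlag K Q} (hG : IsInducedFlag b hs F π h i G)
    (hG' : IsInducedFlag b hs F π h i G') : G = G' :=
  CompleteFlag.ext_of_lt fun d hd => by rw [hG d (hQ ▸ hd), hG' d (hQ ▸ hd)]

variable {π : A →ₗ[K] Q} (hπ : LinearMap.ker π = lineSpan hs F)
include hπ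

/-- The intersection of the shifted member with the hull has dimension d + ε and meets h, the kernel
on the hull, in dimension ε, where ε is 1 for the first two flags and 0 for the others. -/
lemma exists_isInducedFlag [FiniteDimensional K Q] (hA : finrank K A = 4 + b)
    (hQ : finrank K Q = b) (hF : IsTransversal b hs F) (hh : IsLineSolution b hs F h)
    (hg : IsGoodAt b hs F h) (i : Fin s) :
    ∃ G : CompleteFlag K Q, IsInducedFlag b hs F π h i G := by
  classical
  refine ⟨⟨fun d => if d < b then ((F i).space (d + flagShift i) ⊓ hull b hs F h).map π else ⊤,
    fun d d' hdd => ?_, fun d hd => ?_⟩, fun d hd => by simp [hd]⟩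
  · change (if d < b then _ else _) ≤ (if d' < b then _ else _)
    split_ifs with h1 h2 h3
    · exact Submodule.map_mono (inf_le_inf_right _ ((F i).mono (by omega)))
    · exact le_top
    · omega
    · exact le_rfl
  · change sdim (if d < b then _ else _ : Submodule K Q) = d
    split_ifs with h1
    · have e1 := finrank_map_add_finrank_ker_inf π ((F i).space (d + flagShift i) ⊓ hull b hs F h)
      rw [hg.finrank_flag_inf_hull hA hF hh i h1, hπ, inf_left_comm, hg.inf_eq hh, inf_comm _ h,
        hg.finrank_inf_flag hF hh i h1] at e1
      change finrank K _ = d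
      omega
    · rw [sdim, finrank_top]; omega

lemma finrank_inf_isInducedFlag (hF : IsTransversal b hs F) (hh : IsLineSolution b hs F h)
    (hg : IsGoodAt b hs F h) {i : Fin s} {G : CompleteFlag K Q}
    (hG : IsInducedFlag b hs F π h i G) {H : Submodule K A} (hhH : h ≤ H)
    (hHW : H ≤ hull b hs F h) {d : ℕ} (hd : d < b) :
    finrank K ↥(H.map π ⊓ G.space d) + (if i.val < 2 then 1 else 0) =
      finrank K ↥(H ⊓ (F i).space (d + flagShift i)) := by
  rw [hG d hd, ← hg.finrank_inf_flag hF hh i hd]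
  exact finrank_map_inf_map_inf π (by rw [hπ, hg.inf_eq hh]) hhH hHW _

/-- Row j of ν corresponds to row j + 1 of the big partition for the first two flags, where h
contributes one dimension to every intersection, and to row j for the others. The surplus conditions
hold automatically: the first row for the first two flags because h meets the line, row a + 1 for
the next two because H lies in the hull, and the others by codimension. -/
lemma mem_schubertVariety_iff [FiniteDimensional K Q] (hab : a < b) (hA : finrank K A = 4 + b)
    (hQ : finrank K Q = b)
    (hF : IsTransversal b hs F) (hh : IsLineSolution b hs F h)
    (hg : IsGoodAt b hs F h) {i : Fin s} (hν : IsPartitionFor a b (ν i)) {G : CompleteFlag K Q}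
    (hG : IsInducedFlag b hs F π h i G) {H : Submodule K A} (hhH : h ≤ H)
    (hHW : H ≤ hull b hs F h) (hfH : finrank K H = 2 + a) (hfK : finrank K ↥(H.map π) = a) :
    H ∈ schubertVariety (2 + a) (firstFamily a b ν i) (F i) ↔
      H.map π ∈ schubertVariety a (ν i) G := by
  have key := fun d (hd : d < b) => finrank_inf_isInducedFlag hπ hF hh hg hG hhH hHW hd
  have hd0 := hh.finrank_inf_zero hF
  have hd1 := hh.finrank_inf_one hF
  have hd2 := hh.finrank_inf_two hF
  have hd3 := hh.finrank_inf_three hF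
  have hdh := hh.finrank_eq
  have hflag := fun j (hj : j ≤ finrank K A) => (F i).finrank_space j hj
  have mono : ∀ {S T : Submodule K A}, S ≤ T → sdim S ≤ sdim T := fun h => Submodule.finrank_mono h
  have codim := fun j (hj : j ≤ 4 + b) => finrank_add_le_finrank_inf' H ((F i).space j)
  have hincl : finrank K ↥(H ⊓ (F i).space (b + 2)) ≤ finrank K ↥(H ⊓ (F i).space (b + 1)) + 1 := by
    rw [inf_comm, inf_comm H]
    exact (F i).finrank_inf_add_le H (b + 1) 1 (by omega)
  have hsi : ∀ S : Submodule K A, finrank K ↥(S ⊔ h) + finrank K ↥(S ⊓ h) =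
      finrank K S + finrank K h := fun S => Submodule.finrank_sup_add_finrank_inf_eq S h
  rw [mem_schubertVariety_iff_sdim hA, mem_schubertVariety_iff_sdim hQ]
  -- Hypotheses and goal now express dimensions by the same atoms.
  simp only [← sdim.eq_def] at key hd0 hd1 hd2 hd3 hdh hflag codim hincl hsi hfH hfK
  have hp : ∀ j, ν i j ≤ b - a := fun j => (hν.1 (Nat.zero_le j)).trans hν.2.1
  have hz : ∀ j, a ≤ j → ν i j = 0 := fun j hj => Nat.eq_zero_of_le_zero (hν.2.2 ▸ hν.1 hj)
  have htop : ∀ j, 4 + b ≤ j → sdim (H ⊓ (F i).space j) = 2 + a := fun j hj => by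
    rw [(F i).space_top (hA ▸ hj), inf_top_eq, hfH]
  have htopG : ∀ j, b ≤ j → sdim (H.map π ⊓ G.space j) = a := fun j hj => by
    rw [G.space_top (hQ ▸ hj), inf_top_eq, hfK]
  have codim' : ∀ j ≤ 4 + b, 2 + a + j ≤ sdim (H ⊓ (F i).space j) + (4 + b) := by
    intro j hj
    have := codim j hj
    rwa [hfH, hflag _ (hA ▸ hj), hA] at this
  simp only [hfH, hfK, true_and]
  have hsub : 4 + b - (2 + a) = b - a + 2 := by omega
  rw [hsub]
  by_cases hi0 : i.val < 2
  · simp only [flagShift, if_pos hi0] at key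
    have hlam : firstFamily a b ν i = prependRow (b - a + 1) (ν i) := by simp [firstFamily, hi0]
    rw [hlam]
    have hmeet : 1 ≤ sdim (H ⊓ (F i).space 2) := by
      have hval : i = Fin.castLE hs 0 ∨ i = Fin.castLE hs 1 := by
        simp only [Fin.ext_iff, Fin.val_castLE]
        have : ((1 : Fin 4) : ℕ) = 1 := rfl
        simp only [this, Fin.val_zero]
        omega
      rcases hval with rfl | rfl
      · rw [← hd0]
        exact mono (inf_le_inf_right _ hhH)
      · rw [← hd1]
        exact mono (inf_le_inf_right _ hhH)
    constructor
    · intro hcond j hj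
      have h1 := hcond (j + 1) (by omega)
      simp only [prependRow] at h1
      by_cases hd : b - a + (j + 1) - ν i j < b
      · rw [show b - a + 2 + (j + 1 + 1) - ν i j = b - a + (j + 1) - ν i j + 3 by
          have := hp j; omega] at h1
        have := key _ hd
        omega
      · rw [htopG _ (by omega)]; omega
    · intro hcond j hj
      cases j with
      | zero =>
        simp only [prependRow]
        rwa [show b - a + 2 + (0 + 1) - (b - a + 1) = 2 by omega]
      | succ j =>
        simp only [prependRow]
        have hpj := hp j
        by_cases hja : j < a
        · have h1 := hcond j hja
          rw [show b - a + 2 + (j + 1 + 1) - ν i j = b - a + (j + 1) - ν i j + 3 by omega]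
          by_cases hd : b - a + (j + 1) - ν i j < b
          · have := key _ hd
            omega
          · have := codim' (b - a + (j + 1) - ν i j + 3) (by omega)
            omega
        · rw [hz j (by omega), htop _ (by omega)]
          omega
  · simp only [if_neg hi0, add_zero] at key
    by_cases hi1 : i.val < 4
    · simp only [flagShift, if_neg hi0, if_pos hi1] at key
      have hlam : firstFamily a b ν i = onePow (a + 1) + ν i := by simp [firstFamily, hi0, hi1]
      rw [hlam]
      have hmeet : a + 1 ≤ sdim (H ⊓ (F i).space (b + 2)) := by
        -- By the modular law H = (H ∩ S) + h, so H ∩ S has dimension (2 + a) - 2 + 1.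
        have hmod : ∀ S : Submodule K A, H ≤ S ⊔ h → sdim (h ⊓ S) = 1 →
            a + 1 ≤ sdim (H ⊓ S) := by
          intro S hS h1
          have e1 : H = (H ⊓ S) ⊔ h := by
            rw [inf_sup_assoc_of_le _ hhH, inf_eq_left.2 hS]
          have e2 := hsi (H ⊓ S)
          rw [← e1, hfH, hdh] at e2
          have e3 : H ⊓ S ⊓ h = h ⊓ S := by
            rw [inf_right_comm, inf_eq_right.2 hhH]
          rw [e3, h1] at e2
          omega
        have hval : i = Fin.castLE hs 2 ∨ i = Fin.castLE hs 3 := by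
          simp only [Fin.ext_iff, Fin.val_castLE]
          have : ((2 : Fin 4) : ℕ) = 2 := rfl
          have : ((3 : Fin 4) : ℕ) = 3 := rfl
          omega
        rcases hval with rfl | rfl
        · exact hmod _ (hHW.trans inf_le_left) hd2
        · exact hmod _ (hHW.trans inf_le_right) hd3
      constructor
      · intro hcond j hj
        have h1 := hcond j (by omega)
        simp only [Pi.add_apply, onePow, if_pos (show j < a + 1 by omega)] at h1
        by_cases hd : b - a + (j + 1) - ν i j < b
        · rw [show b - a + 2 + (j + 1) - (1 + ν i j) = b - a + (j + 1) - ν i j + 1 by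
            have := hp j; omega] at h1
          have := key _ hd
          omega
        · rw [htopG _ (by omega)]; omega
      · intro hcond j hj
        have hpj := hp j
        simp only [Pi.add_apply, onePow]
        by_cases hja : j < a
        · have h1 := hcond j hja
          rw [if_pos (by omega),
            show b - a + 2 + (j + 1) - (1 + ν i j) = b - a + (j + 1) - ν i j + 1 by omega]
          by_cases hd : b - a + (j + 1) - ν i j < b
          · have := key _ hd
            omega
          -- In this border case the index in the quotient is b, where `key` says nothing. The
          -- member of index b + 1 has codimension one in the member of index b + 2, which H meets
          -- in dimension at least a + 1, and j < a.
          · have h3 : b + 1 = b - a + (j + 1) - ν i j + 1 := by omega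
            rw [← h3]
            omega
        · by_cases hja' : j = a
          · subst hja'
            rw [if_pos (by omega), hz j le_rfl, show b - j + 2 + (j + 1) - (1 + 0) = b + 2 by omega]
            exact hmeet
          · rw [if_neg (by omega), hz j (by omega), htop _ (by omega)]
            omega
    · simp only [flagShift, if_neg hi0, if_neg hi1] at key
      have hlam : firstFamily a b ν i = ν i := by simp [firstFamily, hi0, hi1]
      rw [hlam]
      constructor
      · intro hcond j hj
        have h1 := hcond j (by omega)
        by_cases hd : b - a + (j + 1) - ν i j < b
        · rw [show b - a + 2 + (j + 1) - ν i j = b - a + (j + 1) - ν i j + 2 by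
            have := hp j; omega] at h1
          have := key _ hd
          omega
        · rw [htopG _ (by omega)]; omega
      · intro hcond j hj
        have hpj := hp j
        by_cases hja : j < a
        · have h1 := hcond j hja
          rw [show b - a + 2 + (j + 1) - ν i j = b - a + (j + 1) - ν i j + 2 by omega]
          by_cases hd : b - a + (j + 1) - ν i j < b
          · have := key _ hd
            omega
          · have := codim' (b - a + (j + 1) - ν i j + 2) (by omega)
            omega
        · rw [hz j (by omega)]
          by_cases hja' : j = a
          · have := codim' (b - a + 2 + (j + 1) - 0) (by omega)
            omega
          · rw [htop _ (by omega)]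
            omega

omit hπ in
/-- A solution of the big problem meets the span of the first two lines in a solution of the
problem of four lines, and it is contained in its hull. -/
lemma isLineSolution_of_mem (hab : a < b) (hA : finrank K A = 4 + b)
    (hν : ∀ i, IsPartitionFor a b (ν i)) (hF : IsTransversal b hs F)
    (hg : ∀ h, IsLineSolution b hs F h → IsGoodAt b hs F h) {H : Submodule K A}
    (hH : H ∈ schubertInstance (2 + a) (firstFamily a b ν) F) :
    IsLineSolution b hs F (H ⊓ lineSpan hs F) ∧ H ≤ hull b hs F (H ⊓ lineSpan hs F) := by
  obtain ⟨hfH, hH⟩ := hH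
  have hsub : 4 + b - (2 + a) = b - a + 2 := by omega
  have hm01 : ∀ i : Fin s, i.val < 2 → ¬Disjoint H ((F i).space 2) := by
    intro i hi
    have h1 := ((mem_schubertVariety_iff_sdim hA).1 (hH i)).2 0 (by omega)
    have hlam : firstFamily a b ν i = prependRow (b - a + 1) (ν i) := by simp [firstFamily, hi]
    rw [hlam] at h1
    simp only [prependRow] at h1
    rw [show 4 + b - (2 + a) + (0 + 1) - (b - a + 1) = 2 by omega] at h1
    exact not_disjoint_of_one_le h1
  have hm23 : ∀ i : Fin s, 2 ≤ i.val → i.val < 4 →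
      a + 1 ≤ finrank K ↥(H ⊓ (F i).space (b + 2)) := by
    intro i hi hi'
    have h1 := ((mem_schubertVariety_iff_sdim hA).1 (hH i)).2 a (by omega)
    have hlam : firstFamily a b ν i = onePow (a + 1) + ν i := by
      simp [firstFamily, not_lt.2 hi, hi']
    rw [hlam] at h1
    simp only [onePow, Pi.add_apply, if_pos (Nat.lt_succ_self a), (hν i).2.2] at h1
    rwa [show 4 + b - (2 + a) + (a + 1) - (1 + 0) = b + 2 by omega] at h1
  set V := lineSpan hs F with hV
  set T := H ⊓ V with hT
  have hTV : T ≤ V := inf_le_right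
  set F2 := (F (Fin.castLE hs 2)).space (b + 2) with hF2
  set F3 := (F (Fin.castLE hs 3)).space (b + 2) with hF3
  have h2 := hm23 (Fin.castLE hs 2) (le_refl 2) (by norm_num)
  have h3 := hm23 (Fin.castLE hs 3) (show 2 ≤ 3 by omega) (show 3 < 4 by omega)
  rw [← hF2] at h2
  rw [← hF3] at h3
  -- H ∩ S has codimension at most one in H, so the same holds for T ∩ S in T.
  have hTF : ∀ S : Submodule K A, a + 1 ≤ finrank K ↥(H ⊓ S) →
      finrank K T ≤ finrank K ↥(T ⊓ S) + 1 := by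
    intro S hS
    have e1 := finrank_add_le_finrank_inf T (H ⊓ S) H inf_le_left inf_le_left
    have e0 : T ⊓ (H ⊓ S) = T ⊓ S := by rw [← inf_assoc, inf_eq_left.2 (inf_le_left : T ≤ H)]
    rw [hfH, e0] at e1
    omega
  have hT2 := hTF F2 h2
  have hT3 := hTF F3 h3
  -- the plane spanned by points of the two lines
  obtain ⟨x, ⟨hxH, hx⟩, hx0⟩ := Submodule.exists_mem_ne_zero_of_ne_bot
    (fun e => hm01 (Fin.castLE hs 0) (by simp) (disjoint_iff.2 e))
  obtain ⟨y, ⟨hyH, hy⟩, hy0⟩ := Submodule.exists_mem_ne_zero_of_ne_bot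
    (fun e => hm01 (Fin.castLE hs 1) (by norm_num) (disjoint_iff.2 e))
  have hd01 : Disjoint ((F (Fin.castLE hs 0)).space 2) ((F (Fin.castLE hs 1)).space 2) :=
    hF.disj01.mono_left ((F _).mono (by omega))
  set l := (K ∙ x) ⊔ (K ∙ y) with hl
  have hxl : x ∈ l := Submodule.mem_sup_left (Submodule.mem_span_singleton_self x)
  have hyl : y ∈ l := Submodule.mem_sup_right (Submodule.mem_span_singleton_self y)
  have hfl : finrank K l = 2 := by
    have hdis : Disjoint (K ∙ x) (K ∙ y) := hd01.mono
      ((Submodule.span_singleton_le_iff_mem _ _).2 hx)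
      ((Submodule.span_singleton_le_iff_mem _ _).2 hy)
    rw [hl, hdis.finrank_sup, finrank_span_singleton hx0, finrank_span_singleton hy0]
  have hlT : l ≤ T := by
    refine sup_le ?_ ?_ <;> rw [Submodule.span_singleton_le_iff_mem]
    · exact ⟨hxH, Submodule.mem_sup_left hx⟩
    · exact ⟨hyH, Submodule.mem_sup_right hy⟩
  have hfT : 2 ≤ finrank K T := hfl ▸ Submodule.finrank_mono hlT
  have hTF2 : finrank K ↥(T ⊓ F2) ≤ 2 := by
    rw [← hF.finrank_inf_two hA, inf_comm]
    exact Submodule.finrank_mono (inf_le_inf_left _ hTV)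
  have hTF3 : finrank K ↥(T ⊓ F3) ≤ 2 := by
    rw [← hF.finrank_inf_three hA, inf_comm]
    exact Submodule.finrank_mono (inf_le_inf_left _ hTV)
  have hlF : ∀ S : Submodule K A, finrank K T ≤ finrank K ↥(T ⊓ S) + 1 → ¬Disjoint l S := by
    intro S hS
    have e1 := finrank_add_le_finrank_inf l (T ⊓ S) T hlT inf_le_left
    rw [hfl, ← inf_assoc, inf_eq_left.2 hlT] at e1
    exact not_disjoint_of_one_le (by omega)
  have hsol : IsLineSolution b hs F l := ⟨hlT.trans hTV, hfl,
    fun e => hx0 (Submodule.disjoint_def.1 e x hxl hx),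
    fun e => hy0 (Submodule.disjoint_def.1 e y hyl hy), hlF _ hT2, hlF _ hT3⟩
  -- If T were larger than l, it would be spanned by l and its intersection with each of the two
  -- large members, hence would lie in the hull of l. General position then puts T into l.
  have hfT' : finrank K T = 2 := by
    by_contra hne
    have e1 : ∀ S : Submodule K A, finrank K ↥(l ⊓ S) = 1 → finrank K ↥(T ⊓ S) ≤ 2 →
        finrank K T ≤ finrank K ↥(T ⊓ S) + 1 → T ≤ S ⊔ l := by
      intro S h1 h2 h3
      have e2 := Submodule.finrank_sup_add_finrank_inf_eq (T ⊓ S) l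
      have e0 : T ⊓ S ⊓ l = l ⊓ S := by rw [inf_right_comm, inf_eq_right.2 hlT]
      rw [e0, h1, hfl] at e2
      have e3 : T ⊓ S ⊔ l = T :=
        Submodule.eq_of_le_of_finrank_le (sup_le inf_le_left hlT) (by omega)
      rw [← e3]
      exact sup_le_sup_right inf_le_right _
    have e4 : T ≤ hull b hs F l := le_inf (e1 _ (hsol.finrank_inf_two hF) hTF2 hT2)
      (e1 _ (hsol.finrank_inf_three hF) hTF3 hT3)
    have e5 := Submodule.finrank_mono ((le_inf hTV e4).trans (hg l hsol).inf_le)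
    omega
  have hlT' : l = T := Submodule.eq_of_le_of_finrank_eq hlT (hfl.trans hfT'.symm)
  rw [← hlT']
  refine ⟨hsol, ?_⟩
  -- The dimensions a + 1, 2 and 1 of H ∩ S, l and l ∩ S show that H ∩ S and l already span H.
  have e6 : ∀ S : Submodule K A, a + 1 ≤ finrank K ↥(H ⊓ S) → finrank K ↥(l ⊓ S) = 1 →
      H ≤ S ⊔ l := by
    intro S h1 h2
    have hlH : l ≤ H := hlT.trans inf_le_left
    have e2 := Submodule.finrank_sup_add_finrank_inf_eq (H ⊓ S) l
    rw [inf_right_comm, inf_eq_right.2 hlH, h2, hfl] at e2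
    have e3 : H ⊓ S ⊔ l = H :=
      Submodule.eq_of_le_of_finrank_le (sup_le inf_le_left hlH) (by omega)
    conv_lhs => rw [← e3]
    exact sup_le_sup_right inf_le_right _
  exact le_inf (e6 _ h2 (hsol.finrank_inf_two hF)) (e6 _ h3 (hsol.finrank_inf_three hF))

/-- The solutions of the big problem are the preimages in hulls of solutions `h` of the problem of
four lines of the solutions of the instance induced by `h`. -/
lemma map_mem_schubertInstance [FiniteDimensional K Q] (hab : a < b) (hA : finrank K A = 4 + b)
    (hQ : finrank K Q = b)
    (hν : ∀ i, IsPartitionFor a b (ν i)) (hF : IsTransversal b hs F)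
    (hg : ∀ h, IsLineSolution b hs F h → IsGoodAt b hs F h) {H : Submodule K A}
    (hH : H ∈ schubertInstance (2 + a) (firstFamily a b ν) F) {G : Fin s → CompleteFlag K Q}
    (hG : ∀ i, IsInducedFlag b hs F π (H ⊓ lineSpan hs F) i (G i)) :
    H.map π ∈ schubertInstance a ν G := by
  obtain ⟨h1, h2⟩ := isLineSolution_of_mem hab hA hν hF hg hH
  have h3 := finrank_map_add_finrank_ker_inf π H
  rw [hH.1, hπ, inf_comm, h1.finrank_eq] at h3
  have h4 : finrank K ↥(H.map π) = a := by omega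
  exact ⟨h4, fun i => (mem_schubertVariety_iff hπ hab hA hQ hF h1 (hg _ h1) (hν i) (hG i)
    inf_le_left h2 hH.1 h4).1 (hH.2 i)⟩

omit [FiniteDimensional K A] in
-- The full preimage of the image of H is H + V, and (H + V) ∩ W = H + (V ∩ W) = H + h = H by the
-- modular law. So H is recovered from h and its image.
lemma inf_hull_eq_of_map_eq (hh : IsLineSolution b hs F h) (hg : IsGoodAt b hs F h)
    {H : Submodule K A} (hH : H ⊓ lineSpan hs F = h) (hHW : H ≤ hull b hs F h) :
    (H.map π).comap π ⊓ hull b hs F h = H := by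
  rw [Submodule.comap_map_eq, hπ, sup_inf_assoc_of_le _ hHW, hg.inf_eq hh, sup_eq_left, ← hH]
  exact inf_le_left

omit [FiniteDimensional K A] in
lemma comap_inf_hull_inf (hh : IsLineSolution b hs F h) (hg : IsGoodAt b hs F h)
    (S : Submodule K Q) : S.comap π ⊓ hull b hs F h ⊓ lineSpan hs F = h := by
  rw [inf_assoc, inf_comm (hull b hs F h), hg.inf_eq hh, inf_eq_right]
  refine hh.le.trans ?_
  rw [← hπ]
  exact LinearMap.ker_le_comap π

/-- The hull has dimension b + 2 and kernel h of dimension 2, so it maps onto the quotient. -/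
lemma map_comap_inf_hull (hA : finrank K A = 4 + b) [FiniteDimensional K Q]
    (hQ : finrank K Q = b) (hF : IsTransversal b hs F)
    (hh : IsLineSolution b hs F h) (hg : IsGoodAt b hs F h) (S : Submodule K Q) :
    (S.comap π ⊓ hull b hs F h).map π = S := by
  have h1 : (hull b hs F h).map π = ⊤ := by
    apply Submodule.eq_top_of_finrank_eq
    have h2 := finrank_map_add_finrank_ker_inf π (hull b hs F h)
    rw [hπ, hg.inf_eq hh, hh.finrank_eq, hg.finrank_hull hA hF hh] at h2
    omega
  rw [inf_comm, ← Submodule.map_inf_eq_map_inf_comap, h1, top_inf_eq]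

lemma comap_inf_hull_mem_schubertInstance [FiniteDimensional K Q] (hab : a < b)
    (hA : finrank K A = 4 + b) (hQ : finrank K Q = b)
    (hν : ∀ i, IsPartitionFor a b (ν i)) (hF : IsTransversal b hs F)
    (hh : IsLineSolution b hs F h) (hg : IsGoodAt b hs F h)
    {G : Fin s → CompleteFlag K Q} (hG : ∀ i, IsInducedFlag b hs F π h i (G i))
    {S : Submodule K Q} (hS : S ∈ schubertInstance a ν G) :
    S.comap π ⊓ hull b hs F h ∈ schubertInstance (2 + a) (firstFamily a b ν) F := by
  have h1 := map_comap_inf_hull hπ hA hQ hF hh hg S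
  have h2 := comap_inf_hull_inf hπ hh hg S
  have h3 := finrank_map_add_finrank_ker_inf π (S.comap π ⊓ hull b hs F h)
  rw [h1, hπ, inf_comm, h2, hh.finrank_eq, hS.1] at h3
  have h4 : h ≤ S.comap π ⊓ hull b hs F h := by
    conv_lhs => rw [← h2]
    exact inf_le_left
  refine ⟨by omega, fun i => ?_⟩
  rw [mem_schubertVariety_iff hπ hab hA hQ hF hh hg (hν i) (hG i) h4 inf_le_right (by omega)
    (by rw [h1]; exact hS.1), h1]
  exact hS.2 i

end Splitting

/-! ### Genericity conditions as polynomials in adapted bases -/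

section Forms

variable {R S : Type*} [CommRing R] [CommRing S] {b s : ℕ}

/-- The determinant of the family `g` with its `j`-th member replaced by `x`. -/
noncomputable def coordForm (g : Fin (4 + b) → Fin (4 + b) → R) (j : Fin (4 + b)) :
    (Fin (4 + b) → R) →ₗ[R] R :=
  LinearMap.proj j ∘ₗ Matrix.cramer (Matrix.of g).transpose

/-- The index `b + j` for `j < 4`. -/
def lastIdx (b : ℕ) (j : Fin 4) : Fin (4 + b) := ⟨b + j, by omega⟩

/-- The alternating form whose radical is spanned by the first `b + 2` vectors of `g`. -/
noncomputable def pairForm (g : Fin (4 + b) → Fin (4 + b) → R) (x y : Fin (4 + b) → R) : R :=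
  coordForm g (lastIdx b 2) x * coordForm g (lastIdx b 3) y -
    coordForm g (lastIdx b 3) x * coordForm g (lastIdx b 2) y

/-- The determinant of four vectors modulo the span of the first `b` vectors of `g`. -/
noncomputable def quadForm (g : Fin (4 + b) → Fin (4 + b) → R)
    (w : Fin 4 → Fin (4 + b) → R) : R :=
  Matrix.det (Matrix.of fun j l => coordForm g (lastIdx b j) (w l))

variable (hs : 4 ≤ s) (f : Fin s → Fin (4 + b) → Fin (4 + b) → R)

/-- A vector among the first four members of one of the first four families. -/
def firstVec (i q : Fin 4) : Fin (4 + b) → R := f (Fin.castLE hs i) (Fin.castAdd b q)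

/-- The value on `(x, y)` of the alternating form attached to the third family. -/
noncomputable def etaA (x y : Fin (4 + b) → R) : R := pairForm (f (Fin.castLE hs 2)) x y

/-- The value on `(x, y)` of the alternating form attached to the fourth family. -/
noncomputable def etaB (x y : Fin (4 + b) → R) : R := pairForm (f (Fin.castLE hs 3)) x y

/-- The determinant of the pairs of values at `x` and `y` of the two linear forms given by `p`. -/
noncomputable def etaDet (p x y : Fin (4 + b) → R) : R :=
  etaA hs f p x * etaB hs f p y - etaB hs f p x * etaA hs f p y

/-- The bilinear form whose quadratic form vanishes at those points of the first line which lie on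
a common transversal of the four lines. -/
noncomputable def transversalForm (x y : Fin (4 + b) → R) : R :=
  etaA hs f x (firstVec hs f 1 0) * etaB hs f y (firstVec hs f 1 1) -
    etaA hs f x (firstVec hs f 1 1) * etaB hs f y (firstVec hs f 1 0)

/-- These three are the coefficients of α², αβ and β² in the quadratic form evaluated at a point of
the first line with coordinates α, β; see `transversalForm_comb`. -/
noncomputable def coeffZero : R := transversalForm hs f (firstVec hs f 0 0) (firstVec hs f 0 0)

noncomputable def coeffOne : R := transversalForm hs f (firstVec hs f 0 0) (firstVec hs f 0 1) +
  transversalForm hs f (firstVec hs f 0 1) (firstVec hs f 0 0)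

noncomputable def coeffTwo : R := transversalForm hs f (firstVec hs f 0 1) (firstVec hs f 0 1)

/-- The point of the first line with parameter `θ`. -/
noncomputable def pVec (θ : R) : Fin (4 + b) → R :=
  coeffTwo hs f • firstVec hs f 0 0 + θ • firstVec hs f 0 1

/-- The point of the second line on the transversal through `p`. -/
noncomputable def qVec (p : Fin (4 + b) → R) : Fin (4 + b) → R :=
  etaA hs f p (firstVec hs f 1 1) • firstVec hs f 1 0 -
    etaA hs f p (firstVec hs f 1 0) • firstVec hs f 1 1

/-- The parameters of the transversals are the roots of this monic quadratic polynomial. -/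
noncomputable def transversalPoly (θ : R) : R :=
  θ ^ 2 + coeffOne hs f * θ + coeffZero hs f * coeffTwo hs f

/-- The genericity condition on the `i`-th flag at the transversal through `p`. -/
noncomputable def flagCond (p : Fin (4 + b) → R) (i : Fin s) : R :=
  if i.val < 2 then
    etaDet hs f p (f i (Fin.castAdd b 1)) (f i (Fin.castAdd b 2))
  else if i.val = 2 then etaB hs f p (f i (Fin.castAdd b 0))
  else if i.val = 3 then etaA hs f p (f i (Fin.castAdd b 0))
  else etaDet hs f p (f i (Fin.castAdd b 0)) (f i (Fin.castAdd b 1)) *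
    pairForm (f i) p (qVec hs f p)

/-- The product of the genericity conditions at the transversal through `p`. -/
noncomputable def goodCond (p : Fin (4 + b) → R) : R :=
  etaDet hs f p (firstVec hs f 0 1) (firstVec hs f 1 1) * ∏ i, flagCond hs f p i

/-- The determinant of the four vectors spanning the first two lines modulo the `b`-dimensional
member of a flag. -/
noncomputable def spanCond (i : Fin 4) : R := quadForm (f (Fin.castLE hs i))
  ![firstVec hs f 0 0, firstVec hs f 0 1, firstVec hs f 1 0, firstVec hs f 1 1]

/-- The genericity conditions which do not involve the transversals. -/
noncomputable def staticCond : R :=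
  (∏ i, (Matrix.of (f i)).det) *
  (pairForm (f (Fin.castLE hs 0)) (firstVec hs f 1 0) (firstVec hs f 1 1) *
    pairForm (f (Fin.castLE hs 1)) (firstVec hs f 0 0) (firstVec hs f 0 1)) *
  (etaA hs f (firstVec hs f 0 0) (firstVec hs f 0 1) *
    etaA hs f (firstVec hs f 1 0) (firstVec hs f 1 1)) *
  (etaB hs f (firstVec hs f 0 0) (firstVec hs f 0 1) *
    etaB hs f (firstVec hs f 1 0) (firstVec hs f 1 1)) *
  (spanCond hs f 2 * spanCond hs f 3) *
  (coeffTwo hs f * (coeffOne hs f ^ 2 - 4 * (coeffZero hs f * coeffTwo hs f)))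

/-- The image of a family of vectors under a ring homomorphism. -/
def mapFrame (φ : R →+* S) : Fin s → Fin (4 + b) → Fin (4 + b) → S := fun i q r => φ (f i q r)

/-! ### Naturality of the forms under ring homomorphisms -/

section Map

variable (φ : R →+* S)

/-- All conditions are built from determinants in the entries of the frame, hence commute with ring
homomorphisms. The same formulas can therefore be read over polynomial rings, their fraction fields
and specializations. -/
lemma map_coordForm (g : Fin (4 + b) → Fin (4 + b) → R) (j : Fin (4 + b)) (x : Fin (4 + b) → R) :
    φ (coordForm g j x) = coordForm (fun q r => φ (g q r)) j (φ ∘ x) := by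
  simp only [coordForm, LinearMap.comp_apply, LinearMap.proj_apply, Matrix.cramer_transpose_apply,
    RingHom.map_det]
  congr 1
  ext p q
  simp [Matrix.updateRow_apply]
  split_ifs <;> rfl

lemma map_pairForm (g : Fin (4 + b) → Fin (4 + b) → R) (x y : Fin (4 + b) → R) :
    φ (pairForm g x y) = pairForm (fun q r => φ (g q r)) (φ ∘ x) (φ ∘ y) := by
  simp [pairForm, map_coordForm]

lemma map_etaA (x y : Fin (4 + b) → R) :
    φ (etaA hs f x y) = etaA hs (mapFrame f φ) (φ ∘ x) (φ ∘ y) := map_pairForm _ _ _ _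

lemma map_etaB (x y : Fin (4 + b) → R) :
    φ (etaB hs f x y) = etaB hs (mapFrame f φ) (φ ∘ x) (φ ∘ y) := map_pairForm _ _ _ _

lemma map_etaDet (p x y : Fin (4 + b) → R) :
    φ (etaDet hs f p x y) = etaDet hs (mapFrame f φ) (φ ∘ p) (φ ∘ x) (φ ∘ y) := by
  simp [etaDet, map_etaA, map_etaB]

lemma comp_firstVec (i q : Fin 4) : φ ∘ firstVec hs f i q = firstVec hs (mapFrame f φ) i q := rfl

lemma map_transversalForm (x y : Fin (4 + b) → R) :
    φ (transversalForm hs f x y) = transversalForm hs (mapFrame f φ) (φ ∘ x) (φ ∘ y) := by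
  simp [transversalForm, map_etaA, map_etaB, comp_firstVec]

lemma map_coeffZero : φ (coeffZero hs f) = coeffZero hs (mapFrame f φ) :=
  map_transversalForm _ _ _ _ _

lemma map_coeffOne : φ (coeffOne hs f) = coeffOne hs (mapFrame f φ) := by
  simp [coeffOne, map_transversalForm, comp_firstVec]

lemma map_coeffTwo : φ (coeffTwo hs f) = coeffTwo hs (mapFrame f φ) :=
  map_transversalForm _ _ _ _ _

lemma comp_pVec (θ : R) : φ ∘ pVec hs f θ = pVec hs (mapFrame f φ) (φ θ) := by
  funext r
  simp [pVec, ← map_coeffTwo, ← comp_firstVec]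

lemma comp_qVec (p : Fin (4 + b) → R) : φ ∘ qVec hs f p = qVec hs (mapFrame f φ) (φ ∘ p) := by
  funext r
  simp [qVec, ← comp_firstVec, ← map_etaA]

lemma map_transversalPoly (θ : R) :
    φ (transversalPoly hs f θ) = transversalPoly hs (mapFrame f φ) (φ θ) := by
  simp [transversalPoly, map_coeffZero, map_coeffOne, map_coeffTwo]

lemma map_flagCond (p : Fin (4 + b) → R) (i : Fin s) :
    φ (flagCond hs f p i) = flagCond hs (mapFrame f φ) (φ ∘ p) i := by
  unfold flagCond
  split_ifs
  · exact map_etaDet _ _ _ _ _ _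
  · exact map_etaB _ _ _ _ _
  · exact map_etaA _ _ _ _ _
  · rw [map_mul, map_etaDet, map_pairForm, comp_qVec]
    rfl

lemma map_goodCond (p : Fin (4 + b) → R) :
    φ (goodCond hs f p) = goodCond hs (mapFrame f φ) (φ ∘ p) := by
  simp [goodCond, map_flagCond, map_etaDet, comp_firstVec]

lemma map_spanCond (i : Fin 4) : φ (spanCond hs f i) = spanCond hs (mapFrame f φ) i := by
  unfold spanCond quadForm
  rw [RingHom.map_det]
  congr 1
  ext j l
  simp only [RingHom.mapMatrix_apply, Matrix.map_apply, Matrix.of_apply, map_coordForm]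
  fin_cases l <;> rfl

lemma map_staticCond : φ (staticCond hs f) = staticCond hs (mapFrame f φ) := by
  have h1 : ∀ i, φ (Matrix.of (f i)).det = (Matrix.of (mapFrame f φ i)).det := fun i => by
    rw [RingHom.map_det]; rfl
  have h2 : ∀ (i : Fin s) x y, φ (pairForm (f i) x y) =
      pairForm (mapFrame f φ i) (φ ∘ x) (φ ∘ y) := fun i x y => map_pairForm _ _ _ _
  have h4 : φ 4 = 4 := map_ofNat φ 4
  simp [staticCond, h4, map_etaA, map_etaB, comp_firstVec, map_spanCond, map_coeffZero, map_coeffOne,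
    map_coeffTwo, h1, h2]

end Map

section Bilinear

variable (x x' y y' : Fin (4 + b) → R) (c : R)

lemma etaA_add : etaA hs f x (y + y') = etaA hs f x y + etaA hs f x y' := by
  simp [etaA, pairForm]; ring

lemma etaA_smul : etaA hs f x (c • y) = c * etaA hs f x y := by
  simp [etaA, pairForm]; ring

lemma etaA_self : etaA hs f x x = 0 := by
  simp [etaA, pairForm]; ring

lemma etaB_add : etaB hs f x (y + y') = etaB hs f x y + etaB hs f x y' := by
  simp [etaB, pairForm]; ring

lemma etaB_smul : etaB hs f x (c • y) = c * etaB hs f x y := by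
  simp [etaB, pairForm]; ring

lemma etaB_self : etaB hs f x x = 0 := by
  simp [etaB, pairForm]; ring

lemma etaA_qVec : etaA hs f x (qVec hs f x) = 0 := by
  simp only [qVec, sub_eq_add_neg, ← neg_smul, etaA_add, etaA_smul]; ring

/-- `qVec` is built to be a zero of the first linear form attached to the point; the value of the
second form on it decides whether the plane through both points meets the fourth line. -/
lemma etaB_qVec : etaB hs f x (qVec hs f x) = -transversalForm hs f x x := by
  simp only [qVec, sub_eq_add_neg, ← neg_smul, etaB_add, etaB_smul, transversalForm]; ring

/-- Putting α = c₂ and β = θ gives c₂ (θ² + c₁ θ + c₀ c₂). The parameter θ is thus a root of a monic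
polynomial, which makes it integral over the ring of coordinates. -/
lemma transversalForm_pVec (θ : R) : transversalForm hs f (pVec hs f θ) (pVec hs f θ) =
    coeffTwo hs f * transversalPoly hs f θ := by
  have h : ∀ α β : R, transversalForm hs f (α • firstVec hs f 0 0 + β • firstVec hs f 0 1)
      (α • firstVec hs f 0 0 + β • firstVec hs f 0 1) =
      α ^ 2 * coeffZero hs f + α * β * coeffOne hs f + β ^ 2 * coeffTwo hs f := by
    intro α β
    simp only [transversalForm, coeffZero, coeffOne, coeffTwo, etaA, etaB, pairForm, map_add,
      map_smul, smul_eq_mul]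
    ring
  rw [pVec, h, transversalPoly]
  ring

lemma transversalForm_comb (α β : R) :
    transversalForm hs f (α • firstVec hs f 0 0 + β • firstVec hs f 0 1)
      (α • firstVec hs f 0 0 + β • firstVec hs f 0 1) =
      α ^ 2 * coeffZero hs f + α * β * coeffOne hs f + β ^ 2 * coeffTwo hs f := by
  simp only [transversalForm, coeffZero, coeffOne, coeffTwo, etaA, etaB, pairForm, map_add,
    map_smul, smul_eq_mul]
  ring

end Bilinear

end Forms

/-! ### The forms over a field, for vectors of a basis -/

section FieldForms

variable {k : Type*} [Field k] {b s : ℕ}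

lemma det_of_basis_ne_zero (e : Basis (Fin (4 + b)) k (Fin (4 + b) → k)) :
    (Matrix.of e).det ≠ 0 := by
  have h : IsUnit (Matrix.of e) := Matrix.linearIndependent_rows_iff_isUnit.1 e.linearIndependent
  exact ((Matrix.isUnit_iff_isUnit_det _).1 h).ne_zero

/-- Cramer's rule. -/
lemma coordForm_basis (e : Basis (Fin (4 + b)) k (Fin (4 + b) → k)) (j : Fin (4 + b))
    (x : Fin (4 + b) → k) : coordForm e j x = (Matrix.of e).det * e.repr x j := by
  have h : (Matrix.of e).transpose.mulVec (fun q => e.repr x q) = x := by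
    conv_rhs => rw [← e.sum_repr x]
    ext r
    simp [Matrix.mulVec, dotProduct, mul_comm]
  conv_lhs => rw [← h]
  simp [coordForm, Matrix.cramer_eq_adjugate_mulVec, Matrix.mulVec_mulVec, Matrix.adjugate_mul,
    Matrix.smul_mulVec]

lemma mem_space_add_two_iff (e : Basis (Fin (4 + b)) k (Fin (4 + b) → k)) (x : Fin (4 + b) → k) :
    x ∈ (CompleteFlag.ofBasis e).space (b + 2) ↔
      coordForm e (lastIdx b 2) x = 0 ∧ coordForm e (lastIdx b 3) x = 0 := by
  simp only [coordForm_basis, mul_eq_zero, det_of_basis_ne_zero, false_or,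
    CompleteFlag.mem_ofBasis_space]
  constructor
  · intro h
    exact ⟨h _ (by simp [lastIdx]), h _ (by simp [lastIdx])⟩
  · rintro ⟨h2, h3⟩ q hq
    have : q = lastIdx b 2 ∨ q = lastIdx b 3 := by
      simp only [lastIdx, Fin.ext_iff]
      have : ((2 : Fin 4) : ℕ) = 2 := rfl
      have : ((3 : Fin 4) : ℕ) = 3 := rfl
      omega
    rcases this with rfl | rfl <;> assumption

lemma pairForm_left_eq_zero {e : Basis (Fin (4 + b)) k (Fin (4 + b) → k)} {x : Fin (4 + b) → k}
    (hx : x ∈ (CompleteFlag.ofBasis e).space (b + 2)) (y : Fin (4 + b) → k) :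
    pairForm e x y = 0 := by
  rw [mem_space_add_two_iff] at hx
  simp [pairForm, hx]

lemma pairForm_right_eq_zero {e : Basis (Fin (4 + b)) k (Fin (4 + b) → k)} {y : Fin (4 + b) → k}
    (hy : y ∈ (CompleteFlag.ofBasis e).space (b + 2)) (x : Fin (4 + b) → k) :
    pairForm e x y = 0 := by
  rw [mem_space_add_two_iff] at hy
  simp [pairForm, hy]

lemma eq_zero_of_pairForm_ne_zero {e : Basis (Fin (4 + b)) k (Fin (4 + b) → k)}
    {x y : Fin (4 + b) → k} (h : pairForm e x y ≠ 0) {α β : k}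
    (hm : α • x + β • y ∈ (CompleteFlag.ofBasis e).space (b + 2)) : α = 0 ∧ β = 0 := by
  have h1 := pairForm_left_eq_zero hm y
  have h2 := pairForm_right_eq_zero hm x
  have e1 : pairForm e (α • x + β • y) y = α * pairForm e x y := by simp [pairForm]; ring
  have e2 : pairForm e x (α • x + β • y) = β * pairForm e x y := by simp [pairForm]; ring
  rw [e1] at h1
  rw [e2] at h2
  exact ⟨(mul_eq_zero.1 h1).resolve_right h, (mul_eq_zero.1 h2).resolve_right h⟩

lemma exists_of_two_by_two {a₁ a₂ b₁ b₂ : k} (h : a₁ * b₂ - a₂ * b₁ = 0) :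
    ∃ α β : k, (α ≠ 0 ∨ β ≠ 0) ∧ α * a₁ + β * b₁ = 0 ∧ α * a₂ + β * b₂ = 0 := by
  by_cases h1 : b₁ = 0 ∧ b₂ = 0
  · exact ⟨0, 1, by simp, by simp [h1], by simp [h1]⟩
  · by_cases h2 : b₁ = 0
    · have hb2 : b₂ ≠ 0 := fun h3 => h1 ⟨h2, h3⟩
      refine ⟨b₂, -a₂, Or.inl hb2, ?_, by ring⟩
      linear_combination h
    · refine ⟨b₁, -a₁, Or.inl h2, by ring, ?_⟩
      linear_combination -h

lemma exists_of_pairForm_eq_zero {e : Basis (Fin (4 + b)) k (Fin (4 + b) → k)}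
    {x y : Fin (4 + b) → k} (h : pairForm e x y = 0) :
    ∃ α β : k, (α ≠ 0 ∨ β ≠ 0) ∧
      α • x + β • y ∈ (CompleteFlag.ofBasis e).space (b + 2) := by
  obtain ⟨α, β, hne, h1, h2⟩ := exists_of_two_by_two h
  exact ⟨α, β, hne, by rw [mem_space_add_two_iff]; simp [h1, h2]⟩

/-- The radical of the alternating form is the member of index b + 2, so pairing with p is a linear
form which vanishes exactly on the span of this member and p, and q already lies there. -/
lemma mem_space_sup_span_iff {e : Basis (Fin (4 + b)) k (Fin (4 + b) → k)}
    {p q : Fin (4 + b) → k} (hp : p ∉ (CompleteFlag.ofBasis e).space (b + 2))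
    (hpq : pairForm e p q = 0) (x : Fin (4 + b) → k) :
    x ∈ (CompleteFlag.ofBasis e).space (b + 2) ⊔ Submodule.span k {p, q} ↔ pairForm e p x = 0 := by
  constructor
  · intro hx
    obtain ⟨y, hy, z, hz, rfl⟩ := Submodule.mem_sup.1 hx
    obtain ⟨α, β, rfl⟩ := Submodule.mem_span_pair.1 hz
    have h1 := pairForm_right_eq_zero hy p
    have e1 : pairForm e p (y + (α • p + β • q)) = pairForm e p y + β * pairForm e p q := by
      simp [pairForm]; ring
    rw [e1, h1, hpq]; simp
  · intro hx
    obtain ⟨α, β, hne, hm⟩ := exists_of_pairForm_eq_zero hx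
    have hβ : β ≠ 0 := by
      rintro rfl
      have hα : α ≠ 0 := by simpa using hne
      rw [zero_smul, add_zero] at hm
      exact hp (((Submodule.smul_mem_iff _ hα).1 hm))
    rw [← Submodule.smul_mem_iff _ hβ]
    have e1 : β • x = (α • p + β • x) + (-α) • p := by simp
    rw [e1]
    exact Submodule.add_mem_sup hm (Submodule.smul_mem _ _ (Submodule.subset_span (by simp)))

lemma mem_ofBasis_space_iff_exists {e : Basis (Fin (4 + b)) k (Fin (4 + b) → k)}
    (x : Fin (4 + b) → k) :
    (x ∈ (CompleteFlag.ofBasis e).space 1 ↔ ∃ α : k, x = α • e (Fin.castAdd b 0)) ∧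
    (x ∈ (CompleteFlag.ofBasis e).space 2 ↔
      ∃ α β : k, x = α • e (Fin.castAdd b 0) + β • e (Fin.castAdd b 1)) ∧
    (x ∈ (CompleteFlag.ofBasis e).space 3 ↔ ∃ α β γ : k,
      x = α • e (Fin.castAdd b 0) + β • e (Fin.castAdd b 1) + γ • e (Fin.castAdd b 2)) := by
  have h1 : e '' {q | q.val < 1} = {e (Fin.castAdd b 0)} := by
    have : {q : Fin (4 + b) | q.val < 1} = {Fin.castAdd b 0} := by
      ext q
      simp only [Set.mem_ofPred_eq, Set.mem_singleton_iff, Fin.ext_iff, Fin.val_castAdd, Fin.val_zero]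
      omega
    rw [this, Set.image_singleton]
  have h2 : e '' {q | q.val < 2} = {e (Fin.castAdd b 0), e (Fin.castAdd b 1)} := by
    have : {q : Fin (4 + b) | q.val < 2} = {Fin.castAdd b 0, Fin.castAdd b 1} := by
      ext q
      simp only [Set.mem_ofPred_eq, Set.mem_insert_iff, Set.mem_singleton_iff, Fin.ext_iff,
        Fin.val_castAdd, Fin.val_zero, Fin.val_one]
      omega
    rw [this, Set.image_pair]
  have h3 : e '' {q | q.val < 3} =
      {e (Fin.castAdd b 0), e (Fin.castAdd b 1), e (Fin.castAdd b 2)} := by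
    have : {q : Fin (4 + b) | q.val < 3} =
        {Fin.castAdd b 0, Fin.castAdd b 1, Fin.castAdd b 2} := by
      ext q
      simp only [Set.mem_ofPred_eq, Set.mem_insert_iff, Set.mem_singleton_iff, Fin.ext_iff,
        Fin.val_castAdd, Fin.val_zero, Fin.val_one, Fin.val_two]
      omega
    rw [this, Set.image_insert_eq, Set.image_pair]
  simp only [CompleteFlag.ofBasis_space, h1, h2, h3, Submodule.mem_span_singleton,
    Submodule.mem_span_pair, Submodule.mem_span_triple, eq_comm]
  exact ⟨trivial, trivial, trivial⟩

end FieldForms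

/-! ### Transversality and transversals in terms of the forms -/

section Comparison

variable {k : Type*} [Field k] {b s : ℕ} {hs : 4 ≤ s}
  (e : Fin s → Basis (Fin (4 + b)) k (Fin (4 + b) → k))

/-- The vectors of a tuple of bases. -/
noncomputable def frame : Fin s → Fin (4 + b) → Fin (4 + b) → k := fun i q => e i q

/-- The tuple of flags given by a tuple of bases. -/
noncomputable def frameFlags : Fin s → CompleteFlag k (Fin (4 + b) → k) :=
  fun i => CompleteFlag.ofBasis (e i)

variable {e}

lemma mem_line_iff (i : Fin 4) (x : Fin (4 + b) → k) :
    x ∈ (frameFlags e (Fin.castLE hs i)).space 2 ↔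
      ∃ α β : k, x = α • firstVec hs (frame e) i 0 + β • firstVec hs (frame e) i 1 :=
  (mem_ofBasis_space_iff_exists x).2.1

lemma firstVec_mem (i : Fin 4) : firstVec hs (frame e) i 0 ∈
    (frameFlags e (Fin.castLE hs i)).space 2 ∧
    firstVec hs (frame e) i 1 ∈ (frameFlags e (Fin.castLE hs i)).space 2 :=
  ⟨(mem_line_iff i _).2 ⟨1, 0, by simp⟩, (mem_line_iff i _).2 ⟨0, 1, by simp⟩⟩

lemma eq_zero_of_firstVec (i : Fin 4) {α β : k}
    (h : α • firstVec hs (frame e) i 0 + β • firstVec hs (frame e) i 1 = 0) : α = 0 ∧ β = 0 := by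
  have hne : (Fin.castAdd b 0 : Fin (4 + b)) ≠ Fin.castAdd b 1 := by
    simp [Fin.ext_iff]
  have h0 := congrArg (fun v => (e (Fin.castLE hs i)).repr v (Fin.castAdd b 0)) h
  have h1 := congrArg (fun v => (e (Fin.castLE hs i)).repr v (Fin.castAdd b 1)) h
  simp [firstVec, frame, hne, hne.symm] at h0 h1
  exact ⟨h0, h1⟩

lemma disjoint_of_pairForm_ne_zero {i j : Fin 4}
    (h : pairForm (frame e (Fin.castLE hs i)) (firstVec hs (frame e) j 0)
      (firstVec hs (frame e) j 1) ≠ 0) :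
    Disjoint ((frameFlags e (Fin.castLE hs i)).space (b + 2))
      ((frameFlags e (Fin.castLE hs j)).space 2) := by
  rw [Submodule.disjoint_def]
  intro x hx hx'
  obtain ⟨α, β, rfl⟩ := (mem_line_iff j x).1 hx'
  obtain ⟨rfl, rfl⟩ := eq_zero_of_pairForm_ne_zero (e := e (Fin.castLE hs i)) h hx
  simp

lemma pairForm_ne_zero_of_disjoint {i j : Fin 4}
    (h : Disjoint ((frameFlags e (Fin.castLE hs i)).space (b + 2))
      ((frameFlags e (Fin.castLE hs j)).space 2)) :
    pairForm (frame e (Fin.castLE hs i)) (firstVec hs (frame e) j 0)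
      (firstVec hs (frame e) j 1) ≠ 0 := by
  intro h0
  obtain ⟨α, β, hne, hm⟩ := exists_of_pairForm_eq_zero (e := e (Fin.castLE hs i)) h0
  have h1 := Submodule.disjoint_def.1 h _ hm ((mem_line_iff j _).2 ⟨α, β, rfl⟩)
  obtain ⟨h2, h3⟩ := eq_zero_of_firstVec j h1
  tauto

lemma mem_lineSpan_iff (x : Fin (4 + b) → k) : x ∈ lineSpan hs (frameFlags e) ↔
    ∃ α β γ δ : k, x = α • firstVec hs (frame e) 0 0 + β • firstVec hs (frame e) 0 1 +
      (γ • firstVec hs (frame e) 1 0 + δ • firstVec hs (frame e) 1 1) := by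
  constructor
  · intro hx
    obtain ⟨y, hy, z, hz, rfl⟩ := Submodule.mem_sup.1 hx
    obtain ⟨α, β, rfl⟩ := (mem_line_iff 0 y).1 hy
    obtain ⟨γ, δ, rfl⟩ := (mem_line_iff 1 z).1 hz
    exact ⟨α, β, γ, δ, rfl⟩
  · rintro ⟨α, β, γ, δ, rfl⟩
    exact Submodule.add_mem_sup ((mem_line_iff 0 _).2 ⟨α, β, rfl⟩)
      ((mem_line_iff 1 _).2 ⟨γ, δ, rfl⟩)

lemma mem_space_iff_coordForm (e : Basis (Fin (4 + b)) k (Fin (4 + b) → k)) (x : Fin (4 + b) → k) :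
    x ∈ (CompleteFlag.ofBasis e).space b ↔ ∀ j : Fin 4, coordForm e (lastIdx b j) x = 0 := by
  simp only [coordForm_basis, mul_eq_zero, det_of_basis_ne_zero, false_or,
    CompleteFlag.mem_ofBasis_space]
  constructor
  · intro h j
    exact h _ (by simp [lastIdx])
  · intro h q hq
    have : q = lastIdx b ⟨q.val - b, by omega⟩ := by
      simp only [lastIdx, Fin.ext_iff]
      omega
    rw [this]
    exact h _

/-- A kernel vector of the matrix is a combination of the four spanning vectors whose last four
coordinates vanish. Disjointness of the two lines makes this combination nonzero. -/
lemma disjoint_lineSpan_iff (i : Fin 4)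
    (hd : Disjoint ((frameFlags e (Fin.castLE hs 0)).space 2)
      ((frameFlags e (Fin.castLE hs 1)).space 2)) :
    Disjoint ((frameFlags e (Fin.castLE hs i)).space b) (lineSpan hs (frameFlags e)) ↔
      spanCond hs (frame e) i ≠ 0 := by
  rw [Ne, spanCond, quadForm, ← Matrix.exists_mulVec_eq_zero_iff, Submodule.disjoint_def]
  have key : ∀ v : Fin 4 → k, (∀ j, coordForm (frame e (Fin.castLE hs i)) (lastIdx b j)
      (v 0 • firstVec hs (frame e) 0 0 + v 1 • firstVec hs (frame e) 0 1 +
      (v 2 • firstVec hs (frame e) 1 0 + v 3 • firstVec hs (frame e) 1 1)) = 0) ↔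
      Matrix.mulVec (Matrix.of fun j l => coordForm (frame e (Fin.castLE hs i)) (lastIdx b j)
        (![firstVec hs (frame e) 0 0, firstVec hs (frame e) 0 1, firstVec hs (frame e) 1 0,
          firstVec hs (frame e) 1 1] l)) v = 0 := by
    intro v
    rw [funext_iff]
    refine forall_congr' fun j => ?_
    simp [Matrix.mulVec, dotProduct, Fin.sum_univ_four]
    ring_nf
  constructor
  · rintro h ⟨v, hv, hv0⟩
    refine hv ?_
    have h1 := h _ ((mem_space_iff_coordForm (e (Fin.castLE hs i)) _).2 ((key v).2 hv0))
      ((mem_lineSpan_iff _).2 ⟨_, _, _, _, rfl⟩)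
    have h2 := Submodule.disjoint_def.1 hd _ ((mem_line_iff 0 _).2 ⟨v 0, v 1, rfl⟩) (by
      rw [eq_neg_of_add_eq_zero_left h1]
      exact Submodule.neg_mem _ ((mem_line_iff 1 _).2 ⟨v 2, v 3, rfl⟩))
    rw [h2, zero_add] at h1
    obtain ⟨h3, h4⟩ := eq_zero_of_firstVec 0 h2
    obtain ⟨h5, h6⟩ := eq_zero_of_firstVec 1 h1
    funext j
    fin_cases j <;> assumption
  · intro h x hx hx'
    obtain ⟨α, β, γ, δ, rfl⟩ := (mem_lineSpan_iff x).1 hx'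
    by_contra hne
    refine h ⟨![α, β, γ, δ], fun h0 => hne ?_, (key _).1 ?_⟩
    · have h1 := congrFun h0 0
      have h2 := congrFun h0 1
      have h3 := congrFun h0 2
      have h4 := congrFun h0 3
      simp at h1 h2 h3 h4
      simp [h1, h2, h3, h4]
    · exact (mem_space_iff_coordForm (e (Fin.castLE hs i)) _).1 hx

/-- Nonvanishing of the static conditions implies transversality. -/
lemma isTransversal_of_staticCond (h : staticCond hs (frame e) ≠ 0) :
    IsTransversal b hs (frameFlags e) := by
  simp only [staticCond, mul_ne_zero_iff] at h
  obtain ⟨⟨⟨⟨⟨-, h0, h1⟩, h2, h3⟩, h4, h5⟩, h6, h7⟩, -⟩ := h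
  have hd := (disjoint_of_pairForm_ne_zero (hs := hs) h0).mono_left
    ((frameFlags e _).mono (show 2 ≤ b + 2 by omega))
  exact ⟨disjoint_of_pairForm_ne_zero h0, disjoint_of_pairForm_ne_zero h1,
    disjoint_of_pairForm_ne_zero h2, disjoint_of_pairForm_ne_zero h3,
    disjoint_of_pairForm_ne_zero h4, disjoint_of_pairForm_ne_zero h5,
    (disjoint_lineSpan_iff 2 hd).2 h6, (disjoint_lineSpan_iff 3 hd).2 h7⟩

section Transversals

variable (hF : IsTransversal b hs (frameFlags e))
include hF

/-- Otherwise the second line lies in the span of p and the large member of the third flag. That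
span has dimension b + 3, too small for the large member and a disjoint plane. -/
lemma etaA_ne_zero_or {p : Fin (4 + b) → k} (hp : p ∈ (frameFlags e (Fin.castLE hs 0)).space 2)
    (hp0 : p ≠ 0) : etaA hs (frame e) p (firstVec hs (frame e) 1 0) ≠ 0 ∨
      etaA hs (frame e) p (firstVec hs (frame e) 1 1) ≠ 0 := by
  by_contra! hcon
  obtain ⟨h1, h2⟩ := hcon
  have hpF : p ∉ (frameFlags e (Fin.castLE hs 2)).space (b + 2) := fun h =>
    hp0 (Submodule.disjoint_def.1 hF.disj20 p h hp)
  have h3 := pairForm_ne_zero_of_disjoint hF.disj21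
  have hx : ∀ w, pairForm (frame e (Fin.castLE hs 2)) p w = 0 →
      w ∈ (frameFlags e (Fin.castLE hs 2)).space (b + 2) ⊔ Submodule.span k {p, p} := by
    intro w hw
    exact (mem_space_sup_span_iff hpF (etaA_self hs (frame e) p) w).2 hw
  have hdim : (frameFlags e (Fin.castLE hs 1)).space 2 ≤
      (frameFlags e (Fin.castLE hs 2)).space (b + 2) ⊔ Submodule.span k {p, p} := by
    intro w hw
    obtain ⟨α, β, rfl⟩ := (mem_line_iff 1 w).1 hw
    exact Submodule.add_mem _ (Submodule.smul_mem _ _ (hx _ h1)) (Submodule.smul_mem _ _ (hx _ h2))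
  have e1 := hF.disj21.finrank_add_le le_sup_left hdim
  have e2 := Submodule.finrank_add_le_finrank_add_finrank
    ((frameFlags e (Fin.castLE hs 2)).space (b + 2)) (Submodule.span k {p, p})
  have e3 : finrank k ↥(Submodule.span k {p, p}) = 1 := by
    rw [Set.pair_eq_singleton, finrank_span_singleton hp0]
  rw [CompleteFlag.finrank_space _ _ (by simp; omega),
    CompleteFlag.finrank_space _ _ (by simp; omega)] at e1
  rw [CompleteFlag.finrank_space _ _ (by simp; omega)] at e2
  omega

lemma qVec_mem_and_ne_zero {p : Fin (4 + b) → k}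
    (hp : p ∈ (frameFlags e (Fin.castLE hs 0)).space 2) (hp0 : p ≠ 0) :
    qVec hs (frame e) p ∈ (frameFlags e (Fin.castLE hs 1)).space 2 ∧ qVec hs (frame e) p ≠ 0 := by
  refine ⟨?_, fun h => ?_⟩
  · rw [mem_line_iff]
    exact ⟨etaA hs (frame e) p (firstVec hs (frame e) 1 1),
      -etaA hs (frame e) p (firstVec hs (frame e) 1 0), by rw [qVec, neg_smul,
      sub_eq_add_neg]⟩
  · rw [qVec, sub_eq_add_neg, ← neg_smul] at h
    obtain ⟨h1, h2⟩ := eq_zero_of_firstVec 1 h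
    rcases etaA_ne_zero_or hF hp hp0 with h3 | h3
    · exact h3 (neg_eq_zero.1 h2)
    · exact h3 h1

lemma notMem_two {p : Fin (4 + b) → k} (hp : p ∈ (frameFlags e (Fin.castLE hs 0)).space 2)
    (hp0 : p ≠ 0) : p ∉ (frameFlags e (Fin.castLE hs 2)).space (b + 2) := fun h =>
  hp0 (Submodule.disjoint_def.1 hF.disj20 p h hp)

lemma notMem_three {p : Fin (4 + b) → k} (hp : p ∈ (frameFlags e (Fin.castLE hs 0)).space 2)
    (hp0 : p ≠ 0) : p ∉ (frameFlags e (Fin.castLE hs 3)).space (b + 2) := fun h =>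
  hp0 (Submodule.disjoint_def.1 hF.disj30 p h hp)

lemma disj_lines : Disjoint ((frameFlags e (Fin.castLE hs 0)).space 2)
    ((frameFlags e (Fin.castLE hs 1)).space 2) :=
  hF.disj01.mono_left ((frameFlags e _).mono (show 2 ≤ b + 2 by omega))

lemma linearIndependent_pair_lines {p q : Fin (4 + b) → k}
    (hp : p ∈ (frameFlags e (Fin.castLE hs 0)).space 2) (hp0 : p ≠ 0)
    (hq : q ∈ (frameFlags e (Fin.castLE hs 1)).space 2) (hq0 : q ≠ 0) {α β : k}
    (h : α • p + β • q = 0) : α = 0 ∧ β = 0 := by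
  have h1 : α • p = 0 := Submodule.disjoint_def.1 (disj_lines hF) _ (Submodule.smul_mem _ _ hp) (by
    rw [eq_neg_of_add_eq_zero_left h]
    exact Submodule.neg_mem _ (Submodule.smul_mem _ _ hq))
  rw [h1, zero_add] at h
  exact ⟨(smul_eq_zero.1 h1).resolve_right hp0, (smul_eq_zero.1 h).resolve_right hq0⟩

/-- The plane meets the third line because `qVec` is a zero of its form, and the fourth exactly
because the quadratic form vanishes at p. -/
lemma isLineSolution_span {p : Fin (4 + b) → k}
    (hp : p ∈ (frameFlags e (Fin.castLE hs 0)).space 2) (hp0 : p ≠ 0)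
    (hpp : transversalForm hs (frame e) p p = 0) :
    IsLineSolution b hs (frameFlags e) (Submodule.span k {p, qVec hs (frame e) p}) := by
  obtain ⟨hq, hq0⟩ := qVec_mem_and_ne_zero hF hp hp0
  have hmp : p ∈ Submodule.span k {p, qVec hs (frame e) p} := Submodule.subset_span (by simp)
  have hmq : qVec hs (frame e) p ∈ Submodule.span k {p, qVec hs (frame e) p} :=
    Submodule.subset_span (by simp)
  have hmeet : ∀ i : Fin 4, pairForm (frame e (Fin.castLE hs i)) p (qVec hs (frame e) p) = 0 →
      ¬Disjoint (Submodule.span k {p, qVec hs (frame e) p})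
        ((frameFlags e (Fin.castLE hs i)).space (b + 2)) := by
    intro i h0 hd
    obtain ⟨α, β, hne, hm⟩ := exists_of_pairForm_eq_zero (e := e (Fin.castLE hs i)) h0
    have h1 := Submodule.disjoint_def.1 hd _ (Submodule.mem_span_pair.2 ⟨α, β, rfl⟩) hm
    obtain ⟨h2, h3⟩ := linearIndependent_pair_lines hF hp hp0 hq hq0 h1
    tauto
  refine ⟨?_, ?_, fun h => hp0 (Submodule.disjoint_def.1 h p hmp hp),
    fun h => hq0 (Submodule.disjoint_def.1 h _ hmq hq), hmeet 2 (etaA_qVec hs _ p), hmeet 3 ?_⟩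
  · rw [Submodule.span_le]
    rintro x (rfl | rfl)
    · exact Submodule.mem_sup_left hp
    · exact Submodule.mem_sup_right hq
  · have hli : LinearIndependent k ![p, qVec hs (frame e) p] :=
      LinearIndependent.pair_iff.2 fun α β h => linearIndependent_pair_lines hF hp hp0 hq hq0 h
    have := finrank_span_eq_card hli
    rwa [Matrix.range_cons, Matrix.range_cons, Matrix.range_empty, Set.union_empty,
      Fintype.card_fin] at this
  · have := etaB_qVec hs (frame e) p
    rwa [hpp, neg_zero] at this

/-- A solution is spanned by a point p of the first line and a point q of the second, and meeting
the other two lines means that two linear forms attached to p vanish at q. A nonzero common zero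
forces the determinant of these forms to vanish, and the first form alone determines q up to a
scalar. -/
lemma IsLineSolution.exists_eq_span {h : Submodule k (Fin (4 + b) → k)}
    (hh : IsLineSolution b hs (frameFlags e) h) :
    ∃ p ∈ (frameFlags e (Fin.castLE hs 0)).space 2, p ≠ 0 ∧
      transversalForm hs (frame e) p p = 0 ∧ h = Submodule.span k {p, qVec hs (frame e) p} := by
  obtain ⟨p, ⟨hph, hp⟩, hp0⟩ := Submodule.exists_mem_ne_zero_of_ne_bot
    (fun e => hh.meet0 (disjoint_iff.2 e))
  obtain ⟨q, ⟨hqh, hq⟩, hq0⟩ := Submodule.exists_mem_ne_zero_of_ne_bot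
    (fun e => hh.meet1 (disjoint_iff.2 e))
  have hli : LinearIndependent k ![p, q] :=
    LinearIndependent.pair_iff.2 fun α β h => linearIndependent_pair_lines hF hp hp0 hq hq0 h
  have hspan : h = Submodule.span k {p, q} := by
    refine (Submodule.eq_of_le_of_finrank_eq (Submodule.span_le.2 ?_) ?_).symm
    · rintro x (rfl | rfl) <;> assumption
    · have := finrank_span_eq_card hli
      rw [Matrix.range_cons, Matrix.range_cons, Matrix.range_empty, Set.union_empty,
        Fintype.card_fin] at this
      rw [hh.finrank_eq]
      exact this
  have hpair : ∀ i : Fin 4, ¬Disjoint h ((frameFlags e (Fin.castLE hs i)).space (b + 2)) →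
      pairForm (frame e (Fin.castLE hs i)) p q = 0 := by
    intro i hi
    by_contra hne
    refine hi (Submodule.disjoint_def.2 fun x hx hx' => ?_)
    rw [hspan] at hx
    obtain ⟨α, β, rfl⟩ := Submodule.mem_span_pair.1 hx
    obtain ⟨rfl, rfl⟩ := eq_zero_of_pairForm_ne_zero (e := e (Fin.castLE hs i)) hne hx'
    simp
  have hA : etaA hs (frame e) p q = 0 := hpair 2 hh.meet2
  have hB : etaB hs (frame e) p q = 0 := hpair 3 hh.meet3
  obtain ⟨γ, δ, rfl⟩ := (mem_line_iff 1 q).1 hq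
  set v₁ := firstVec hs (frame e) 1 0 with hv₁
  set v₂ := firstVec hs (frame e) 1 1 with hv₂
  rw [etaA_add, etaA_smul, etaA_smul] at hA
  rw [etaB_add, etaB_smul, etaB_smul] at hB
  have hγδ : γ ≠ 0 ∨ δ ≠ 0 := by
    by_contra! hc
    exact hq0 (by simp [hc])
  have hT : transversalForm hs (frame e) p p = 0 := by
    rw [transversalForm, ← hv₁, ← hv₂]
    rcases hγδ with hne | hne
    · refine (mul_eq_zero.1 ?_).resolve_left hne
      linear_combination etaB hs (frame e) p v₂ * hA - etaA hs (frame e) p v₂ * hB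
    · refine (mul_eq_zero.1 ?_).resolve_left hne
      linear_combination etaA hs (frame e) p v₁ * hB - etaB hs (frame e) p v₁ * hA
  refine ⟨p, hp, hp0, hT, ?_⟩
  have hsol := isLineSolution_span hF hp hp0 hT
  refine (Submodule.eq_of_le_of_finrank_eq (Submodule.span_le.2 ?_)
    (hsol.finrank_eq.trans hh.finrank_eq.symm)).symm
  rintro x (rfl | rfl)
  · exact hph
  · change qVec hs (frame e) p ∈ h
    rcases hγδ with hne | hne
    · rw [← Submodule.smul_mem_iff _ hne]
      have : γ • qVec hs (frame e) p = etaA hs (frame e) p v₂ • (γ • v₁ + δ • v₂) := by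
        rw [qVec, ← hv₁, ← hv₂, smul_sub, smul_smul, smul_smul, smul_add, smul_smul, smul_smul,
          show γ * etaA hs (frame e) p v₁ = -(etaA hs (frame e) p v₂ * δ) by
            linear_combination hA]
        rw [neg_smul, sub_neg_eq_add, mul_comm γ]
      rw [this]
      exact Submodule.smul_mem _ _ hqh
    · rw [← Submodule.smul_mem_iff _ hne]
      have : δ • qVec hs (frame e) p = (-etaA hs (frame e) p v₁) • (γ • v₁ + δ • v₂) := by
        rw [qVec, ← hv₁, ← hv₂, smul_sub, smul_smul, smul_smul, smul_add, smul_smul, smul_smul,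
          show δ * etaA hs (frame e) p v₂ = -(etaA hs (frame e) p v₁ * γ) by
            linear_combination hA]
        rw [neg_mul, neg_mul, neg_smul, neg_smul, sub_eq_add_neg, mul_comm δ]
      rw [this]
      exact Submodule.smul_mem _ _ hqh

omit hF in
lemma pVec_mem (θ : k) :
    pVec hs (frame e) θ ∈ (frameFlags e (Fin.castLE hs 0)).space 2 :=
  (mem_line_iff 0 _).2 ⟨_, _, rfl⟩

omit hF in
lemma pVec_ne_zero (hc : coeffTwo hs (frame e) ≠ 0) (θ : k) : pVec hs (frame e) θ ≠ 0 := fun h =>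
  hc (eq_zero_of_firstVec 0 h).1

/-- The transversal with parameter `θ`. -/
noncomputable def lineSol (hs : 4 ≤ s) (f : Fin s → Fin (4 + b) → Fin (4 + b) → k) (θ : k) :
    Submodule k (Fin (4 + b) → k) :=
  Submodule.span k {pVec hs f θ, qVec hs f (pVec hs f θ)}

lemma isLineSolution_lineSol (hc : coeffTwo hs (frame e) ≠ 0) {θ : k}
    (hθ : transversalPoly hs (frame e) θ = 0) :
    IsLineSolution b hs (frameFlags e) (lineSol hs (frame e) θ) :=
  isLineSolution_span hF (pVec_mem θ) (pVec_ne_zero hc θ)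
    (by rw [transversalForm_pVec, hθ, mul_zero])

omit hF in
lemma span_qVec_smul {p : Fin (4 + b) → k} {c : k} (hc : c ≠ 0) :
    Submodule.span k {c • p, qVec hs (frame e) (c • p)} =
      Submodule.span k {p, qVec hs (frame e) p} := by
  have h1 : qVec hs (frame e) (c • p) = c • qVec hs (frame e) p := by
    simp only [qVec, etaA, pairForm, map_smul, smul_eq_mul, smul_sub, smul_smul]
    congr 2 <;> ring
  rw [h1, Submodule.span_insert, Submodule.span_insert, Submodule.span_singleton_smul_eq
    (IsUnit.mk0 c hc), Submodule.span_singleton_smul_eq (IsUnit.mk0 c hc)]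

/-- A point αu + βv with α = 0 would make c₂ vanish; otherwise scaling by c₂ / α gives the point
with parameter c₂ β / α. -/
lemma IsLineSolution.exists_eq_lineSol (hc : coeffTwo hs (frame e) ≠ 0)
    {h : Submodule k (Fin (4 + b) → k)} (hh : IsLineSolution b hs (frameFlags e) h) :
    ∃ θ, transversalPoly hs (frame e) θ = 0 ∧ h = lineSol hs (frame e) θ := by
  obtain ⟨p, hp, hp0, hT, rfl⟩ := hh.exists_eq_span hF
  obtain ⟨α, β, rfl⟩ := (mem_line_iff 0 p).1 hp
  rw [transversalForm_comb] at hT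
  have hα : α ≠ 0 := by
    rintro rfl
    have hβ : β ≠ 0 := by
      rintro rfl
      exact hp0 (by simp)
    have h0 : β ^ 2 * coeffTwo hs (frame e) = 0 := by linear_combination hT
    exact (mul_ne_zero (pow_ne_zero 2 hβ) hc) h0
  refine ⟨coeffTwo hs (frame e) * β / α, ?_, ?_⟩
  · rw [transversalPoly]
    field_simp
    linear_combination coeffTwo hs (frame e) * hT
  · rw [lineSol, ← span_qVec_smul (c := coeffTwo hs (frame e) / α) (div_ne_zero hc hα)]
    have : (coeffTwo hs (frame e) / α) •
        (α • firstVec hs (frame e) 0 0 + β • firstVec hs (frame e) 0 1) =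
        pVec hs (frame e) (coeffTwo hs (frame e) * β / α) := by
      rw [pVec, smul_add, smul_smul, smul_smul, div_mul_cancel₀ _ hα, mul_div_right_comm]
    rw [this]

/-- A plane containing the points of two different parameters contains the whole first line, which a
solution does not. -/
lemma lineSol_injective (hc : coeffTwo hs (frame e) ≠ 0) {θ θ' : k}
    (hθ : transversalPoly hs (frame e) θ = 0)
    (h : lineSol hs (frame e) θ = lineSol hs (frame e) θ') : θ = θ' := by
  have hsol := isLineSolution_lineSol hF hc hθ
  by_contra hne
  have h1 : pVec hs (frame e) θ - pVec hs (frame e) θ' = (θ - θ') • firstVec hs (frame e) 0 1 := by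
    rw [pVec, pVec, add_sub_add_left_eq_sub, sub_smul]
  have hp : pVec hs (frame e) θ ∈ lineSol hs (frame e) θ := Submodule.subset_span (by simp)
  have hp' : pVec hs (frame e) θ' ∈ lineSol hs (frame e) θ := by
    rw [h]; exact Submodule.subset_span (by simp)
  have hu2 : firstVec hs (frame e) 0 1 ∈ lineSol hs (frame e) θ := by
    have := Submodule.sub_mem _ hp hp'
    rw [h1] at this
    exact (Submodule.smul_mem_iff _ (sub_ne_zero.2 hne)).1 this
  have hu1 : firstVec hs (frame e) 0 0 ∈ lineSol hs (frame e) θ := by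
    have := Submodule.sub_mem _ hp (Submodule.smul_mem _ θ hu2)
    rw [pVec, add_sub_cancel_right] at this
    exact (Submodule.smul_mem_iff _ hc).1 this
  have hle : (frameFlags e (Fin.castLE hs 0)).space 2 ≤ lineSol hs (frame e) θ := by
    intro x hx
    obtain ⟨α, β, rfl⟩ := (mem_line_iff 0 x).1 hx
    exact Submodule.add_mem _ (Submodule.smul_mem _ _ hu1) (Submodule.smul_mem _ _ hu2)
  have h2 := hsol.finrank_inf_zero hF
  rw [inf_eq_right.2 hle, CompleteFlag.finrank_space _ _ (by simp; omega)] at h2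
  omega

/-- The hull is cut out by two linear forms depending polynomially on p; this turns general position
with respect to the hull into the nonvanishing of polynomials. -/
lemma mem_hull_span_iff {p : Fin (4 + b) → k}
    (hp : p ∈ (frameFlags e (Fin.castLE hs 0)).space 2) (hp0 : p ≠ 0)
    (hpp : transversalForm hs (frame e) p p = 0) (x : Fin (4 + b) → k) :
    x ∈ hull b hs (frameFlags e) (Submodule.span k {p, qVec hs (frame e) p}) ↔
      etaA hs (frame e) p x = 0 ∧ etaB hs (frame e) p x = 0 := by
  have h1 := mem_space_sup_span_iff (e := e (Fin.castLE hs 2)) (notMem_two hF hp hp0)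
    (etaA_qVec hs (frame e) p) x
  have h2 := mem_space_sup_span_iff (e := e (Fin.castLE hs 3)) (notMem_three hF hp hp0)
    (q := qVec hs (frame e) p) (by
      have := etaB_qVec hs (frame e) p
      rwa [hpp, neg_zero] at this) x
  exact and_congr h1 h2

omit hF in
lemma eq_zero_of_etaDet_ne_zero {p x y : Fin (4 + b) → k} (h : etaDet hs (frame e) p x y ≠ 0)
    {β γ : k} (h1 : β * etaA hs (frame e) p x + γ * etaA hs (frame e) p y = 0)
    (h2 : β * etaB hs (frame e) p x + γ * etaB hs (frame e) p y = 0) : β = 0 ∧ γ = 0 := by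
  constructor
  · refine (mul_eq_zero.1 ?_).resolve_right h
    rw [etaDet]
    linear_combination etaB hs (frame e) p y * h1 - etaA hs (frame e) p y * h2
  · refine (mul_eq_zero.1 ?_).resolve_right h
    rw [etaDet]
    linear_combination etaA hs (frame e) p x * h2 - etaB hs (frame e) p x * h1

omit hF in
lemma exists_of_etaDet_eq_zero {p x y : Fin (4 + b) → k} (h : etaDet hs (frame e) p x y = 0) :
    ∃ β γ : k, (β ≠ 0 ∨ γ ≠ 0) ∧ etaA hs (frame e) p (β • x + γ • y) = 0 ∧
      etaB hs (frame e) p (β • x + γ • y) = 0 := by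
  obtain ⟨β, γ, hne, h1, h2⟩ := exists_of_two_by_two h
  refine ⟨β, γ, hne, ?_, ?_⟩
  · rw [etaA_add, etaA_smul, etaA_smul, h1]
  · rw [etaB_add, etaB_smul, etaB_smul, h2]

end Transversals

end Comparison

/-! ### General position at a transversal and the nonvanishing of `goodCond` -/

section Good

variable {k : Type*} [Field k] {b s : ℕ} {hs : 4 ≤ s}
  {e : Fin s → Basis (Fin (4 + b)) k (Fin (4 + b) → k)}

lemma castLE_cases (hs : 4 ≤ s) {i : Fin s} (hi : i.val < 4) :
    ∃ j : Fin 4, i = Fin.castLE hs j ∧ j.val = i.val :=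
  ⟨⟨i.val, hi⟩, by simp, rfl⟩

lemma flagCond_ne_zero_iff {p : Fin (4 + b) → k} {i : Fin s} :
    flagCond hs (frame e) p i ≠ 0 ↔
      (i.val < 2 → etaDet hs (frame e) p (frame e i (Fin.castAdd b 1))
        (frame e i (Fin.castAdd b 2)) ≠ 0) ∧
      (i.val = 2 → etaB hs (frame e) p (frame e i (Fin.castAdd b 0)) ≠ 0) ∧
      (i.val = 3 → etaA hs (frame e) p (frame e i (Fin.castAdd b 0)) ≠ 0) ∧
      (4 ≤ i.val → etaDet hs (frame e) p (frame e i (Fin.castAdd b 0))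
        (frame e i (Fin.castAdd b 1)) ≠ 0 ∧
        pairForm (frame e i) p (qVec hs (frame e) p) ≠ 0) := by
  unfold flagCond
  split_ifs with h1 h2 h3
  · exact ⟨fun h => ⟨fun _ => h, by omega, by omega, by omega⟩, fun h => h.1 h1⟩
  · exact ⟨fun h => ⟨by omega, fun _ => h, by omega, by omega⟩, fun h => h.2.1 h2⟩
  · exact ⟨fun h => ⟨by omega, by omega, fun _ => h, by omega⟩, fun h => h.2.2.1 h3⟩
  · rw [mul_ne_zero_iff]
    exact ⟨fun h => ⟨by omega, by omega, by omega, fun _ => h⟩, fun h => h.2.2.2 (by omega)⟩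

variable (hF : IsTransversal b hs (frameFlags e))
include hF

/-- The genericity conditions imply that the flags are in general position. -/
lemma isGoodAt_of_goodCond (hc : coeffTwo hs (frame e) ≠ 0) {θ : k}
    (hθ : transversalPoly hs (frame e) θ = 0)
    (hg : goodCond hs (frame e) (pVec hs (frame e) θ) ≠ 0) :
    IsGoodAt b hs (frameFlags e) (lineSol hs (frame e) θ) := by
  have hp := pVec_mem (hs := hs) (e := e) θ
  have hp0 := pVec_ne_zero hc θ
  have hpp : transversalForm hs (frame e) (pVec hs (frame e) θ) (pVec hs (frame e) θ) = 0 := by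
    rw [transversalForm_pVec, hθ, mul_zero]
  have hpdef : pVec hs (frame e) θ = coeffTwo hs (frame e) • firstVec hs (frame e) 0 0 +
    θ • firstVec hs (frame e) 0 1 := rfl
  -- On the first line u₁ is eliminated in favour of p, on which both forms vanish, so that only the
  -- coefficient of u₂ matters.
  have hu1 : ∀ α : k, α • firstVec hs (frame e) 0 0 =
      (α / coeffTwo hs (frame e)) • pVec hs (frame e) θ -
      (α * θ / coeffTwo hs (frame e)) • firstVec hs (frame e) 0 1 := by
    intro α
    rw [hpdef, smul_add, smul_smul, smul_smul, div_mul_cancel₀ _ hc, mul_div_right_comm,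
      add_sub_cancel_right]
  have hW := mem_hull_span_iff hF hp hp0 hpp
  have hAp := etaA_self hs (frame e) (pVec hs (frame e) θ)
  have hBp := etaB_self hs (frame e) (pVec hs (frame e) θ)
  have hAq := etaA_qVec hs (frame e) (pVec hs (frame e) θ)
  have hBq := etaB_qVec hs (frame e) (pVec hs (frame e) θ)
  rw [hpp, neg_zero] at hBq
  have hor := etaA_ne_zero_or hF hp hp0
  rw [goodCond, mul_ne_zero_iff, Finset.prod_ne_zero_iff] at hg
  obtain ⟨hg0, hg⟩ := hg
  replace hg := fun i => flagCond_ne_zero_iff.1 (hg i (Finset.mem_univ i))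
  unfold lineSol
  set p := pVec hs (frame e) θ with hpd
  set q := qVec hs (frame e) p with hqd
  set u₁ := firstVec hs (frame e) 0 0 with hu₁
  set u₂ := firstVec hs (frame e) 0 1 with hu₂
  set v₁ := firstVec hs (frame e) 1 0 with hv₁
  set v₂ := firstVec hs (frame e) 1 1 with hv₂
  -- If the first form vanished at v₂ it would not vanish at v₁; then the vanishing of the quadratic
  -- form at p would make the second form vanish at v₂ too, against the first factor of `goodCond`.
  -- So v₁ can be eliminated in favour of q.
  have hAv : etaA hs (frame e) p v₂ ≠ 0 := by
    intro h0
    have h1 : etaA hs (frame e) p v₁ ≠ 0 := by tauto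
    have h2 : etaB hs (frame e) p v₂ = 0 := by
      have : etaA hs (frame e) p v₁ * etaB hs (frame e) p v₂ -
        etaA hs (frame e) p v₂ * etaB hs (frame e) p v₁ = 0 := hpp
      rw [h0, zero_mul, sub_zero] at this
      exact (mul_eq_zero.1 this).resolve_left h1
    exact hg0 (by rw [etaDet, h0, h2]; ring)
  have hqdef : q = etaA hs (frame e) p v₂ • v₁ - etaA hs (frame e) p v₁ • v₂ := rfl
  have hv1 : ∀ γ : k, γ • v₁ = (γ / etaA hs (frame e) p v₂) • q +
      (γ * etaA hs (frame e) p v₁ / etaA hs (frame e) p v₂) • v₂ := by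
    intro γ
    rw [hqdef, smul_sub, smul_smul, smul_smul, div_mul_cancel₀ _ hAv, mul_div_right_comm,
      sub_add_cancel]
  refine ⟨?_, ?_, ?_, ?_, ?_⟩
  · rintro x ⟨hx, hx'⟩
    obtain ⟨α, β, γ, δ, rfl⟩ := (mem_lineSpan_iff x).1 hx
    obtain ⟨h1, h2⟩ := (hW _).1 hx'
    rw [← hu₁, ← hu₂, ← hv₁, ← hv₂, hu1, hv1] at h1 h2 ⊢
    have e1 : (α / coeffTwo hs (frame e)) • p - (α * θ / coeffTwo hs (frame e)) • u₂ + β • u₂ +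
        ((γ / etaA hs (frame e) p v₂) • q +
        (γ * etaA hs (frame e) p v₁ / etaA hs (frame e) p v₂) • v₂ + δ • v₂) =
        (α / coeffTwo hs (frame e)) • p + (β - α * θ / coeffTwo hs (frame e)) • u₂ +
        ((γ / etaA hs (frame e) p v₂) • q +
        (γ * etaA hs (frame e) p v₁ / etaA hs (frame e) p v₂ + δ) • v₂) := by
      module
    rw [e1] at h1 h2 ⊢
    simp only [etaA_add, etaA_smul, etaB_add, etaB_smul, hAp, hBp, hAq, hBq, mul_zero,
      zero_add] at h1 h2
    obtain ⟨h3, h4⟩ := eq_zero_of_etaDet_ne_zero hg0 h1 h2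
    rw [h3, h4, zero_smul, zero_smul, add_zero, add_zero]
    exact Submodule.mem_span_pair.2 ⟨_, _, rfl⟩
  · rintro i hi x ⟨hx, hx'⟩
    obtain ⟨h1, h2⟩ := (hW x).1 hx'
    have hg1 := (hg i).1 hi
    obtain ⟨α, β, γ, rfl⟩ := (mem_ofBasis_space_iff_exists (e := e i) x).2.2.1 hx
    obtain ⟨j, rfl, hj⟩ := castLE_cases hs (by omega : i.val < 4)
    rw [Fin.val_castLE] at hi
    have hj' : j = 0 ∨ j = 1 := by omega
    refine (mem_ofBasis_space_iff_exists (e := e _) _).2.1.2 ⟨α, β, ?_⟩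
    suffices hγ : γ = 0 by rw [hγ, zero_smul, add_zero]
    rcases hj' with rfl | rfl
    · change etaA hs (frame e) p (α • u₁ + β • u₂ + γ • _) = 0 at h1
      change etaB hs (frame e) p (α • u₁ + β • u₂ + γ • _) = 0 at h2
      rw [hu1] at h1 h2
      have e1 : (α / coeffTwo hs (frame e)) • p - (α * θ / coeffTwo hs (frame e)) • u₂ + β • u₂ =
        (α / coeffTwo hs (frame e)) • p + (β - α * θ / coeffTwo hs (frame e)) • u₂ := by module
      rw [e1] at h1 h2
      simp only [etaA_add, etaA_smul, etaB_add, etaB_smul, hAp, hBp, mul_zero, zero_add] at h1 h2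
      exact (eq_zero_of_etaDet_ne_zero hg1 h1 h2).2
    · change etaA hs (frame e) p (α • v₁ + β • v₂ + γ • _) = 0 at h1
      change etaB hs (frame e) p (α • v₁ + β • v₂ + γ • _) = 0 at h2
      rw [hv1] at h1 h2
      have e1 : (α / etaA hs (frame e) p v₂) • q +
          (α * etaA hs (frame e) p v₁ / etaA hs (frame e) p v₂) • v₂ + β • v₂ =
        (α / etaA hs (frame e) p v₂) • q +
          (α * etaA hs (frame e) p v₁ / etaA hs (frame e) p v₂ + β) • v₂ := by module
      rw [e1] at h1 h2
      simp only [etaA_add, etaA_smul, etaB_add, etaB_smul, hAq, hBq, mul_zero, zero_add] at h1 h2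
      exact (eq_zero_of_etaDet_ne_zero hg1 h1 h2).2
  · intro i hi hi'
    rw [Submodule.disjoint_def]
    intro x hx hx'
    obtain ⟨h1, h2⟩ := (hW x).1 hx'
    obtain ⟨α, rfl⟩ := (mem_ofBasis_space_iff_exists (e := e i) x).1.1 hx
    suffices hα : α = 0 by rw [hα, zero_smul]
    rw [etaA_smul] at h1
    rw [etaB_smul] at h2
    obtain hi2 | hi3 : i.val = 2 ∨ i.val = 3 := by omega
    · exact (mul_eq_zero.1 h2).resolve_right ((hg i).2.1 hi2)
    · exact (mul_eq_zero.1 h1).resolve_right ((hg i).2.2.1 hi3)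
  · intro i hi
    rw [Submodule.disjoint_def]
    intro x hx hx'
    obtain ⟨h1, h2⟩ := (hW x).1 hx'
    obtain ⟨α, β, rfl⟩ := (mem_ofBasis_space_iff_exists (e := e i) x).2.1.1 hx
    simp only [etaA_add, etaA_smul, etaB_add, etaB_smul] at h1 h2
    obtain ⟨rfl, rfl⟩ := eq_zero_of_etaDet_ne_zero ((hg i).2.2.2 hi).1 h1 h2
    simp
  · intro i hi
    rw [Submodule.disjoint_def]
    intro x hx hx'
    obtain ⟨α, β, rfl⟩ := Submodule.mem_span_pair.1 hx'
    obtain ⟨rfl, rfl⟩ := eq_zero_of_pairForm_ne_zero (e := e i) ((hg i).2.2.2 hi).2 hx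
    simp

/-- If the flags are in general position and the bases are chosen suitably, then the genericity
conditions are satisfied. -/
lemma goodCond_ne_zero (hc : coeffTwo hs (frame e) ≠ 0) {θ : k}
    (hθ : transversalPoly hs (frame e) θ = 0)
    (hg : IsGoodAt b hs (frameFlags e) (lineSol hs (frame e) θ))
    (hu : firstVec hs (frame e) 0 1 ∉ lineSol hs (frame e) θ)
    (hv : firstVec hs (frame e) 1 1 ∉ lineSol hs (frame e) θ) :
    goodCond hs (frame e) (pVec hs (frame e) θ) ≠ 0 := by
  have hp := pVec_mem (hs := hs) (e := e) θ
  have hp0 := pVec_ne_zero hc θ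
  have hpp : transversalForm hs (frame e) (pVec hs (frame e) θ) (pVec hs (frame e) θ) = 0 := by
    rw [transversalForm_pVec, hθ, mul_zero]
  have hW : ∀ x, x ∈ hull b hs (frameFlags e) (lineSol hs (frame e) θ) ↔ _ :=
    mem_hull_span_iff hF hp hp0 hpp
  obtain ⟨hq, hq0⟩ := qVec_mem_and_ne_zero hF hp hp0
  have hsol := isLineSolution_lineSol hF hc hθ
  set p := pVec hs (frame e) θ with hpd
  set q := qVec hs (frame e) p with hqd
  set h := lineSol hs (frame e) θ with hh
  have hsub : ∀ i : Fin 4, i = 0 ∨ i = 1 → (frameFlags e (Fin.castLE hs i)).space 2 ≤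
      lineSpan hs (frameFlags e) := by
    rintro i (rfl | rfl)
    · exact le_sup_left
    · exact le_sup_right
  have hmem : ∀ i : Fin 4, i = 0 ∨ i = 1 → firstVec hs (frame e) i 1 ∉ h := by
    rintro i (rfl | rfl) <;> assumption
  rw [goodCond, mul_ne_zero_iff, Finset.prod_ne_zero_iff]
  refine ⟨fun h0 => ?_, fun i _ => flagCond_ne_zero_iff.2 ⟨fun hi h0 => ?_, fun hi h0 => ?_,
    fun hi h0 => ?_, fun hi => ⟨fun h0 => ?_, fun h0 => ?_⟩⟩⟩
  · obtain ⟨β, δ, hne, h1, h2⟩ := exists_of_etaDet_eq_zero h0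
    have h3 : β • firstVec hs (frame e) 0 1 + δ • firstVec hs (frame e) 1 1 ∈ h :=
      hg.inf_le ⟨Submodule.add_mem_sup (Submodule.smul_mem _ _ (firstVec_mem 0).2)
        (Submodule.smul_mem _ _ (firstVec_mem 1).2), (hW _).2 ⟨h1, h2⟩⟩
    obtain ⟨α, γ, h4⟩ := Submodule.mem_span_pair.1 h3
    -- The components of the relation in the two disjoint lines vanish separately.
    have h5 : β • firstVec hs (frame e) 0 1 - α • p = 0 := by
      refine Submodule.disjoint_def.1 (disj_lines hF) _ (Submodule.sub_mem _
        (Submodule.smul_mem _ _ (firstVec_mem 0).2) (Submodule.smul_mem _ _ hp)) ?_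
      have : β • firstVec hs (frame e) 0 1 - α • p = γ • q - δ • firstVec hs (frame e) 1 1 := by
        have h4' : α • p + γ • q =
          β • firstVec hs (frame e) 0 1 + δ • firstVec hs (frame e) 1 1 := h4
        rw [sub_eq_sub_iff_add_eq_add, ← h4']
        exact add_comm _ _
      rw [this]
      exact Submodule.sub_mem _ (Submodule.smul_mem _ _ hq)
        (Submodule.smul_mem _ _ (firstVec_mem 1).2)
    have h6 : β • firstVec hs (frame e) 0 1 ∈ h := by
      rw [sub_eq_zero.1 h5]
      exact Submodule.smul_mem _ _
        (Submodule.subset_span (Set.mem_insert _ _) : p ∈ Submodule.span k {p, q})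
    have hβ : β = 0 := by
      by_contra hβ
      exact hu ((Submodule.smul_mem_iff _ hβ).1 h6)
    have h7 : δ • firstVec hs (frame e) 1 1 ∈ h := by
      rw [hβ, zero_smul, zero_add] at h3
      exact h3
    have hδ : δ = 0 := by
      by_contra hδ
      exact hv ((Submodule.smul_mem_iff _ hδ).1 h7)
    tauto
  · obtain ⟨j, rfl, hj⟩ := castLE_cases hs (by omega : i.val < 4)
    obtain ⟨β, γ, hne, h1, h2⟩ := exists_of_etaDet_eq_zero h0
    rw [Fin.val_castLE] at hi
    have hj' : j = 0 ∨ j = 1 := by omega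
    have h3 := hg.le_of_lt_two (Fin.castLE hs j) (by simpa using hi) ⟨(mem_ofBasis_space_iff_exists (e := e _) _).2.2.2
      ⟨0, β, γ, by rw [zero_smul, zero_add]; rfl⟩, (hW _).2 ⟨h1, h2⟩⟩
    have hγ : γ = 0 := by
      obtain ⟨α', β', h4⟩ := (mem_ofBasis_space_iff_exists (e := e _) _).2.1.1 h3
      have h5 := congrArg (fun v => (e (Fin.castLE hs j)).repr v (Fin.castAdd b 2)) h4
      have n1 : (Fin.castAdd b 0 : Fin (4 + b)) ≠ Fin.castAdd b 2 := by simp [Fin.ext_iff]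
      have n2 : (Fin.castAdd b 1 : Fin (4 + b)) ≠ Fin.castAdd b 2 := by simp [Fin.ext_iff]
      simpa [frame, Finsupp.single_apply, n1, n2] using h5
    subst hγ
    have hβ : β ≠ 0 := by simpa using hne
    rw [zero_smul, add_zero] at h1 h2 h3
    have h6 := hg.inf_le ⟨hsub j hj' h3, (hW _).2 ⟨h1, h2⟩⟩
    exact hmem j hj' ((Submodule.smul_mem_iff _ hβ).1 h6)
  · have hA0 : etaA hs (frame e) p (frame e i (Fin.castAdd b 0)) = 0 := by
      have : i = Fin.castLE hs 2 := by
        simp only [Fin.ext_iff, Fin.val_castLE]; exact hi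
      subst this
      exact pairForm_right_eq_zero (e := e (Fin.castLE hs 2))
        (CompleteFlag.ofBasis_mem _ (by simp)) _
    have h1 := Submodule.disjoint_def.1 (hg.disj_of_lt_four i (by omega) (by omega)) _
      ((mem_ofBasis_space_iff_exists (e := e i) _).1.2 ⟨1, (one_smul _ _).symm⟩)
      ((hW _).2 ⟨hA0, h0⟩)
    exact (e i).ne_zero _ h1
  · have hB0 : etaB hs (frame e) p (frame e i (Fin.castAdd b 0)) = 0 := by
      have : i = Fin.castLE hs 3 := by
        simp only [Fin.ext_iff, Fin.val_castLE]; exact hi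
      subst this
      exact pairForm_right_eq_zero (e := e (Fin.castLE hs 3))
        (CompleteFlag.ofBasis_mem _ (by simp)) _
    have h1 := Submodule.disjoint_def.1 (hg.disj_of_lt_four i (by omega) (by omega)) _
      ((mem_ofBasis_space_iff_exists (e := e i) _).1.2 ⟨1, (one_smul _ _).symm⟩)
      ((hW _).2 ⟨h0, hB0⟩)
    exact (e i).ne_zero _ h1
  · obtain ⟨β, γ, hne, h1, h2⟩ := exists_of_etaDet_eq_zero h0
    have h3 := Submodule.disjoint_def.1 (hg.disj_of_four_le i hi) _
      ((mem_ofBasis_space_iff_exists (e := e i) _).2.1.2 ⟨β, γ, rfl⟩) ((hW _).2 ⟨h1, h2⟩)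
    have n1 : (Fin.castAdd b 0 : Fin (4 + b)) ≠ Fin.castAdd b 1 := by simp [Fin.ext_iff]
    have h4 := congrArg (fun v => (e i).repr v (Fin.castAdd b 0)) h3
    have h5 := congrArg (fun v => (e i).repr v (Fin.castAdd b 1)) h3
    simp [n1, n1.symm] at h4 h5
    tauto
  · obtain ⟨α, β, hne, hm⟩ := exists_of_pairForm_eq_zero (e := e i) h0
    have h1 := Submodule.disjoint_def.1 (hg.disj_of_four_le' i hi) _ hm
      (Submodule.mem_span_pair.2 ⟨α, β, rfl⟩)
    obtain ⟨h2, h3⟩ := linearIndependent_pair_lines hF hp hp0 hq hq0 h1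
    tauto

/-- If c₂ vanishes, the second vector of the first flag is itself the point of a transversal. -/
lemma coeffTwo_ne_zero
    (hu : ∀ h, IsLineSolution b hs (frameFlags e) h → firstVec hs (frame e) 0 1 ∉ h) :
    coeffTwo hs (frame e) ≠ 0 := by
  intro h0
  have hne : firstVec hs (frame e) 0 1 ≠ 0 := (e _).ne_zero _
  exact hu _ (isLineSolution_span hF (firstVec_mem 0).2 hne h0) (Submodule.subset_span (by simp))

/-- If the flags are transversal, the problem of four lines has two solutions, and the bases are
chosen suitably, then the static conditions are satisfied. -/
lemma staticCond_ne_zero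
    (hu : ∀ h, IsLineSolution b hs (frameFlags e) h → firstVec hs (frame e) 0 1 ∉ h)
    {h h' : Submodule k (Fin (4 + b) → k)} (hh : IsLineSolution b hs (frameFlags e) h)
    (hh' : IsLineSolution b hs (frameFlags e) h') (hne : h ≠ h') :
    staticCond hs (frame e) ≠ 0 := by
  have hc := coeffTwo_ne_zero hF hu
  obtain ⟨θ, hθ, rfl⟩ := hh.exists_eq_lineSol hF hc
  obtain ⟨θ', hθ', rfl⟩ := hh'.exists_eq_lineSol hF hc
  have hθθ : θ ≠ θ' := fun h => hne (by rw [h])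
  simp only [staticCond, mul_ne_zero_iff, Finset.prod_ne_zero_iff]
  refine ⟨⟨⟨⟨⟨fun i _ => det_of_basis_ne_zero (e i), pairForm_ne_zero_of_disjoint hF.disj01,
    pairForm_ne_zero_of_disjoint hF.disj10⟩, pairForm_ne_zero_of_disjoint hF.disj20,
    pairForm_ne_zero_of_disjoint hF.disj21⟩, pairForm_ne_zero_of_disjoint hF.disj30,
    pairForm_ne_zero_of_disjoint hF.disj31⟩, (disjoint_lineSpan_iff 2 (disj_lines hF)).1
    hF.disjSpan2, (disjoint_lineSpan_iff 3 (disj_lines hF)).1 hF.disjSpan3⟩, hc, ?_⟩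
  rw [transversalPoly] at hθ hθ'
  have h1 : coeffOne hs (frame e) = -(θ + θ') := by
    have : (θ - θ') * (θ + θ' + coeffOne hs (frame e)) = 0 := by linear_combination hθ - hθ'
    have := (mul_eq_zero.1 this).resolve_left (sub_ne_zero.2 hθθ)
    linear_combination this
  have h2 : coeffZero hs (frame e) * coeffTwo hs (frame e) = θ * θ' := by
    rw [h1] at hθ
    linear_combination hθ
  rw [h1, h2, show (-(θ + θ')) ^ 2 - 4 * (θ * θ') = (θ - θ') ^ 2 by ring]
  exact pow_ne_zero 2 (sub_ne_zero.2 hθθ)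

omit hF in
/-- Over an algebraically closed field the problem of four lines has exactly two solutions. -/
lemma exists_two_roots [IsAlgClosed k] (h : staticCond hs (frame e) ≠ 0) :
    ∃ θ θ' : k, θ ≠ θ' ∧ θ + θ' = -coeffOne hs (frame e) ∧
      θ * θ' = coeffZero hs (frame e) * coeffTwo hs (frame e) ∧
      ∀ x, transversalPoly hs (frame e) x = 0 ↔ x = θ ∨ x = θ' := by
  simp only [staticCond, mul_ne_zero_iff] at h
  obtain ⟨-, -, hd⟩ := h
  set c₁ := coeffOne hs (frame e) with hc1
  set c₂ := coeffZero hs (frame e) * coeffTwo hs (frame e) with hc2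
  obtain ⟨θ, hθ⟩ := IsAlgClosed.exists_root
    (Polynomial.X ^ 2 + Polynomial.C c₁ * Polynomial.X + Polynomial.C c₂) (by
      have : (Polynomial.X ^ 2 + Polynomial.C c₁ * Polynomial.X + Polynomial.C c₂).degree = 2 := by
        compute_degree!
      rw [this]; norm_num)
  have hθ' : θ ^ 2 + c₁ * θ + c₂ = 0 := by simpa using hθ
  refine ⟨θ, -c₁ - θ, fun h => hd ?_, by ring, by linear_combination -hθ', fun x => ?_⟩
  · have h2 : 2 * θ = -c₁ := by linear_combination h
    linear_combination -4 * hθ' + (2 * θ + c₁) * h2 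
  · have : transversalPoly hs (frame e) x = (x - θ) * (x - (-c₁ - θ)) := by
      rw [transversalPoly, ← hc1, ← hc2]
      linear_combination hθ'
    rw [this, mul_eq_zero, sub_eq_zero, sub_eq_zero]

end Good

/-! ### Flags in a direct sum -/

namespace CompleteFlag

variable {K P Q : Type*} [Field K] [AddCommGroup P] [Module K P] [AddCommGroup Q] [Module K Q]

lemma mem_map_space (g : P ≃ₗ[K] Q) (F : CompleteFlag K P) (j : ℕ) (x : Q) :
    x ∈ (F.map g).space j ↔ g.symm x ∈ F.space j := by
  rw [map_space, Submodule.mem_map]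
  constructor
  · rintro ⟨y, hy, rfl⟩
    simpa using hy
  · exact fun h => ⟨_, h, by simp⟩

/-- The shear `(v, y) ↦ (v + β(y) s, y)`. -/
def shear (β : Q →ₗ[K] K) (s : P) : (P × Q) ≃ₗ[K] (P × Q) where
  toFun x := (x.1 + β x.2 • s, x.2)
  invFun x := (x.1 - β x.2 • s, x.2)
  map_add' x y := by ext <;> simp [add_smul]; abel
  map_smul' c x := by ext <;> simp [mul_smul]
  left_inv x := by simp
  right_inv x := by simp

variable [FiniteDimensional K P] [FiniteDimensional K Q]

/-- The flag in `P × Q` which interleaves flags in `P` and in `Q`. -/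
noncomputable def interleave (E : CompleteFlag K P) (G : CompleteFlag K Q) (u v : ℕ → ℕ)
    (hu : Monotone u) (hv : Monotone v)
    (h : ∀ j ≤ finrank K P + finrank K Q, u j + v j = j ∧ u j ≤ finrank K P ∧ v j ≤ finrank K Q) :
    CompleteFlag K (P × Q) where
  space j := (E.space (u j)).prod (G.space (v j))
  mono i j hij := Submodule.prod_mono (E.mono (hu hij)) (G.mono (hv hij))
  finrank_space j hj := by
    rw [finrank_prod] at hj
    obtain ⟨h1, h2, h3⟩ := h j hj
    have h4 : (E.space (u j)).prod (G.space (v j)) =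
        LinearMap.range ((E.space (u j)).subtype.prodMap (G.space (v j)).subtype) := by
      rw [LinearMap.range_prodMap, Submodule.range_subtype, Submodule.range_subtype]
    rw [h4, LinearMap.finrank_range_of_inj ((Submodule.subtype_injective _).prodMap
      (Submodule.subtype_injective _)), finrank_prod, E.finrank_space _ h2, G.finrank_space _ h3,
      h1]

/-- The image of an interleaved flag under a shear. The first `m` members of the flag, as well as
those with index greater than `finrank K Q + m`, come from `P`. -/
noncomputable def twist (m : ℕ) (hm : m ≤ finrank K P) (E : CompleteFlag K P) (G : CompleteFlag K Q)
    (β : Q →ₗ[K] K) (s : P) : CompleteFlag K (P × Q) :=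
  (interleave E G (fun j => max (min j m) (j - finrank K Q)) (fun j => min (j - m) (finrank K Q))
    (fun i j h => by dsimp only; omega) (fun i j h => by dsimp only; omega)
    (fun j hj => by omega)).map (shear β s)

lemma mem_twist {m : ℕ} {hm : m ≤ finrank K P} {E : CompleteFlag K P} {G : CompleteFlag K Q}
    {β : Q →ₗ[K] K} {s : P} {j : ℕ} {x : P × Q} : x ∈ (twist m hm E G β s).space j ↔
      x.1 - β x.2 • s ∈ E.space (max (min j m) (j - finrank K Q)) ∧
        x.2 ∈ G.space (min (j - m) (finrank K Q)) := by
  rw [twist, mem_map_space]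
  exact Submodule.mem_prod

/-- The flag whose members are the span of `g` and the members of the flag `G`. -/
def extend (G : CompleteFlag K Q) (g : Q) (hg : g ∉ G.space (finrank K Q - 1)) :
    CompleteFlag K Q where
  space
    | 0 => ⊥
    | d + 1 => Submodule.span K {g} ⊔ G.space d
  mono := monotone_nat_of_le_succ fun d => by
    cases d with
    | zero => exact bot_le
    | succ d => exact sup_le_sup_left (G.mono (Nat.le_succ d)) _
  finrank_space j hj := by
    cases j with
    | zero => simp
    | succ d =>
      have hgd : g ∉ G.space d := fun h => hg (G.mono (by omega) h)
      have hg0 : g ≠ 0 := fun h => hgd (h ▸ Submodule.zero_mem _)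
      have hd : Disjoint (Submodule.span K {g}) (G.space d) :=
        (Submodule.disjoint_span_singleton' hg0).2 hgd |>.symm
      change finrank K ↥(Submodule.span K {g} ⊔ G.space d) = d + 1
      rw [hd.finrank_sup, finrank_span_singleton hg0, G.finrank_space d (by omega), add_comm]

lemma mem_extend_succ {G : CompleteFlag K Q} {g : Q} {hg : g ∉ G.space (finrank K Q - 1)} {d : ℕ}
    {x : Q} : x ∈ (G.extend g hg).space (d + 1) ↔ ∃ c : K, ∃ y ∈ G.space d, x = c • g + y := by
  change x ∈ Submodule.span K {g} ⊔ G.space d ↔ _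
  rw [Submodule.mem_sup]
  simp only [Submodule.mem_span_singleton]
  constructor
  · rintro ⟨_, ⟨c, rfl⟩, y, hy, rfl⟩
    exact ⟨c, y, hy, rfl⟩
  · rintro ⟨c, y, hy, rfl⟩
    exact ⟨_, ⟨c, rfl⟩, y, hy, rfl⟩

/-- The pair of g and β serves to shear a flag along its last step: β sees g and none of the proper
members. -/
lemma exists_dual (G : CompleteFlag K Q) (hQ : 0 < finrank K Q) :
    ∃ (g : Q) (β : Q →ₗ[K] K), g ∉ G.space (finrank K Q - 1) ∧ β g = 1 ∧
      ∀ d < finrank K Q, ∀ x ∈ G.space d, β x = 0 := by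
  obtain ⟨g, -, hg⟩ := G.exists_mem_notMem (j := finrank K Q - 1) (by omega)
  obtain ⟨β, hβ, h1⟩ := LinearMap.exists_extend_of_notMem (0 : G.space (finrank K Q - 1) →ₗ[K] K)
    hg 1
  refine ⟨g, β, hg, h1, fun d hd x hx => ?_⟩
  have hx' : x ∈ G.space (finrank K Q - 1) := G.mono (by omega) hx
  simpa using LinearMap.congr_fun hβ ⟨x, hx'⟩

end CompleteFlag

/-! ### Four lines in coordinate space -/

section Lines

variable {k : Type*} [Field k]

/-- The flag in `k⁴` with two-dimensional member `x 2 = x 3 = 0`. -/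
noncomputable def stdFlag (k : Type*) [Field k] : CompleteFlag k (Fin 4 → k) :=
  CompleteFlag.ofBasis (Pi.basisFun k (Fin 4))

/-- A flag in `k⁴` with two-dimensional member `x 0 = x 1 = 0`. -/
noncomputable def oppFlag (k : Type*) [Field k] : CompleteFlag k (Fin 4 → k) :=
  CompleteFlag.ofBasis (Basis.ofEquivFun
    { toFun := fun x : Fin 4 → k => ![x 2, x 3, x 0, x 1]
      invFun := fun x => ![x 2, x 3, x 0, x 1]
      map_add' := fun x y => by ext i; fin_cases i <;> rfl
      map_smul' := fun c x => by ext i; fin_cases i <;> rfl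
      left_inv := fun x => by ext i; fin_cases i <;> rfl
      right_inv := fun x => by ext i; fin_cases i <;> rfl })

/-- A flag in `k⁴` whose two-dimensional member is the graph of a `2 × 2` matrix. -/
noncomputable def graphFlag (m₁ m₂ m₃ m₄ : k) : CompleteFlag k (Fin 4 → k) :=
  CompleteFlag.ofBasis (Basis.ofEquivFun
    { toFun := fun x : Fin 4 → k =>
        ![x 0, x 1, x 2 - (m₁ * x 0 + m₂ * x 1), x 3 - (m₃ * x 0 + m₄ * x 1)]
      invFun := fun x => ![x 0, x 1, x 2 + (m₁ * x 0 + m₂ * x 1), x 3 + (m₃ * x 0 + m₄ * x 1)]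
      map_add' := fun x y => by ext i; fin_cases i <;> simp <;> ring
      map_smul' := fun c x => by ext i; fin_cases i <;> simp <;> ring
      left_inv := fun x => by ext i; fin_cases i <;> simp
      right_inv := fun x => by ext i; fin_cases i <;> simp })

/-- A flag in `k⁴` with two-dimensional member `x 0 = x 1`, `x 2 = x 3`. -/
noncomputable def diagFlag (k : Type*) [Field k] : CompleteFlag k (Fin 4 → k) :=
  CompleteFlag.ofBasis (Basis.ofEquivFun
    { toFun := fun x : Fin 4 → k => ![x 1, x 3, x 0 - x 1, x 2 - x 3]
      invFun := fun x => ![x 2 + x 0, x 0, x 3 + x 1, x 1]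
      map_add' := fun x y => by ext i; fin_cases i <;> simp <;> ring
      map_smul' := fun c x => by ext i; fin_cases i <;> simp <;> ring
      left_inv := fun x => by ext i; fin_cases i <;> simp
      right_inv := fun x => by ext i; fin_cases i <;> simp })

lemma mem_ofBasis_two {e : Basis (Fin 4) k (Fin 4 → k)} {x : Fin 4 → k} :
    x ∈ (CompleteFlag.ofBasis e).space 2 ↔ e.repr x 2 = 0 ∧ e.repr x 3 = 0 := by
  rw [CompleteFlag.mem_ofBasis_space]
  constructor
  · intro h
    exact ⟨h 2 (by simp), h 3 (by decide)⟩
  · rintro ⟨h2, h3⟩ q hq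
    fin_cases q
    · simp at hq
    · simp at hq
    · exact h2
    · exact h3

lemma mem_stdFlag {x : Fin 4 → k} : x ∈ (stdFlag k).space 2 ↔ x 2 = 0 ∧ x 3 = 0 := by
  rw [stdFlag, mem_ofBasis_two]; simp

lemma mem_oppFlag {x : Fin 4 → k} : x ∈ (oppFlag k).space 2 ↔ x 0 = 0 ∧ x 1 = 0 := by
  rw [oppFlag, mem_ofBasis_two]; simp

lemma mem_graphFlag {m₁ m₂ m₃ m₄ : k} {x : Fin 4 → k} :
    x ∈ (graphFlag m₁ m₂ m₃ m₄).space 2 ↔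
      x 2 = m₁ * x 0 + m₂ * x 1 ∧ x 3 = m₃ * x 0 + m₄ * x 1 := by
  rw [graphFlag, mem_ofBasis_two]; simp [sub_eq_zero]

lemma mem_diagFlag {x : Fin 4 → k} : x ∈ (diagFlag k).space 2 ↔ x 0 = x 1 ∧ x 2 = x 3 := by
  rw [diagFlag, mem_ofBasis_two]; simp [sub_eq_zero]

end Lines

/-! ### Construction of flags with prescribed induced flags -/

section Assemble

variable {k Q : Type*} [Field k] [AddCommGroup Q] [Module k Q] [FiniteDimensional k Q] {b s : ℕ}

/-- The flags in `k⁴ × Q` obtained by interleaving flags in `k⁴` and in `Q`. -/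
noncomputable def assemble (E : Fin 4 → CompleteFlag k (Fin 4 → k)) (G : Fin s → CompleteFlag k Q)
    (β : Fin s → Q →ₗ[k] k) (w : Fin s → Fin 4 → k) (i : Fin s) :
    CompleteFlag k ((Fin 4 → k) × Q) :=
  CompleteFlag.twist (if 2 ≤ i.val ∧ i.val < 4 then 0 else 2) (by rw [finrank_fin_fun]; split_ifs <;> omega)
    (if h : i.val < 4 then E ⟨i, h⟩ else diagFlag k) (G i) (β i) (w i)

variable {A : Type*} [AddCommGroup A] [Module k A]
  {E : Fin 4 → CompleteFlag k (Fin 4 → k)} {G : Fin s → CompleteFlag k Q}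
  {β : Fin s → Q →ₗ[k] k} {w : Fin s → Fin 4 → k} {Θ : A ≃ₗ[k] (Fin 4 → k) × Q}

/-- The transport of the flags `assemble E G β w` along a linear equivalence. -/
noncomputable def assembleAt (Θ : A ≃ₗ[k] (Fin 4 → k) × Q) (E : Fin 4 → CompleteFlag k (Fin 4 → k))
    (G : Fin s → CompleteFlag k Q) (β : Fin s → Q →ₗ[k] k) (w : Fin s → Fin 4 → k) (i : Fin s) :
    CompleteFlag k A :=
  (assemble E G β w i).map Θ.symm

lemma mem_assembleAt_castLE_lt {hs : 4 ≤ s} {i : Fin 4} (hi : i.val < 2) {j : ℕ} {x : A} :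
    x ∈ (assembleAt Θ E G β w (Fin.castLE hs i)).space j ↔
      (Θ x).1 - β (Fin.castLE hs i) (Θ x).2 • w (Fin.castLE hs i) ∈
        (E i).space (max (min j 2) (j - finrank k Q)) ∧
        (Θ x).2 ∈ (G (Fin.castLE hs i)).space (min (j - 2) (finrank k Q)) := by
  rw [assembleAt, CompleteFlag.mem_map_space, assemble, CompleteFlag.mem_twist]
  simp [show ¬ 2 ≤ i.val by omega]

lemma mem_assembleAt_castLE_ge {hs : 4 ≤ s} {i : Fin 4} (hi : 2 ≤ i.val) {j : ℕ} {x : A} :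
    x ∈ (assembleAt Θ E G β w (Fin.castLE hs i)).space j ↔
      (Θ x).1 - β (Fin.castLE hs i) (Θ x).2 • w (Fin.castLE hs i) ∈
        (E i).space (j - finrank k Q) ∧
        (Θ x).2 ∈ (G (Fin.castLE hs i)).space (min j (finrank k Q)) := by
  rw [assembleAt, CompleteFlag.mem_map_space, assemble, CompleteFlag.mem_twist]
  simp [hi]

lemma mem_assembleAt_four_le {i : Fin s} (hi : 4 ≤ i.val) {j : ℕ} {x : A} :
    x ∈ (assembleAt Θ E G β w i).space j ↔
      (Θ x).1 - β i (Θ x).2 • w i ∈ (diagFlag k).space (max (min j 2) (j - finrank k Q)) ∧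
        (Θ x).2 ∈ (G i).space (min (j - 2) (finrank k Q)) := by
  rw [assembleAt, CompleteFlag.mem_map_space, assemble, CompleteFlag.mem_twist]
  simp [show ¬ i.val < 4 by omega]

/-- The index of the flag in the total space which cuts out the `j`-th member of the `i`-th flag in
the span of the first two lines. -/
def lineIdx (b : ℕ) (i : Fin 4) (j : ℕ) : ℕ := if i.val < 2 ∧ j ≤ 2 then j else b + j

lemma lineIdx_mono (b : ℕ) (i : Fin 4) : Monotone (lineIdx b i) := by
  intro j j' h
  unfold lineIdx
  split_ifs <;> omega

/-- On vectors with trivial component in Q the shear does nothing, and the index is chosen so that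
the interleaved flag has reached the j-th member in k⁴. -/
lemma mem_assembleAt_lineIdx {hs : 4 ≤ s} (hQ : finrank k Q = b) (i : Fin 4) (j : ℕ) {x : A}
    (hx : (Θ x).2 = 0) :
    x ∈ (assembleAt Θ E G β w (Fin.castLE hs i)).space (lineIdx b i j) ↔
      (Θ x).1 ∈ (E i).space j := by
  by_cases hi : i.val < 2
  · rw [mem_assembleAt_castLE_lt hi, hx, hQ]
    have : max (min (lineIdx b i j) 2) (lineIdx b i j - b) = j := by
      unfold lineIdx; split_ifs <;> omega
    simp [this]
  · rw [mem_assembleAt_castLE_ge (not_lt.1 hi), hx, hQ]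
    have : lineIdx b i j - b = j := by
      unfold lineIdx; split_ifs <;> omega
    simp [this]

lemma mem_assembleAt_two {hs : 4 ≤ s} (hQ : finrank k Q = b) {i : Fin 4} (hi : i.val < 2) {x : A} :
    x ∈ (assembleAt Θ E G β w (Fin.castLE hs i)).space 2 ↔
      (Θ x).2 = 0 ∧ (Θ x).1 ∈ (E i).space 2 := by
  constructor
  · intro h
    have h2 : (Θ x).2 = 0 := by
      have := ((mem_assembleAt_castLE_lt hi).1 h).2
      simpa [CompleteFlag.space_zero] using this
    have h3 := mem_assembleAt_lineIdx (E := E) (G := G) (β := β) (w := w) (hs := hs) hQ i 2 h2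
    simp only [lineIdx, hi, le_refl, and_self, if_true] at h3
    exact ⟨h2, h3.1 h⟩
  · rintro ⟨h2, h⟩
    have h3 := mem_assembleAt_lineIdx (E := E) (G := G) (β := β) (w := w) (hs := hs) hQ i 2 h2
    simp only [lineIdx, hi, le_refl, and_self, if_true] at h3
    exact h3.2 h

lemma mem_assembleAt_add_two {hs : 4 ≤ s} (hQ : finrank k Q = b) {i : Fin 4} {x : A} :
    x ∈ (assembleAt Θ E G β w (Fin.castLE hs i)).space (b + 2) ↔
      (Θ x).1 - β (Fin.castLE hs i) (Θ x).2 • w (Fin.castLE hs i) ∈ (E i).space 2 := by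
  by_cases hi : i.val < 2
  · rw [mem_assembleAt_castLE_lt hi, hQ]
    simp [CompleteFlag.space_top _ hQ.le]
  · rw [mem_assembleAt_castLE_ge (not_lt.1 hi), hQ]
    simp [CompleteFlag.space_top _ hQ.le]

lemma mem_lineSpan_assembleAt {hs : 4 ≤ s} (hQ : finrank k Q = b)
    (h01 : Disjoint ((E 0).space 2) ((E 1).space 2)) {x : A} :
    x ∈ lineSpan hs (assembleAt Θ E G β w) ↔ (Θ x).2 = 0 := by
  constructor
  · intro hx
    obtain ⟨y, hy, z, hz, rfl⟩ := Submodule.mem_sup.1 hx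
    rw [map_add, Prod.snd_add, ((mem_assembleAt_two hQ (by decide)).1 hy).1,
      ((mem_assembleAt_two hQ (by decide)).1 hz).1, add_zero]
  · intro hx
    have htop : (E 0).space 2 ⊔ (E 1).space 2 = ⊤ := by
      apply Submodule.eq_top_of_finrank_eq
      rw [h01.finrank_sup, (E 0).finrank_space _ (by simp), (E 1).finrank_space _ (by simp)]
      simp
    obtain ⟨y, hy, z, hz, hyz⟩ := Submodule.mem_sup.1 (htop ▸ Submodule.mem_top : (Θ x).1 ∈ _)
    have : x = Θ.symm (y, 0) + Θ.symm (z, 0) := by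
      rw [← map_add, Prod.mk_add_mk, hyz, add_zero, ← hx, Prod.mk.eta, Θ.symm_apply_apply]
    rw [this]
    exact Submodule.add_mem_sup ((mem_assembleAt_two hQ (by decide)).2 (by simpa using hy))
      ((mem_assembleAt_two hQ (by decide)).2 (by simpa using hz))

lemma isTransversal_assembleAt {hs : 4 ≤ s} (hQ : finrank k Q = b)
    (h01 : Disjoint ((E 0).space 2) ((E 1).space 2))
    (h20 : Disjoint ((E 2).space 2) ((E 0).space 2))
    (h21 : Disjoint ((E 2).space 2) ((E 1).space 2))
    (h30 : Disjoint ((E 3).space 2) ((E 0).space 2))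
    (h31 : Disjoint ((E 3).space 2) ((E 1).space 2)) :
    IsTransversal b hs (assembleAt Θ E G β w) := by
  have key : ∀ i j : Fin 4, j.val < 2 → Disjoint ((E i).space 2) ((E j).space 2) →
      Disjoint ((assembleAt Θ E G β w (Fin.castLE hs i)).space (b + 2))
        ((assembleAt Θ E G β w (Fin.castLE hs j)).space 2) := by
    intro i j hj hd
    rw [Submodule.disjoint_def] at hd ⊢
    intro x hx hx'
    rw [mem_assembleAt_two hQ hj] at hx'
    rw [mem_assembleAt_add_two hQ, hx'.1, map_zero, zero_smul, sub_zero] at hx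
    rw [← Θ.map_eq_zero_iff]
    exact Prod.ext (hd _ hx hx'.2) hx'.1
  have key' : ∀ i : Fin 4, 2 ≤ i.val →
      Disjoint ((assembleAt Θ E G β w (Fin.castLE hs i)).space b)
        (lineSpan hs (assembleAt Θ E G β w)) := by
    intro i hi
    rw [Submodule.disjoint_def]
    intro x hx hx'
    rw [mem_lineSpan_assembleAt hQ h01] at hx'
    rw [mem_assembleAt_castLE_ge hi, hx', hQ] at hx
    rw [← Θ.map_eq_zero_iff]
    exact Prod.ext (by simpa [CompleteFlag.space_zero] using hx.1) hx'
  exact ⟨key _ _ (by decide) h01, key _ _ (by decide) h01.symm, key _ _ (by decide) h20,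
    key _ _ (by decide) h21, key _ _ (by decide) h30, key _ _ (by decide) h31,
    key' _ (by decide), key' _ (by decide)⟩

end Assemble

/-! ### Flags over four lines in normal form -/

section Normal

variable {k Q A : Type*} [Field k] [AddCommGroup Q] [Module k Q] [FiniteDimensional k Q]
  [AddCommGroup A] [Module k A] [FiniteDimensional k A] {b s : ℕ}

/-- The plane in `A` corresponding to a coordinate plane in `k⁴`. -/
def coordPlane (Θ : A ≃ₗ[k] (Fin 4 → k) × Q) (a c : Fin 4) : Submodule k A :=
  Submodule.span k {Θ.symm (Pi.single a 1, 0), Θ.symm (Pi.single c 1, 0)}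

omit [FiniteDimensional k Q] [FiniteDimensional k A] in
lemma mem_coordPlane {Θ : A ≃ₗ[k] (Fin 4 → k) × Q} {a c : Fin 4} (hac : a ≠ c) {x : A} :
    x ∈ coordPlane Θ a c ↔ (Θ x).2 = 0 ∧ ∀ q, q ≠ a → q ≠ c → (Θ x).1 q = 0 := by
  rw [coordPlane, Submodule.mem_span_pair]
  constructor
  · rintro ⟨α, γ, rfl⟩
    refine ⟨by simp, fun q h1 h2 => by simp [h1, h2]⟩
  · rintro ⟨h1, h2⟩
    refine ⟨(Θ x).1 a, (Θ x).1 c, ?_⟩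
    apply Θ.injective
    refine Prod.ext (funext fun q => ?_) (by simp [h1])
    by_cases ha : q = a
    · subst ha; simp [hac]
    · by_cases hc : q = c
      · subst hc; simp [hac.symm]
      · simp [h2 q ha hc, ha, hc]

omit [FiniteDimensional k Q] [FiniteDimensional k A] in
lemma finrank_coordPlane {Θ : A ≃ₗ[k] (Fin 4 → k) × Q} {a c : Fin 4} (hac : a ≠ c) :
    finrank k (coordPlane Θ a c) = 2 := by
  have h : LinearIndependent k ![Θ.symm (Pi.single a 1, 0), Θ.symm (Pi.single c 1, 0)] := by
    rw [LinearIndependent.pair_iff]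
    intro α γ h
    have h1 := congrArg Θ h
    simp only [map_add, map_smul, LinearEquiv.apply_symm_apply, map_zero] at h1
    have ha := congrFun (congrArg Prod.fst h1) a
    have hc := congrFun (congrArg Prod.fst h1) c
    exact ⟨by simpa [hac] using ha, by simpa [hac.symm] using hc⟩
  have := finrank_span_eq_card h
  rwa [Matrix.range_cons, Matrix.range_cons, Matrix.range_empty, Set.union_empty,
    Set.singleton_union, Fintype.card_fin] at this

/-- The four lines given by the two-dimensional members of flags in `k⁴` are in normal form, with
the parameters `t ≠ t'`: their common transversals are the coordinate planes. -/
structure IsNormalForm (E : Fin 4 → CompleteFlag k (Fin 4 → k)) (t t' : k) : Prop where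
  mem_zero : ∀ x, x ∈ (E 0).space 2 ↔ x 2 = 0 ∧ x 3 = 0
  mem_one : ∀ x, x ∈ (E 1).space 2 ↔ x 0 = 0 ∧ x 1 = 0
  mem_two : ∀ x, x ∈ (E 2).space 2 ↔ x 2 = x 0 ∧ x 3 = x 1
  mem_three : ∀ x, x ∈ (E 3).space 2 ↔ x 2 = t * x 0 ∧ x 3 = t' * x 1
  ne : t ≠ t'
  ne_zero : t ≠ 0
  ne_one : t ≠ 1
  ne_zero' : t' ≠ 0
  ne_one' : t' ≠ 1

/-- The result of the construction: flags in general position whose two transversals are the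
coordinate planes, which cut out the flags `E` and which induce the flags `G` at the first
transversal. -/
structure IsRealization (b : ℕ) (hs : 4 ≤ s) (F : Fin s → CompleteFlag k A)
    (Θ : A ≃ₗ[k] (Fin 4 → k) × Q) (E : Fin 4 → CompleteFlag k (Fin 4 → k))
    (G : Fin s → CompleteFlag k Q) : Prop where
  isTransversal : IsTransversal b hs F
  mem_lineSpan : ∀ x, x ∈ lineSpan hs F ↔ (Θ x).2 = 0
  mem_lineIdx : ∀ i j x, (Θ x).2 = 0 →
    (x ∈ (F (Fin.castLE hs i)).space (lineIdx b i j) ↔ (Θ x).1 ∈ (E i).space j)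
  isLineSolution : IsLineSolution b hs F (coordPlane Θ 0 2)
  isLineSolution' : IsLineSolution b hs F (coordPlane Θ 1 3)
  eq_or_eq : ∀ h, IsLineSolution b hs F h → h = coordPlane Θ 0 2 ∨ h = coordPlane Θ 1 3
  isGoodAt : IsGoodAt b hs F (coordPlane Θ 0 2)
  isGoodAt' : IsGoodAt b hs F (coordPlane Θ 1 3)
  isInducedFlag : ∀ i, IsInducedFlag b hs F (LinearMap.snd k (Fin 4 → k) Q ∘ₗ Θ.toLinearMap)
    (coordPlane Θ 0 2) i (G i)

end Normal

section Normal

variable {k Q A : Type*} [Field k] [AddCommGroup Q] [Module k Q] [FiniteDimensional k Q]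
  [AddCommGroup A] [Module k A] [FiniteDimensional k A] {b s : ℕ}
  {E : Fin 4 → CompleteFlag k (Fin 4 → k)} {t t' : k} {Θ : A ≃ₗ[k] (Fin 4 → k) × Q}

lemma IsNormalForm.disjoint (hE : IsNormalForm E t t') :
    Disjoint ((E 0).space 2) ((E 1).space 2) ∧ Disjoint ((E 2).space 2) ((E 0).space 2) ∧
    Disjoint ((E 2).space 2) ((E 1).space 2) ∧ Disjoint ((E 3).space 2) ((E 0).space 2) ∧
    Disjoint ((E 3).space 2) ((E 1).space 2) := by
  have key : ∀ {S T : Submodule k (Fin 4 → k)},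
      (∀ x, x ∈ S → x ∈ T → x 0 = 0 ∧ x 1 = 0 ∧ x 2 = 0 ∧ x 3 = 0) → Disjoint S T := by
    intro S T h
    rw [Submodule.disjoint_def]
    intro x hx hx'
    obtain ⟨h0, h1, h2, h3⟩ := h x hx hx'
    funext q
    fin_cases q <;> assumption
  refine ⟨key fun x h h' => ?_, key fun x h h' => ?_, key fun x h h' => ?_, key fun x h h' => ?_,
    key fun x h h' => ?_⟩
  · rw [hE.mem_zero] at h
    rw [hE.mem_one] at h'
    exact ⟨h'.1, h'.2, h.1, h.2⟩
  · rw [hE.mem_two] at h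
    rw [hE.mem_zero] at h'
    exact ⟨h.1 ▸ h'.1, h.2 ▸ h'.2, h'.1, h'.2⟩
  · rw [hE.mem_two] at h
    rw [hE.mem_one] at h'
    exact ⟨h'.1, h'.2, h.1.trans h'.1, h.2.trans h'.2⟩
  · rw [hE.mem_three] at h
    rw [hE.mem_zero] at h'
    rw [h'.1, h'.2] at h
    exact ⟨(mul_eq_zero.1 h.1.symm).resolve_left hE.ne_zero,
      (mul_eq_zero.1 h.2.symm).resolve_left hE.ne_zero', h'.1, h'.2⟩
  · rw [hE.mem_three] at h
    rw [hE.mem_one] at h'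
    rw [h'.1, h'.2, mul_zero, mul_zero] at h
    exact ⟨h'.1, h'.2, h.1, h.2⟩

section Solutions

variable {hs : 4 ≤ s} {G : Fin s → CompleteFlag k Q} {β : Fin s → Q →ₗ[k] k}
  {w : Fin s → Fin 4 → k} (hQ : finrank k Q = b) (hE : IsNormalForm E t t')
include hQ hE

omit [FiniteDimensional k A] in
-- The four lines are met in e_a, e_c, e_a + e_c, and e_a + t e_c or e_a + t' e_c.
lemma isLineSolution_coordPlane {a c : Fin 4} (hac : a = 0 ∧ c = 2 ∨ a = 1 ∧ c = 3) :
    IsLineSolution b hs (assembleAt Θ E G β w) (coordPlane Θ a c) := by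
  have hne : a ≠ c := by rintro rfl; omega
  have key : ∀ (S : Submodule k A) (x : Fin 4 → k), (∀ q, q ≠ a → q ≠ c → x q = 0) → x ≠ 0 →
      Θ.symm (x, 0) ∈ S → ¬ Disjoint (coordPlane Θ a c) S := by
    intro S x hx hx0 hS hd
    have := Submodule.disjoint_def.1 hd _ ((mem_coordPlane hne).2 ⟨by simp, by simpa using hx⟩) hS
    rw [LinearEquiv.map_eq_zero_iff] at this
    exact hx0 (congrArg Prod.fst this)
  refine ⟨fun x hx => (mem_lineSpan_assembleAt hQ hE.disjoint.1).2 ((mem_coordPlane hne).1 hx).1,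
    finrank_coordPlane hne, ?_, ?_, ?_, ?_⟩
  · refine key _ (Pi.single a 1) (fun q h1 _ => by simp [h1]) (by simp) ?_
    rw [mem_assembleAt_two hQ (by decide), hE.mem_zero]
    rcases hac with ⟨rfl, rfl⟩ | ⟨rfl, rfl⟩ <;> simp
  · refine key _ (Pi.single c 1) (fun q _ h1 => by simp [h1]) (by simp) ?_
    rw [mem_assembleAt_two hQ (by decide), hE.mem_one]
    rcases hac with ⟨rfl, rfl⟩ | ⟨rfl, rfl⟩ <;> simp
  · refine key _ (Pi.single a 1 + Pi.single c 1) (fun q h1 h2 => by simp [h1, h2])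
      (fun h => by simpa [hne] using congrFun h a) ?_
    rw [mem_assembleAt_add_two hQ, hE.mem_two]
    rcases hac with ⟨rfl, rfl⟩ | ⟨rfl, rfl⟩ <;> simp
  · refine key _ (Pi.single a 1 + Pi.single c (if a = 0 then t else t'))
      (fun q h1 h2 => by simp [h1, h2]) (fun h => by simpa [hne] using congrFun h a) ?_
    rw [mem_assembleAt_add_two hQ, hE.mem_three]
    rcases hac with ⟨rfl, rfl⟩ | ⟨rfl, rfl⟩ <;> simp

/-- Writing the lines as the two coordinate planes, the graph of the identity and the graph of
diag(t, t'), a transversal is given by an eigenvector of diag(t, t'). As t ≠ t', this eigenvector is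
on a coordinate axis. -/
lemma eq_coordPlane_or {h : Submodule k A}
    (hh : IsLineSolution b hs (assembleAt Θ E G β w) h) :
    h = coordPlane Θ 0 2 ∨ h = coordPlane Θ 1 3 := by
  obtain ⟨h01, h20, h21, h30, h31⟩ := hE.disjoint
  have hF : IsTransversal b hs (assembleAt Θ E G β w) :=
    isTransversal_assembleAt hQ h01 h20 h21 h30 h31
  obtain ⟨p, ⟨hph, hp⟩, hp0⟩ := Submodule.exists_mem_ne_zero_of_ne_bot
    (fun e => hh.meet0 (disjoint_iff.2 e))
  obtain ⟨q, ⟨hqh, hq⟩, hq0⟩ := Submodule.exists_mem_ne_zero_of_ne_bot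
    (fun e => hh.meet1 (disjoint_iff.2 e))
  obtain ⟨x, ⟨hxh, hx⟩, hx0⟩ := Submodule.exists_mem_ne_zero_of_ne_bot
    (fun e => hh.meet2 (disjoint_iff.2 e))
  obtain ⟨y, ⟨hyh, hy⟩, hy0⟩ := Submodule.exists_mem_ne_zero_of_ne_bot
    (fun e => hh.meet3 (disjoint_iff.2 e))
  have hd : Disjoint ((assembleAt Θ E G β w (Fin.castLE hs 0)).space 2)
      ((assembleAt Θ E G β w (Fin.castLE hs 1)).space 2) :=
    hF.disj01.mono_left ((assembleAt Θ E G β w _).mono (show 2 ≤ b + 2 by omega))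
  have hspan : Submodule.span k {p, q} = h := by
    apply Submodule.eq_of_le_of_finrank_eq
    · rw [Submodule.span_le]
      rintro z (rfl | rfl) <;> assumption
    · have hli : LinearIndependent k ![p, q] := by
        rw [LinearIndependent.pair_iff]
        intro α γ h0
        have h1 : α • p = 0 := Submodule.disjoint_def.1 hd _ (Submodule.smul_mem _ _ hp) (by
          rw [eq_neg_of_add_eq_zero_left h0]
          exact Submodule.neg_mem _ (Submodule.smul_mem _ _ hq))
        rw [h1, zero_add] at h0
        exact ⟨(smul_eq_zero.1 h1).resolve_right hp0, (smul_eq_zero.1 h0).resolve_right hq0⟩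
      have := finrank_span_eq_card hli
      rw [Matrix.range_cons, Matrix.range_cons, Matrix.range_empty, Set.union_empty,
        Set.singleton_union, Fintype.card_fin] at this
      rw [this, hh.finrank_eq]
  have hpl := hh.le hph
  have hql := hh.le hqh
  have hxl := hh.le hxh
  have hyl := hh.le hyh
  rw [mem_lineSpan_assembleAt hQ h01] at hpl hql hxl hyl
  rw [SetLike.mem_coe, mem_assembleAt_two hQ (by decide), hE.mem_zero] at hp
  rw [SetLike.mem_coe, mem_assembleAt_two hQ (by decide), hE.mem_one] at hq
  rw [SetLike.mem_coe, mem_assembleAt_add_two hQ, hxl, map_zero, zero_smul, sub_zero, hE.mem_two] at hx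
  rw [SetLike.mem_coe, mem_assembleAt_add_two hQ, hyl, map_zero, zero_smul, sub_zero, hE.mem_three] at hy
  have key : ∀ z ∈ h, ∃ α γ : k, (Θ z).1 0 = α * (Θ p).1 0 ∧ (Θ z).1 1 = α * (Θ p).1 1 ∧
      (Θ z).1 2 = γ * (Θ q).1 2 ∧ (Θ z).1 3 = γ * (Θ q).1 3 := by
    intro z hz
    rw [← hspan] at hz
    obtain ⟨α, γ, rfl⟩ := Submodule.mem_span_pair.1 hz
    exact ⟨α, γ, by simp [hq], by simp [hq], by simp [hp], by simp [hp]⟩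
  have hne : ∀ z, (Θ z).2 = 0 → z ≠ 0 →
      ¬ ((Θ z).1 0 = 0 ∧ (Θ z).1 1 = 0 ∧ (Θ z).1 2 = 0 ∧ (Θ z).1 3 = 0) := by
    rintro z hz hz0 ⟨e0, e1, e2, e3⟩
    refine hz0 (Θ.map_eq_zero_iff.1 (Prod.ext (funext fun q => ?_) hz))
    fin_cases q <;> assumption
  have hx0' := hne x hxl hx0
  have hy0' := hne y hyl hy0
  have hp0' := hne p hpl hp0
  have hq0' := hne q hql hq0
  obtain ⟨α, γ, x0, x1, x2, x3⟩ := key x hxh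
  obtain ⟨α', γ', y0, y1, y2, y3⟩ := key y hyh
  rw [x0, x1, x2, x3] at hx hx0'
  rw [y0, y1, y2, y3] at hy hy0'
  obtain ⟨hx1, hx2⟩ := hx
  obtain ⟨hy1, hy2⟩ := hy
  have hγ : γ ≠ 0 := by
    rintro rfl
    simp only [zero_mul] at *
    simp [← hx1, ← hx2] at hx0'
  have hα' : α' ≠ 0 := by
    rintro rfl
    simp only [zero_mul, mul_zero] at *
    simp [hy1, hy2] at hy0'
  -- The coordinates of q are eliminated from the conditions on the third and fourth line; the two
  -- equations say that the first two coordinates of p form an eigenvector.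
  have e1 : γ * α' * t * (Θ p).1 0 = γ' * α * (Θ p).1 0 := by
    linear_combination (-γ) * hy1 + γ' * hx1
  have e2 : γ * α' * t' * (Θ p).1 1 = γ' * α * (Θ p).1 1 := by
    linear_combination (-γ) * hy2 + γ' * hx2
  have e3 : (Θ p).1 0 = 0 ∨ (Θ p).1 1 = 0 := by
    by_contra! hcon
    have h1 := mul_right_cancel₀ hcon.1 e1
    have h2 := mul_right_cancel₀ hcon.2 e2
    exact hE.ne (mul_left_cancel₀ (mul_ne_zero hγ hα') (h1.trans h2.symm))
  have fin : ∀ a c : Fin 4, a ≠ c → p ∈ coordPlane Θ a c → q ∈ coordPlane Θ a c →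
      h = coordPlane Θ a c := by
    intro a c hac h1 h2
    apply Submodule.eq_of_le_of_finrank_eq
    · rw [← hspan, Submodule.span_le]
      rintro z (rfl | rfl) <;> assumption
    · rw [hh.finrank_eq, finrank_coordPlane hac]
  rcases e3 with e3 | e3
  · right
    rw [e3, mul_zero, mul_eq_zero] at hx1
    have e4 := hx1.resolve_left hγ
    refine fin 1 3 (by decide) ((mem_coordPlane (by decide)).2 ⟨hpl, fun r => ?_⟩)
      ((mem_coordPlane (by decide)).2 ⟨hql, fun r => ?_⟩)
    · fin_cases r <;> simp [hp, e3]
    · fin_cases r <;> simp [hq, e4]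
  · left
    rw [e3, mul_zero, mul_eq_zero] at hx2
    have e4 := hx2.resolve_left hγ
    refine fin 0 2 (by decide) ((mem_coordPlane (by decide)).2 ⟨hpl, fun r => ?_⟩)
      ((mem_coordPlane (by decide)).2 ⟨hql, fun r => ?_⟩)
    · fin_cases r <;> simp [hp, e3]
    · fin_cases r <;> simp [hq, e4]

omit [FiniteDimensional k A] in
/-- Equations for the members of the hull of the first transversal. -/
lemma hull_coordPlane_zero_two (h2 : w (Fin.castLE hs 2) 1 = w (Fin.castLE hs 2) 3)
    (h3 : w (Fin.castLE hs 3) 3 = t' * w (Fin.castLE hs 3) 1) {x : A}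
    (hx : x ∈ hull b hs (assembleAt Θ E G β w) (coordPlane Θ 0 2)) :
    (Θ x).1 1 = 0 ∧ (Θ x).1 3 = 0 := by
  obtain ⟨hx2, hx3⟩ := hx
  have e2 : (Θ x).1 3 = (Θ x).1 1 := by
    obtain ⟨y, hy, z, hz, rfl⟩ := Submodule.mem_sup.1 hx2
    rw [mem_assembleAt_add_two hQ, hE.mem_two] at hy
    rw [mem_coordPlane (by decide)] at hz
    have z1 := hz.2 1 (by decide) (by decide)
    have z3 := hz.2 3 (by decide) (by decide)
    have hy2 := hy.2
    simp only [Pi.sub_apply, Pi.smul_apply, smul_eq_mul] at hy2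
    simp only [map_add, Prod.fst_add, Pi.add_apply, z1, z3]
    rw [h2] at hy2
    linear_combination hy2
  have e3 : (Θ x).1 3 = t' * (Θ x).1 1 := by
    obtain ⟨y, hy, z, hz, rfl⟩ := Submodule.mem_sup.1 hx3
    rw [mem_assembleAt_add_two hQ, hE.mem_three] at hy
    rw [mem_coordPlane (by decide)] at hz
    have z1 := hz.2 1 (by decide) (by decide)
    have z3 := hz.2 3 (by decide) (by decide)
    have hy2 := hy.2
    simp only [Pi.sub_apply, Pi.smul_apply, smul_eq_mul] at hy2
    simp only [map_add, Prod.fst_add, Pi.add_apply, z1, z3]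
    rw [h3] at hy2
    linear_combination hy2
  have e4 : (1 - t') * (Θ x).1 1 = 0 := by linear_combination e3 - e2
  have e5 := (mul_eq_zero.1 e4).resolve_left (sub_ne_zero.2 hE.ne_one'.symm)
  exact ⟨e5, e2.trans e5⟩

omit [FiniteDimensional k A] in
/-- Equations for the members of the hull of the second transversal. -/
lemma hull_coordPlane_one_three {κ : k} (h20 : w (Fin.castLE hs 2) 0 = κ)
    (h22 : w (Fin.castLE hs 2) 2 = 0) (h30 : w (Fin.castLE hs 3) 0 = 1)
    (h32 : w (Fin.castLE hs 3) 2 = 0) {x : A}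
    (hx : x ∈ hull b hs (assembleAt Θ E G β w) (coordPlane Θ 1 3)) :
    (Θ x).1 0 - (Θ x).1 2 = κ * β (Fin.castLE hs 2) (Θ x).2 ∧
      (Θ x).1 2 = t * ((Θ x).1 0 - β (Fin.castLE hs 3) (Θ x).2) := by
  obtain ⟨hx2, hx3⟩ := hx
  constructor
  · obtain ⟨y, hy, z, hz, rfl⟩ := Submodule.mem_sup.1 hx2
    rw [mem_assembleAt_add_two hQ, hE.mem_two] at hy
    rw [mem_coordPlane (by decide)] at hz
    have z0 := hz.2 0 (by decide) (by decide)
    have z2 := hz.2 2 (by decide) (by decide)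
    have hy2 := hy.1
    simp only [Pi.sub_apply, Pi.smul_apply, smul_eq_mul, h20, h22] at hy2
    simp only [map_add, Prod.fst_add, Pi.add_apply, z0, z2, Prod.snd_add, hz.1, map_zero]
    linear_combination -hy2
  · obtain ⟨y, hy, z, hz, rfl⟩ := Submodule.mem_sup.1 hx3
    rw [mem_assembleAt_add_two hQ, hE.mem_three] at hy
    rw [mem_coordPlane (by decide)] at hz
    have z0 := hz.2 0 (by decide) (by decide)
    have z2 := hz.2 2 (by decide) (by decide)
    have hy2 := hy.1
    simp only [Pi.sub_apply, Pi.smul_apply, smul_eq_mul, h30, h32] at hy2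
    simp only [map_add, Prod.fst_add, Pi.add_apply, z0, z2, Prod.snd_add, hz.1, map_zero]
    linear_combination hy2

end Solutions


/-- For flags in normal form in `k⁴` and arbitrary flags in `Q` there are flags in `k⁴ × Q` whose
transports along any linear equivalence realize the given ones. -/
theorem exists_isRealization [Infinite k] (hs : 4 ≤ s) (hb : 0 < b) (hQ : finrank k Q = b)
    (hE : IsNormalForm E t t') (G : Fin s → CompleteFlag k Q) :
    ∃ F : Fin s → CompleteFlag k ((Fin 4 → k) × Q), ∀ Θ : A ≃ₗ[k] (Fin 4 → k) × Q,
      IsRealization b hs (fun i => (F i).map Θ.symm) Θ E G := by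
  classical
  choose g δ hg hδ1 hδ0 using fun i => (G i).exists_dual (hQ ▸ hb)
  -- The two excluded values are those for which the first member of the third or the fourth flag
  -- could lie in the hull of the second transversal.
  obtain ⟨κ, hκ⟩ := Infinite.exists_notMem_finset
    ({δ (Fin.castLE hs 3) (g (Fin.castLE hs 2)), (δ (Fin.castLE hs 2) (g (Fin.castLE hs 3)))⁻¹} :
      Finset k)
  simp only [Finset.mem_insert, Finset.mem_singleton, not_or] at hκ
  obtain ⟨hκ1, hκ2⟩ := hκ
  have ht1 : (1 - t) ≠ 0 := sub_ne_zero.2 hE.ne_one.symm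
  -- The constants x₀ and x₁ are chosen so that the sheared vectors over g for the first two flags
  -- avoid the hull of the second transversal; the inequalities are the coefficients of c in the
  -- computation below.
  have hex : ∀ r : k, ∃ x : k, x * (1 - t) - r ≠ 0 := fun r =>
    ⟨r / (1 - t) + 1, by rw [add_mul, div_mul_cancel₀ _ ht1]; simpa using ht1⟩
  obtain ⟨x₀, hx₀⟩ := hex (t * (κ * δ (Fin.castLE hs 2) (g (Fin.castLE hs 0)) -
    δ (Fin.castLE hs 3) (g (Fin.castLE hs 0))))
  obtain ⟨x₁, hx₁⟩ := hex (κ * δ (Fin.castLE hs 2) (g (Fin.castLE hs 1)) -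
    t * δ (Fin.castLE hs 3) (g (Fin.castLE hs 1)))
  -- For the first four flags g is put in front of G, and the shear gives g a component in k⁴
  -- outside the hull of the first transversal. Intersecting with this hull then discards g and
  -- leaves exactly the members of G. The remaining flags need no shear.
  set G' : Fin s → CompleteFlag k Q := fun i => if 4 ≤ i.val then G i else (G i).extend (g i) (hg i)
    with hG'
  set β : Fin s → Q →ₗ[k] k := fun i => if 4 ≤ i.val then 0 else δ i with hβ
  -- The hull of the first transversal has vanishing coordinates 1 and 3, and in each vector a
  -- coordinate equal to 1 detects the value of β there. For the third and fourth vectors,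
  -- coordinates 1 and 3 moreover satisfy the equation of the corresponding line, so the shear does
  -- not disturb the equations of the hull.
  set w : Fin s → Fin 4 → k := fun i => if i.val = 0 then ![0, 0, x₀, 1] else
    if i.val = 1 then ![x₁, 1, 0, 0] else if i.val = 2 then ![κ, 1, 0, 1] else ![1, 1, 0, t'] with hw
  refine ⟨assemble E G' β w, fun Θ => ?_⟩
  change IsRealization b hs (assembleAt Θ E G' β w) Θ E G
  have hβ' : ∀ i : Fin 4, β (Fin.castLE hs i) = δ (Fin.castLE hs i) := fun i => by
    simp [hβ]
  have hβ4 : ∀ i : Fin s, 4 ≤ i.val → β i = 0 := fun i hi => by simp [hβ, hi]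
  have hG4 : ∀ i : Fin s, 4 ≤ i.val → G' i = G i := fun i hi => by simp [hG', hi]
  have hGlt : ∀ (i : Fin 4) d x, x ∈ (G' (Fin.castLE hs i)).space (d + 1) ↔ ∃ c : k,
      ∃ y ∈ (G (Fin.castLE hs i)).space d, x = c • g (Fin.castLE hs i) + y := fun i d x => by
    have : G' (Fin.castLE hs i) = (G _).extend (g (Fin.castLE hs i)) (hg _) := by simp [hG']
    rw [this, CompleteFlag.mem_extend_succ]
  have hGone : ∀ (i : Fin 4) x, x ∈ (G' (Fin.castLE hs i)).space 1 → ∃ c : k,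
      x = c • g (Fin.castLE hs i) := fun i x hx => by
    obtain ⟨c, y, hy, rfl⟩ := (hGlt i 0 x).1 hx
    rw [CompleteFlag.space_zero, Submodule.mem_bot] at hy
    exact ⟨c, by rw [hy, add_zero]⟩
  have hGker : ∀ (i : Fin 4) d x, d < b → x ∈ (G' (Fin.castLE hs i)).space (d + 1) →
      δ (Fin.castLE hs i) x = 0 → x ∈ (G (Fin.castLE hs i)).space d := fun i d x hd hx h0 => by
    obtain ⟨c, y, hy, rfl⟩ := (hGlt i d x).1 hx
    rw [map_add, map_smul, hδ1, hδ0 _ d (hQ ▸ hd) y hy, smul_eq_mul, mul_one, add_zero] at h0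
    rwa [h0, zero_smul, zero_add]
  have hw0 : w (Fin.castLE hs 0) = ![0, 0, x₀, 1] := by simp [hw]
  have hw1 : w (Fin.castLE hs 1) = ![x₁, 1, 0, 0] := by simp [hw]
  have hw2 : w (Fin.castLE hs 2) = ![κ, 1, 0, 1] := by simp [hw]
  have hw3 : w (Fin.castLE hs 3) = ![1, 1, 0, t'] := by simp [hw]
  obtain ⟨h01, h20, h21, h30, h31⟩ := hE.disjoint
  have hF : IsTransversal b hs (assembleAt Θ E G' β w) :=
    isTransversal_assembleAt hQ h01 h20 h21 h30 h31
  have hull1 : ∀ x ∈ hull b hs (assembleAt Θ E G' β w) (coordPlane Θ 0 2),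
      (Θ x).1 1 = 0 ∧ (Θ x).1 3 = 0 := fun x hx =>
    hull_coordPlane_zero_two hQ hE (by simp [hw2]) (by simp [hw3]) hx
  have hull2 : ∀ x ∈ hull b hs (assembleAt Θ E G' β w) (coordPlane Θ 1 3),
      (Θ x).1 0 - (Θ x).1 2 = κ * δ (Fin.castLE hs 2) (Θ x).2 ∧
        (Θ x).1 2 = t * ((Θ x).1 0 - δ (Fin.castLE hs 3) (Θ x).2) := fun x hx => by
    rw [← hβ', ← hβ']
    exact hull_coordPlane_one_three hQ hE (by simp [hw2]) (by simp [hw2]) (by simp [hw3])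
      (by simp [hw3]) hx
  have hmid : ∀ (i : Fin 4) (j : ℕ) (x : A), i.val < 2 → 2 ≤ j → j ≤ b + 2 →
      x ∈ (assembleAt Θ E G' β w (Fin.castLE hs i)).space j →
      (Θ x).1 - δ (Fin.castLE hs i) (Θ x).2 • w (Fin.castLE hs i) ∈ (E i).space 2 ∧
        (Θ x).2 ∈ (G' (Fin.castLE hs i)).space (j - 2) := fun i j x hi h1 h2 hx => by
    rw [mem_assembleAt_castLE_lt hi, hQ, hβ'] at hx
    rwa [show max (min j 2) (j - b) = 2 by omega, show min (j - 2) b = j - 2 by omega] at hx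
  have hlow : ∀ (i : Fin 4) (j : ℕ) (x : A), 2 ≤ i.val → j ≤ b →
      x ∈ (assembleAt Θ E G' β w (Fin.castLE hs i)).space j →
      (Θ x).1 = δ (Fin.castLE hs i) (Θ x).2 • w (Fin.castLE hs i) ∧
        (Θ x).2 ∈ (G' (Fin.castLE hs i)).space j := fun i j x hi h1 hx => by
    rw [mem_assembleAt_castLE_ge hi, hQ, hβ', show j - b = 0 by omega, show min j b = j by omega,
      CompleteFlag.space_zero, Submodule.mem_bot, sub_eq_zero] at hx
    exact hx
  have hhigh : ∀ (i : Fin s) (j : ℕ) (x : A), 4 ≤ i.val → 2 ≤ j → j ≤ b + 2 →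
      x ∈ (assembleAt Θ E G' β w i).space j →
      ((Θ x).1 0 = (Θ x).1 1 ∧ (Θ x).1 2 = (Θ x).1 3) ∧ (Θ x).2 ∈ (G i).space (j - 2) :=
    fun i j x hi h1 h2 hx => by
      rw [mem_assembleAt_four_le hi, hQ, hβ4 i hi, hG4 i hi, LinearMap.zero_apply, zero_smul,
        sub_zero, show max (min j 2) (j - b) = 2 by omega, show min (j - 2) b = j - 2 by omega,
        mem_diagFlag] at hx
      exact hx
  have hzero : ∀ x : A, (Θ x).2 = 0 → (Θ x).1 0 = 0 → (Θ x).1 1 = 0 → (Θ x).1 2 = 0 →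
      (Θ x).1 3 = 0 → x = 0 := fun x h h0 h1 h2 h3 => by
    refine Θ.map_eq_zero_iff.1 (Prod.ext (funext fun q => ?_) h)
    fin_cases q <;> assumption
  have hsol := isLineSolution_coordPlane (Θ := Θ) (G := G') (β := β) (w := w) (hs := hs)
    (a := 0) (c := 2) hQ hE (Or.inl ⟨rfl, rfl⟩)
  have hsol' := isLineSolution_coordPlane (Θ := Θ) (G := G') (β := β) (w := w) (hs := hs)
    (a := 1) (c := 3) hQ hE (Or.inr ⟨rfl, rfl⟩)
  have hlt : ∀ (i : Fin 4) (j : ℕ) (x : A), i.val < 2 → 2 ≤ j → j ≤ b + 2 →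
      x ∈ (assembleAt Θ E G' β w (Fin.castLE hs i)).space j →
      x ∈ hull b hs (assembleAt Θ E G' β w) (coordPlane Θ 0 2) →
      δ (Fin.castLE hs i) (Θ x).2 = 0 := by
    intro i j x hi h1 h2 hx hx'
    obtain ⟨h3, h4⟩ := hmid i j x hi h1 h2 hx
    obtain ⟨h5, h6⟩ := hull1 x hx'
    have : i = 0 ∨ i = 1 := by omega
    rcases this with rfl | rfl
    · rw [hE.mem_zero, hw0] at h3
      simpa [h6] using h3.2
    · rw [hE.mem_one, hw1] at h3
      simpa [h5] using h3.2
  have hge : ∀ (i : Fin 4) (j : ℕ) (x : A), 2 ≤ i.val → j ≤ b →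
      x ∈ (assembleAt Θ E G' β w (Fin.castLE hs i)).space j →
      x ∈ hull b hs (assembleAt Θ E G' β w) (coordPlane Θ 0 2) →
      δ (Fin.castLE hs i) (Θ x).2 = 0 := by
    intro i j x hi h1 hx hx'
    obtain ⟨h3, h4⟩ := hlow i j x hi h1 hx
    obtain ⟨h5, h6⟩ := hull1 x hx'
    have h7 := congrFun h3 1
    have : i = 2 ∨ i = 3 := by omega
    rcases this with rfl | rfl
    · rw [hw2] at h7
      simpa [h5] using h7.symm
    · rw [hw3] at h7
      simpa [h5] using h7.symm
  have hgood : IsGoodAt b hs (assembleAt Θ E G' β w) (coordPlane Θ 0 2) := by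
    refine ⟨?_, ?_, ?_, ?_, ?_⟩
    · rintro x ⟨hx, hx'⟩
      rw [SetLike.mem_coe, mem_lineSpan_assembleAt hQ h01] at hx
      refine (mem_coordPlane (by decide)).2 ⟨hx, fun q => ?_⟩
      obtain ⟨h1, h3⟩ := hull1 x hx'
      fin_cases q <;> simp [h1, h3]
    · rintro i hi x ⟨hx, hx'⟩
      obtain ⟨j, rfl, hj⟩ := castLE_cases hs (by omega : i.val < 4)
      have hj2 : j.val < 2 := by omega
      have h0 := hlt j 3 x hj2 (by omega) (by omega) hx hx'
      obtain ⟨h1, h2⟩ := hmid j 3 x hj2 (by omega) (by omega) hx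
      obtain ⟨c, hc⟩ := hGone j _ h2
      rw [hc, map_smul, hδ1, smul_eq_mul, mul_one] at h0
      rw [h0, zero_smul] at hc
      rw [hc, map_zero, zero_smul, sub_zero] at h1
      exact (mem_assembleAt_two hQ hj2).2 ⟨hc, h1⟩
    · intro i hi hi'
      obtain ⟨j, rfl, hj⟩ := castLE_cases hs hi'
      have hj2 : 2 ≤ j.val := by omega
      rw [Submodule.disjoint_def]
      intro x hx hx'
      have h0 := hge j 1 x hj2 (by omega) hx hx'
      obtain ⟨h1, h2⟩ := hlow j 1 x hj2 (by omega) hx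
      obtain ⟨c, hc⟩ := hGone j _ h2
      rw [h0, zero_smul] at h1
      rw [hc, map_smul, hδ1, smul_eq_mul, mul_one] at h0
      rw [h0, zero_smul] at hc
      exact Θ.map_eq_zero_iff.1 (Prod.ext h1 hc)
    · intro i hi
      rw [Submodule.disjoint_def]
      intro x hx hx'
      obtain ⟨⟨h1, h2⟩, h3⟩ := hhigh i 2 x hi le_rfl (by omega) hx
      obtain ⟨h4, h5⟩ := hull1 x hx'
      rw [CompleteFlag.space_zero, Submodule.mem_bot] at h3
      exact hzero x h3 (h1.trans h4) h4 (h2.trans h5) h5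
    · intro i hi
      rw [Submodule.disjoint_def]
      intro x hx hx'
      obtain ⟨⟨h1, h2⟩, -⟩ := hhigh i (b + 2) x hi (by omega) le_rfl hx
      rw [mem_coordPlane (by decide)] at hx'
      have h4 := hx'.2 1 (by decide) (by decide)
      have h5 := hx'.2 3 (by decide) (by decide)
      exact hzero x hx'.1 (h1.trans h4) h4 (h2.trans h5) h5
  have hgood' : IsGoodAt b hs (assembleAt Θ E G' β w) (coordPlane Θ 1 3) := by
    refine ⟨?_, ?_, ?_, ?_, ?_⟩
    · rintro x ⟨hx, hx'⟩
      rw [SetLike.mem_coe, mem_lineSpan_assembleAt hQ h01] at hx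
      obtain ⟨h1, h2⟩ := hull2 x hx'
      rw [hx, map_zero, mul_zero] at h1
      rw [hx, map_zero, sub_zero] at h2
      have h3 : (1 - t) * (Θ x).1 0 = 0 := by linear_combination h1 + h2
      have h4 := (mul_eq_zero.1 h3).resolve_left ht1
      rw [h4, mul_zero] at h2
      refine (mem_coordPlane (by decide)).2 ⟨hx, fun q => ?_⟩
      fin_cases q <;> simp [h2, h4]
    · rintro i hi x ⟨hx, hx'⟩
      obtain ⟨j, rfl, hj⟩ := castLE_cases hs (by omega : i.val < 4)
      have hj2 : j.val < 2 := by omega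
      obtain ⟨h1, h2⟩ := hmid j 3 x hj2 (by omega) (by omega) hx
      obtain ⟨c, hc⟩ := hGone j _ h2
      obtain ⟨h3, h4⟩ := hull2 x hx'
      -- The equations of the hull and of the sheared line combine to c times the quantity that x₀
      -- or x₁ keeps nonzero.
      have hc0 : c = 0 := by
        rw [hc, map_smul, smul_eq_mul] at h3 h4
        rw [hc, map_smul, hδ1, smul_eq_mul, mul_one] at h1
        have : j = 0 ∨ j = 1 := by omega
        rcases this with rfl | rfl
        · rw [hE.mem_zero, hw0] at h1
          have h5 : (Θ x).1 2 - c * x₀ = 0 := by simpa using h1.1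
          refine (mul_eq_zero.1 (?_ : c * _ = 0)).resolve_right hx₀
          linear_combination h4 + t * h3 + (t - 1) * h5
        · rw [hE.mem_one, hw1] at h1
          have h5 : (Θ x).1 0 - c * x₁ = 0 := by simpa using h1.1
          refine (mul_eq_zero.1 (?_ : c * _ = 0)).resolve_right hx₁
          linear_combination h4 + h3 + (t - 1) * h5
      rw [hc0, zero_smul] at hc
      rw [hc, map_zero, zero_smul, sub_zero] at h1
      exact (mem_assembleAt_two hQ hj2).2 ⟨hc, h1⟩
    · intro i hi hi'
      obtain ⟨j, rfl, hj⟩ := castLE_cases hs hi'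
      have hj2 : 2 ≤ j.val := by omega
      rw [Submodule.disjoint_def]
      intro x hx hx'
      obtain ⟨h1, h2⟩ := hlow j 1 x hj2 (by omega) hx
      obtain ⟨c, hc⟩ := hGone j _ h2
      obtain ⟨h3, h4⟩ := hull2 x hx'
      have h5 : δ (Fin.castLE hs j) (Θ x).2 = c := by
        rw [hc, map_smul, hδ1, smul_eq_mul, mul_one]
      have hc0 : c = 0 := by
        rw [h5] at h1
        rw [h1] at h3 h4
        have : j = 2 ∨ j = 3 := by omega
        rcases this with rfl | rfl
        · rw [hc, map_smul, smul_eq_mul] at h4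
          rw [hw2] at h4
          have h6 : t = 0 ∨ c * κ - c * δ (Fin.castLE hs 3) (g (Fin.castLE hs 2)) = 0 := by
            simpa [eq_comm] using h4
          have h7 := h6.resolve_left hE.ne_zero
          rw [← mul_sub, mul_eq_zero] at h7
          exact h7.resolve_right (sub_ne_zero.2 hκ1)
        · rw [hc, map_smul, smul_eq_mul] at h3
          rw [hw3] at h3
          have h6 : c = κ * (c * δ (Fin.castLE hs 2) (g (Fin.castLE hs 3))) := by
            simpa using h3
          have h7 : c * (1 - κ * δ (Fin.castLE hs 2) (g (Fin.castLE hs 3))) = 0 := by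
            linear_combination h6
          refine (mul_eq_zero.1 h7).resolve_right fun h8 => hκ2 ?_
          exact eq_inv_of_mul_eq_one_left (sub_eq_zero.1 h8).symm
      rw [h5, hc0, zero_smul] at h1
      rw [hc0, zero_smul] at hc
      exact Θ.map_eq_zero_iff.1 (Prod.ext h1 hc)
    · intro i hi
      rw [Submodule.disjoint_def]
      intro x hx hx'
      obtain ⟨⟨h1, h2⟩, h3⟩ := hhigh i 2 x hi le_rfl (by omega) hx
      rw [CompleteFlag.space_zero, Submodule.mem_bot] at h3
      obtain ⟨h4, h5⟩ := hull2 x hx'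
      rw [h3, map_zero, mul_zero] at h4
      rw [h3, map_zero, sub_zero] at h5
      have h6 : (1 - t) * (Θ x).1 0 = 0 := by linear_combination h4 + h5
      have h7 := (mul_eq_zero.1 h6).resolve_left ht1
      rw [h7, mul_zero] at h5
      exact hzero x h3 h7 (h1 ▸ h7) h5 (h2 ▸ h5)
    · intro i hi
      rw [Submodule.disjoint_def]
      intro x hx hx'
      obtain ⟨⟨h1, h2⟩, -⟩ := hhigh i (b + 2) x hi (by omega) le_rfl hx
      rw [mem_coordPlane (by decide)] at hx'
      have h4 := hx'.2 0 (by decide) (by decide)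
      have h5 := hx'.2 2 (by decide) (by decide)
      exact hzero x hx'.1 h4 (h1 ▸ h4) h5 (h2 ▸ h5)
  have hls : ∀ x, x ∈ lineSpan hs (assembleAt Θ E G' β w) ↔ (Θ x).2 = 0 := fun x =>
    mem_lineSpan_assembleAt hQ h01
  refine ⟨hF, hls, fun i j x hx => mem_assembleAt_lineIdx hQ i j hx, hsol, hsol',
    fun h hh => eq_coordPlane_or hQ hE hh, hgood, hgood', fun i => ?_⟩
  have hA : finrank k A = 4 + b := by rw [Θ.finrank_eq, finrank_prod, hQ, finrank_fin_fun]
  have hker : LinearMap.ker (LinearMap.snd k (Fin 4 → k) Q ∘ₗ Θ.toLinearMap) =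
      lineSpan hs (assembleAt Θ E G' β w) := by
    ext x
    rw [LinearMap.mem_ker, hls]
    rfl
  obtain ⟨G'', hG''⟩ := exists_isInducedFlag hker hA hQ hF hsol hgood i
  -- Between complete flags inclusions suffice. A vector of the hull in a member of the assembled
  -- flag has no component along g, so its image lies in G.
  have : G'' = G i := by
    refine CompleteFlag.ext_of_le fun d hd => ?_
    rw [hQ] at hd
    rw [hG'' d hd]
    rintro _ ⟨x, ⟨hx, hx'⟩, rfl⟩
    change (Θ x).2 ∈ _
    by_cases hi : i.val < 4
    · obtain ⟨j, rfl, hj⟩ := castLE_cases hs hi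
      by_cases hi2 : j.val < 2
      · simp only [flagShift, Fin.val_castLE, hi2, if_true] at hx
        have h0 := hlt j (d + 3) x hi2 (by omega) (by omega) hx hx'
        exact hGker j d _ hd (hmid j (d + 3) x hi2 (by omega) (by omega) hx).2 h0
      · simp only [flagShift, Fin.val_castLE, hi2, if_false, j.isLt, if_true] at hx
        have h0 := hge j (d + 1) x (by omega) (by omega) hx hx'
        exact hGker j d _ hd (hlow j (d + 1) x (by omega) (by omega) hx).2 h0
    · have hi2 : ¬ i.val < 2 := by omega
      simp only [flagShift, hi, hi2, if_false] at hx
      exact (hhigh i (d + 2) x (by omega) (by omega) (by omega) hx).2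
  rw [← this]
  exact hG''

end Normal

/-! ### Zariski open sets of flags -/

section Open

universe u

/-- The entries of a lower unitriangular matrix over a commutative ring. -/
def unitriangular {R : Type*} [CommRing R] {m : ℕ} (x : BelowDiag m → R) (p q : Fin m) : R :=
  if h : q < p then x ⟨(p, q), h⟩ else if p = q then 1 else 0

lemma map_unitriangular {R S : Type*} [CommRing R] [CommRing S] (φ : R →+* S) {m : ℕ}
    (x : BelowDiag m → R) (p q : Fin m) :
    φ (unitriangular x p q) = unitriangular (φ ∘ x) p q := by
  unfold unitriangular
  split_ifs <;> simp

/-- A set of flags which is described by the nonvanishing of a natural expression in the coordinates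
of adapted bases is Zariski open. -/
lemma isZariskiOpen_of_natural {K V : Type u} [Field K] [AddCommGroup V] [Module K V] {m s : ℕ}
    (c : V ≃ₗ[K] (Fin m → K))
    (P : ∀ (R : Type u) [CommRing R], (Fin s → Fin m → Fin m → R) → R)
    (hP : ∀ (R S : Type u) [CommRing R] [CommRing S] (φ : R →+* S) (f : Fin s → Fin m → Fin m → R),
      φ (P R f) = P S fun i q r => φ (f i q r)) :
    IsZariskiOpen {F : Fin s → CompleteFlag K V | ∃ e : Fin s → Basis (Fin m) K V,
      (F = fun i => CompleteFlag.ofBasis (e i)) ∧ P K (fun i q r => c (e i q) r) ≠ 0} := by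
  rintro F ⟨e, rfl, hne⟩
  -- The chart is centred at the given flags: the coordinates x replace the bases e by their
  -- unitriangular combinations, and x = 0 returns e.
  let p : MvPolynomial (Fin s × BelowDiag m) K := P _ fun i q r =>
    ∑ l, unitriangular (fun pq => MvPolynomial.X (i, pq)) l q * MvPolynomial.C (c (e i l) r)
  have hp : ∀ x, MvPolynomial.eval x p =
      P K fun i q r => c (cellVector (e i) (fun pq => x (i, pq)) q) r := by
    intro x
    simp only [p, hP, map_sum, map_mul, MvPolynomial.eval_C, map_unitriangular]
    congr 1
    funext i q r
    rw [cellVector, map_sum, Finset.sum_apply]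
    refine Finset.sum_congr rfl fun l _ => ?_
    rw [map_smul, Pi.smul_apply, smul_eq_mul]
    congr 1
    simp only [unitriangular, lowerUnipotent, Matrix.of_apply, Function.comp_apply,
      MvPolynomial.eval_X]
  refine ⟨m, e, p, ⟨0, ?_, ?_⟩, ?_⟩
  · rw [hp]
    have : ∀ i, cellVector (e i) (fun pq => (0 : Fin s × BelowDiag m → K) (i, pq)) = e i :=
      fun i => CompleteFlag.cellVector_zero (e i)
    simpa only [this] using hne
  · rfl
  · rintro _ ⟨x, hx, rfl⟩
    refine ⟨fun i => CompleteFlag.cellBasis (e i) fun pq => x (i, pq), ?_, ?_⟩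
    · funext i
      exact CompleteFlag.cellFlag_eq_ofBasis _ _
    · rw [hp] at hx
      simpa using hx

end Open

/-! ### The norm of the condition at a transversal -/

section Norm

open Polynomial

variable {R S : Type*} [CommRing R] [CommRing S] {b s : ℕ} (hs : 4 ≤ s)
  (f : Fin s → Fin (4 + b) → Fin (4 + b) → R)

/-- The monic quadratic polynomial whose roots are the parameters of the transversals. -/
noncomputable def lineQuadratic : R[X] :=
  X ^ 2 + C (coeffOne hs f) * X + C (coeffZero hs f * coeffTwo hs f)

lemma lineQuadratic_monic : (lineQuadratic hs f).Monic := by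
  unfold lineQuadratic
  monicity!

lemma eval_lineQuadratic (θ : R) : (lineQuadratic hs f).eval θ = transversalPoly hs f θ := by
  simp [lineQuadratic, transversalPoly]

lemma map_lineQuadratic (φ : R →+* S) :
    (lineQuadratic hs f).map φ = lineQuadratic hs (mapFrame f φ) := by
  simp only [lineQuadratic, Polynomial.map_add, Polynomial.map_mul, Polynomial.map_pow, map_X,
    map_C, map_mul φ, map_coeffZero hs f φ, map_coeffOne hs f φ, map_coeffTwo hs f φ]

/-- The genericity condition at a transversal, as a polynomial in the parameter. -/
noncomputable def goodPoly : R[X] := goodCond hs (mapFrame f C) (pVec hs (mapFrame f C) X)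

lemma map_goodPoly (φ : R →+* S) : (goodPoly hs f).map φ = goodPoly hs (mapFrame f φ) := by
  rw [← coe_mapRingHom, goodPoly, map_goodCond, comp_pVec, coe_mapRingHom, map_X, goodPoly]
  have : mapFrame (mapFrame f C) (mapRingHom φ) = mapFrame (mapFrame f φ) C := by
    funext i q r
    simp [mapFrame]
  rw [this]

lemma eval_goodPoly (θ : R) : (goodPoly hs f).eval θ = goodCond hs f (pVec hs f θ) := by
  rw [← coe_evalRingHom, goodPoly, map_goodCond, comp_pVec, coe_evalRingHom, eval_X]
  have : mapFrame (mapFrame f C) (evalRingHom θ) = f := by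
    funext i q r
    simp [mapFrame]
  rw [this]

/-- The norm of the genericity condition. -/
noncomputable def normCond : R :=
  ((goodPoly hs f) %ₘ (lineQuadratic hs f)).coeff 0 ^ 2 -
    ((goodPoly hs f) %ₘ (lineQuadratic hs f)).coeff 0 *
      ((goodPoly hs f) %ₘ (lineQuadratic hs f)).coeff 1 * coeffOne hs f +
    ((goodPoly hs f) %ₘ (lineQuadratic hs f)).coeff 1 ^ 2 * (coeffZero hs f * coeffTwo hs f)

lemma map_normCond (φ : R →+* S) : φ (normCond hs f) = normCond hs (mapFrame f φ) := by
  simp only [normCond, map_add, map_sub, map_mul, map_pow, map_coeffZero, map_coeffOne,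
    map_coeffTwo, ← coeff_map, map_modByMonic φ (lineQuadratic_monic hs f), map_goodPoly,
    map_lineQuadratic]

/-- Modulo the quadratic polynomial the condition is r₁ X + r₀, and the product of its values at the
roots is r₀² + r₀ r₁ (θ + θ') + r₁² θ θ'. Expressed by coefficients, this is natural in the frame
and needs no choice of root. -/
lemma normCond_eq_mul [Nontrivial R] {θ θ' : R} (h1 : θ + θ' = -coeffOne hs f)
    (h2 : θ * θ' = coeffZero hs f * coeffTwo hs f) :
    normCond hs f = goodCond hs f (pVec hs f θ) * goodCond hs f (pVec hs f θ') := by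
  have hdeg : (lineQuadratic hs f).natDegree = 2 := by
    unfold lineQuadratic
    compute_degree!
  have hr := natDegree_modByMonic_lt (goodPoly hs f) (lineQuadratic_monic hs f) (by
    intro h; rw [h] at hdeg; simp at hdeg)
  have hX := Polynomial.eq_X_add_C_of_natDegree_le_one
    (show ((goodPoly hs f) %ₘ (lineQuadratic hs f)).natDegree ≤ 1 by omega)
  have hev : ∀ x, transversalPoly hs f x = 0 → goodCond hs f (pVec hs f x) =
      ((goodPoly hs f) %ₘ (lineQuadratic hs f)).coeff 1 * x +
        ((goodPoly hs f) %ₘ (lineQuadratic hs f)).coeff 0 := by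
    intro x hx
    have h3 := congrArg (eval x) (modByMonic_add_div (goodPoly hs f) (lineQuadratic hs f))
    rw [eval_add, eval_mul, eval_lineQuadratic, hx, zero_mul, add_zero, eval_goodPoly] at h3
    rw [← h3, hX]
    simp
  have hc : coeffOne hs f = -(θ + θ') := by rw [h1, neg_neg]
  rw [hev θ (by rw [transversalPoly, ← h2, hc]; ring),
    hev θ' (by rw [transversalPoly, ← h2, hc]; ring), normCond, ← h2, hc]
  ring

/-- The product of all the genericity conditions. -/
noncomputable def genCond : R := staticCond hs f * normCond hs f

lemma map_genCond (φ : R →+* S) : φ (genCond hs f) = genCond hs (mapFrame f φ) := by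
  simp [genCond, map_staticCond, map_normCond]

end Norm

section Generic

variable {k : Type*} [Field k] {b s : ℕ} {hs : 4 ≤ s}
  {e : Fin s → Basis (Fin (4 + b)) k (Fin (4 + b) → k)}

/-- The consequences of the genericity conditions over an algebraically closed field. -/
lemma isTransversal_and_isGoodAt_of_genCond [IsAlgClosed k] (h : genCond hs (frame e) ≠ 0) :
    IsTransversal b hs (frameFlags e) ∧
      ∀ g, IsLineSolution b hs (frameFlags e) g → IsGoodAt b hs (frameFlags e) g := by
  rw [genCond, mul_ne_zero_iff] at h
  obtain ⟨h1, h2⟩ := h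
  have hF := isTransversal_of_staticCond h1
  have hc : coeffTwo hs (frame e) ≠ 0 := by
    simp only [staticCond, mul_ne_zero_iff] at h1
    exact h1.2.1
  obtain ⟨θ, θ', -, hθ1, hθ2, hroots⟩ := exists_two_roots h1
  rw [normCond_eq_mul hs _ hθ1 hθ2, mul_ne_zero_iff] at h2
  refine ⟨hF, fun g hg => ?_⟩
  obtain ⟨x, hx, rfl⟩ := hg.exists_eq_lineSol hF hc
  refine isGoodAt_of_goodCond hF hc hx ?_
  rcases (hroots x).1 hx with rfl | rfl
  · exact h2.1
  · exact h2.2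

/-- If the flags are in general position with two transversals and the bases are chosen suitably,
then the genericity conditions are satisfied. -/
lemma genCond_ne_zero (hF : IsTransversal b hs (frameFlags e))
    {h h' : Submodule k (Fin (4 + b) → k)} (hh : IsLineSolution b hs (frameFlags e) h)
    (hh' : IsLineSolution b hs (frameFlags e) h') (hne : h ≠ h')
    (honly : ∀ g, IsLineSolution b hs (frameFlags e) g → g = h ∨ g = h')
    (hg : IsGoodAt b hs (frameFlags e) h) (hg' : IsGoodAt b hs (frameFlags e) h')
    (hu : firstVec hs (frame e) 0 1 ∉ h) (hu' : firstVec hs (frame e) 0 1 ∉ h')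
    (hv : firstVec hs (frame e) 1 1 ∉ h) (hv' : firstVec hs (frame e) 1 1 ∉ h') :
    ∃ θ θ' : k, θ + θ' = -coeffOne hs (frame e) ∧
      θ * θ' = coeffZero hs (frame e) * coeffTwo hs (frame e) ∧ h = lineSol hs (frame e) θ ∧
      h' = lineSol hs (frame e) θ' ∧ genCond hs (frame e) ≠ 0 := by
  have hu2 : ∀ g, IsLineSolution b hs (frameFlags e) g → firstVec hs (frame e) 0 1 ∉ g := by
    intro g hg
    rcases honly g hg with rfl | rfl <;> assumption
  have h1 := staticCond_ne_zero hF hu2 hh hh' hne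
  have hc := coeffTwo_ne_zero hF hu2
  obtain ⟨θ, hθ, rfl⟩ := hh.exists_eq_lineSol hF hc
  obtain ⟨θ', hθ', rfl⟩ := hh'.exists_eq_lineSol hF hc
  have hθθ : θ ≠ θ' := fun h => hne (by rw [h])
  have e1 : θ + θ' = -coeffOne hs (frame e) := by
    rw [transversalPoly] at hθ hθ'
    have : (θ - θ') * (θ + θ' + coeffOne hs (frame e)) = 0 := by linear_combination hθ - hθ'
    have := (mul_eq_zero.1 this).resolve_left (sub_ne_zero.2 hθθ)
    linear_combination this
  have e2 : θ * θ' = coeffZero hs (frame e) * coeffTwo hs (frame e) := by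
    rw [transversalPoly] at hθ
    have : coeffOne hs (frame e) = -(θ + θ') := by rw [e1, neg_neg]
    rw [this] at hθ
    linear_combination -hθ
  refine ⟨θ, θ', e1, e2, rfl, rfl, ?_⟩
  rw [genCond, normCond_eq_mul hs _ e1 e2]
  exact mul_ne_zero h1 (mul_ne_zero (goodCond_ne_zero hF hc hθ hg hu hv)
    (goodCond_ne_zero hF hc hθ' hg' hu' hv'))

end Generic

/-! ### Adapted bases which avoid the transversals -/

section Adapted

variable {k : Type*} [Field k] {b s : ℕ} {hs : 4 ≤ s}

/-- A vector space over an infinite field is not the union of finitely many proper subspaces. -/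
lemma CompleteFlag.exists_mem_two_notMem {A : Type*} [AddCommGroup A] [Module k A] [Infinite k]
    [FiniteDimensional k A] (F : CompleteFlag k A) (hA : 2 ≤ finrank k A) {h h' : Submodule k A}
    (h1 : ¬ F.space 2 ≤ h) (h2 : ¬ F.space 2 ≤ h') :
    ∃ x ∈ F.space 2, x ∉ F.space 1 ∧ x ∉ h ∧ x ∉ h' := by
  by_contra! hcon
  let p : Fin 3 → Submodule k (F.space 2) := fun i =>
    (![F.space 1, h, h'] i).comap (F.space 2).subtype
  have hcov : ⋃ i, (p i : Set (F.space 2)) = Set.univ := by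
    ext ⟨x, hx⟩
    simp only [Set.mem_iUnion, Set.mem_univ, iff_true]
    by_cases hx1 : x ∈ F.space 1
    · exact ⟨0, hx1⟩
    · by_cases hx2 : x ∈ h
      · exact ⟨1, hx2⟩
      · exact ⟨2, hcon x hx hx1 hx2⟩
  obtain ⟨i, hi⟩ := Subspace.exists_eq_top_of_iUnion_eq_univ hcov
  rw [Submodule.comap_subtype_eq_top] at hi
  fin_cases i
  · have := Submodule.finrank_mono (show F.space 2 ≤ F.space 1 from hi)
    rw [F.finrank_space 1 (by omega), F.finrank_space 2 hA] at this
    omega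
  · exact h1 hi
  · exact h2 hi

/-- Nonvanishing of the polynomial conditions depends on the bases as well as on the flags: it fails
if the second vector of one of the first two bases lies on a transversal. This choice excludes that.
-/
lemma exists_adapted_basis [Infinite k] (hs : 4 ≤ s)
    (F : Fin s → CompleteFlag k (Fin (4 + b) → k))
    {h h' : Submodule k (Fin (4 + b) → k)}
    (hh : ∀ i : Fin 4, i.val < 2 →
      ¬ (F (Fin.castLE hs i)).space 2 ≤ h ∧ ¬ (F (Fin.castLE hs i)).space 2 ≤ h') :
    ∃ e : Fin s → Basis (Fin (4 + b)) k (Fin (4 + b) → k), F = frameFlags e ∧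
      ∀ i : Fin 4, i.val < 2 → firstVec hs (frame e) i 1 ∉ h ∧ firstVec hs (frame e) i 1 ∉ h' := by
  have key : ∀ i : Fin s, ∃ e : Basis (Fin (4 + b)) k (Fin (4 + b) → k),
      F i = CompleteFlag.ofBasis e ∧
      (i.val < 2 → e (Fin.castAdd b 1) ∉ h ∧ e (Fin.castAdd b 1) ∉ h') := by
    intro i
    by_cases hi : i.val < 2
    · obtain ⟨j, rfl, hj⟩ := castLE_cases hs (by omega : i.val < 4)
      obtain ⟨h1, h2⟩ := hh j (by omega)
      obtain ⟨x, hx, hx1, hxh, hxh'⟩ := (F (Fin.castLE hs j)).exists_mem_two_notMem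
        (by simp; omega) h1 h2
      choose v hv hv' using fun q : Fin (4 + b) =>
        (F (Fin.castLE hs j)).exists_mem_notMem (j := q) (by simp)
      obtain ⟨e, he, hF⟩ := (F (Fin.castLE hs j)).exists_eq_ofBasis_of_notMem (by simp)
        (fun q => if q.val = 1 then x else v q)
        (fun q => by
          split_ifs with hq
          · rw [hq]; exact hx
          · exact hv q)
        (fun q => by
          split_ifs with hq
          · rw [hq]; exact hx1
          · exact hv' q)
      refine ⟨e, hF, fun _ => ?_⟩
      have : e (Fin.castAdd b 1) = x := by rw [he]; simp
      rw [this]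
      exact ⟨hxh, hxh'⟩
    · obtain ⟨e, he⟩ := (F i).exists_eq_ofBasis (m := 4 + b) (by simp)
      exact ⟨e, he, fun h => absurd h hi⟩
  choose e he1 he2 using key
  exact ⟨e, funext he1, fun i hi => he2 (Fin.castLE hs i) hi⟩

lemma IsLineSolution.not_le {A : Type*} [AddCommGroup A] [Module k A] [FiniteDimensional k A]
    {F : Fin s → CompleteFlag k A} (hA : finrank k A = 4 + b) (hF : IsTransversal b hs F)
    {h : Submodule k A} (hh : IsLineSolution b hs F h) (i : Fin 4) (hi : i.val < 2) :
    ¬ (F (Fin.castLE hs i)).space 2 ≤ h := by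
  intro hle
  have heq := Submodule.eq_of_le_of_finrank_eq hle
    (by rw [hh.finrank_eq, (F _).finrank_space 2 (by omega)])
  have : i = 0 ∨ i = 1 := by omega
  rcases this with rfl | rfl
  · exact hh.meet2 (heq ▸ hF.disj20.symm)
  · exact hh.meet2 (heq ▸ hF.disj21.symm)

/-- A realization satisfies the genericity conditions in suitable adapted bases. -/
lemma IsRealization.exists_genCond_ne_zero [Infinite k] {Q : Type*} [AddCommGroup Q] [Module k Q]
    {F : Fin s → CompleteFlag k (Fin (4 + b) → k)}
    {Θ : (Fin (4 + b) → k) ≃ₗ[k] (Fin 4 → k) × Q} {E : Fin 4 → CompleteFlag k (Fin 4 → k)}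
    {G : Fin s → CompleteFlag k Q} (hF : IsRealization b hs F Θ E G) :
    ∃ e : Fin s → Basis (Fin (4 + b)) k (Fin (4 + b) → k), F = frameFlags e ∧
      genCond hs (frame e) ≠ 0 := by
  have hA : finrank k (Fin (4 + b) → k) = 4 + b := by simp
  have hT := hF.isTransversal
  have hh := hF.isLineSolution
  have hh' := hF.isLineSolution'
  obtain ⟨e, rfl, he⟩ := exists_adapted_basis hs F fun i hi =>
    ⟨hh.not_le hA hT i hi, hh'.not_le hA hT i hi⟩
  have hne : coordPlane Θ 0 2 ≠ coordPlane Θ 1 3 := by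
    intro h
    have h1 : Θ.symm (Pi.single 0 1, 0) ∈ coordPlane Θ 0 2 :=
      (mem_coordPlane (by decide)).2 ⟨by simp, fun q h1 _ => by simp [h1]⟩
    rw [h, mem_coordPlane (by decide)] at h1
    simpa using h1.2 0 (by decide) (by decide)
  obtain ⟨θ, θ', -, -, -, -, h⟩ := genCond_ne_zero hT hh hh' hne hF.eq_or_eq hF.isGoodAt
    hF.isGoodAt' (he 0 (by decide)).1 (he 0 (by decide)).2 (he 1 (by decide)).1
    (he 1 (by decide)).2
  exact ⟨e, rfl, h⟩

end Adapted

/-! ### Normal form of four lines with two transversals -/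

section NormalForm

variable {k : Type*} [Field k] {s : ℕ} {hs : 4 ≤ s}
  {e : Fin s → Basis (Fin (4 + 0)) k (Fin (4 + 0) → k)}

/-- Four lines in a projective space with two transversals can be brought into normal form. -/
theorem exists_isNormalForm (hF : IsTransversal 0 hs (frameFlags e))
    (hd : Disjoint ((frameFlags e (Fin.castLE hs 2)).space 2)
      ((frameFlags e (Fin.castLE hs 3)).space 2))
    (hc : coeffTwo hs (frame e) ≠ 0)
    {h h' : Submodule k (Fin (4 + 0) → k)} (hh : IsLineSolution 0 hs (frameFlags e) h)
    (hh' : IsLineSolution 0 hs (frameFlags e) h') (hne : h ≠ h')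
    (honly : ∀ g, IsLineSolution 0 hs (frameFlags e) g → g = h ∨ g = h') :
    ∃ (w : Basis (Fin 4) k (Fin (4 + 0) → k)) (t t' : k),
      IsNormalForm (fun i => (frameFlags e (Fin.castLE hs i)).map w.equivFun) t t' ∧
      h = Submodule.span k {w 0, w 2} ∧ h' = Submodule.span k {w 1, w 3} := by
  have hd01 := disj_lines hF
  have hd20 : Disjoint ((frameFlags e (Fin.castLE hs 2)).space 2)
    ((frameFlags e (Fin.castLE hs 0)).space 2) := hF.disj20
  have hd21 : Disjoint ((frameFlags e (Fin.castLE hs 2)).space 2)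
    ((frameFlags e (Fin.castLE hs 1)).space 2) := hF.disj21
  have hd30 : Disjoint ((frameFlags e (Fin.castLE hs 3)).space 2)
    ((frameFlags e (Fin.castLE hs 0)).space 2) := hF.disj30
  have hd31 : Disjoint ((frameFlags e (Fin.castLE hs 3)).space 2)
    ((frameFlags e (Fin.castLE hs 1)).space 2) := hF.disj31
  obtain ⟨θ, hθ, rfl⟩ := hh.exists_eq_lineSol hF hc
  obtain ⟨θ', hθ', rfl⟩ := hh'.exists_eq_lineSol hF hc
  have hθθ : θ - θ' ≠ 0 := sub_ne_zero.2 fun h => hne (by rw [h])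
  have hpl : ∀ θ, pVec hs (frame e) θ ∈ (frameFlags e (Fin.castLE hs 0)).space 2 := pVec_mem
  have hql : ∀ θ, qVec hs (frame e) (pVec hs (frame e) θ) ∈
    (frameFlags e (Fin.castLE hs 1)).space 2 := fun θ =>
      (qVec_mem_and_ne_zero hF (pVec_mem θ) (pVec_ne_zero hc θ)).1
  -- the point of each transversal on a line which is disjoint from the first two
  have key : ∀ (i : Fin 4) (θ : k), Disjoint ((frameFlags e (Fin.castLE hs i)).space 2)
      ((frameFlags e (Fin.castLE hs 0)).space 2) →
      Disjoint ((frameFlags e (Fin.castLE hs i)).space 2)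
        ((frameFlags e (Fin.castLE hs 1)).space 2) →
      ¬ Disjoint (lineSol hs (frame e) θ) ((frameFlags e (Fin.castLE hs i)).space 2) →
      ∃ c : k, c ≠ 0 ∧ pVec hs (frame e) θ + c • qVec hs (frame e) (pVec hs (frame e) θ) ∈
        (frameFlags e (Fin.castLE hs i)).space 2 := by
    intro i θ h0 h1 hm
    obtain ⟨x, ⟨hxh, hx⟩, hx0⟩ := Submodule.exists_mem_ne_zero_of_ne_bot
      (fun e => hm (disjoint_iff.2 e))
    obtain ⟨α, β, rfl⟩ := Submodule.mem_span_pair.1 hxh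
    have hα : α ≠ 0 := by
      rintro rfl
      refine hx0 (Submodule.disjoint_def.1 h1 _ hx ?_)
      rw [zero_smul, zero_add]
      exact Submodule.smul_mem _ _ (hql θ)
    have hβ : β ≠ 0 := by
      rintro rfl
      refine hx0 (Submodule.disjoint_def.1 h0 _ hx ?_)
      rw [zero_smul, add_zero (α • pVec hs (frame e) θ)]
      exact Submodule.smul_mem _ _ (hpl θ)
    refine ⟨α⁻¹ * β, mul_ne_zero (inv_ne_zero hα) hβ, ?_⟩
    have := Submodule.smul_mem _ α⁻¹ hx
    rwa [smul_add, smul_smul, smul_smul, inv_mul_cancel₀ hα, one_smul] at this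
  obtain ⟨c, hc0, hc2⟩ := key 2 θ hd20 hd21 hh.meet2
  obtain ⟨c', hc0', hc2'⟩ := key 2 θ' hd20 hd21 hh'.meet2
  obtain ⟨d, hd0, hd3⟩ := key 3 θ hd30 hd31 hh.meet3
  obtain ⟨d', hd0', hd3'⟩ := key 3 θ' hd30 hd31 hh'.meet3
  have hpind : ∀ α β : k, α • pVec hs (frame e) θ + β • pVec hs (frame e) θ' = 0 →
      α = 0 ∧ β = 0 := by
    intro α β h0
    have h1 : ((α + β) * coeffTwo hs (frame e)) • firstVec hs (frame e) 0 0 +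
        (α * θ + β * θ') • firstVec hs (frame e) 0 1 = 0 := by
      rw [← h0, pVec, pVec]
      module
    obtain ⟨h2, h3⟩ := eq_zero_of_firstVec 0 h1
    have h4 := (mul_eq_zero.1 h2).resolve_right hc
    have h5 : α * (θ - θ') = 0 := by linear_combination h3 - θ' * h4
    have h6 := (mul_eq_zero.1 h5).resolve_right hθθ
    exact ⟨h6, by rwa [h6, zero_add] at h4⟩
  have hqlin : ∀ α β : k, qVec hs (frame e) (α • pVec hs (frame e) θ + β • pVec hs (frame e) θ') =
      α • qVec hs (frame e) (pVec hs (frame e) θ) +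
        β • qVec hs (frame e) (pVec hs (frame e) θ') := by
    intro α β
    simp only [qVec, etaA, pairForm, map_add, map_smul, smul_eq_mul]
    module
  have hqind : ∀ α β : k, α • qVec hs (frame e) (pVec hs (frame e) θ) +
      β • qVec hs (frame e) (pVec hs (frame e) θ') = 0 → α = 0 ∧ β = 0 := by
    intro α β h0
    rw [← hqlin] at h0
    by_contra hcon
    exact (qVec_mem_and_ne_zero hF (Submodule.add_mem _ (Submodule.smul_mem _ _ (hpl θ))
      (Submodule.smul_mem _ _ (hpl θ'))) fun h => hcon (hpind α β h)).2 h0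
  set p := pVec hs (frame e) θ
  set p' := pVec hs (frame e) θ'
  -- Scaling the points of the second line puts p + q and p' + q' on the third line, making it the
  -- graph of the identity.
  set q := c • qVec hs (frame e) p with hq
  set q' := c' • qVec hs (frame e) p' with hq'
  have hqL : q ∈ (frameFlags e (Fin.castLE hs 1)).space 2 := Submodule.smul_mem _ _ (hql θ)
  have hqL' : q' ∈ (frameFlags e (Fin.castLE hs 1)).space 2 := Submodule.smul_mem _ _ (hql θ')
  have hqind' : ∀ α β : k, α • q + β • q' = 0 → α = 0 ∧ β = 0 := by
    intro α β h0
    rw [hq, hq', smul_smul, smul_smul] at h0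
    obtain ⟨h1, h2⟩ := hqind _ _ h0
    exact ⟨(mul_eq_zero.1 h1).resolve_right hc0, (mul_eq_zero.1 h2).resolve_right hc0'⟩
  have hdq : p + (c⁻¹ * d) • q ∈ (frameFlags e (Fin.castLE hs 3)).space 2 := by
    rw [hq, smul_smul, mul_right_comm, inv_mul_cancel₀ hc0, one_mul]
    exact hd3
  have hdq' : p' + (c'⁻¹ * d') • q' ∈ (frameFlags e (Fin.castLE hs 3)).space 2 := by
    rw [hq', smul_smul, mul_right_comm, inv_mul_cancel₀ hc0', one_mul]
    exact hd3'
  have ht0 : c⁻¹ * d ≠ 0 := mul_ne_zero (inv_ne_zero hc0) hd0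
  have ht0' : c'⁻¹ * d' ≠ 0 := mul_ne_zero (inv_ne_zero hc0') hd0'
  -- After the scaling, p + t q and p' + t' q' are on the fourth line.
  set t := c⁻¹ * d
  set t' := c'⁻¹ * d'
  have hli : LinearIndependent k ![p, p', q, q'] := by
    rw [Fintype.linearIndependent_iff]
    intro g hg
    simp only [Fin.sum_univ_four, Matrix.cons_val] at hg
    have h1 : g 0 • p + g 1 • p' = 0 := by
      refine Submodule.disjoint_def.1 hd01 _ (Submodule.add_mem _ (Submodule.smul_mem _ _ (hpl θ))
        (Submodule.smul_mem _ _ (hpl θ'))) ?_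
      have : g 0 • p + g 1 • p' = -(g 2 • q + g 3 • q') := by
        rw [eq_neg_iff_add_eq_zero, ← hg]; abel
      rw [this]
      exact Submodule.neg_mem _ (Submodule.add_mem _ (Submodule.smul_mem _ _ hqL)
        (Submodule.smul_mem _ _ hqL'))
    rw [h1, zero_add] at hg
    obtain ⟨h2, h3⟩ := hpind _ _ h1
    obtain ⟨h4, h5⟩ := hqind' _ _ hg
    intro i
    fin_cases i <;> assumption
  let w := basisOfLinearIndependentOfCardEqFinrank hli (by simp)
  have hw : ⇑w = ![p, p', q, q'] := coe_basisOfLinearIndependentOfCardEqFinrank _ _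
  have hws : ∀ x : Fin 4 → k, w.equivFun.symm x = x 0 • p + x 1 • p' + (x 2 • q + x 3 • q') := by
    intro x
    rw [Basis.equivFun_symm_apply, hw, Fin.sum_univ_four]
    simp only [Matrix.cons_val]
    abel
  have hpx : ∀ x : Fin 4 → k, x 0 • p + x 1 • p' ∈ (frameFlags e (Fin.castLE hs 0)).space 2 :=
    fun x => Submodule.add_mem _ (Submodule.smul_mem _ _ (hpl θ)) (Submodule.smul_mem _ _ (hpl θ'))
  have hqx : ∀ α β : k, α • q + β • q' ∈ (frameFlags e (Fin.castLE hs 1)).space 2 :=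
    fun α β => Submodule.add_mem _ (Submodule.smul_mem _ _ hqL) (Submodule.smul_mem _ _ hqL')
  have hgraph : ∀ (i : Fin 4) (α β : k), Disjoint ((frameFlags e (Fin.castLE hs i)).space 2)
      ((frameFlags e (Fin.castLE hs 1)).space 2) →
      p + α • q ∈ (frameFlags e (Fin.castLE hs i)).space 2 →
      p' + β • q' ∈ (frameFlags e (Fin.castLE hs i)).space 2 → ∀ x : Fin 4 → k,
      w.equivFun.symm x ∈ (frameFlags e (Fin.castLE hs i)).space 2 ↔
        x 2 = α * x 0 ∧ x 3 = β * x 1 := by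
    intro i α β hdi h1 h2 x
    have h3 : x 0 • (p + α • q) + x 1 • (p' + β • q') ∈
        (frameFlags e (Fin.castLE hs i)).space 2 :=
      Submodule.add_mem _ (Submodule.smul_mem _ _ h1) (Submodule.smul_mem _ _ h2)
    have h4 : w.equivFun.symm x = (x 0 • (p + α • q) + x 1 • (p' + β • q')) +
        ((x 2 - α * x 0) • q + (x 3 - β * x 1) • q') := by
      rw [hws]; module
    rw [h4, Submodule.add_mem_iff_right _ h3]
    constructor
    · intro h5
      obtain ⟨h6, h7⟩ := hqind' _ _ (Submodule.disjoint_def.1 hdi _ h5 (hqx _ _))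
      exact ⟨sub_eq_zero.1 h6, sub_eq_zero.1 h7⟩
    · rintro ⟨h6, h7⟩
      rw [h6, h7]; simp
  -- With parameter 1 the third and fourth lines would share a point.
  have ht1 : ∀ (x y : Fin (4 + 0) → k) (r : k), x ∈ (frameFlags e (Fin.castLE hs 0)).space 2 →
      y ∈ (frameFlags e (Fin.castLE hs 1)).space 2 →
      x + y ∈ (frameFlags e (Fin.castLE hs 2)).space 2 →
      x + r • y ∈ (frameFlags e (Fin.castLE hs 3)).space 2 → x ≠ 0 → r ≠ 1 := by
    rintro x y r hx hy h2 h3 hx0 rfl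
    rw [one_smul] at h3
    have h4 := Submodule.disjoint_def.1 hd _ h2 h3
    refine hx0 (Submodule.disjoint_def.1 hd01 _ hx ?_)
    rw [eq_neg_of_add_eq_zero_left h4]
    exact Submodule.neg_mem _ hy
  have hp0 : p ≠ 0 := pVec_ne_zero hc θ
  have hp0' : p' ≠ 0 := pVec_ne_zero hc θ'
  have hspan : ∀ {x y : Fin (4 + 0) → k} {r : k}, r ≠ 0 →
      Submodule.span k {x, r • y} = Submodule.span k {x, y} := by
    intro x y r hr
    rw [Submodule.span_insert, Submodule.span_insert (x := x) (s := {y}),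
      Submodule.span_singleton_smul_eq (isUnit_iff_ne_zero.2 hr)]
  have hhq : lineSol hs (frame e) θ = Submodule.span k {p, q} := (hspan hc0).symm
  have hhq' : lineSol hs (frame e) θ' = Submodule.span k {p', q'} := (hspan hc0').symm
  refine ⟨w, t, t', ⟨fun x => ?_, fun x => ?_, fun x => ?_, fun x => ?_, ?_, ht0,
    ht1 p q t (hpl θ) hqL hc2 hdq hp0, ht0', ht1 p' q' t' (hpl θ') hqL' hc2' hdq' hp0'⟩, ?_, ?_⟩
  · rw [CompleteFlag.mem_map_space, hws, Submodule.add_mem_iff_right _ (hpx x)]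
    constructor
    · intro h5
      exact hqind' _ _ (Submodule.disjoint_def.1 hd01 _ h5 (hqx _ _))
    · rintro ⟨h6, h7⟩
      rw [h6, h7]; simp
  · rw [CompleteFlag.mem_map_space, hws, Submodule.add_mem_iff_left _ (hqx _ _)]
    constructor
    · intro h5
      exact hpind _ _ (Submodule.disjoint_def.1 hd01 _ (hpx x) h5)
    · rintro ⟨h6, h7⟩
      rw [h6, h7]; simp
  · rw [CompleteFlag.mem_map_space, hgraph 2 1 1 hd21 (by rwa [one_smul]) (by rwa [one_smul]),
      one_mul, one_mul]
  · rw [CompleteFlag.mem_map_space, hgraph 3 t t' hd31 hdq hdq']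
  -- If t = t', the plane spanned by p + p' and q + q' would be a third transversal.
  · intro htt
    have hne0 : p + p' ≠ 0 := fun h => by
      have := hpind 1 1 (by simpa using h)
      exact one_ne_zero this.1
    have hne1 : q + q' ≠ 0 := fun h => by
      have := hqind' 1 1 (by simpa using h)
      exact one_ne_zero this.1
    have hli2 : LinearIndependent k ![p + p', q + q'] := by
      rw [LinearIndependent.pair_iff]
      intro α β h0
      have h1 : α • (p + p') = 0 := Submodule.disjoint_def.1 hd01 _
        (Submodule.smul_mem _ _ (Submodule.add_mem _ (hpl θ) (hpl θ'))) (by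
          rw [eq_neg_of_add_eq_zero_left h0]
          exact Submodule.neg_mem _ (Submodule.smul_mem _ _ (Submodule.add_mem _ hqL hqL')))
      rw [h1, zero_add] at h0
      exact ⟨(smul_eq_zero.1 h1).resolve_right hne0, (smul_eq_zero.1 h0).resolve_right hne1⟩
    have hmp : p + p' ∈ Submodule.span k {p + p', q + q'} := Submodule.subset_span (by simp)
    have hmq : q + q' ∈ Submodule.span k {p + p', q + q'} := Submodule.subset_span (by simp)
    have hcomb : ∀ r : k, (p + p') + r • (q + q') = (p + r • q) + (p' + r • q') := by
      intro r; module
    have hnz : ∀ r : k, (p + p') + r • (q + q') ≠ 0 := by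
      intro r h0
      have := LinearIndependent.pair_iff.1 hli2 1 r (by rwa [one_smul])
      exact one_ne_zero this.1
    have hsol : IsLineSolution 0 hs (frameFlags e) (Submodule.span k {p + p', q + q'}) := by
      refine ⟨?_, ?_, ?_, ?_, ?_, ?_⟩
      · rw [Submodule.span_le]
        rintro z (rfl | rfl)
        · exact (le_sup_left : _ ≤ lineSpan hs (frameFlags e))
            (Submodule.add_mem _ (hpl θ) (hpl θ'))
        · exact (le_sup_right : _ ≤ lineSpan hs (frameFlags e)) (Submodule.add_mem _ hqL hqL')
      · have := finrank_span_eq_card hli2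
        rwa [Matrix.range_cons, Matrix.range_cons, Matrix.range_empty, Set.union_empty,
          Set.singleton_union, Fintype.card_fin] at this
      · exact fun h => hne0 (Submodule.disjoint_def.1 h _ hmp (Submodule.add_mem _ (hpl θ) (hpl θ')))
      · exact fun h => hne1 (Submodule.disjoint_def.1 h _ hmq (Submodule.add_mem _ hqL hqL'))
      · refine fun h => hnz 1 (Submodule.disjoint_def.1 h _
          (Submodule.add_mem _ hmp (Submodule.smul_mem _ _ hmq)) ?_)
        rw [hcomb, one_smul, one_smul]
        exact Submodule.add_mem _ hc2 hc2'
      · refine fun h => hnz t (Submodule.disjoint_def.1 h _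
          (Submodule.add_mem _ hmp (Submodule.smul_mem _ _ hmq)) ?_)
        rw [hcomb]
        exact Submodule.add_mem _ hdq (htt ▸ hdq')
    have hcontra : ∀ α β γ δ : k, α • p + β • p' + (γ • q + δ • q') = 0 → α = 0 ∧ β = 0 := by
      intro α β γ δ h0
      have := Fintype.linearIndependent_iff.1 hli ![α, β, γ, δ] (by
        simp only [Fin.sum_univ_four, Matrix.cons_val]
        rw [← h0]; abel)
      exact ⟨this 0, this 1⟩
    rcases honly _ hsol with h1 | h1
    · rw [h1, hhq] at hmp
      obtain ⟨α, β, h2⟩ := Submodule.mem_span_pair.1 hmp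
      have h3 := hcontra (α - 1) (-1) β 0 (by
        have : (α - 1) • p + (-1 : k) • p' + (β • q + (0 : k) • q') =
          (α • p + β • q) - (p + p') := by module
        rw [this, h2, sub_self])
      exact one_ne_zero (neg_eq_zero.1 h3.2)
    · rw [h1, hhq'] at hmp
      obtain ⟨α, β, h2⟩ := Submodule.mem_span_pair.1 hmp
      have h3 := hcontra (-1) (α - 1) 0 β (by
        have : (-1 : k) • p + (α - 1) • p' + ((0 : k) • q + β • q') =
          (α • p' + β • q') - (p + p') := by module
        rw [this, h2, sub_self])
      exact one_ne_zero (neg_eq_zero.1 h3.1)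
  · rw [hhq, hw]
    rfl
  · rw [hhq', hw]
    rfl

end NormalForm

/-! ### The datum attached to flags in general position -/

section Datum

variable {K A : Type*} [Field K] [AddCommGroup A] [Module K A] {a b s : ℕ} {hs : 4 ≤ s}
  {F : Fin s → CompleteFlag K A} {ν : Fin s → ℕ → ℕ}

/-- The datum `D` is attached to the flags `F`. -/
structure IsDatumOf (b : ℕ) (hs : 4 ≤ s) (F : Fin s → CompleteFlag K A)
    (D : FibrationDatum K A 4 s) : Prop where
  sub_eq : D.sub = lineSpan hs F
  E_eq : ∀ i, ∀ j ≤ 4, (D.E i).space j =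
    ((F (Fin.castLE hs i)).space (lineIdx b i j)).comap D.sub.subtype
  G_eq : ∀ g : Submodule K D.sub, IsLineSolution b hs F (g.map D.sub.subtype) →
    ∀ i, IsInducedFlag b hs F D.sub.mkQ (g.map D.sub.subtype) i (D.G g i)

variable [FiniteDimensional K A] (hA : finrank K A = 4 + b)
include hA

/-- The members up to index 2 of the first two flags lie in the span, and those up to b + 2 add
nothing. For the other two flags the member of index b meets the span trivially. From there the
dimension must reach its full value in the remaining steps, each adding at most one. -/
lemma IsTransversal.finrank_lineIdx (hF : IsTransversal b hs F) (i : Fin 4) {j : ℕ} (hj : j ≤ 4) :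
    finrank K ↥((F (Fin.castLE hs i)).space (lineIdx b i j) ⊓ lineSpan hs F) = j := by
  have hV := hF.finrank_lineSpan hA
  have htop : finrank K ↥((F (Fin.castLE hs i)).space (b + 4) ⊓ lineSpan hs F) = 4 := by
    rw [(F _).space_top (by omega), top_inf_eq, hV]
  by_cases hi : i.val < 2
  · have hi' : i = 0 ∨ i = 1 := by omega
    have hle : (F (Fin.castLE hs i)).space 2 ≤ lineSpan hs F := by
      rcases hi' with rfl | rfl
      · exact le_sup_left
      · exact le_sup_right
    by_cases hj2 : j ≤ 2
    · rw [lineIdx, if_pos ⟨hi, hj2⟩, inf_eq_left.2 (((F _).mono hj2).trans hle),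
        (F _).finrank_space _ (by omega)]
    · rw [lineIdx, if_neg (by omega)]
      have h2 : finrank K ↥((F (Fin.castLE hs i)).space (b + 2) ⊓ lineSpan hs F) ≤ 2 := by
        have : (F (Fin.castLE hs i)).space (b + 2) ⊓ lineSpan hs F ≤
            (F (Fin.castLE hs i)).space 2 := by
          rcases hi' with rfl | rfl
          · exact hF.inf_lineSpan_zero
          · exact hF.inf_lineSpan_one
        exact (Submodule.finrank_mono this).trans ((F _).finrank_space 2 (by omega)).le
      have h3 := (F (Fin.castLE hs i)).finrank_inf_add_le (lineSpan hs F) (b + 2) (j - 2) (by omega)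
      have h4 := (F (Fin.castLE hs i)).finrank_inf_add_le (lineSpan hs F) (b + j) (4 - j) (by omega)
      rw [show b + 2 + (j - 2) = b + j by omega] at h3
      rw [show b + j + (4 - j) = b + 4 by omega, htop] at h4
      omega
  · have hi' : i = 2 ∨ i = 3 := by omega
    rw [lineIdx, if_neg (by omega)]
    have h2 : finrank K ↥((F (Fin.castLE hs i)).space b ⊓ lineSpan hs F) = 0 := by
      have : Disjoint ((F (Fin.castLE hs i)).space b) (lineSpan hs F) := by
        rcases hi' with rfl | rfl
        · exact hF.disjSpan2
        · exact hF.disjSpan3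
      rw [disjoint_iff.1 this, finrank_bot]
    have h3 := (F (Fin.castLE hs i)).finrank_inf_add_le (lineSpan hs F) b j (by omega)
    have h4 := (F (Fin.castLE hs i)).finrank_inf_add_le (lineSpan hs F) (b + j) (4 - j) (by omega)
    rw [show b + j + (4 - j) = b + 4 by omega, htop] at h4
    omega

omit hA [FiniteDimensional K A] in
lemma finrank_comap_subtype (V S : Submodule K A) :
    finrank K ↥(S.comap V.subtype) = finrank K ↥(S ⊓ V) := by
  rw [LinearEquiv.finrank_eq (Submodule.equivMapOfInjective V.subtype V.subtype_injective
    (S.comap V.subtype)), Submodule.map_comap_subtype, inf_comm]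

/-- The flags cut out in the span of the first two lines. -/
noncomputable def IsTransversal.lineFlag (hF : IsTransversal b hs F) (i : Fin 4) :
    CompleteFlag K (lineSpan hs F) where
  space j := ((F (Fin.castLE hs i)).space (lineIdx b i j)).comap (lineSpan hs F).subtype
  mono j j' h := Submodule.comap_mono ((F _).mono (lineIdx_mono b i h))
  finrank_space j hj := by
    rw [hF.finrank_lineSpan hA] at hj
    rw [finrank_comap_subtype, hF.finrank_lineIdx hA i hj]

omit hA [FiniteDimensional K A] in
lemma finrank_quotient_eq [FiniteDimensional K A] (hA : finrank K A = 4 + b)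
    {V : Submodule K A} (hV : finrank K V = 4) :
    finrank K (A ⧸ V) = b := by
  have := V.finrank_quotient_add_finrank
  omega

lemma exists_isDatumOf (hF : IsTransversal b hs F)
    (hg : ∀ h, IsLineSolution b hs F h → IsGoodAt b hs F h) :
    ∃ D, IsDatumOf b hs F D := by
  classical
  have key : ∀ (g : Submodule K (lineSpan hs F)) (i : Fin s), ∃ G : CompleteFlag K (A ⧸ lineSpan hs F),
      IsLineSolution b hs F (g.map (lineSpan hs F).subtype) →
      IsInducedFlag b hs F (lineSpan hs F).mkQ (g.map (lineSpan hs F).subtype) i G := by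
    intro g i
    by_cases h : IsLineSolution b hs F (g.map (lineSpan hs F).subtype)
    · obtain ⟨G, hG⟩ := exists_isInducedFlag (Submodule.ker_mkQ _) hA
        (finrank_quotient_eq hA (hF.finrank_lineSpan hA)) hF h (hg _ h) i
      exact ⟨G, fun _ => hG⟩
    -- Away from the solutions the flags in the quotient are irrelevant.
    · exact ⟨Classical.arbitrary _, fun h' => absurd h' h⟩
  choose G hG using key
  exact ⟨⟨lineSpan hs F, hF.lineFlag hA, G⟩, rfl, fun i j hj => rfl, fun g hg i => hG g i hg⟩

/-- The second condition of the partition (1) in Gr(2, 4) is vacuous and the first asks that g meet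
the two-dimensional member, which is cut out by the member of the big flag with index `lineIdx b i
2`. -/
lemma mem_fourLines_iff {D : FibrationDatum K A 4 s} (hF : IsTransversal b hs F)
    (hD : IsDatumOf b hs F D) {g : Submodule K D.sub} :
    g ∈ schubertInstance 2 fourLines D.E ↔ IsLineSolution b hs F (g.map D.sub.subtype) := by
  have hV : finrank K D.sub = 4 := by rw [hD.sub_eq, hF.finrank_lineSpan hA]
  have hfr : finrank K ↥(g.map D.sub.subtype) = finrank K g :=
    (LinearEquiv.finrank_eq (Submodule.equivMapOfInjective D.sub.subtype
      D.sub.subtype_injective g)).symm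
  have hdis : ∀ i : Fin 4, Disjoint g ((D.E i).space 2) ↔ Disjoint (g.map D.sub.subtype)
      ((F (Fin.castLE hs i)).space (lineIdx b i 2)) := by
    intro i
    rw [hD.E_eq i 2 (by omega), disjoint_iff, disjoint_iff,
      Submodule.map_inf_eq_map_inf_comap]
    rw [← Submodule.map_bot D.sub.subtype,
      (Submodule.map_injective_of_injective D.sub.subtype_injective).eq_iff]
  have hvar : ∀ i : Fin 4, g ∈ schubertVariety 2 (fourLines i) (D.E i) ↔
      finrank K g = 2 ∧ ¬ Disjoint g ((D.E i).space 2) := by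
    intro i
    rw [mem_schubertVariety_iff_sdim hV]
    have h4 : (D.E i).space (4 - 2 + (1 + 1) - fourLines i 1) = ⊤ :=
      (D.E i).space_top (by simp [fourLines, onePow, hV])
    have h2 : 4 - 2 + (0 + 1) - fourLines i 0 = 2 := by simp [fourLines, onePow]
    constructor
    · rintro ⟨h1, h⟩
      have := h 0 (by omega)
      rw [h2] at this
      exact ⟨h1, not_disjoint_of_one_le this⟩
    · rintro ⟨h1, h⟩
      refine ⟨h1, fun j hj => ?_⟩
      have : j = 0 ∨ j = 1 := by omega
      rcases this with rfl | rfl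
      · rw [h2]
        exact one_le_finrank_inf h
      · rw [h4, inf_top_eq]
        exact h1.ge
  constructor
  · rintro ⟨h1, h⟩
    have h' := fun i => mt (hdis i).2 ((hvar i).1 (h i)).2
    exact ⟨hD.sub_eq ▸ Submodule.map_subtype_le _ _, hfr.trans h1, h' 0, h' 1, h' 2, h' 3⟩
  · intro h
    have h1 : finrank K g = 2 := hfr.symm.trans h.finrank_eq
    refine ⟨h1, fun i => (hvar i).2 ⟨h1, mt (hdis i).1 ?_⟩⟩
    fin_cases i
    · exact h.meet0
    · exact h.meet1
    · exact h.meet2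
    · exact h.meet3

/-- Injectivity holds because H is recovered from h and its image inside the hull; surjectivity
because the preimage in the hull of a solution in the quotient solves the big problem. -/
theorem IsDatumOf.exhibits {D : FibrationDatum K A 4 s} (hab : a < b)
    (hν : ∀ i, IsPartitionFor a b (ν i)) (hF : IsTransversal b hs F)
    (hg : ∀ h, IsLineSolution b hs F h → IsGoodAt b hs F h) (hD : IsDatumOf b hs F D) :
    D.Exhibits 2 4 a (firstFamily a b ν) fourLines ν F := by
  have hV : finrank K D.sub = 4 := by rw [hD.sub_eq, hF.finrank_lineSpan hA]
  have hQ := finrank_quotient_eq hA hV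
  have hker : LinearMap.ker D.sub.mkQ = lineSpan hs F := by rw [Submodule.ker_mkQ, hD.sub_eq]
  have hinf : ∀ H : Submodule K A, (H.comap D.sub.subtype).map D.sub.subtype =
      H ⊓ lineSpan hs F := fun H => by
    rw [Submodule.map_comap_subtype, inf_comm, hD.sub_eq]
  have h1 : ∀ H ∈ schubertInstance (2 + a) (firstFamily a b ν) F,
      (splitAlong D.sub H).1 ∈ schubertInstance 2 fourLines D.E := by
    intro H hH
    rw [mem_fourLines_iff hA hF hD]
    change IsLineSolution b hs F ((H.comap D.sub.subtype).map D.sub.subtype)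
    rw [hinf]
    exact (isLineSolution_of_mem hab hA hν hF hg hH).1
  have h2 : ∀ H ∈ schubertInstance (2 + a) (firstFamily a b ν) F,
      (splitAlong D.sub H).2 ∈ schubertInstance a ν (D.G (splitAlong D.sub H).1) := by
    intro H hH
    refine map_mem_schubertInstance hker hab hA hQ hν hF hg hH fun i => ?_
    have := hD.G_eq _ ((mem_fourLines_iff hA hF hD).1 (h1 H hH)) i
    rwa [show ((splitAlong D.sub H).1).map D.sub.subtype = H ⊓ lineSpan hs F from hinf H] at this
  refine ⟨hV, h1, h2, fun H hH => ⟨h1 H hH, h2 H hH⟩, fun H hH H' hH' heq => ?_, ?_⟩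
  · have e1 : H ⊓ lineSpan hs F = H' ⊓ lineSpan hs F := by
      rw [← hinf, ← hinf]
      exact congrArg (fun q => q.1.map D.sub.subtype) heq
    have e2 : H.map D.sub.mkQ = H'.map D.sub.mkQ := congrArg Prod.snd heq
    obtain ⟨l1, l2⟩ := isLineSolution_of_mem hab hA hν hF hg hH
    obtain ⟨l1', l2'⟩ := isLineSolution_of_mem hab hA hν hF hg hH'
    rw [← inf_hull_eq_of_map_eq hker l1 (hg _ l1) rfl l2,
      ← inf_hull_eq_of_map_eq hker l1' (hg _ l1') rfl l2', e1, e2]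
  · rintro ⟨g, S⟩ ⟨hgE, hS⟩
    have hsol := (mem_fourLines_iff hA hF hD).1 hgE
    refine ⟨S.comap D.sub.mkQ ⊓ hull b hs F (g.map D.sub.subtype),
      comap_inf_hull_mem_schubertInstance hker hab hA hQ hν hF hsol (hg _ hsol)
        (hD.G_eq g hsol) hS, Prod.ext ?_ ?_⟩
    · apply Submodule.map_injective_of_injective D.sub.subtype_injective
      exact (hinf _).trans (comap_inf_hull_inf hker hsol (hg _ hsol) S)
    · exact map_comap_inf_hull hker hA hQ hF hsol (hg _ hsol) S

end Datum

/-! ### The fibration over the problem of four lines -/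

section Fibration

variable {a b s : ℕ} {hs : 4 ≤ s} {ν : Fin s → ℕ → ℕ}

/-- The open set of instances over which the fibration is defined. -/
def genericSet (b : ℕ) (hs : 4 ≤ s) : Set (Fin s → CompleteFlag ℂ (Fin (4 + b) → ℂ)) :=
  {F | ∃ e : Fin s → Basis (Fin (4 + b)) ℂ (Fin (4 + b) → ℂ),
    F = frameFlags e ∧ genCond hs (frame e) ≠ 0}

/-- `genCond` is one formula over all commutative rings, compatible with homomorphisms. -/
lemma isZariskiOpen_genericSet : IsZariskiOpen (genericSet b hs) :=
  isZariskiOpen_of_natural (LinearEquiv.refl ℂ (Fin (4 + b) → ℂ)) (fun _ _ f => genCond hs f)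
    fun _ _ _ _ φ f => map_genCond hs f φ

lemma isTransversal_of_mem_genericSet {F : Fin s → CompleteFlag ℂ (Fin (4 + b) → ℂ)}
    (hF : F ∈ genericSet b hs) : IsTransversal b hs F ∧
      ∀ g, IsLineSolution b hs F g → IsGoodAt b hs F g := by
  obtain ⟨e, rfl, he⟩ := hF
  exact isTransversal_and_isGoodAt_of_genCond he

/-- Explicit flags in normal form. -/
lemma isNormalForm_explicit {k : Type*} [Field k] [CharZero k] :
    IsNormalForm ![stdFlag k, oppFlag k, graphFlag 1 0 0 1, graphFlag 2 0 0 3] 2 3 := by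
  refine ⟨fun x => ?_, fun x => ?_, fun x => ?_, fun x => ?_, ?_, ?_, ?_, ?_, ?_⟩
  · exact mem_stdFlag
  · exact mem_oppFlag
  · change x ∈ (graphFlag 1 0 0 1).space 2 ↔ _
    rw [mem_graphFlag]; simp
  · change x ∈ (graphFlag 2 0 0 3).space 2 ↔ _
    rw [mem_graphFlag]; simp
  all_goals norm_num

/-- The realization of any four lines in normal form with arbitrary flags in the quotient is in
general position. -/
lemma genericSet_nonempty (hb : 0 < b) : (genericSet b hs).Nonempty := by
  let Θ : (Fin (4 + b) → ℂ) ≃ₗ[ℂ] (Fin 4 → ℂ) × (Fin b → ℂ) :=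
    LinearEquiv.ofFinrankEq _ _ (by simp)
  obtain ⟨F, hF⟩ := exists_isRealization (A := Fin (4 + b) → ℂ) (Q := Fin b → ℂ) hs hb (by simp)
    (isNormalForm_explicit (k := ℂ)) (fun _ => Classical.arbitrary (CompleteFlag ℂ (Fin b → ℂ)))
  obtain ⟨e, he⟩ := (hF Θ).exists_genCond_ne_zero
  exact ⟨_, e, he⟩

/-- The genericity conditions on an instance of the problem of four lines. -/
noncomputable def linesCond {R : Type*} [CommRing R]
    (f : Fin 4 → Fin (4 + 0) → Fin (4 + 0) → R) : R :=
  staticCond (le_refl 4) f *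
    pairForm (f (Fin.castLE (le_refl 4) 2)) (firstVec (le_refl 4) f 3 0) (firstVec (le_refl 4) f 3 1)

lemma map_linesCond {R S : Type*} [CommRing R] [CommRing S] (φ : R →+* S)
    (f : Fin 4 → Fin (4 + 0) → Fin (4 + 0) → R) :
    φ (linesCond f) = linesCond (mapFrame f φ) := by
  rw [linesCond, map_mul, map_staticCond, map_pairForm]
  rfl

variable {k : Type*} [Field k]

/-- The problem of four lines itself is treated as the case b = 0, in which the quotient is trivial
and no shear is needed; the test lines have parameters 2 and 3. -/
lemma exists_linesCond_ne_zero [CharZero k] :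
    ∃ e : Fin 4 → Basis (Fin (4 + 0)) k (Fin (4 + 0) → k), linesCond (frame e) ≠ 0 := by
  have hE := isNormalForm_explicit (k := k)
  let Θ : (Fin (4 + 0) → k) ≃ₗ[k] (Fin 4 → k) × (Fin 0 → k) :=
    LinearEquiv.ofFinrankEq _ _ (by simp)
  have hQ : finrank k (Fin 0 → k) = 0 := by simp
  have hA : finrank k (Fin (4 + 0) → k) = 4 + 0 := by simp
  let G : Fin 4 → CompleteFlag k (Fin 0 → k) := fun _ => Classical.arbitrary _
  obtain ⟨h01, h20, h21, h30, h31⟩ := hE.disjoint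
  have hT : IsTransversal 0 (le_refl 4) (assembleAt Θ ![stdFlag k, oppFlag k, graphFlag 1 0 0 1, graphFlag 2 0 0 3] G 0 0) :=
    isTransversal_assembleAt hQ h01 h20 h21 h30 h31
  have hh := isLineSolution_coordPlane (Θ := Θ) (G := G) (β := 0) (w := 0) (hs := le_refl 4)
    (a := 0) (c := 2) hQ hE (Or.inl ⟨rfl, rfl⟩)
  have hh' := isLineSolution_coordPlane (Θ := Θ) (G := G) (β := 0) (w := 0) (hs := le_refl 4)
    (a := 1) (c := 3) hQ hE (Or.inr ⟨rfl, rfl⟩)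
  have honly := fun g hg => eq_coordPlane_or (Θ := Θ) (G := G) (β := 0) (w := 0) (hs := le_refl 4)
    hQ hE (h := g) hg
  have hd : Disjoint ((assembleAt Θ ![stdFlag k, oppFlag k, graphFlag 1 0 0 1, graphFlag 2 0 0 3] G 0 0 (Fin.castLE (le_refl 4) 2)).space (0 + 2))
      ((assembleAt Θ ![stdFlag k, oppFlag k, graphFlag 1 0 0 1, graphFlag 2 0 0 3] G 0 0 (Fin.castLE (le_refl 4) 3)).space 2) := by
    rw [Submodule.disjoint_def]
    intro x hx hx'
    have hx3 := (mem_assembleAt_add_two (b := 0) hQ).1 hx'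
    rw [mem_assembleAt_add_two (b := 0) hQ, hE.mem_two] at hx
    rw [hE.mem_three] at hx3
    simp only [Pi.zero_apply, LinearMap.zero_apply, zero_smul, sub_zero] at hx hx3
    have e0 : (Θ x).1 0 = 0 := by linear_combination hx.1 - hx3.1
    have e1 : (Θ x).1 1 = 0 := by linear_combination (hx.2 - hx3.2) / 2
    refine Θ.map_eq_zero_iff.1 (Prod.ext (funext fun q => ?_) (Subsingleton.elim _ _))
    fin_cases q
    · exact e0
    · exact e1
    · exact hx.1.trans e0
    · exact hx.2.trans e1
  obtain ⟨e, heq, he⟩ := exists_adapted_basis (le_refl 4) (assembleAt Θ ![stdFlag k, oppFlag k, graphFlag 1 0 0 1, graphFlag 2 0 0 3] G 0 0) fun i hi =>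
    ⟨hh.not_le hA hT i hi, hh'.not_le hA hT i hi⟩
  rw [heq] at hT hh hh' honly hd
  have hne : coordPlane Θ 0 2 ≠ coordPlane Θ 1 3 := by
    intro h
    have h1 : Θ.symm (Pi.single 0 1, 0) ∈ coordPlane Θ 0 2 :=
      (mem_coordPlane (by decide)).2 ⟨by simp, fun q h1 _ => by simp [h1]⟩
    rw [h, mem_coordPlane (by decide)] at h1
    simpa using h1.2 0 (by decide) (by decide)
  refine ⟨e, mul_ne_zero (staticCond_ne_zero hT (fun g hg => ?_) hh hh' hne)
    (pairForm_ne_zero_of_disjoint (hs := le_refl 4) (i := 2) (j := 3) hd)⟩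
  rcases honly g hg with rfl | rfl
  · exact (he 0 (by decide)).1
  · exact (he 0 (by decide)).2

/-- Two tuples of flags attached to the same instance at the same solution agree. -/
lemma IsDatumOf.eq_of_isInducedFlag {K A : Type*} [Field K] [AddCommGroup A] [Module K A]
    [FiniteDimensional K A] {F : Fin s → CompleteFlag K A} {V : Submodule K A}
    {E : Fin 4 → CompleteFlag K V} {G : Submodule K V → Fin s → CompleteFlag K (A ⧸ V)}
    (hQ : finrank K (A ⧸ V) = b) (hD : IsDatumOf b hs F ⟨V, E, G⟩) {g : Submodule K V}
    (hg : IsLineSolution b hs F (g.map V.subtype)) {G' : Fin s → CompleteFlag K (A ⧸ V)}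
    (hG' : ∀ i, IsInducedFlag b hs F V.mkQ (g.map V.subtype) i (G' i)) : G g = G' :=
  funext fun i => (hD.G_eq g hg i).unique hQ (hG' i)

/-- A retraction onto V identifies the ambient space with V × A / V; normal coordinates on V then
bring the situation to `exists_isRealization`. -/
lemma exists_mem_genericSet_of_isNormalForm (hb : 0 < b) {V : Submodule ℂ (Fin (4 + b) → ℂ)}
    (hV : finrank ℂ V = 4) {E : Fin 4 → CompleteFlag ℂ V} (Ψ : V ≃ₗ[ℂ] (Fin 4 → ℂ)) {t t' : ℂ}
    (hE : IsNormalForm (fun i => (E i).map Ψ) t t')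
    (Gh : Fin s → CompleteFlag ℂ ((Fin (4 + b) → ℂ) ⧸ V)) {h₁ h₂ : Submodule ℂ V}
    (h1 : h₁ = Submodule.span ℂ {Ψ.symm (Pi.single 0 1), Ψ.symm (Pi.single 2 1)})
    (h2 : h₂ = Submodule.span ℂ {Ψ.symm (Pi.single 1 1), Ψ.symm (Pi.single 3 1)}) :
    ∃ F ∈ genericSet b hs, lineSpan hs F = V ∧
      (∀ i j, (E i).space j = ((F (Fin.castLE hs i)).space (lineIdx b i j)).comap V.subtype) ∧
      (∀ h, IsLineSolution b hs F (h.map V.subtype) → h = h₁ ∨ h = h₂) ∧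
      IsLineSolution b hs F (h₁.map V.subtype) ∧
      ∀ i, IsInducedFlag b hs F V.mkQ (h₁.map V.subtype) i (Gh i) := by
  have hQ : finrank ℂ ((Fin (4 + b) → ℂ) ⧸ V) = b := finrank_quotient_eq (by simp) hV
  obtain ⟨r, hr⟩ := LinearMap.exists_leftInverse_of_injective V.subtype V.ker_subtype
  have hr' : ∀ v : V, r v = v := fun v => LinearMap.congr_fun hr v
  have hinj : Function.Injective ((Ψ.toLinearMap ∘ₗ r).prod V.mkQ) := by
    rw [← LinearMap.ker_eq_bot, LinearMap.ker_eq_bot']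
    intro x hx
    have hx2 : V.mkQ x = 0 := congrArg Prod.snd hx
    have hx1 : Ψ (r x) = 0 := congrArg Prod.fst hx
    rw [Submodule.mkQ_apply, Submodule.Quotient.mk_eq_zero] at hx2
    rw [LinearEquiv.map_eq_zero_iff, hr' ⟨x, hx2⟩] at hx1
    exact congrArg Subtype.val hx1
  let Θ : (Fin (4 + b) → ℂ) ≃ₗ[ℂ] (Fin 4 → ℂ) × ((Fin (4 + b) → ℂ) ⧸ V) :=
    LinearMap.linearEquivOfInjective _ hinj (by rw [finrank_prod, hQ]; simp)
  have hΘ : ∀ x, Θ x = (Ψ (r x), V.mkQ x) := fun x => rfl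
  have hΘV : ∀ v : V, Θ v = (Ψ v, 0) := fun v => by
    rw [hΘ, hr', Prod.mk.injEq]
    exact ⟨rfl, (Submodule.Quotient.mk_eq_zero V).2 v.2⟩
  have hΘs : ∀ x, Θ.symm (x, 0) = Ψ.symm x := fun x => by
    rw [LinearEquiv.symm_apply_eq, hΘV, LinearEquiv.apply_symm_apply]
  have hplane : ∀ a c : Fin 4, coordPlane Θ a c =
      (Submodule.span ℂ {Ψ.symm (Pi.single a 1), Ψ.symm (Pi.single c 1)}).map V.subtype := by
    intro a c
    rw [coordPlane, hΘs, hΘs, Submodule.map_span, Set.image_pair]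
    rfl
  obtain ⟨F', hF'⟩ := exists_isRealization (A := Fin (4 + b) → ℂ) hs hb hQ hE Gh
  have hF := hF' Θ
  set F : Fin s → CompleteFlag ℂ (Fin (4 + b) → ℂ) := fun i => (F' i).map Θ.symm
  obtain ⟨e, he⟩ := hF.exists_genCond_ne_zero
  have hmem : ∀ x, x ∈ V ↔ (Θ x).2 = 0 := fun x => by
    rw [hΘ]
    exact (Submodule.Quotient.mk_eq_zero V).symm
  refine ⟨F, ⟨e, he⟩, ?_, ?_, ?_, ?_, ?_⟩
  · ext x
    rw [hF.mem_lineSpan, hmem]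
  · intro i j
    ext v
    rw [Submodule.mem_comap, Submodule.subtype_apply,
      hF.mem_lineIdx i j v ((hmem _).1 v.2), hΘV, CompleteFlag.mem_map_space,
      LinearEquiv.symm_apply_apply]
  · intro h hh
    have hinjm := Submodule.map_injective_of_injective V.subtype_injective
    rcases hF.eq_or_eq _ hh with h3 | h3
    · left
      rw [hplane] at h3
      rw [h1]
      exact hinjm h3
    · right
      rw [hplane] at h3
      rw [h2]
      exact hinjm h3
  · rw [h1, ← hplane]
    exact hF.isLineSolution
  · intro i
    rw [h1, ← hplane]
    exact hF.isInducedFlag i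

/-- For every instance of the problem of four lines in general position and each of its solutions,
all flags in the quotient are attached to this solution by flags in general position. -/
lemma exists_mem_genericSet (hb : 0 < b) {V : Submodule ℂ (Fin (4 + b) → ℂ)}
    (hV : finrank ℂ V = 4) (c : V ≃ₗ[ℂ] (Fin (4 + 0) → ℂ))
    (e : Fin 4 → Basis (Fin (4 + 0)) ℂ V)
    (he : linesCond (fun i q r => c (e i q) r) ≠ 0) :
    ∃ h₁ h₂ : Submodule ℂ V, ∀ g, g = h₁ ∨ g = h₂ →
      ∀ Gh : Fin s → CompleteFlag ℂ ((Fin (4 + b) → ℂ) ⧸ V),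
      ∃ F ∈ genericSet b hs, lineSpan hs F = V ∧
        (∀ i j, (CompleteFlag.ofBasis (e i)).space j =
          ((F (Fin.castLE hs i)).space (lineIdx b i j)).comap V.subtype) ∧
        (∀ h, IsLineSolution b hs F (h.map V.subtype) → h = h₁ ∨ h = h₂) ∧
        IsLineSolution b hs F (g.map V.subtype) ∧
        ∀ i, IsInducedFlag b hs F V.mkQ (g.map V.subtype) i (Gh i) := by
  let e' : Fin 4 → Basis (Fin (4 + 0)) ℂ (Fin (4 + 0) → ℂ) := fun i => (e i).map c
  have hfr : frame e' = fun i q r => c (e i q) r := by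
    funext i q r
    simp [frame, e']
  rw [← hfr, linesCond, mul_ne_zero_iff] at he
  obtain ⟨hst, hpair⟩ := he
  have hT := isTransversal_of_staticCond hst
  have hd := disjoint_of_pairForm_ne_zero (hs := le_refl 4) (e := e') (i := 2) (j := 3) hpair
  have hc : coeffTwo (le_refl 4) (frame e') ≠ 0 := by
    simp only [staticCond, mul_ne_zero_iff] at hst
    exact hst.2.1
  obtain ⟨θ, θ', hθθ, -, -, hroots⟩ := exists_two_roots hst
  have hθ := (hroots θ).2 (Or.inl rfl)
  have hθ' := (hroots θ').2 (Or.inr rfl)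
  have hh := isLineSolution_lineSol hT hc hθ
  have hh' := isLineSolution_lineSol hT hc hθ'
  have hne : lineSol (le_refl 4) (frame e') θ ≠ lineSol (le_refl 4) (frame e') θ' := fun h =>
    hθθ (lineSol_injective hT hc hθ h)
  have honly : ∀ g, IsLineSolution 0 (le_refl 4) (frameFlags e') g →
      g = lineSol (le_refl 4) (frame e') θ ∨ g = lineSol (le_refl 4) (frame e') θ' := by
    intro g hg
    obtain ⟨x, hx, rfl⟩ := hg.exists_eq_lineSol hT hc
    rcases (hroots x).1 hx with rfl | rfl
    · exact Or.inl rfl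
    · exact Or.inr rfl
  have hfl : ∀ (w : Basis (Fin 4) ℂ (Fin (4 + 0) → ℂ)) i,
      (frameFlags e' (Fin.castLE (le_refl 4) i)).map w.equivFun =
        (CompleteFlag.ofBasis (e i)).map (c.trans w.equivFun) := by
    intro w i
    ext j x
    rw [CompleteFlag.mem_map_space, CompleteFlag.mem_map_space, frameFlags,
      CompleteFlag.mem_ofBasis_space, CompleteFlag.mem_ofBasis_space]
    simp [e']
  -- The construction prescribes the induced flags at the first transversal only, so it is stated
  -- for either order of the two solutions.
  have key : ∀ h h' : Submodule ℂ (Fin (4 + 0) → ℂ),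
      IsLineSolution 0 (le_refl 4) (frameFlags e') h →
      IsLineSolution 0 (le_refl 4) (frameFlags e') h' → h ≠ h' →
      (∀ g, IsLineSolution 0 (le_refl 4) (frameFlags e') g → g = h ∨ g = h') →
      ∀ Gh : Fin s → CompleteFlag ℂ ((Fin (4 + b) → ℂ) ⧸ V),
      ∃ F ∈ genericSet b hs, lineSpan hs F = V ∧
        (∀ i j, (CompleteFlag.ofBasis (e i)).space j =
          ((F (Fin.castLE hs i)).space (lineIdx b i j)).comap V.subtype) ∧
        (∀ g, IsLineSolution b hs F (g.map V.subtype) →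
          g = h.map c.symm.toLinearMap ∨ g = h'.map c.symm.toLinearMap) ∧
        IsLineSolution b hs F ((h.map c.symm.toLinearMap).map V.subtype) ∧
        ∀ i, IsInducedFlag b hs F V.mkQ ((h.map c.symm.toLinearMap).map V.subtype) i (Gh i) := by
    intro h h' hh hh' hne honly Gh
    obtain ⟨w, t, t', hN, e1, e2⟩ := exists_isNormalForm hT hd hc hh hh' hne honly
    simp only [hfl] at hN
    have hw : ∀ i, (c.trans w.equivFun).symm (Pi.single i 1) = c.symm (w i) := by
      intro i
      simp
    refine exists_mem_genericSet_of_isNormalForm hb hV (c.trans w.equivFun) hN Gh ?_ ?_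
    · rw [e1, Submodule.map_span, Set.image_pair, hw, hw]
      rfl
    · rw [e2, Submodule.map_span, Set.image_pair, hw, hw]
      rfl
  refine ⟨(lineSol (le_refl 4) (frame e') θ).map c.symm.toLinearMap,
    (lineSol (le_refl 4) (frame e') θ').map c.symm.toLinearMap, ?_⟩
  rintro g (rfl | rfl) Gh
  · exact key _ _ hh hh' hne honly Gh
  · obtain ⟨F, h1, h2, h3, h4, h5⟩ := key _ _ hh' hh hne.symm (fun g hg => (honly g hg).symm) Gh
    exact ⟨F, h1, h2, h3, fun h hh => (h4 h hh).symm, h5⟩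

lemma forGeneralFlags_of_forall {K V : Type*} [Field K] [AddCommGroup V] [Module K V]
    [FiniteDimensional K V] {P : (Fin s → CompleteFlag K V) → Prop} (h : ∀ F, P F) :
    ForGeneralFlags P := by
  refine ⟨Set.univ, fun F _ => ?_, ⟨fun _ => Classical.arbitrary _, trivial⟩, fun F _ => h F⟩
  choose e he using fun i => (F i).exists_eq_ofBasis (m := finrank K V) rfl
  refine ⟨finrank K V, e, 1, ⟨0, by simp, ?_⟩, Set.subset_univ _⟩
  funext i
  exact he i

/-- For four lines in general position every tuple of flags in the quotient, not only a general one,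
arises at each solution. -/
theorem isFiberedOver_fourLines (hab : a < b) (hs : 4 ≤ s) (hν : IsSchubertProblem a b ν) :
    IsFiberedOver 2 4 a b (firstFamily a b ν) fourLines ν := by
  classical
  have hb : 0 < b := by omega
  have hA : finrank ℂ (Fin (4 + b) → ℂ) = 4 + b := by simp
  have hdat : ∀ F : Fin s → CompleteFlag ℂ (Fin (4 + b) → ℂ), F ∈ genericSet b hs →
      ∃ D, IsDatumOf b hs F D := fun F hF =>
    exists_isDatumOf hA (isTransversal_of_mem_genericSet hF).1 (isTransversal_of_mem_genericSet hF).2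
  have hdat' : ∀ F : Fin s → CompleteFlag ℂ (Fin (4 + b) → ℂ), ∃ D,
      F ∈ genericSet b hs → IsDatumOf b hs F D := by
    intro F
    by_cases hF : F ∈ genericSet b hs
    · obtain ⟨D, hD⟩ := hdat F hF
      exact ⟨D, fun _ => hD⟩
    · obtain ⟨F₀, hF₀⟩ := genericSet_nonempty (hs := hs) hb
      obtain ⟨D, -⟩ := hdat F₀ hF₀
      exact ⟨D, fun h => absurd h hF⟩
  choose Φ hΦ using hdat'
  refine ⟨isSchubertProblem_firstFamily hab hs hν, isSchubertProblem_fourLines, hν,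
    genericSet b hs, Φ, isZariskiOpen_genericSet, genericSet_nonempty hb, fun F hF => ?_,
    fun V hV => ?_⟩
  · obtain ⟨hT, hg⟩ := isTransversal_of_mem_genericSet hF
    exact (hΦ F hF).exhibits hA hab hν.2.1 hT hg
  · let c : V ≃ₗ[ℂ] (Fin (4 + 0) → ℂ) := LinearEquiv.ofFinrankEq _ _ (by rw [hV]; simp)
    refine ⟨_, isZariskiOpen_of_natural c (fun _ _ f => linesCond f)
      fun _ _ _ _ φ f => map_linesCond φ f, ?_, ?_⟩
    · obtain ⟨e, he⟩ := exists_linesCond_ne_zero (k := ℂ)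
      refine ⟨_, fun i => (e i).map c.symm, rfl, ?_⟩
      have : (fun i q r => c (((e i).map c.symm) q) r) = frame e := by
        funext i q r
        simp [frame]
      rwa [this]
    · rintro _ ⟨e, rfl, he⟩
      obtain ⟨h₁, h₂, hex⟩ := exists_mem_genericSet (hs := hs) hb hV c e he
      have hQ : finrank ℂ ((Fin (4 + b) → ℂ) ⧸ V) = b := finrank_quotient_eq hA hV
      have key : ∀ g, g = h₁ ∨ g = h₂ → ∀ Gh : Fin s → CompleteFlag ℂ ((Fin (4 + b) → ℂ) ⧸ V),
          ∃ F ∈ genericSet b hs, ∃ G, Φ F = ⟨V, fun i => CompleteFlag.ofBasis (e i), G⟩ ∧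
            G g = Gh ∧ ∀ h, IsLineSolution b hs F (h.map V.subtype) → h = h₁ ∨ h = h₂ := by
        intro g hg Gh
        obtain ⟨F, hF, hV', hE, honly, hsol, hind⟩ := hex g hg Gh
        have hD := hΦ F hF
        rcases hD' : Φ F with ⟨sub, E, G⟩
        rw [hD'] at hD
        obtain rfl : sub = V := hD.sub_eq.trans hV'
        have hEE : E = fun i => CompleteFlag.ofBasis (e i) := by
          funext i
          refine CompleteFlag.ext_of_lt fun j hj => ?_
          rw [hE]
          exact hD.E_eq i j (by omega)
        subst hEE
        exact ⟨F, hF, G, hD', hD.eq_of_isInducedFlag hQ hsol hind, honly⟩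
      -- One ambient instance over these four lines is needed to identify the solutions of E with h₁
      -- and h₂.
      obtain ⟨F₀, hF₀, G₀, hD₀, -, honly⟩ := key h₁ (Or.inl rfl) fun _ => Classical.arbitrary _
      refine ⟨⟨F₀, hF₀, G₀, hD₀⟩, fun h hh => forGeneralFlags_of_forall fun Gh => ?_⟩
      have hD := hΦ F₀ hF₀
      rw [hD₀] at hD
      have hsol := (mem_fourLines_iff hA (isTransversal_of_mem_genericSet hF₀).1 hD).1 hh
      obtain ⟨F, hF, G, h1, h2, -⟩ := key h (honly h hsol) Gh
      exact ⟨F, hF, G, h1, h2⟩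

end Fibration

/-! ### Extension of scalars for subspaces of coordinate spaces -/

section BaseChange

variable {C L M : Type*} [Field C] [Field L] [Field M] (κ : C →+* L) {n m : ℕ}

/-- The subspace spanned by the images of the vectors of a subspace under a homomorphism of
fields. -/
def extendCoords (S : Submodule C (Fin n → C)) : Submodule L (Fin n → L) :=
  Submodule.span L ((fun v => κ ∘ v) '' (S : Set (Fin n → C)))

variable {κ}

lemma comp_mem_extendCoords {S : Submodule C (Fin n → C)} {v : Fin n → C} (hv : v ∈ S) :
    κ ∘ v ∈ extendCoords κ S :=
  Submodule.subset_span ⟨v, hv, rfl⟩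

lemma extendCoords_le {S : Submodule C (Fin n → C)} {T : Submodule L (Fin n → L)} :
    extendCoords κ S ≤ T ↔ ∀ v ∈ S, κ ∘ v ∈ T := by
  rw [extendCoords, Submodule.span_le, Set.image_subset_iff]
  rfl

lemma extendCoords_mono {S T : Submodule C (Fin n → C)} (h : S ≤ T) :
    extendCoords κ S ≤ extendCoords κ T :=
  extendCoords_le.2 fun _ hv => comp_mem_extendCoords (h hv)

lemma extendCoords_span (T : Set (Fin n → C)) :
    extendCoords κ (Submodule.span C T) = Submodule.span L ((fun v => κ ∘ v) '' T) := by
  refine le_antisymm (extendCoords_le.2 fun v hv => ?_)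
    (Submodule.span_mono (Set.image_mono Submodule.subset_span))
  induction hv using Submodule.span_induction with
  | mem x hx => exact Submodule.subset_span ⟨x, hx, rfl⟩
  | zero =>
    convert Submodule.zero_mem _
    funext i
    simp
  | add x y _ _ hx hy =>
    convert Submodule.add_mem _ hx hy
    funext i
    simp
  | smul c x _ hx =>
    convert Submodule.smul_mem _ (κ c) hx
    funext i
    simp

lemma extendCoords_sup (S T : Submodule C (Fin n → C)) :
    extendCoords κ (S ⊔ T) = extendCoords κ S ⊔ extendCoords κ T := by
  conv_lhs => rw [← Submodule.span_eq S, ← Submodule.span_eq T, ← Submodule.span_union,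
    extendCoords_span, Set.image_union, Submodule.span_union]
  rfl

lemma extendCoords_top : extendCoords κ (⊤ : Submodule C (Fin n → C)) = ⊤ := by
  rw [eq_top_iff, ← (Pi.basisFun L (Fin n)).span_eq, Submodule.span_le]
  rintro _ ⟨i, rfl⟩
  have h : Pi.basisFun L (Fin n) i = κ ∘ Pi.single i (1 : C) := by
    funext j
    simp only [Pi.basisFun_apply, Function.comp_apply, Pi.single_apply]
    split_ifs <;> simp
  rw [h]
  exact comp_mem_extendCoords Submodule.mem_top

lemma finrank_extendCoords_le (S : Submodule C (Fin n → C)) :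
    finrank L (extendCoords κ S) ≤ finrank C S := by
  let e := finBasis C S
  have h : S = Submodule.span C (Set.range fun i => (e i : Fin n → C)) := by
    have := congrArg (Submodule.map S.subtype) e.span_eq
    rw [Submodule.map_span, Submodule.map_top, Submodule.range_subtype, ← Set.range_comp] at this
    exact this.symm
  have h2 : extendCoords κ S = Submodule.span L (Set.range fun i => κ ∘ (e i : Fin n → C)) := by
    conv_lhs => rw [h, extendCoords_span, ← Set.range_comp]
    rfl
  rw [h2]
  exact (finrank_range_le_card _).trans_eq (Fintype.card_fin _)

-- The dimension cannot grow. For complementary subspaces the extensions still span everything, so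
-- it cannot drop either.
@[simp] lemma finrank_extendCoords (S : Submodule C (Fin n → C)) :
    finrank L (extendCoords κ S) = finrank C S := by
  obtain ⟨T, hT⟩ := S.exists_isCompl
  have h1 := finrank_extendCoords_le (κ := κ) S
  have h2 := finrank_extendCoords_le (κ := κ) T
  have h3 := Submodule.finrank_add_le_finrank_add_finrank (extendCoords κ S) (extendCoords κ T)
  rw [← extendCoords_sup, hT.sup_eq_top, extendCoords_top, finrank_top, finrank_fin_fun] at h3
  have h4 := Submodule.finrank_add_eq_of_isCompl hT
  rw [finrank_fin_fun] at h4
  omega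

/-- One inclusion is clear and the dimensions agree, because extension respects sums and dimensions.
-/
lemma extendCoords_inf (S T : Submodule C (Fin n → C)) :
    extendCoords κ (S ⊓ T) = extendCoords κ S ⊓ extendCoords κ T := by
  refine Submodule.eq_of_le_of_finrank_eq
    (le_inf (extendCoords_mono inf_le_left) (extendCoords_mono inf_le_right)) ?_
  have h1 := Submodule.finrank_sup_add_finrank_inf_eq S T
  have h2 := Submodule.finrank_sup_add_finrank_inf_eq (extendCoords κ S) (extendCoords κ T)
  rw [← extendCoords_sup] at h2
  simp only [finrank_extendCoords] at h2 ⊢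
  omega

/-- If v lies in the extension of S, adjoining v to S does not change the dimension after extension,
hence not before. -/
lemma comp_mem_extendCoords_iff {S : Submodule C (Fin n → C)} {v : Fin n → C} :
    κ ∘ v ∈ extendCoords κ S ↔ v ∈ S := by
  refine ⟨fun h => ?_, comp_mem_extendCoords⟩
  have h1 : extendCoords κ (S ⊔ Submodule.span C {v}) = extendCoords κ S := by
    rw [extendCoords_sup, extendCoords_span, Set.image_singleton, sup_eq_left,
      Submodule.span_singleton_le_iff_mem]
    exact h
  have h2 := congrArg (fun T : Submodule L (Fin n → L) => finrank L T) h1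
  simp only [finrank_extendCoords] at h2
  rw [Submodule.eq_of_le_of_finrank_eq le_sup_left h2.symm]
  exact Submodule.mem_sup_right (Submodule.mem_span_singleton_self v)

lemma extendCoords_injective : Function.Injective (extendCoords κ (n := n)) := by
  intro S T h
  ext v
  rw [← comp_mem_extendCoords_iff (κ := κ), h, comp_mem_extendCoords_iff]

lemma extendCoords_comp (κ' : L →+* M) (S : Submodule C (Fin n → C)) :
    extendCoords (κ'.comp κ) S = extendCoords κ' (extendCoords κ S) := by
  conv_rhs => rw [extendCoords.eq_def κ, extendCoords_span, ← Set.image_comp]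
  rfl

lemma map_extendCoords {π : (Fin n → C) →ₗ[C] (Fin m → C)} {π' : (Fin n → L) →ₗ[L] (Fin m → L)}
    (h : ∀ v, π' (κ ∘ v) = κ ∘ π v) (S : Submodule C (Fin n → C)) :
    (extendCoords κ S).map π' = extendCoords κ (S.map π) := by
  rw [extendCoords, Submodule.map_span, ← Set.image_comp, extendCoords, Submodule.map_coe,
    ← Set.image_comp]
  congr 2
  funext v
  exact h v

lemma exists_eq_extendCoords {T : Set (Fin n → L)} (hT : ∀ v ∈ T, ∀ i, v i ∈ κ.range) :
    ∃ S, Submodule.span L T = extendCoords κ S := by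
  refine ⟨Submodule.span C {v | κ ∘ v ∈ T}, ?_⟩
  rw [extendCoords_span]
  congr 1
  ext v
  constructor
  · intro hv
    choose w hw using hT v hv
    have : κ ∘ w = v := funext hw
    exact ⟨w, show κ ∘ w ∈ T from this ▸ hv, this⟩
  · rintro ⟨w, hw, rfl⟩
    exact hw

lemma conjSubspace_eq_extendCoords [Algebra C L] (σ : L ≃ₐ[C] L) (H : Submodule L (Fin n → L)) :
    conjSubspace σ H = extendCoords (σ : L →+* L) H := by
  refine le_antisymm (fun v hv => ?_) (extendCoords_le.2 fun v hv => ?_)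
  · have : v = (σ : L →+* L) ∘ fun i => σ.symm (v i) := funext fun i => by simp
    rw [this]
    exact comp_mem_extendCoords hv
  · change (fun i => σ.symm (((σ : L →+* L) ∘ v) i)) ∈ H
    simpa using hv

lemma cellFlag_map_space (x : BelowDiag n → C) (j : ℕ) :
    (cellFlag (Pi.basisFun L (Fin n)) (κ ∘ x)).space j =
      extendCoords κ ((cellFlag (Pi.basisFun C (Fin n)) x).space j) := by
  change Submodule.span L _ = extendCoords κ (Submodule.span C _)
  rw [extendCoords_span, ← Set.image_comp]
  congr 2
  funext q r
  simp only [cellVector, Finset.sum_apply, Pi.smul_apply, Function.comp_apply, map_sum,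
    Pi.basisFun_apply, smul_eq_mul, map_mul, lowerUnipotent, Matrix.of_apply, Pi.single_apply]
  refine Finset.sum_congr rfl fun p _ => ?_
  split_ifs <;> simp

lemma extendCoords_mem_schubertInstance_iff {s k : ℕ} {lam : Fin s → ℕ → ℕ}
    {F : Fin s → CompleteFlag C (Fin n → C)} {F' : Fin s → CompleteFlag L (Fin n → L)}
    (hF : ∀ i j, (F' i).space j = extendCoords κ ((F i).space j)) {S : Submodule C (Fin n → C)} :
    extendCoords κ S ∈ schubertInstance k lam F' ↔ S ∈ schubertInstance k lam F := by
  have h : ∀ i j, finrank L ↥(extendCoords κ S ⊓ (F' i).space j) =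
      finrank C ↥(S ⊓ (F i).space j) := fun i j => by
    rw [hF, ← extendCoords_inf, finrank_extendCoords]
  have hL : finrank L (Fin n → L) = finrank C (Fin n → C) := by simp
  simp only [schubertInstance, schubertVariety, Set.mem_ofPred_eq, h, finrank_extendCoords]
  rw [hL]

end BaseChange

/-! ### Fields of definition of subspaces and flags -/

section Definition

variable {k L : Type*} [Field k] [Field L] [Algebra k L] {n : ℕ}

/-- The subspace `S` is spanned by vectors with coordinates in `E`. -/
def IsDefinedOver (E : IntermediateField k L) (S : Submodule L (Fin n → L)) : Prop :=
  ∃ T : Set (Fin n → L), (∀ v ∈ T, ∀ i, v i ∈ E) ∧ S = Submodule.span L T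

variable {E E' : IntermediateField k L} {S W P H : Submodule L (Fin n → L)}

lemma IsDefinedOver.mono (h : IsDefinedOver E S) (hE : E ≤ E') : IsDefinedOver E' S :=
  let ⟨T, hT, hS⟩ := h
  ⟨T, fun v hv i => hE (hT v hv i), hS⟩

lemma IsDefinedOver.exists_eq (h : IsDefinedOver E S) :
    ∃ S₀ : Submodule E (Fin n → E), S = extendCoords (algebraMap E L) S₀ := by
  obtain ⟨T, hT, rfl⟩ := h
  exact exists_eq_extendCoords fun v hv i => ⟨⟨v i, hT v hv i⟩, rfl⟩

lemma isDefinedOver_bot : IsDefinedOver E (⊥ : Submodule L (Fin n → L)) :=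
  ⟨∅, by simp, by simp⟩

lemma isDefinedOver_top : IsDefinedOver E (⊤ : Submodule L (Fin n → L)) := by
  refine ⟨Set.range (Pi.basisFun L (Fin n)), ?_, (Pi.basisFun L (Fin n)).span_eq.symm⟩
  rintro _ ⟨i, rfl⟩ j
  rw [Pi.basisFun_apply, Pi.single_apply]
  split_ifs
  exacts [E.one_mem, E.zero_mem]

/-- The subspace spanned by `W` and a vector of `P` is defined over an extension of the field of
definition of `W` and `P` by fewer than `dim P / (P ∩ W)` elements. -/
lemma exists_isDefinedOver_sup_span (hW : IsDefinedOver E W) (hP : IsDefinedOver E P)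
    {v : Fin n → L} (hv : v ∈ P) (hvW : v ∉ W) :
    ∃ g : Finset L, g.card + finrank L ↥(P ⊓ W) + 1 ≤ finrank L P ∧
      ∀ E', E ≤ E' → (∀ x ∈ g, x ∈ E') → IsDefinedOver E' (W ⊔ Submodule.span L {v}) := by
  classical
  obtain ⟨W₀, hW₀⟩ := hW.exists_eq
  obtain ⟨P₀, hP₀⟩ := hP.exists_eq
  obtain ⟨D, hD⟩ := (P₀ ⊓ W₀).exists_isCompl
  have hsup : P₀ ⊓ W₀ ⊔ D ⊓ P₀ = P₀ := by
    rw [← sup_inf_assoc_of_le D (inf_le_left : P₀ ⊓ W₀ ≤ P₀), hD.sup_eq_top, top_inf_eq]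
  have hfin := Submodule.finrank_sup_add_finrank_inf_eq (P₀ ⊓ W₀) (D ⊓ P₀)
  have hinf : P₀ ⊓ W₀ ⊓ (D ⊓ P₀) = ⊥ :=
    eq_bot_iff.2 ((inf_le_inf_left _ inf_le_left).trans hD.inf_eq_bot.le)
  rw [hsup, hinf, finrank_bot, add_zero] at hfin
  let c := finBasis E ↥(D ⊓ P₀)
  have hv' := hv
  rw [hP₀, ← hsup, extendCoords_sup] at hv'
  obtain ⟨w, hw, t, ht, hwt⟩ := Submodule.mem_sup.1 hv'
  have hwW : w ∈ W := hW₀ ▸ extendCoords_mono inf_le_right hw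
  have hspan : D ⊓ P₀ = Submodule.span E (Set.range fun i => (c i : Fin n → E)) := by
    have := congrArg (Submodule.map (D ⊓ P₀).subtype) c.span_eq
    rw [Submodule.map_span, Submodule.map_top, Submodule.range_subtype, ← Set.range_comp] at this
    exact this.symm
  rw [hspan, extendCoords_span, ← Set.range_comp] at ht
  obtain ⟨a, ha⟩ := (Submodule.mem_span_range_iff_exists_fun L).1 ht
  obtain ⟨i₀, hi₀⟩ : ∃ i, a i ≠ 0 := by
    by_contra! h
    simp only [h, zero_smul, Finset.sum_const_zero] at ha
    rw [← ha, add_zero] at hwt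
    exact hvW (hwt ▸ hwW)
  obtain ⟨T, hT, hTW⟩ := hW
  -- Modulo W only the line through v counts, so one coefficient can be scaled to 1; this saves one
  -- generator.
  let u : Fin n → L := ∑ i, (a i / a i₀) • fun j => (algebraMap E L) ((c i : Fin n → E) j)
  have hu : t = a i₀ • u := by
    rw [← ha, Finset.smul_sum]
    refine Finset.sum_congr rfl fun i _ => ?_
    rw [smul_smul, mul_div_cancel₀ _ hi₀]
    rfl
  refine ⟨(Finset.univ.erase i₀).image fun i => a i / a i₀, ?_, fun E' hE hg =>
    ⟨T ∪ {u}, ?_, ?_⟩⟩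
  · have h1 := Finset.card_image_le (s := Finset.univ.erase i₀) (f := fun i => a i / a i₀)
    rw [Finset.card_erase_of_mem (Finset.mem_univ _), Finset.card_univ, Fintype.card_fin] at h1
    have h2 := i₀.isLt
    rw [hP₀, hW₀, ← extendCoords_inf, finrank_extendCoords, finrank_extendCoords]
    omega
  · rintro x (hx | rfl) j
    · exact hE (hT x hx j)
    · simp only [u, Finset.sum_apply, Pi.smul_apply, smul_eq_mul]
      refine E'.sum_mem fun i _ => E'.mul_mem ?_ (hE ((c i : Fin n → E) j).2)
      by_cases hi : i = i₀
      · rw [hi, div_self hi₀]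
        exact E'.one_mem
      · exact hg _ (Finset.mem_image_of_mem _ (Finset.mem_erase.2 ⟨hi, Finset.mem_univ _⟩))
  · rw [Submodule.span_union, ← hTW]
    refine le_antisymm (sup_le le_sup_left ?_) (sup_le le_sup_left ?_) <;>
      rw [Submodule.span_singleton_le_iff_mem]
    · rw [← hwt, hu]
      exact add_mem (Submodule.mem_sup_left hwW) (Submodule.mem_sup_right
        (Submodule.smul_mem _ _ (Submodule.mem_span_singleton_self u)))
    · have : u = (a i₀)⁻¹ • (v - w) := by
        rw [← hwt, add_sub_cancel_left, hu, inv_smul_smul₀ hi₀]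
      rw [this]
      exact Submodule.smul_mem _ _ (sub_mem (Submodule.mem_sup_right
        (Submodule.mem_span_singleton_self v)) (Submodule.mem_sup_left hwW))

/-- A subspace is defined over a field generated by as many elements as the dimension of the
Grassmannian. -/
lemma exists_isDefinedOver (H : Submodule L (Fin n → L)) :
    ∃ g : Finset L, g.card ≤ finrank L H * (n - finrank L H) ∧
      ∀ E : IntermediateField k L, (∀ x ∈ g, x ∈ E) → IsDefinedOver E H := by
  classical
  have hfin := H.finrank_quotient_add_finrank
  rw [finrank_fin_fun] at hfin
  let f : Fin n → (Fin n → L) ⧸ H := fun i => H.mkQ (Pi.single i 1)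
  have hf : Submodule.span L (Set.range f) = ⊤ := by
    have := congrArg (Submodule.map H.mkQ) (Pi.basisFun L (Fin n)).span_eq
    rw [Submodule.map_span, Submodule.map_top, Submodule.range_mkQ, ← Set.range_comp] at this
    have h : f = ⇑H.mkQ ∘ ⇑(Pi.basisFun L (Fin n)) := by
      funext i
      simp [f]
    rw [h]
    exact this
  -- The standard vectors e_{J(j)} give a basis of the quotient by H. Then H is spanned by the
  -- vectors e_i - ∑ c_{ij} e_{J(j)} for i outside J, and the coefficients c_{ij} are the
  -- generators.
  obtain ⟨κ, J, hJ, hspan, hli⟩ := exists_linearIndependent' L f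
  have : Finite κ := Finite.of_injective J hJ
  have := Fintype.ofFinite κ
  rw [hf] at hspan
  have hκ : Fintype.card κ = n - finrank L H := by
    rw [← finrank_span_eq_card hli, hspan, finrank_top]
    omega
  have hc : ∀ i, ∃ c : κ → L, ∑ j, c j • (f ∘ J) j = f i := fun i =>
    (Submodule.mem_span_range_iff_exists_fun L).1 (hspan ▸ Submodule.mem_top)
  choose c hc using hc
  have hmem : ∀ i, Pi.single i 1 - ∑ j, c i j • Pi.single (J j) (1 : L) ∈ H := fun i => by
    rw [← Submodule.ker_mkQ H, LinearMap.mem_ker, map_sub, map_sum]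
    simp only [map_smul]
    exact sub_eq_zero.2 (hc i).symm
  let I : Finset (Fin n) := Finset.univ.filter fun i => i ∉ Set.range J
  have hI : I.card = finrank L H := by
    have h1 : I = (Finset.univ.image J)ᶜ := by
      ext i
      simp [I]
    rw [h1, Finset.card_compl, Finset.card_image_of_injective _ hJ, Finset.card_univ, hκ,
      Fintype.card_fin]
    omega
  refine ⟨(I ×ˢ Finset.univ).image fun ij => c ij.1 ij.2, ?_, fun E hE =>
    ⟨{v | ∃ i ∈ I, v = Pi.single i 1 - ∑ j, c i j • Pi.single (J j) (1 : L)}, ?_, ?_⟩⟩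
  · refine Finset.card_image_le.trans ?_
    rw [Finset.card_product, hI, Finset.card_univ, hκ]
  · have h01 : ∀ i r : Fin n, (Pi.single i 1 : Fin n → L) r ∈ E := fun i r => by
      rw [Pi.single_apply]
      split_ifs
      exacts [E.one_mem, E.zero_mem]
    rintro _ ⟨i, hi, rfl⟩ r
    simp only [Pi.sub_apply, Finset.sum_apply, Pi.smul_apply, smul_eq_mul]
    refine E.sub_mem (h01 _ _) (E.sum_mem fun j _ => E.mul_mem (hE _ ?_) (h01 _ _))
    exact Finset.mem_image.2 ⟨(i, j), by simpa using hi, rfl⟩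
  · refine le_antisymm (fun h hh => ?_) (Submodule.span_le.2 ?_)
    · set T := Submodule.span L {v | ∃ i ∈ I, v = Pi.single i 1 - ∑ j, c i j • Pi.single (J j) (1 : L)}
        with hT
      have hTH : T ≤ H := Submodule.span_le.2 (by rintro _ ⟨i, -, rfl⟩; exact hmem i)
      let u : Fin n → L := ∑ i ∈ I, h i • (Pi.single i 1 - ∑ j, c i j • Pi.single (J j) (1 : L))
      have hu : u ∈ T := Submodule.sum_mem _ fun i hi =>
        Submodule.smul_mem _ _ (Submodule.subset_span ⟨i, hi, rfl⟩)
      obtain ⟨d, hd⟩ : ∃ d : κ → L, h - u = ∑ j, d j • Pi.single (J j) 1 := by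
        refine ⟨fun j => h (J j) + ∑ i ∈ I, h i * c i j, ?_⟩
        have h1 : h = ∑ i ∈ I, h i • Pi.single i (1 : L) +
            ∑ j, h (J j) • Pi.single (J j) (1 : L) := by
          have h2 : ∑ j, h (J j) • Pi.single (J j) (1 : L) =
              ∑ i ∈ Iᶜ, h i • Pi.single i (1 : L) := by
            have : Iᶜ = Finset.univ.image J := by
              ext i
              simp [I]
            rw [this, Finset.sum_image fun x _ y _ hxy => hJ hxy]
          rw [h2, Finset.sum_add_sum_compl]
          exact pi_eq_sum_univ' h
        conv_lhs => rw [h1]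
        simp only [u, smul_sub, Finset.sum_sub_distrib, add_smul, Finset.sum_add_distrib,
          Finset.sum_smul, Finset.smul_sum, smul_smul]
        rw [Finset.sum_comm (s := I)]
        abel
      have hd0 : ∀ j, d j = 0 := by
        refine Fintype.linearIndependent_iff.1 hli d ?_
        have : H.mkQ (h - u) = 0 := by
          rw [← LinearMap.mem_ker, Submodule.ker_mkQ]
          exact sub_mem hh (hTH hu)
        rw [hd, map_sum] at this
        simp only [map_smul] at this
        exact this
      simp only [hd0, zero_smul, Finset.sum_const_zero] at hd
      rwa [sub_eq_zero.1 hd]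
    · rintro _ ⟨i, -, rfl⟩
      exact hmem i

/-- Column j has n - 1 - j entries below the diagonal; this is the number of parameters for the
member of index j + 1 once that of index j is given. -/
lemma card_belowDiag (n : ℕ) : Fintype.card (BelowDiag n) = ∑ j ∈ Finset.range n, (n - 1 - j) := by
  rw [Fintype.card_subtype, Finset.card_filter, Fintype.sum_prod_type_right, Finset.sum_range]
  refine Finset.sum_congr rfl fun q _ => ?_
  rw [← Finset.card_filter]
  convert Fin.card_Ioi q using 2
  ext p
  simp

/-- If `H` lies in a Schubert variety of the flag `F`, then the members of `F` are defined over an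
extension of the field of definition of `H` by at most as many elements as the dimension of the
Schubert variety of flags which is given by `H`. -/
lemma exists_isDefinedOver_flag (F : CompleteFlag L (Fin n → L)) {r : ℕ} {p : ℕ → ℕ}
    (hH : IsDefinedOver E H) (hF : H ∈ schubertVariety r p F) :
    ∃ g : Finset L, g.card + ∑ t ∈ Finset.range r, p t ≤ Fintype.card (BelowDiag n) ∧
      ∀ E', E ≤ E' → (∀ x ∈ g, x ∈ E') → ∀ j, IsDefinedOver E' (F.space j) := by
  classical
  obtain ⟨hr, hF⟩ := hF
  have hn : finrank L (Fin n → L) = n := finrank_fin_fun L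
  rw [hn] at hF
  have hrn : r ≤ n := hr ▸ (Submodule.finrank_le H).trans_eq hn
  have key : ∀ m ≤ n, ∃ g : Finset L,
      g.card + ∑ t ∈ Finset.range (finrank L ↥(H ⊓ F.space m)), p t ≤
        ∑ j ∈ Finset.range m, (n - 1 - j) ∧
      ∀ E', E ≤ E' → (∀ x ∈ g, x ∈ E') → ∀ j ≤ m, IsDefinedOver E' (F.space j) := by
    intro m
    induction m with
    | zero =>
      refine fun _ => ⟨∅, by rw [F.space_zero, inf_bot_eq, finrank_bot]; simp,
        fun E' _ _ j hj => ?_⟩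
      rw [Nat.le_zero.1 hj, F.space_zero]
      exact isDefinedOver_bot
    | succ m ih =>
      intro hm
      obtain ⟨g, hg, hgE⟩ := ih (by omega)
      let E₁ := E ⊔ IntermediateField.adjoin k (g : Set L)
      have hE₁ : ∀ x ∈ g, x ∈ E₁ := fun x hx =>
        (le_sup_right : _ ≤ E₁) (IntermediateField.subset_adjoin k _ hx)
      have hdm := F.finrank_space m (by omega)
      have hup : finrank L ↥(H ⊓ F.space (m + 1)) ≤ finrank L ↥(H ⊓ F.space m) + 1 := by
        rw [inf_comm, inf_comm H]
        exact F.finrank_inf_add_le H m 1 (by omega)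
      have hlo : finrank L ↥(H ⊓ F.space m) ≤ finrank L ↥(H ⊓ F.space (m + 1)) :=
        Submodule.finrank_mono (inf_le_inf_left _ (F.mono (Nat.le_succ m)))
      -- a vector which spans the next member, in a subspace chosen as small as possible
      have step : ∀ P v, IsDefinedOver E P → v ∈ P → v ∈ F.space (m + 1) → v ∉ F.space m →
          ∀ c, finrank L P + c ≤ finrank L ↥(P ⊓ F.space m) + n - m → 
          finrank L ↥(H ⊓ F.space (m + 1)) = finrank L ↥(H ⊓ F.space m) ∧ c = 0 ∨
          finrank L ↥(H ⊓ F.space (m + 1)) = finrank L ↥(H ⊓ F.space m) + 1 ∧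
            c = p (finrank L ↥(H ⊓ F.space m)) →
          ∃ g : Finset L,
            g.card + ∑ t ∈ Finset.range (finrank L ↥(H ⊓ F.space (m + 1))), p t ≤
              ∑ j ∈ Finset.range (m + 1), (n - 1 - j) ∧
            ∀ E', E ≤ E' → (∀ x ∈ g, x ∈ E') → ∀ j ≤ m + 1, IsDefinedOver E' (F.space j) := by
        intro P v hP hvP hv hvm c hc hcases
        obtain ⟨g', hg', hg'E⟩ := exists_isDefinedOver_sup_span
          (hgE E₁ le_sup_left hE₁ m le_rfl) (hP.mono (le_sup_left : E ≤ E₁)) hvP hvm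
        refine ⟨g ∪ g', ?_, fun E' hE' hx j hj => ?_⟩
        · have h1 := Finset.card_union_le g g'
          rw [Finset.sum_range_succ]
          rcases hcases with ⟨h2, rfl⟩ | ⟨h2, rfl⟩
          · rw [h2]
            omega
          · rw [h2, Finset.sum_range_succ]
            omega
        · rcases Nat.of_le_succ hj with hj | rfl
          · exact hgE E' hE' (fun x h => hx x (Finset.mem_union_left _ h)) j hj
          · have h3 : F.space (m + 1) = F.space m ⊔ Submodule.span L {v} := by
              refine (Submodule.eq_of_le_of_finrank_le (sup_le (F.mono (Nat.le_succ m)) ?_) ?_).symm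
              · rwa [Submodule.span_singleton_le_iff_mem]
              · rw [F.finrank_space _ (by omega)]
                have := Submodule.finrank_lt_finrank_of_lt
                  (lt_of_le_of_ne (le_sup_left : F.space m ≤ F.space m ⊔ Submodule.span L {v})
                    fun h => hvm (h ▸ Submodule.mem_sup_right
                      (Submodule.mem_span_singleton_self v)))
                omega
            rw [h3]
            refine hg'E E' (sup_le hE' (IntermediateField.adjoin_le_iff.2 fun x h => ?_)) fun x h =>
              hx x (Finset.mem_union_right _ h)
            exact hx x (Finset.mem_union_left _ h)
      by_cases hjump : finrank L ↥(H ⊓ F.space (m + 1)) = finrank L ↥(H ⊓ F.space m)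
      · obtain ⟨v, hv, hvm⟩ := F.exists_mem_notMem (show m < finrank L (Fin n → L) by omega)
        refine step ⊤ v isDefinedOver_top Submodule.mem_top hv hvm 0 ?_ (Or.inl ⟨hjump, rfl⟩)
        rw [finrank_top, top_inf_eq, hdm, hn]
        omega
      · obtain ⟨v, hv, hvm⟩ := SetLike.exists_of_lt (lt_of_le_of_ne
          (inf_le_inf_left H (F.mono (Nat.le_succ m))) fun h => hjump (by rw [h]))
        have hlt : finrank L ↥(H ⊓ F.space m) < r := by
          have := Submodule.finrank_mono (inf_le_left : H ⊓ F.space (m + 1) ≤ H)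
          omega
        have hS := hF _ hlt
        -- The Schubert condition forces the next jump to happen no later than the index n - r + (t
        -- + 1) - p_t. So m lies below it, which is the saving claimed.
        have hmlt : m < n - r + (finrank L ↥(H ⊓ F.space m) + 1) -
            p (finrank L ↥(H ⊓ F.space m)) := by
          by_contra! h
          have := Submodule.finrank_mono (inf_le_inf_left H (F.mono h))
          omega
        refine step H v hH hv.1 hv.2 (fun h => hvm ⟨hv.1, h⟩) _ ?_ (Or.inr ⟨by omega, rfl⟩)
        rw [hr]
        omega
  obtain ⟨g, hg, hgE⟩ := key n le_rfl
  rw [F.space_top hn.le, inf_top_eq, hr] at hg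
  refine ⟨g, (card_belowDiag n).symm ▸ hg, fun E' hE' hx j => ?_⟩
  rcases le_total j n with hj | hj
  · exact hgE E' hE' hx j hj
  · rw [F.space_top (hn.trans_le hj)]
    exact isDefinedOver_top

lemma cellVector_basisFun_apply (x : BelowDiag n → L) (q r : Fin n) :
    cellVector (Pi.basisFun L (Fin n)) x q r = lowerUnipotent x r q := by
  simp [cellVector, Pi.single_apply]

lemma cellVector_mem (x : BelowDiag n → L) (q : Fin n) :
    cellVector (Pi.basisFun L (Fin n)) x q ∈ (cellFlag (Pi.basisFun L (Fin n)) x).space (q + 1) :=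
  Submodule.subset_span ⟨q, Nat.lt_succ_self _, rfl⟩

/-- Forward substitution: the first j coordinates of a combination of the first j columns of a
unitriangular matrix determine its coefficients. -/
lemma eq_zero_of_mem_cellFlag {x : BelowDiag n → L} {j : ℕ} {v : Fin n → L}
    (hv : v ∈ (cellFlag (Pi.basisFun L (Fin n)) x).space j) (h : ∀ r : Fin n, r.val < j → v r = 0) :
    v = 0 := by
  set e := CompleteFlag.cellBasis (Pi.basisFun L (Fin n)) x with he
  rw [CompleteFlag.cellFlag_eq_ofBasis, CompleteFlag.mem_ofBasis_space] at hv
  have hsum : ∀ r, v r = ∑ q, e.repr v q * lowerUnipotent x r q := fun r => by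
    conv_lhs => rw [← e.sum_repr v]
    simp only [Finset.sum_apply, Pi.smul_apply, smul_eq_mul, he, CompleteFlag.coe_cellBasis,
      cellVector_basisFun_apply]
  have key : ∀ m : ℕ, ∀ q : Fin n, q.val = m → e.repr v q = 0 := by
    intro m
    induction m using Nat.strong_induction_on with
    | _ m ih =>
      rintro q rfl
      by_cases hq : j ≤ q.val
      · exact hv q hq
      · have h1 := hsum q
        rw [h q (not_le.1 hq), Finset.sum_eq_single q] at h1
        · simpa [lowerUnipotent] using h1.symm
        · intro q' _ hne
          rcases lt_or_gt_of_ne hne with hlt | hlt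
          · rw [ih q' hlt q' rfl, zero_mul]
          · simp [lowerUnipotent, hlt.not_gt, hlt.ne]
        · simp
  funext r
  rw [hsum r]
  simp [key _ _ rfl]

/-- The unitriangular coordinates of a flag lie in each of its fields of definition. -/
lemma mem_of_isDefinedOver_cellFlag {x : BelowDiag n → L}
    (h : ∀ j, IsDefinedOver E ((cellFlag (Pi.basisFun L (Fin n)) x).space j)) (pq : BelowDiag n) :
    x pq ∈ E := by
  obtain ⟨⟨p, q⟩, hqp⟩ := pq
  obtain ⟨S, hS⟩ := (h (q + 1)).exists_eq
  let Z : Submodule E (Fin n → E) := Submodule.span E {v | ∃ r, q ≤ r ∧ v = Pi.single r 1}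
  have hZ : ∀ v ∈ Z, ∀ r < q, v r = 0 := by
    intro v hv r hr
    induction hv using Submodule.span_induction with
    | mem v hv =>
      obtain ⟨r', hr', rfl⟩ := hv
      exact Pi.single_eq_of_ne (hr.trans_le hr').ne _
    | zero => rfl
    | add v w _ _ hv hw => rw [Pi.add_apply, hv, hw, add_zero]
    | smul c v _ hv => rw [Pi.smul_apply, hv, smul_zero]
  -- The member of index q + 1 and the space of vectors whose first q coordinates vanish are both
  -- defined over E and meet in the line through column q. A nonzero vector of this line with
  -- entries in E gives the coordinates as quotients of its entries.
  have hmem : cellVector (Pi.basisFun L (Fin n)) x q ∈ extendCoords (algebraMap E L) (S ⊓ Z) := by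
    rw [extendCoords_inf, ← hS]
    refine ⟨cellVector_mem x q, ?_⟩
    rw [extendCoords_span, cellVector]
    refine Submodule.sum_mem _ fun r _ => ?_
    by_cases hr : q ≤ r
    · refine Submodule.smul_mem _ _ (Submodule.subset_span ⟨_, ⟨r, hr, rfl⟩, ?_⟩)
      funext r'
      simp only [Function.comp_apply, Pi.basisFun_apply, Pi.single_apply]
      split_ifs <;> simp
    · rw [not_le] at hr
      simp [lowerUnipotent, hr.not_gt, hr.ne]
  have hne : S ⊓ Z ≠ ⊥ := fun h0 => by
    rw [h0, show (⊥ : Submodule E (Fin n → E)) = Submodule.span E ∅ by simp, extendCoords_span,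
      Set.image_empty, Submodule.span_empty, Submodule.mem_bot] at hmem
    exact (linearIndependent_cellVector (Pi.basisFun L (Fin n)) x).ne_zero q hmem
  obtain ⟨w, hw, hw0⟩ := Submodule.exists_mem_ne_zero_of_ne_bot hne
  have hw' : algebraMap E L ∘ w =
      (w q : L) • cellVector (Pi.basisFun L (Fin n)) x q := by
    refine sub_eq_zero.1 (eq_zero_of_mem_cellFlag (x := x) (j := q + 1) (sub_mem ?_
      (Submodule.smul_mem _ _ (cellVector_mem x q))) fun r hr => ?_)
    · rw [hS]
      exact comp_mem_extendCoords hw.1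
    · simp only [Pi.sub_apply, Function.comp_apply, Pi.smul_apply, cellVector_basisFun_apply,
        smul_eq_mul]
      rcases (Nat.lt_succ_iff.1 hr).lt_or_eq with hlt | heq
      · have hlt' : r < q := hlt
        simp [hZ w hw.2 r hlt', lowerUnipotent, hlt'.not_gt, hlt'.ne]
      · obtain rfl : r = q := Fin.ext heq
        simp [lowerUnipotent]
  have hq0 : (w q : L) ≠ 0 := fun h0 => by
    rw [h0, zero_smul] at hw'
    refine hw0 (funext fun r => Subtype.ext ?_)
    exact congrFun hw' r
  have hp := congrFun hw' p
  simp only [Function.comp_apply, Pi.smul_apply, cellVector_basisFun_apply, smul_eq_mul,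
    lowerUnipotent, Matrix.of_apply, dif_pos hqp] at hp
  have : x ⟨(p, q), hqp⟩ = (w p : L) / w q := by
    rw [eq_div_iff hq0, mul_comm]
    exact hp.symm
  rw [this]
  exact E.div_mem (w p).2 (w q).2

/-- In the matroid of algebraic independence y is an independent set in the closure of g with at
least as many elements as g, so it has the same closure. -/
lemma isAlgebraic_of_card_le {ι : Type*} [Fintype ι] {y : ι → L} (hy : AlgebraicIndependent k y)
    {g : Finset L} (hg : g.card ≤ Fintype.card ι)
    (h : ∀ i, y i ∈ IntermediateField.adjoin k (g : Set L)) {z : L}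
    (hz : z ∈ IntermediateField.adjoin k (g : Set L)) :
    IsAlgebraic (Algebra.adjoin k (Set.range y)) z := by
  let M := AlgebraicIndependent.matroid k L
  have hcl : ∀ z ∈ IntermediateField.adjoin k (g : Set L), z ∈ M.closure g := by
    intro z hz
    obtain ⟨r, hr, t, ht, rfl⟩ := IntermediateField.mem_adjoin_iff_div.1 hz
    rw [AlgebraicIndependent.matroid_closure_eq]
    rw [SetLike.mem_coe, Subalgebra.mem_algebraicClosure, div_eq_mul_inv]
    exact (isAlgebraic_algebraMap (⟨r, hr⟩ : Algebra.adjoin k (g : Set L))).mul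
      (isAlgebraic_algebraMap (⟨t, ht⟩ : Algebra.adjoin k (g : Set L))).inv
  have hsub : Set.range y ⊆ M.closure g := by
    rintro _ ⟨i, rfl⟩
    exact hcl _ (h i)
  have hind : M.Indep (Set.range y) :=
    AlgebraicIndependent.matroid_indep_iff.2 hy.coe_range
  have heq : M.closure (Set.range y) = M.closure (M.closure g) := by
    refine (M.isRkFinite_of_finite (Set.finite_range y)).closure_eq_closure_of_subset_of_eRk_ge_eRk
      hsub ?_
    rw [M.eRk_closure_eq, hind.eRk_eq_encard]
    refine (M.eRk_le_encard _).trans ?_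
    rw [Set.encard_coe_eq_coe_finsetCard, ← Set.image_univ, hy.injective.injOn.encard_image,
      Set.encard_univ, ENat.card_eq_coe_fintype_card]
    exact_mod_cast hg
  have := hcl z hz
  rw [← M.closure_closure, ← heq, AlgebraicIndependent.matroid_closure_eq] at this
  exact this

/-- The solutions of a Schubert problem for flags with algebraically independent coordinates are
algebraic over the field generated by these coordinates. -/
theorem exists_isAlgebraic_of_mem_schubertInstance {s r : ℕ} {lam : Fin s → ℕ → ℕ}
    (hlam : IsSchubertProblem r n lam) {y : Fin s × BelowDiag n → L}
    (hy : AlgebraicIndependent k y)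
    (hH : H ∈ schubertInstance r lam fun i =>
      cellFlag (Pi.basisFun L (Fin n)) fun pq => y (i, pq)) :
    ∃ T : Set (Fin n → L), (∀ v ∈ T, ∀ i, IsAlgebraic (Algebra.adjoin k (Set.range y)) (v i)) ∧
      H = Submodule.span L T := by
  classical
  obtain ⟨g₀, hg₀, hg₀E⟩ := exists_isDefinedOver (k := k) H
  let E₀ := IntermediateField.adjoin k (g₀ : Set L)
  have hHE := hg₀E E₀ fun x hx => IntermediateField.subset_adjoin k _ hx
  choose g hg hgE using fun i => exists_isDefinedOver_flag _ hHE (hH.2 i)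
  let G := g₀ ∪ Finset.univ.biUnion g
  let E := IntermediateField.adjoin k (G : Set L)
  have hG : ∀ x ∈ G, x ∈ E := fun x hx => IntermediateField.subset_adjoin k _ hx
  -- There are at most r (n - r) generators for H, and for each flag at most the dimension of the
  -- flag variety minus the size of its partition. Since the sizes add up to r (n - r), the total is
  -- at most the number of coordinates of all the flags.
  have hcard : G.card ≤ Fintype.card (Fin s × BelowDiag n) := by
    have h1 := Finset.card_union_le g₀ (Finset.univ.biUnion g)
    have h2 : (Finset.univ.biUnion g).card ≤ ∑ i, (g i).card := Finset.card_biUnion_le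
    have h3 := Finset.sum_le_sum fun (i : Fin s) (_ : i ∈ Finset.univ) => hg i
    rw [Finset.sum_add_distrib, hlam.2.2, Finset.sum_const, Finset.card_univ, Fintype.card_fin,
      smul_eq_mul] at h3
    rw [hH.1] at hg₀
    rw [Fintype.card_prod, Fintype.card_fin]
    have h4 : G.card ≤ g₀.card + (Finset.univ.biUnion g).card := h1
    omega
  have hyE : ∀ i, y i ∈ E := fun i => by
    refine mem_of_isDefinedOver_cellFlag (x := fun pq => y (i.1, pq)) (hgE i.1 E
      (IntermediateField.adjoin_le_iff.2 fun x hx => hG x (Finset.mem_union_left _ hx))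
      fun x hx => hG x (Finset.mem_union_right _
        (Finset.mem_biUnion.2 ⟨i.1, Finset.mem_univ _, hx⟩))) i.2
  obtain ⟨T, hT, rfl⟩ := hg₀E E fun x hx => hG x (Finset.mem_union_left _ hx)
  exact ⟨T, fun v hv i => isAlgebraic_of_card_le hy hcard hyE (hT v hv i), rfl⟩

end Definition

/-! ### Coordinates of flags in the standard cell -/

section Cell

section Ring

variable {R S : Type*} [CommRing R] [CommRing S] {m : ℕ}

/-- The minor of the family `g` given by its first `q + 1` members and the coordinates which precede
`q`, together with `p`. -/
noncomputable def cellMinor (g : Fin m → Fin m → R) (q p : Fin m) : R :=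
  Matrix.det (Matrix.of fun r c : Fin (q + 1) =>
    g (Fin.castLE q.isLt r) (if c = Fin.last q then p else Fin.castLE q.isLt c))

lemma map_cellMinor (φ : R →+* S) (g : Fin m → Fin m → R) (q p : Fin m) :
    φ (cellMinor g q p) = cellMinor (fun q r => φ (g q r)) q p := by
  rw [cellMinor, RingHom.map_det]
  rfl

lemma cellMinor_of_lt (g : Fin m → Fin m → R) {q p : Fin m} (h : p < q) : cellMinor g q p = 0 := by
  have h' : p.val < q.val := h
  refine Matrix.det_zero_of_column_eq (i := ⟨p, h'.trans (Nat.lt_succ_self _)⟩) (j := Fin.last q)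
    (fun he => h'.ne (by simpa [Fin.ext_iff] using he)) fun r => ?_
  simp only [Matrix.of_apply, if_pos, Fin.castLE_mk]
  split_ifs <;> rfl

/-- Expansion along the last column: the minors with varying p are the coordinates of one vector in
the span of the first q + 1 members of the family. -/
lemma exists_cellMinor_eq_sum (g : Fin m → Fin m → R) (q : Fin m) :
    ∃ c : Fin (q + 1) → R, ∀ p, cellMinor g q p = ∑ r, c r * g (Fin.castLE q.isLt r) p := by
  let A : Matrix (Fin (q + 1)) (Fin (q + 1)) R :=
    Matrix.of fun r c => g (Fin.castLE q.isLt r) (Fin.castLE q.isLt c)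
  refine ⟨A.adjugate (Fin.last q), fun p => ?_⟩
  have h : (Matrix.of fun r c : Fin (q + 1) =>
      g (Fin.castLE q.isLt r) (if c = Fin.last q then p else Fin.castLE q.isLt c)) =
      A.updateCol (Fin.last q) fun r => g (Fin.castLE q.isLt r) p := by
    ext r c
    rw [Matrix.updateCol_apply]
    simp only [Matrix.of_apply, A]
    split_ifs <;> rfl
  rw [cellMinor, h, ← Matrix.cramer_apply, Matrix.cramer_eq_adjugate_mulVec]
  rfl

end Ring

variable {k : Type*} [Field k] {m : ℕ}

/-- The vector of minors vanishes before position q, so after division by its entry there it is the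
q-th column of a unitriangular matrix. The last vector is not needed, since the last member of the
flag is the whole space. -/
lemma exists_cellFlag_eq {G : CompleteFlag k (Fin m → k)} {g : Fin m → Fin m → k}
    (hg : ∀ q : Fin m, g q ∈ G.space (q + 1)) (hne : ∀ q : Fin m, q.val + 1 < m → cellMinor g q q ≠ 0) :
    G = cellFlag (Pi.basisFun k (Fin m)) fun pq =>
      cellMinor g pq.1.2 pq.1.1 / cellMinor g pq.1.2 pq.1.2 := by
  symm
  refine CompleteFlag.ext_of_le fun j hj => Submodule.span_le.2 ?_
  rw [finrank_fin_fun] at hj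
  rintro _ ⟨q, hq, rfl⟩
  have hqm : q.val + 1 < m := (Nat.succ_le_of_lt hq).trans_lt hj
  refine G.mono (Nat.succ_le_of_lt hq) ?_
  obtain ⟨c, hc⟩ := exists_cellMinor_eq_sum g q
  have : cellVector (Pi.basisFun k (Fin m)) (fun pq : BelowDiag m =>
      cellMinor g pq.1.2 pq.1.1 / cellMinor g pq.1.2 pq.1.2) q =
      (cellMinor g q q)⁻¹ • ∑ r, c r • g (Fin.castLE q.isLt r) := by
    funext p
    rw [cellVector_basisFun_apply, Pi.smul_apply, Finset.sum_apply, smul_eq_mul]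
    simp only [Pi.smul_apply, smul_eq_mul]
    rw [← hc p]
    simp only [lowerUnipotent, Matrix.of_apply]
    split_ifs with h1 h2
    · rw [div_eq_mul_inv, mul_comm]
    · rw [h2, inv_mul_cancel₀ (hne q hqm)]
    · rw [cellMinor_of_lt g (lt_of_le_of_ne (not_lt.1 h1) h2), mul_zero]
  rw [this]
  exact Submodule.smul_mem _ _ (Submodule.sum_mem _ fun r _ => Submodule.smul_mem _ _
    (G.mono (Nat.succ_le_of_lt r.isLt) (hg (Fin.castLE q.isLt r))))

lemma cellFlag_injective :
    Function.Injective fun x : BelowDiag m → k => cellFlag (Pi.basisFun k (Fin m)) x := by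
  intro x x' h
  have h : cellFlag (Pi.basisFun k (Fin m)) x = cellFlag (Pi.basisFun k (Fin m)) x' := h
  funext pq
  obtain ⟨⟨p, q⟩, hqp⟩ := pq
  have h0 : cellVector (Pi.basisFun k (Fin m)) x q - cellVector (Pi.basisFun k (Fin m)) x' q = 0 := by
    refine eq_zero_of_mem_cellFlag (x := x) (j := q + 1)
      (sub_mem (cellVector_mem x q) (h ▸ cellVector_mem x' q)) fun r hr => ?_
    rw [Pi.sub_apply, cellVector_basisFun_apply, cellVector_basisFun_apply]
    have hr' : ¬ q < r := not_lt.2 (Nat.lt_succ_iff.1 hr)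
    simp [lowerUnipotent, hr']
  have := congrFun (sub_eq_zero.1 h0) p
  simpa only [cellVector_basisFun_apply, lowerUnipotent, Matrix.of_apply, dif_pos hqp] using this

/-- A relation between the rows would give a vector of the member of index q + 1 whose first q + 1
coordinates vanish, hence the zero vector. -/
lemma cellMinor_ne_zero {x : BelowDiag m → k} {g : Fin m → Fin m → k} {q : Fin m}
    (hg : ∀ r : Fin (q + 1),
      g (Fin.castLE q.isLt r) ∈ (cellFlag (Pi.basisFun k (Fin m)) x).space (r + 1))
    (hli : LinearIndependent k fun r : Fin (q + 1) => g (Fin.castLE q.isLt r)) :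
    cellMinor g q q ≠ 0 := by
  intro h0
  obtain ⟨v, hv, hv0⟩ := Matrix.exists_vecMul_eq_zero_iff.2 h0
  have hx : ∑ r, v r • g (Fin.castLE q.isLt r) = 0 := by
    refine eq_zero_of_mem_cellFlag (x := x) (j := q + 1) (Submodule.sum_mem _ fun r _ =>
      Submodule.smul_mem _ _ (CompleteFlag.mono _ (Nat.succ_le_of_lt r.isLt)
        (hg r))) fun c hc => ?_
    have := congrFun hv0 ⟨c, hc⟩
    simp only [Matrix.vecMul, dotProduct, Matrix.of_apply, Pi.zero_apply] at this
    rw [Finset.sum_apply, ← this]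
    refine Finset.sum_congr rfl fun r _ => ?_
    rw [Pi.smul_apply, smul_eq_mul]
    congr 2
    split_ifs with h
    · simpa [Fin.ext_iff, eq_comm] using h
    · rfl
  exact hv (funext (Fintype.linearIndependent_iff.1 hli v hx))

lemma coord_eq_of_notMem {x : BelowDiag m → k} {g : Fin m → Fin m → k}
    (hg : ∀ q : Fin m, g q ∈ (cellFlag (Pi.basisFun k (Fin m)) x).space (q + 1))
    (hg' : ∀ q : Fin m, q.val + 1 < m → g q ∉ (cellFlag (Pi.basisFun k (Fin m)) x).space q) :
    (∀ q : Fin m, q.val + 1 < m → cellMinor g q q ≠ 0) ∧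
      x = fun pq => cellMinor g pq.1.2 pq.1.1 / cellMinor g pq.1.2 pq.1.2 := by
  set G := cellFlag (Pi.basisFun k (Fin m)) x with hG
  have hne : ∀ q : Fin m, q.val + 1 < m → cellMinor g q q ≠ 0 := by
    intro q hq
    -- Nothing is assumed about the last vector of the family. Only the members up to q enter the
    -- minor, so the later ones are replaced.
    have : ∀ r : Fin m, ∃ v ∈ G.space (r + 1), v ∉ G.space r ∧ (r ≤ q → v = g r) := fun r => by
      by_cases hr : r ≤ q
      · have hr' : r.val ≤ q.val := hr
        exact ⟨g r, hg r, hg' r (by omega), fun _ => rfl⟩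
      · obtain ⟨v, hv, hv'⟩ := G.exists_mem_notMem (j := r) (by rw [finrank_fin_fun]; exact r.isLt)
        exact ⟨v, hv, hv', fun h => absurd h hr⟩
    choose v hv hv' hvq using this
    obtain ⟨w, hw, -⟩ := G.exists_eq_ofBasis_of_notMem (finrank_fin_fun k) v hv hv'
    have hli := w.linearIndependent.comp _ (Fin.castLE_injective q.isLt)
    refine cellMinor_ne_zero (x := x) (fun r => hg (Fin.castLE q.isLt r)) ?_
    have h : (fun r : Fin (q + 1) => g (Fin.castLE q.isLt r)) = ⇑w ∘ Fin.castLE q.isLt := by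
      funext r
      rw [Function.comp_apply, hw]
      exact (hvq _ (Nat.lt_succ_iff.1 r.isLt)).symm
    rw [h]
    exact hli
  exact ⟨hne, cellFlag_injective (exists_cellFlag_eq hg hne)⟩

/-- Finitely many flags and finitely many nonzero vectors can be moved into general position with
respect to the standard flags by a matrix with entries in a given infinite subfield. -/
theorem exists_matrix_map_eq_cellFlag (k₀ : Type*) [Field k₀] [Infinite k₀] [Algebra k₀ k]
    {s t : ℕ} (F : Fin s → CompleteFlag k (Fin m → k)) (v : Fin t → Fin m → k) (hv : ∀ j, v j ≠ 0)
    (i₀ : Fin m) :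
    ∃ (A : Fin m → Fin m → k₀) (γ : (Fin m → k) ≃ₗ[k] (Fin m → k)),
      (∀ x r, γ x r = ∑ c, algebraMap k₀ k (A r c) * x c) ∧
      (∀ i, ∃ x, (F i).map γ = cellFlag (Pi.basisFun k (Fin m)) x) ∧ ∀ j, γ (v j) i₀ ≠ 0 := by
  classical
  choose e he using fun i => (F i).exists_eq_ofBasis (finrank_fin_fun k (n := m))
  let X : Matrix (Fin m) (Fin m) (MvPolynomial (Fin m × Fin m) k) :=
    Matrix.of fun r c => MvPolynomial.X (r, c)
  let f : Fin s → Fin m → Fin m → MvPolynomial (Fin m × Fin m) k := fun i q r =>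
    ∑ c, X r c * MvPolynomial.C (e i q c)
  -- All requirements on the matrix are put into one polynomial in its entries. Each factor is
  -- nonzero for its own reason: at the identity matrix, at the matrix which straightens one of the
  -- bases, and at a matrix whose row `i₀` selects a nonzero coordinate.
  let D : MvPolynomial (Fin m × Fin m) k := X.det * (∏ i, ∏ q, cellMinor (f i) q q) *
    ∏ j, ∑ c, X i₀ c * MvPolynomial.C (v j c)
  have hX : ∀ z : Fin m × Fin m → k, MvPolynomial.eval z X.det =
      (Matrix.of fun r c => z (r, c)).det := fun z => by
    rw [RingHom.map_det]
    congr 1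
    ext r c
    simp [X]
  have hf : ∀ (z : Fin m × Fin m → k) i q, MvPolynomial.eval z (cellMinor (f i) q q) =
      cellMinor (fun q r => ∑ c, z (r, c) * e i q c) q q := fun z i q => by
    rw [map_cellMinor]
    simp [f, X]
  have hvz : ∀ (z : Fin m × Fin m → k) j, MvPolynomial.eval z (∑ c, X i₀ c * MvPolynomial.C (v j c)) =
      ∑ c, z (i₀, c) * v j c := fun z j => by simp [X]
  have hD : D ≠ 0 := by
    refine mul_ne_zero (mul_ne_zero ?_ ?_) ?_
    · intro h
      have := hX fun rc => if rc.1 = rc.2 then 1 else 0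
      rw [h, map_zero] at this
      have h1 : (Matrix.of fun r c : Fin m => if r = c then (1 : k) else 0) = 1 := by
        ext r c
        simp [Matrix.one_apply]
      rw [h1, Matrix.det_one] at this
      exact zero_ne_one this
    · refine Finset.prod_ne_zero_iff.2 fun i _ => Finset.prod_ne_zero_iff.2 fun q _ h => ?_
      have := hf (fun rc => (e i).repr (Pi.single rc.2 1) rc.1) i q
      rw [h, map_zero] at this
      have h1 : (fun q r => ∑ c, (e i).repr (Pi.single c 1) r * e i q c) =
          fun q => Pi.single q (1 : k) := by
        funext q r
        have h2 : e i q = ∑ c, e i q c • Pi.single c (1 : k) := pi_eq_sum_univ' _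
        have h3 := congrArg (fun x => (e i).repr x r) h2
        simp only [map_sum, map_smul, Finsupp.coe_finsetSum, Finset.sum_apply, Finsupp.smul_apply,
          smul_eq_mul, Basis.repr_self] at h3
        rw [Finset.sum_congr rfl fun c _ => mul_comm _ _, ← h3, Finsupp.single_eq_pi_single]
      rw [h1] at this
      refine cellMinor_ne_zero (x := 0) (g := fun q => Pi.single q (1 : k)) (q := q) (fun r => ?_) ?_
        this.symm
      · have := cellVector_mem (0 : BelowDiag m → k) (Fin.castLE q.isLt r)
        rw [CompleteFlag.cellVector_zero, Pi.basisFun_apply] at this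
        exact this
      · convert (Pi.basisFun k (Fin m)).linearIndependent.comp _ (Fin.castLE_injective q.isLt)
          with r
        simp
    · refine Finset.prod_ne_zero_iff.2 fun j _ h => ?_
      obtain ⟨c₀, hc₀⟩ := Function.ne_iff.1 (hv j)
      have := hvz (fun rc => if rc.2 = c₀ then 1 else 0) j
      rw [h, map_zero] at this
      simp at this
      exact hc₀ this.symm
  -- A nonzero polynomial does not vanish on all points with coordinates in an infinite subset.
  obtain ⟨z, hz, hzD⟩ : ∃ z ∈ Set.pi Set.univ fun _ : Fin m × Fin m => Set.range (algebraMap k₀ k),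
      MvPolynomial.eval z D ≠ 0 := by
    by_contra! h
    exact hD (MvPolynomial.funext_set _ (fun _ => Set.infinite_range_of_injective
      (algebraMap k₀ k).injective) fun x hx => by rw [h x hx, map_zero])
  choose a ha using fun rc => hz rc (Set.mem_univ _)
  simp only [D, map_mul, map_prod, hX, hf, hvz] at hzD
  have hdet := left_ne_zero_of_mul (left_ne_zero_of_mul hzD)
  let γ := Matrix.toLinearEquiv' _ ((Matrix.of fun r c => z (r, c)).invertibleOfIsUnitDet hdet.isUnit)
  have hγ : ∀ x r, γ x r = ∑ c, z (r, c) * x c := fun x r => rfl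
  refine ⟨fun r c => a (r, c), γ, fun x r => ?_, fun i => ⟨_, exists_cellFlag_eq
    (g := fun q r => ∑ c, z (r, c) * e i q c) (fun q => ?_) fun q _ => ?_⟩, fun j => ?_⟩
  · simp only [hγ, ha]
  · rw [CompleteFlag.mem_map_space, he i]
    have : γ.symm (fun r => ∑ c, z (r, c) * e i q c) = e i q := by
      rw [LinearEquiv.symm_apply_eq]
      funext r
      rw [hγ]
    rw [this]
    exact CompleteFlag.ofBasis_mem _ (Nat.lt_succ_self _)
  · exact Finset.prod_ne_zero_iff.1 (Finset.prod_ne_zero_iff.1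
      (right_ne_zero_of_mul (left_ne_zero_of_mul hzD)) i (Finset.mem_univ _)) q (Finset.mem_univ _)
  · rw [hγ]
    exact Finset.prod_ne_zero_iff.1 (right_ne_zero_of_mul hzD) j (Finset.mem_univ _)

end Cell

/-! ### Explicit adapted vectors for the induced flags -/

section Forms

variable {R S : Type*} [CommRing R] [CommRing S] {b s : ℕ}

lemma flagShift_le (i : ℕ) : flagShift i ≤ 3 := by
  unfold flagShift
  split_ifs <;> omega

variable (hs : 4 ≤ s) (f : Fin s → Fin (4 + b) → Fin (4 + b) → R)

/-- A combination of `x`, `x'`, `y` on which both linear forms attached to `p` vanish. -/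
noncomputable def etaSyzygy (p x x' y : Fin (4 + b) → R) : Fin (4 + b) → R :=
  etaDet hs f p x x' • y + (etaDet hs f p x' y • x - etaDet hs f p x y • x')

/-- A vector of the `i`-th flag in the hull of the transversal through `p`. -/
noncomputable def hullVec (p : Fin (4 + b) → R) (i : Fin s) (q : Fin b) : Fin (4 + b) → R :=
  let y := f i ⟨q + flagShift i, by have := flagShift_le i; omega⟩
  if i.val < 2 then etaSyzygy hs f p (f i (Fin.castAdd b 1)) (f i (Fin.castAdd b 2)) y
  else if i.val = 2 then
    etaB hs f p (f i (Fin.castAdd b 0)) • y + -etaB hs f p y • f i (Fin.castAdd b 0)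
  else if i.val = 3 then
    etaA hs f p (f i (Fin.castAdd b 0)) • y + -etaA hs f p y • f i (Fin.castAdd b 0)
  else etaSyzygy hs f p (f i (Fin.castAdd b 0)) (f i (Fin.castAdd b 1)) y

/-- The vectors spanning the first two lines, completed by the family `C`. -/
noncomputable def splitFrame (C : Fin b → Fin (4 + b) → R) : Fin (4 + b) → Fin (4 + b) → R :=
  Fin.append ![firstVec hs f 0 0, firstVec hs f 0 1, firstVec hs f 1 0, firstVec hs f 1 1] C

/-- A multiple of the projection along the span of the first two lines with respect to the
family `C`. -/
noncomputable def splitForm (C : Fin b → Fin (4 + b) → R) :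
    (Fin (4 + b) → R) →ₗ[R] (Fin b → R) :=
  LinearMap.pi fun r => coordForm (splitFrame hs f C) (Fin.natAdd 4 r)

/-- The images of the vectors `hullVec` in the quotient by the span of the first two lines. -/
noncomputable def inducedVec (C : Fin b → Fin (4 + b) → R) (p : Fin (4 + b) → R) (i : Fin s)
    (q : Fin b) : Fin b → R :=
  splitForm hs f C (hullVec hs f p i q)

variable (φ : R →+* S)

lemma comp_hullVec (p : Fin (4 + b) → R) (i : Fin s) (q : Fin b) :
    φ ∘ hullVec hs f p i q = hullVec hs (mapFrame f φ) (φ ∘ p) i q := by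
  have h : ∀ i j, φ ∘ f i j = mapFrame f φ i j := fun i j => rfl
  have h' : ∀ i j r, φ (f i j r) = mapFrame f φ i j r := fun i j r => rfl
  funext r
  unfold hullVec
  simp only
  split_ifs <;>
    simp only [etaSyzygy, Function.comp_apply, Pi.add_apply, Pi.sub_apply, Pi.smul_apply,
      smul_eq_mul, map_add, map_sub, map_mul, map_neg, map_etaDet, map_etaA, map_etaB, h, h']

lemma comp_splitForm (C : Fin b → Fin (4 + b) → R) (x : Fin (4 + b) → R) :
    φ ∘ splitForm hs f C x =
      splitForm hs (mapFrame f φ) (fun q r => φ (C q r)) (φ ∘ x) := by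
  have h : (fun q r => φ (splitFrame hs f C q r)) =
      splitFrame hs (mapFrame f φ) fun q r => φ (C q r) := by
    funext q r
    refine Fin.addCases (fun q => ?_) (fun q => ?_) q
    · simp only [splitFrame, Fin.append_left]
      fin_cases q <;> rfl
    · simp only [splitFrame, Fin.append_right]
  funext r
  simp only [Function.comp_apply, splitForm, LinearMap.pi_apply, map_coordForm, h]

lemma comp_inducedVec (C : Fin b → Fin (4 + b) → R) (p : Fin (4 + b) → R) (i : Fin s) (q : Fin b) :
    φ ∘ inducedVec hs f C p i q =
      inducedVec hs (mapFrame f φ) (fun q r => φ (C q r)) (φ ∘ p) i q := by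
  rw [inducedVec, comp_splitForm, comp_hullVec]
  rfl

lemma etaA_neg_smul_add (p x y : Fin (4 + b) → R) (c d : R) :
    etaA hs f p (c • x + d • y) = c * etaA hs f p x + d * etaA hs f p y := by
  rw [etaA_add, etaA_smul, etaA_smul]

lemma etaB_neg_smul_add (p x y : Fin (4 + b) → R) (c d : R) :
    etaB hs f p (c • x + d • y) = c * etaB hs f p x + d * etaB hs f p y := by
  rw [etaB_add, etaB_smul, etaB_smul]

/-- The pairs of values of two linear forms at three vectors satisfy Cramer's relation. -/
lemma eta_etaSyzygy (p x x' y : Fin (4 + b) → R) :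
    etaA hs f p (etaSyzygy hs f p x x' y) = 0 ∧ etaB hs f p (etaSyzygy hs f p x x' y) = 0 := by
  have h : etaSyzygy hs f p x x' y = etaDet hs f p x x' • y +
      (1 : R) • (etaDet hs f p x' y • x + -etaDet hs f p x y • x') := by
    rw [etaSyzygy, one_smul, neg_smul, sub_eq_add_neg]
  rw [h, etaA_neg_smul_add, etaA_neg_smul_add, etaB_neg_smul_add, etaB_neg_smul_add]
  unfold etaDet
  constructor <;> ring

end Forms

/-! ### Coordinates of the induced flags -/

section Field

variable {k : Type*} [Field k] {b s : ℕ} {hs : 4 ≤ s}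
  {e : Fin s → Basis (Fin (4 + b)) k (Fin (4 + b) → k)} {p : Fin (4 + b) → k}

/-- The leading coefficient is the factor of the genericity condition belonging to this flag. -/
lemma hullVec_eq_add (hg : ∀ i, flagCond hs (frame e) p i ≠ 0) (i : Fin s) (q : Fin b) :
    ∃ c : k, c ≠ 0 ∧ ∃ z ∈ (frameFlags e i).space (flagShift i),
      hullVec hs (frame e) p i q =
        c • e i ⟨q + flagShift i, by have := flagShift_le i; omega⟩ + z := by
  obtain ⟨h1, h2, h3, h4⟩ := flagCond_ne_zero_iff.1 (hg i)
  let y : Fin (4 + b) → k := e i ⟨q + flagShift i, by have := flagShift_le i; omega⟩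
  have hmem : ∀ j : Fin 4, j.val < flagShift i →
      frame e i (Fin.castAdd b j) ∈ (frameFlags e i).space (flagShift i) := fun j hj =>
    CompleteFlag.ofBasis_mem (e i) hj
  by_cases hi0 : i.val < 2
  · have hsh : flagShift i = 3 := by simp [flagShift, hi0]
    refine ⟨_, h1 hi0, etaDet hs (frame e) p (frame e i (Fin.castAdd b 2)) y •
        frame e i (Fin.castAdd b 1) - etaDet hs (frame e) p (frame e i (Fin.castAdd b 1)) y •
        frame e i (Fin.castAdd b 2), sub_mem (Submodule.smul_mem _ _ (hmem 1 (by simp [hsh])))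
      (Submodule.smul_mem _ _ (hmem 2 (by simp [hsh]))), ?_⟩
    simp only [hullVec, if_pos hi0]
    rfl
  by_cases hi2 : i.val = 2
  · have hsh : flagShift i = 1 := by simp [flagShift, hi2]
    refine ⟨_, h2 hi2, -etaB hs (frame e) p y • frame e i (Fin.castAdd b 0), Submodule.smul_mem _ _ (hmem 0 (by simp [hsh])), ?_⟩
    simp only [hullVec, if_neg hi0, if_pos hi2]
    rfl
  by_cases hi3 : i.val = 3
  · have hsh : flagShift i = 1 := by simp [flagShift, hi3]
    refine ⟨_, h3 hi3, -etaA hs (frame e) p y • frame e i (Fin.castAdd b 0), Submodule.smul_mem _ _ (hmem 0 (by simp [hsh])), ?_⟩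
    simp only [hullVec, if_neg hi0, if_neg hi2, if_pos hi3]
    rfl
  · have hi4 : 4 ≤ i.val := by omega
    have hsh : flagShift i = 2 := by simp [flagShift, hi0, show ¬ i.val < 4 by omega]
    refine ⟨_, (h4 hi4).1, etaDet hs (frame e) p (frame e i (Fin.castAdd b 1)) y •
        frame e i (Fin.castAdd b 0) - etaDet hs (frame e) p (frame e i (Fin.castAdd b 0)) y •
        frame e i (Fin.castAdd b 1), sub_mem (Submodule.smul_mem _ _ (hmem 0 (by simp [hsh])))
      (Submodule.smul_mem _ _ (hmem 1 (by simp [hsh]))), ?_⟩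
    simp only [hullVec, if_neg hi0, if_neg hi2, if_neg hi3]
    rfl

/-- For the third and fourth flags one of the two forms vanishes on all members involved, so a
correction by a single vector suffices; the others need a correction by two. -/
lemma eta_hullVec (i : Fin s) (q : Fin b) :
    etaA hs (frame e) p (hullVec hs (frame e) p i q) = 0 ∧
      etaB hs (frame e) p (hullVec hs (frame e) p i q) = 0 := by
  by_cases hi0 : i.val < 2
  · simp only [hullVec, if_pos hi0]
    exact eta_etaSyzygy _ _ _ _ _ _
  by_cases hi2 : i.val = 2
  · obtain rfl : i = Fin.castLE hs 2 := Fin.ext hi2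
    have hz : ∀ j : Fin (4 + b), j.val < b + 2 →
        etaA hs (frame e) p (frame e (Fin.castLE hs 2) j) = 0 := fun j hj =>
      pairForm_right_eq_zero (CompleteFlag.ofBasis_mem (e (Fin.castLE hs 2)) hj) p
    have hsh : flagShift (Fin.castLE hs 2 : Fin s) = 1 := rfl
    simp only [hullVec, if_neg hi0, if_pos hi2, etaA_neg_smul_add, etaB_neg_smul_add]
    rw [hz _ (show q + flagShift (Fin.castLE hs 2 : Fin s) < b + 2 by rw [hsh]; omega),
      hz (Fin.castAdd b 0) (by simp)]
    constructor <;> ring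
  by_cases hi3 : i.val = 3
  · obtain rfl : i = Fin.castLE hs 3 := Fin.ext hi3
    have hz : ∀ j : Fin (4 + b), j.val < b + 2 →
        etaB hs (frame e) p (frame e (Fin.castLE hs 3) j) = 0 := fun j hj =>
      pairForm_right_eq_zero (CompleteFlag.ofBasis_mem (e (Fin.castLE hs 3)) hj) p
    have hsh : flagShift (Fin.castLE hs 3 : Fin s) = 1 := rfl
    simp only [hullVec, if_neg hi0, if_neg hi2, if_pos hi3, etaA_neg_smul_add, etaB_neg_smul_add]
    rw [hz _ (show q + flagShift (Fin.castLE hs 3 : Fin s) < b + 2 by rw [hsh]; omega),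
      hz (Fin.castAdd b 0) (by simp)]
    constructor <;> ring
  · simp only [hullVec, if_neg hi0, if_neg hi2, if_neg hi3]
    exact eta_etaSyzygy _ _ _ _ _ _

variable {C : Fin b → Fin (4 + b) → k} {θ : k}

/-- The kernel of the projection is the span of the first two lines. -/
lemma ker_splitForm (hC : (Matrix.of (splitFrame hs (frame e) C)).det ≠ 0) :
    LinearMap.ker (splitForm hs (frame e) C) = lineSpan hs (frameFlags e) := by
  have hunit := hC.isUnit
  obtain ⟨w, hw⟩ : ∃ w : Basis (Fin (4 + b)) k (Fin (4 + b) → k),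
      ⇑w = splitFrame hs (frame e) C := by
    have h1 := Matrix.linearIndependent_rows_of_det_ne_zero hC
    exact ⟨basisOfLinearIndependentOfCardEqFinrank' _ h1 (by simp), by
      rw [coe_basisOfLinearIndependentOfCardEqFinrank']; rfl⟩
  have hw0 : ∀ j : Fin 4, w (Fin.castAdd b j) = ![firstVec hs (frame e) 0 0,
      firstVec hs (frame e) 0 1, firstVec hs (frame e) 1 0, firstVec hs (frame e) 1 1] j := by
    intro j
    rw [hw, splitFrame, Fin.append_left]
  ext x
  have h2 : x ∈ LinearMap.ker (splitForm hs (frame e) C) ↔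
      ∀ r : Fin b, w.repr x (Fin.natAdd 4 r) = 0 := by
    rw [LinearMap.mem_ker, funext_iff]
    simp only [splitForm, LinearMap.pi_apply, Pi.zero_apply, ← hw, coordForm_basis]
    refine forall_congr' fun r => ?_
    rw [mul_eq_zero, hw]
    exact ⟨fun h => h.resolve_left hC, Or.inr⟩
  rw [h2, mem_lineSpan_iff]
  constructor
  · intro h
    refine ⟨w.repr x (Fin.castAdd b 0), w.repr x (Fin.castAdd b 1), w.repr x (Fin.castAdd b 2),
      w.repr x (Fin.castAdd b 3), ?_⟩
    conv_lhs => rw [← w.sum_repr x]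
    rw [Fin.sum_univ_add]
    simp only [h, zero_smul, Finset.sum_const_zero, add_zero, hw0, Fin.sum_univ_four]
    simp [add_assoc]
  · rintro ⟨α, β, γ, δ, rfl⟩ r
    have h0 : ∀ j : Fin 4, w.repr (w (Fin.castAdd b j)) (Fin.natAdd 4 r) = 0 := fun j => by
      rw [Basis.repr_self, Finsupp.single_eq_of_ne]
      simp [Fin.ext_iff]
      omega
    have e0 := h0 0
    have e1 := h0 1
    have e2 := h0 2
    have e3 := h0 3
    rw [hw0] at e0 e1 e2 e3
    simp only [Matrix.cons_val] at e0 e1 e2 e3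
    simp [e0, e1, e2, e3]

variable (hF : IsTransversal b hs (frameFlags e)) (hc : coeffTwo hs (frame e) ≠ 0)
  (hθ : transversalPoly hs (frame e) θ = 0)
  (hg : goodCond hs (frame e) (pVec hs (frame e) θ) ≠ 0)
include hF hc hθ hg

omit hF hc hθ in
lemma flagCond_ne_zero (i : Fin s) : flagCond hs (frame e) (pVec hs (frame e) θ) i ≠ 0 :=
  Finset.prod_ne_zero_iff.1 (right_ne_zero_of_mul hg) i (Finset.mem_univ _)

lemma hullVec_mem (i : Fin s) (q : Fin b) : hullVec hs (frame e) (pVec hs (frame e) θ) i q ∈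
    (frameFlags e i).space (q + 1 + flagShift i) ⊓ hull b hs (frameFlags e) (lineSol hs (frame e) θ) := by
  constructor
  · obtain ⟨c, -, z, hz, h⟩ := hullVec_eq_add (flagCond_ne_zero hg) i q
    rw [h]
    refine add_mem (Submodule.smul_mem _ _ (CompleteFlag.ofBasis_mem (e i) ?_))
      ((frameFlags e i).mono (by omega) hz)
    change q.val + flagShift i < _
    omega
  · exact (mem_hull_span_iff hF (pVec_mem θ) (pVec_ne_zero hc θ)
      (by rw [transversalForm_pVec, hθ, mul_zero]) _).2 (eta_hullVec i q)

lemma inducedVec_mem {i : Fin s} {G : CompleteFlag k (Fin b → k)}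
    (hG : IsInducedFlag b hs (frameFlags e) (splitForm hs (frame e) C) (lineSol hs (frame e) θ) i G)
    (q : Fin b) : inducedVec hs (frame e) C (pVec hs (frame e) θ) i q ∈ G.space (q + 1) := by
  rcases lt_or_eq_of_le (Nat.succ_le_of_lt q.isLt) with h | h
  · rw [hG _ h]
    exact Submodule.mem_map_of_mem (hullVec_mem hF hc hθ hg i q)
  · rw [G.space_top (by rw [finrank_fin_fun]; exact h.ge)]
    exact Submodule.mem_top

/-- Otherwise the hull vector would differ from a vector of the smaller member by an element of h.
The intersections of h with the two consecutive members coincide, so the hull vector itself would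
lie in the smaller member, against its nonzero leading coefficient. -/
lemma inducedVec_notMem (hC : (Matrix.of (splitFrame hs (frame e) C)).det ≠ 0) {i : Fin s}
    {G : CompleteFlag k (Fin b → k)}
    (hG : IsInducedFlag b hs (frameFlags e) (splitForm hs (frame e) C) (lineSol hs (frame e) θ) i G)
    {q : Fin b} (hq : q.val + 1 < b) :
    inducedVec hs (frame e) C (pVec hs (frame e) θ) i q ∉ G.space q := by
  rw [hG _ (by omega)]
  rintro ⟨y, hy, hyq⟩
  have hh := isLineSolution_lineSol hF hc hθ
  have hgood := isGoodAt_of_goodCond hF hc hθ hg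
  have hmem := hullVec_mem hF hc hθ hg i q
  have hmono := (frameFlags e i).mono (show q.val + flagShift i ≤ q + 1 + flagShift i by omega)
  have hsub : hullVec hs (frame e) (pVec hs (frame e) θ) i q - y ∈
      lineSol hs (frame e) θ ⊓ (frameFlags e i).space (q + 1 + flagShift i) := by
    refine ⟨hgood.inf_le ⟨?_, sub_mem hmem.2 hy.2⟩, sub_mem hmem.1 (hmono hy.1)⟩
    rw [← ker_splitForm hC, SetLike.mem_coe, LinearMap.mem_ker, map_sub, hyq]
    exact sub_self _
  have heq : lineSol hs (frame e) θ ⊓ (frameFlags e i).space (q + flagShift i) =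
      lineSol hs (frame e) θ ⊓ (frameFlags e i).space (q + 1 + flagShift i) := by
    refine Submodule.eq_of_le_of_finrank_eq (inf_le_inf_left _ hmono) ?_
    rw [hgood.finrank_inf_flag hF hh i (show q.val < b by omega), hgood.finrank_inf_flag hF hh i hq]
  rw [← heq] at hsub
  have hcon : hullVec hs (frame e) (pVec hs (frame e) θ) i q ∈
      (frameFlags e i).space (q + flagShift i) := by
    have := add_mem hsub.2 hy.1
    rwa [sub_add_cancel] at this
  obtain ⟨c, hc0, z, hz, h⟩ := hullVec_eq_add (flagCond_ne_zero hg) i q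
  rw [h] at hcon
  have h1 := sub_mem hcon ((frameFlags e i).mono (show flagShift i ≤ q + flagShift i by omega) hz)
  rw [add_sub_cancel_right] at h1
  have h2 := (CompleteFlag.mem_ofBasis_space (e i) _ _).1 h1
    ⟨q + flagShift i, by have := flagShift_le i; omega⟩ le_rfl
  rw [map_smul, Basis.repr_self] at h2
  simp at h2
  exact hc0 h2

/-- The minors of the adapted vectors of an induced flag in the standard cell do not vanish, and
they give the coordinates of the flag. -/
lemma cellMinor_inducedVec_ne_zero (hC : (Matrix.of (splitFrame hs (frame e) C)).det ≠ 0)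
    {i : Fin s} {x : BelowDiag b → k}
    (hG : IsInducedFlag b hs (frameFlags e) (splitForm hs (frame e) C) (lineSol hs (frame e) θ) i
      (cellFlag (Pi.basisFun k (Fin b)) x)) :
    (∀ q : Fin b, q.val + 1 < b →
      cellMinor (inducedVec hs (frame e) C (pVec hs (frame e) θ) i) q q ≠ 0) ∧
    x = fun pq => cellMinor (inducedVec hs (frame e) C (pVec hs (frame e) θ) i) pq.1.2 pq.1.1 /
      cellMinor (inducedVec hs (frame e) C (pVec hs (frame e) θ) i) pq.1.2 pq.1.2 := by
  exact coord_eq_of_notMem (inducedVec_mem hF hc hθ hg hG) fun q hq =>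
    inducedVec_notMem hF hc hθ hg hC hG hq

/-- The induced flags have the coordinates given by the adapted vectors if the relevant minors do
not vanish. -/
lemma isInducedFlag_cellFlag (hC : (Matrix.of (splitFrame hs (frame e) C)).det ≠ 0) {i : Fin s}
    (hne : ∀ q : Fin b, q.val + 1 < b →
      cellMinor (inducedVec hs (frame e) C (pVec hs (frame e) θ) i) q q ≠ 0) :
    IsInducedFlag b hs (frameFlags e) (splitForm hs (frame e) C) (lineSol hs (frame e) θ) i
      (cellFlag (Pi.basisFun k (Fin b)) fun pq =>
        cellMinor (inducedVec hs (frame e) C (pVec hs (frame e) θ) i) pq.1.2 pq.1.1 /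
        cellMinor (inducedVec hs (frame e) C (pVec hs (frame e) θ) i) pq.1.2 pq.1.2) := by
  obtain ⟨G, hG⟩ := exists_isInducedFlag (ker_splitForm hC) (by simp) (by simp) hF
    (isLineSolution_lineSol hF hc hθ) (isGoodAt_of_goodCond hF hc hθ hg) i
  rwa [← exists_cellFlag_eq (inducedVec_mem hF hc hθ hg hG) hne]

end Field

/-! ### The generic frame and its specializations -/

section GenericFrame

variable (s m : ℕ)

/-- The vectors of the generic tuple of flags with unitriangular coordinates. -/
noncomputable def genericFrame (i : Fin s) (q r : Fin m) :
    MvPolynomial (Fin s × BelowDiag m) ℂ :=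
  unitriangular (fun pq => MvPolynomial.X (i, pq)) r q

variable {s m} {k : Type*} [Field k]

lemma frame_cellBasis {b : ℕ} (x : Fin s → BelowDiag (4 + b) → k) :
    frame (fun i => CompleteFlag.cellBasis (Pi.basisFun k (Fin (4 + b))) (x i)) =
      fun i q r => unitriangular (x i) r q := by
  funext i q r
  rw [frame, CompleteFlag.coe_cellBasis, cellVector_basisFun_apply]
  rfl

lemma frameFlags_cellBasis {b : ℕ} (x : Fin s → BelowDiag (4 + b) → k) :
    frameFlags (fun i => CompleteFlag.cellBasis (Pi.basisFun k (Fin (4 + b))) (x i)) =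
      fun i => cellFlag (Pi.basisFun k (Fin (4 + b))) (x i) := by
  funext i
  exact (CompleteFlag.cellFlag_eq_ofBasis _ _).symm

lemma mapFrame_genericFrame {b : ℕ} (φ : MvPolynomial (Fin s × BelowDiag (4 + b)) ℂ →+* k)
    {x : Fin s → BelowDiag (4 + b) → k} (hx : ∀ i pq, φ (MvPolynomial.X (i, pq)) = x i pq) :
    mapFrame (genericFrame s (4 + b)) φ =
      frame fun i => CompleteFlag.cellBasis (Pi.basisFun k (Fin (4 + b))) (x i) := by
  rw [frame_cellBasis]
  funext i q r
  rw [mapFrame, genericFrame, map_unitriangular]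
  congr 1
  funext pq
  exact hx i pq

lemma CompleteFlag.map_map {K V W U : Type*} [Field K] [AddCommGroup V] [Module K V]
    [AddCommGroup W] [Module K W] [AddCommGroup U] [Module K U] (F : CompleteFlag K V)
    (g : V ≃ₗ[K] W) (h : W ≃ₗ[K] U) : (F.map g).map h = F.map (g.trans h) := by
  ext1
  funext j
  simp only [CompleteFlag.map_space, ← Submodule.map_comp]
  rfl

end GenericFrame

/-! ### Four lines without rational transversals -/

section NoSolution

variable {k Q A : Type*} [Field k] [AddCommGroup Q] [Module k Q] [FiniteDimensional k Q]
  [AddCommGroup A] [Module k A] [FiniteDimensional k A] {b s : ℕ} {hs : 4 ≤ s}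
  {Θ : A ≃ₗ[k] (Fin 4 → k) × Q} {G : Fin s → CompleteFlag k Q}

lemma disjoint_twisted {w : k} (hw : w ≠ 0) (E : Fin 4 → CompleteFlag k (Fin 4 → k))
    (hE : E = ![stdFlag k, oppFlag k, graphFlag 1 0 0 1, graphFlag 0 w 1 0]) :
    Disjoint ((E 0).space 2) ((E 1).space 2) ∧ Disjoint ((E 2).space 2) ((E 0).space 2) ∧
    Disjoint ((E 2).space 2) ((E 1).space 2) ∧ Disjoint ((E 3).space 2) ((E 0).space 2) ∧
    Disjoint ((E 3).space 2) ((E 1).space 2) := by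
  have hext : ∀ x : Fin 4 → k, x 0 = 0 → x 1 = 0 → x 2 = 0 → x 3 = 0 → x = 0 := by
    intro x h0 h1 h2 h3
    funext i
    fin_cases i <;> assumption
  subst hE
  simp only [Submodule.disjoint_def, Matrix.cons_val, mem_stdFlag, mem_oppFlag, mem_graphFlag]
  refine ⟨?_, ?_, ?_, ?_, ?_⟩
  · rintro x ⟨h2, h3⟩ ⟨h0, h1⟩
    exact hext x h0 h1 h2 h3
  · rintro x ⟨h2, h3⟩ ⟨h0, h1⟩
    exact hext x (by simpa [h0] using h2.symm) (by simpa [h1] using h3.symm) h0 h1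
  · rintro x ⟨h2, h3⟩ ⟨h0, h1⟩
    exact hext x h0 h1 (by simpa [h0] using h2) (by simpa [h1] using h3)
  · rintro x ⟨h2, h3⟩ ⟨h0, h1⟩
    rw [h0] at h2
    rw [h1] at h3
    exact hext x (by simpa using h3.symm) (by simpa [hw] using h2.symm) h0 h1
  · rintro x ⟨h2, h3⟩ ⟨h0, h1⟩
    exact hext x h0 h1 (by simpa [h1] using h2) (by simpa [h0] using h3)

/-- Four lines whose common transversals are the eigenspaces of a matrix with characteristic
polynomial `X² - w`. -/
lemma isSquare_of_isLineSolution (hQ : finrank k Q = b) {w : k} (hw : w ≠ 0) {h : Submodule k A}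
    (hh : IsLineSolution b hs (assembleAt Θ
      ![stdFlag k, oppFlag k, graphFlag 1 0 0 1, graphFlag 0 w 1 0] G 0 0) h) : IsSquare w := by
  obtain ⟨h01, h20, h21, h30, h31⟩ := disjoint_twisted hw _ rfl
  have hF : IsTransversal b hs (assembleAt Θ
      ![stdFlag k, oppFlag k, graphFlag 1 0 0 1, graphFlag 0 w 1 0] G 0 0) :=
    isTransversal_assembleAt hQ h01 h20 h21 h30 h31
  set F := assembleAt Θ ![stdFlag k, oppFlag k, graphFlag 1 0 0 1, graphFlag 0 w 1 0] G 0 0 with hFdef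
  obtain ⟨p, ⟨hph, hp⟩, hp0⟩ := Submodule.exists_mem_ne_zero_of_ne_bot
    (fun e => hh.meet0 (disjoint_iff.2 e))
  obtain ⟨q, ⟨hqh, hq⟩, hq0⟩ := Submodule.exists_mem_ne_zero_of_ne_bot
    (fun e => hh.meet1 (disjoint_iff.2 e))
  obtain ⟨x, ⟨hxh, hx⟩, hx0⟩ := Submodule.exists_mem_ne_zero_of_ne_bot
    (fun e => hh.meet2 (disjoint_iff.2 e))
  obtain ⟨y, ⟨hyh, hy⟩, hy0⟩ := Submodule.exists_mem_ne_zero_of_ne_bot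
    (fun e => hh.meet3 (disjoint_iff.2 e))
  have hd : Disjoint ((F (Fin.castLE hs 0)).space 2) ((F (Fin.castLE hs 1)).space 2) :=
    hF.disj01.mono_left ((F _).mono (show 2 ≤ b + 2 by omega))
  have hspan : Submodule.span k {p, q} = h := by
    apply Submodule.eq_of_le_of_finrank_eq
    · rw [Submodule.span_le]
      rintro z (rfl | rfl) <;> assumption
    · have hli : LinearIndependent k ![p, q] := by
        rw [LinearIndependent.pair_iff]
        intro α γ h0
        have h1 : α • p = 0 := Submodule.disjoint_def.1 hd _ (Submodule.smul_mem _ _ hp) (by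
          rw [eq_neg_of_add_eq_zero_left h0]
          exact Submodule.neg_mem _ (Submodule.smul_mem _ _ hq))
        rw [h1, zero_add] at h0
        exact ⟨(smul_eq_zero.1 h1).resolve_right hp0, (smul_eq_zero.1 h0).resolve_right hq0⟩
      have := finrank_span_eq_card hli
      rw [Matrix.range_cons, Matrix.range_cons, Matrix.range_empty, Set.union_empty,
        Set.singleton_union, Fintype.card_fin] at this
      rw [this, hh.finrank_eq]
  rw [SetLike.mem_coe, hFdef, mem_assembleAt_two hQ (by decide)] at hp hq
  rw [SetLike.mem_coe, hFdef, mem_assembleAt_add_two hQ] at hx hy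
  simp only [Pi.zero_apply, smul_zero, sub_zero, Matrix.cons_val, mem_stdFlag, mem_oppFlag,
    mem_graphFlag, one_mul, zero_mul, add_zero, zero_add] at hp hq hx hy
  obtain ⟨hpl, hp2, hp3⟩ := hp
  obtain ⟨hql, hq0', hq1⟩ := hq
  have hp' : ¬ ((Θ p).1 0 = 0 ∧ (Θ p).1 1 = 0) := by
    rintro ⟨e0, e1⟩
    refine hp0 (Θ.map_eq_zero_iff.1 (Prod.ext (funext fun j => ?_) hpl))
    fin_cases j <;> assumption
  have hq' : ¬ ((Θ q).1 2 = 0 ∧ (Θ q).1 3 = 0) := by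
    rintro ⟨e2, e3⟩
    refine hq0 (Θ.map_eq_zero_iff.1 (Prod.ext (funext fun j => ?_) hql))
    fin_cases j <;> assumption
  rw [← hspan] at hxh hyh
  obtain ⟨α, β, rfl⟩ := Submodule.mem_span_pair.1 hxh
  obtain ⟨α', β', rfl⟩ := Submodule.mem_span_pair.1 hyh
  simp only [map_add, map_smul, Prod.fst_add, Prod.smul_fst, Pi.add_apply, Pi.smul_apply,
    smul_eq_mul, hp2, hp3, hq0', hq1, mul_zero, add_zero, zero_add] at hx hy
  have hα : α ≠ 0 := by
    rintro rfl
    rcases eq_or_ne β 0 with rfl | hβ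
    · simp at hx0
    · exact hq' ⟨by simpa [hβ] using hx.1, by simpa [hβ] using hx.2⟩
  have hα' : α' ≠ 0 := by
    rintro rfl
    rcases eq_or_ne β' 0 with rfl | hβ
    · simp at hy0
    · exact hq' ⟨by simpa [hβ] using hy.1, by simpa [hβ] using hy.2⟩
  have hβ : β ≠ 0 := by
    rintro rfl
    exact hp' ⟨by simpa [hα, eq_comm] using hx.1, by simpa [hα, eq_comm] using hx.2⟩
  obtain ⟨hx1, hx2⟩ := hx
  obtain ⟨hy1, hy2⟩ := hy
  -- The third line identifies q with a multiple of p. The fourth then says that p is an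
  -- eigenvector, whose eigenvalue is a square root of w.
  have hc : (Θ q).1 2 = α / β * (Θ p).1 0 := by field_simp; linear_combination hx1
  have hd' : (Θ q).1 3 = α / β * (Θ p).1 1 := by field_simp; linear_combination hx2
  rw [hc] at hy1
  rw [hd'] at hy2
  have h1 : w * (Θ p).1 1 = β' * α / (α' * β) * (Θ p).1 0 := by
    field_simp
    field_simp at hy1
    linear_combination -hy1
  have h2 : (Θ p).1 0 = β' * α / (α' * β) * (Θ p).1 1 := by
    field_simp
    field_simp at hy2
    linear_combination -hy2
  have hp1 : (Θ p).1 1 ≠ 0 := fun h0 => hp' ⟨by rw [h2, h0, mul_zero], h0⟩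
  refine ⟨β' * α / (α' * β), mul_right_cancel₀ hp1 ?_⟩
  rw [h1, mul_assoc, ← h2]

end NoSolution

section Split

/-- The splitting of a coordinate space of dimension `4 + b` into the first four and the last `b`
coordinates. -/
def splitEquiv (k : Type*) [Field k] (b : ℕ) :
    (Fin (4 + b) → k) ≃ₗ[k] (Fin 4 → k) × (Fin b → k) where
  toFun x := (fun i => x (Fin.castAdd b i), fun j => x (Fin.natAdd 4 j))
  invFun y := Fin.append y.1 y.2
  map_add' _ _ := rfl
  map_smul' _ _ := rfl
  left_inv x := by
    funext i
    refine Fin.addCases (fun i => ?_) (fun i => ?_) i <;> simp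
  right_inv y := by
    ext i <;> simp

end Split

/-! ### Irrationality of the generic transversals -/

section NoRoot

variable {b s : ℕ} (hs : 4 ≤ s)

/-- In X q² = p² the degrees have different parity. -/
lemma not_isSquare_X {k : Type*} [Field k] :
    ¬ IsSquare (algebraMap (Polynomial k) (FractionRing (Polynomial k)) Polynomial.X) := by
  rintro ⟨u, hu⟩
  obtain ⟨p, q, hq, rfl⟩ := IsFractionRing.div_surjective (A := Polynomial k) u
  have hq0 : q ≠ 0 := nonZeroDivisors.ne_zero hq
  have hq0' : algebraMap (Polynomial k) (FractionRing (Polynomial k)) q ≠ 0 := by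
    rwa [Ne, FaithfulSMul.algebraMap_eq_zero_iff]
  rw [div_mul_div_comm, eq_div_iff (mul_ne_zero hq0' hq0'), ← map_mul, ← map_mul, ← map_mul] at hu
  have h := congrArg Polynomial.natDegree (FaithfulSMul.algebraMap_injective _ _ hu)
  have hp0 : p ≠ 0 := by
    rintro rfl
    have h0 := FaithfulSMul.algebraMap_injective _ _ hu
    rw [mul_zero] at h0
    exact mul_ne_zero Polynomial.X_ne_zero (mul_ne_zero hq0 hq0) h0
  rw [Polynomial.natDegree_mul Polynomial.X_ne_zero (mul_ne_zero hq0 hq0),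
    Polynomial.natDegree_mul hq0 hq0, Polynomial.natDegree_mul hp0 hp0, Polynomial.natDegree_X] at h
  omega

/-- The common transversals of the generic lines are not rational over the function field. -/
theorem transversalPoly_generic_ne_zero (K : Type*) [Field K]
    [Algebra (MvPolynomial (Fin s × BelowDiag (4 + b)) ℂ) K]
    [IsFractionRing (MvPolynomial (Fin s × BelowDiag (4 + b)) ℂ) K] (θ : K) :
    transversalPoly hs (mapFrame (genericFrame s (4 + b))
      (algebraMap (MvPolynomial (Fin s × BelowDiag (4 + b)) ℂ) K)) θ ≠ 0 := by
  intro h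
  -- A rational root would be integral, hence a polynomial in the coordinates, so it could be
  -- specialized without denominators to a root for any particular flags.
  have hint : IsIntegral (MvPolynomial (Fin s × BelowDiag (4 + b)) ℂ) θ := by
    refine ⟨lineQuadratic hs (genericFrame s (4 + b)), lineQuadratic_monic hs _, ?_⟩
    rw [← Polynomial.eval_map, map_lineQuadratic, eval_lineQuadratic, h]
  obtain ⟨r, rfl⟩ := IsIntegrallyClosed.isIntegral_iff.1 hint
  rw [← map_transversalPoly, FaithfulSMul.algebraMap_eq_zero_iff] at h
  let k := FractionRing (Polynomial ℂ)
  let w : k := algebraMap (Polynomial ℂ) k Polynomial.X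
  have hw : w ≠ 0 := fun h0 => not_isSquare_X (k := ℂ) ⟨0, by rw [mul_zero]; exact h0⟩
  let G : Fin s → CompleteFlag k (Fin b → k) := fun _ => Classical.arbitrary _
  let E : Fin 4 → CompleteFlag k (Fin 4 → k) :=
    ![stdFlag k, oppFlag k, graphFlag 1 0 0 1, graphFlag 0 w 1 0]
  -- The test flags over ℂ(X) must be moved into the standard cell to become a specialization of the
  -- generic ones.
  obtain ⟨A, γ, -, hγ, -⟩ := exists_matrix_map_eq_cellFlag (m := 4 + b) ℂ
    (fun i : Fin s => assembleAt (splitEquiv k b) E G 0 0 i) (t := 0) (fun j => j.elim0)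
    (fun j => j.elim0) (Fin.castAdd b 0)
  choose x hx using hγ
  let Θ := γ.symm.trans (splitEquiv k b)
  have hFΘ : (fun i => cellFlag (Pi.basisFun k (Fin (4 + b))) (x i)) = assembleAt Θ E G 0 0 := by
    funext i
    rw [← hx i, assembleAt, CompleteFlag.map_map]
    rfl
  rw [← frameFlags_cellBasis] at hFΘ
  let φ : MvPolynomial (Fin s × BelowDiag (4 + b)) ℂ →+* k :=
    MvPolynomial.eval₂Hom (algebraMap ℂ k) fun ipq => x ipq.1 ipq.2
  have hfr := mapFrame_genericFrame φ (x := x) fun i pq => by simp [φ]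
  have hr := congrArg φ h
  rw [map_transversalPoly, map_zero, hfr] at hr
  obtain ⟨h01, h20, h21, h30, h31⟩ := disjoint_twisted hw E rfl
  have hF : IsTransversal b hs (frameFlags fun i =>
      CompleteFlag.cellBasis (Pi.basisFun k (Fin (4 + b))) (x i)) := by
    rw [hFΘ]
    exact isTransversal_assembleAt (by simp) h01 h20 h21 h30 h31
  have hno : ∀ g, ¬ IsLineSolution b hs (frameFlags fun i =>
      CompleteFlag.cellBasis (Pi.basisFun k (Fin (4 + b))) (x i)) g := by
    intro g hg
    rw [hFΘ] at hg
    exact not_isSquare_X (isSquare_of_isLineSolution (by simp) hw hg)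
  exact hno _ (isLineSolution_lineSol hF (coeffTwo_ne_zero hF fun g hg => absurd hg (hno g)) hr)

end NoRoot

/-! ### Specializations with prescribed induced flags -/

section Section

variable {k : Type*} [Field k] {b s : ℕ} {hs : 4 ≤ s}

lemma det_splitFrame_ne_zero {e : Fin s → Basis (Fin (4 + b)) k (Fin (4 + b) → k)}
    (hd : Disjoint ((frameFlags e (Fin.castLE hs 0)).space 2)
      ((frameFlags e (Fin.castLE hs 1)).space 2))
    {ρ : (Fin (4 + b) → k) →ₗ[k] (Fin b → k)} {C : Fin b → Fin (4 + b) → k}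
    (hρ : ∀ x ∈ lineSpan hs (frameFlags e), ρ x = 0) (hC : ∀ r, ρ (C r) = Pi.single r 1) :
    (Matrix.of (splitFrame hs (frame e) C)).det ≠ 0 := by
  intro h0
  obtain ⟨v, hv0, hv⟩ := Matrix.exists_vecMul_eq_zero_iff.2 h0
  have hsum : ∑ q, v q • splitFrame hs (frame e) C q = 0 := by
    rw [← hv]
    funext j
    simp [Matrix.vecMul, dotProduct]
  rw [Fin.sum_univ_add] at hsum
  simp only [splitFrame, Fin.append_left, Fin.append_right, Fin.sum_univ_four,
    Matrix.cons_val] at hsum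
  have hmem : v (Fin.castAdd b 0) • firstVec hs (frame e) 0 0 +
      v (Fin.castAdd b 1) • firstVec hs (frame e) 0 1 +
      v (Fin.castAdd b 2) • firstVec hs (frame e) 1 0 +
      v (Fin.castAdd b 3) • firstVec hs (frame e) 1 1 ∈ lineSpan hs (frameFlags e) :=
    (mem_lineSpan_iff _).2 ⟨_, _, _, _, by rw [add_assoc]⟩
  have hr : ∀ r, v (Fin.natAdd 4 r) = 0 := by
    intro r
    have h1 := congrFun (congrArg ρ hsum) r
    rw [map_add, hρ _ hmem, map_sum] at h1
    simpa [hC, Pi.single_apply] using h1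
  simp only [hr, zero_smul, Finset.sum_const_zero, add_zero] at hsum
  rw [add_assoc] at hsum
  have h1 : v (Fin.castAdd b 0) • firstVec hs (frame e) 0 0 +
      v (Fin.castAdd b 1) • firstVec hs (frame e) 0 1 = 0 := by
    refine Submodule.disjoint_def.1 hd _ ((mem_line_iff 0 _).2 ⟨_, _, rfl⟩) ?_
    rw [eq_neg_of_add_eq_zero_left hsum]
    exact Submodule.neg_mem _ ((mem_line_iff 1 _).2 ⟨_, _, rfl⟩)
  rw [h1, zero_add] at hsum
  obtain ⟨e0, e1⟩ := eq_zero_of_firstVec 0 h1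
  obtain ⟨e2, e3⟩ := eq_zero_of_firstVec 1 hsum
  refine hv0 (funext fun q => ?_)
  refine Fin.addCases (fun q => ?_) hr q
  fin_cases q <;> assumption

lemma splitForm_self {f : Fin s → Fin (4 + b) → Fin (4 + b) → k} {C : Fin b → Fin (4 + b) → k}
    (hC : (Matrix.of (splitFrame hs f C)).det ≠ 0) (r : Fin b) :
    splitForm hs f C (C r) = (Matrix.of (splitFrame hs f C)).det • Pi.single r 1 := by
  obtain ⟨w, hw⟩ : ∃ w : Basis (Fin (4 + b)) k (Fin (4 + b) → k), ⇑w = splitFrame hs f C := by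
    have h1 := Matrix.linearIndependent_rows_of_det_ne_zero hC
    exact ⟨basisOfLinearIndependentOfCardEqFinrank' _ h1 (by simp), by
      rw [coe_basisOfLinearIndependentOfCardEqFinrank']; rfl⟩
  have hr : C r = w (Fin.natAdd 4 r) := by rw [hw, splitFrame, Fin.append_right]
  funext j
  rw [splitForm, LinearMap.pi_apply, ← hw, coordForm_basis, hr, Basis.repr_self]
  simp [Pi.single_apply, Finsupp.single_apply, eq_comm]

/-- Both maps vanish on the span of the first two lines and are proportional, with the determinant
as factor, on the complement C. -/
lemma splitForm_eq_smul {e : Fin s → Basis (Fin (4 + b)) k (Fin (4 + b) → k)}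
    {ρ : (Fin (4 + b) → k) →ₗ[k] (Fin b → k)} {C : Fin b → Fin (4 + b) → k}
    (hρ : ∀ x, x ∈ lineSpan hs (frameFlags e) ↔ ρ x = 0) (hC : ∀ r, ρ (C r) = Pi.single r 1)
    (hdet : (Matrix.of (splitFrame hs (frame e) C)).det ≠ 0) :
    splitForm hs (frame e) C = (Matrix.of (splitFrame hs (frame e) C)).det • ρ := by
  refine LinearMap.ext fun x => ?_
  have hx : x - ∑ r, ρ x r • C r ∈ lineSpan hs (frameFlags e) := by
    rw [hρ, map_sub, map_sum, sub_eq_zero]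
    funext j
    simp [hC, Pi.single_apply]
  rw [← ker_splitForm hdet, LinearMap.mem_ker, map_sub, sub_eq_zero] at hx
  rw [hx, map_sum]
  funext j
  simp [splitForm_self hdet, Pi.single_apply, mul_comm]

lemma IsInducedFlag.smul {F : Fin s → CompleteFlag k (Fin (4 + b) → k)}
    {π : (Fin (4 + b) → k) →ₗ[k] (Fin b → k)} {h : Submodule k (Fin (4 + b) → k)} {i : Fin s}
    {G : CompleteFlag k (Fin b → k)} (hG : IsInducedFlag b hs F π h i G) {c : k} (hc : c ≠ 0) :
    IsInducedFlag b hs F (c • π) h i G := fun d hd => by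
  rw [hG d hd, Submodule.map_smul _ _ _ hc]

/-- A vector of the plane with one coordinate zero is a multiple of an axis vector; ξ vanishes at u
but not on the axes. -/
lemma notMem_coordPlane {Q A : Type*} [AddCommGroup Q] [Module k Q] [AddCommGroup A] [Module k A]
    {Θ : A ≃ₗ[k] (Fin 4 → k) × Q} {a c : Fin 4} (hac : a ≠ c) {u : A} (hu : u ≠ 0)
    {ξ : A →ₗ[k] k} (hξ : ξ u = 0) (hΘ : ∀ j, ξ (Θ.symm (Pi.single j 1, 0)) ≠ 0)
    (h0 : (Θ u).1 c = 0) : u ∉ coordPlane Θ a c := by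
  intro h
  obtain ⟨h2, h1⟩ := (mem_coordPlane hac).1 h
  have he : Θ u = (Θ u).1 a • (Pi.single a 1, (0 : Q)) := by
    refine Prod.ext (funext fun j => ?_) (by simp [h2])
    by_cases hj : j = a
    · subst hj; simp
    · by_cases hjc : j = c
      · subst hjc; simp [h0, hj]
      · simp [h1 j hj hjc, hj]
  have hu' : u = (Θ u).1 a • Θ.symm (Pi.single a 1, (0 : Q)) := by
    rw [← map_smul, ← he, LinearEquiv.symm_apply_apply]
  rw [hu', map_smul, smul_eq_mul, mul_eq_zero] at hξ
  refine hu ?_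
  rw [hu', hξ.resolve_right (hΘ a), zero_smul]

lemma coeffTwo_ne_zero_of_genCond {R : Type*} [CommRing R] {f : Fin s → Fin (4 + b) → Fin (4 + b) → R}
    (h : genCond hs f ≠ 0) : coeffTwo hs f ≠ 0 := by
  intro h0
  rw [genCond, staticCond, h0, zero_mul, mul_zero, zero_mul] at h
  exact h rfl

/-- Every tuple of flags with unitriangular coordinates is induced on the quotient by the span of
the first two lines by a tuple of flags with unitriangular coordinates, for a complement of this
span which is defined over the base field. -/
theorem exists_specialization [CharZero k] [Algebra ℂ k] (hs : 4 ≤ s) (hb : 0 < b)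
    (y : Fin s → BelowDiag b → k) :
    ∃ (x : Fin s × BelowDiag (4 + b) → k) (θ : k) (C : Fin b → Fin (4 + b) → ℂ),
      let f := mapFrame (genericFrame s (4 + b)) (MvPolynomial.aeval (R := ℂ) x).toRingHom
      let g := inducedVec hs f (fun r j => algebraMap ℂ k (C r j)) (pVec hs f θ)
      genCond hs f ≠ 0 ∧ transversalPoly hs f θ = 0 ∧
      (Matrix.of (splitFrame hs f fun r j => algebraMap ℂ k (C r j))).det ≠ 0 ∧
      ∀ i, (∀ q : Fin b, q.val + 1 < b → cellMinor (g i) q q ≠ 0) ∧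
        y i = fun pq => cellMinor (g i) pq.1.2 pq.1.1 / cellMinor (g i) pq.1.2 pq.1.2 := by
  have hE := isNormalForm_explicit (k := k)
  obtain ⟨F, hF⟩ := exists_isRealization (A := Fin (4 + b) → k) (Q := Fin b → k) hs hb (by simp)
    hE (fun i => cellFlag (Pi.basisFun k (Fin b)) (y i))
  -- A complex matrix brings the realization into the standard cell. In addition it gives the four
  -- axis vectors a nonzero coordinate at index 0.
  obtain ⟨A, γ, hA, hγ, hv⟩ := exists_matrix_map_eq_cellFlag ℂ
    (fun i => (F i).map (splitEquiv k b).symm)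
    (fun j : Fin 4 => (splitEquiv k b).symm (Pi.single j 1, 0)) (fun j => by simp)
    (Fin.castAdd b 0)
  choose x hx using hγ
  let Θ := γ.symm.trans (splitEquiv k b)
  have hFx : (fun i => (F i).map Θ.symm) =
      frameFlags fun i => CompleteFlag.cellBasis (Pi.basisFun k (Fin (4 + b))) (x i) := by
    rw [frameFlags_cellBasis]
    funext i
    rw [← hx i, CompleteFlag.map_map]
    rfl
  have H := hF Θ
  rw [hFx] at H
  have hfr := mapFrame_genericFrame (b := b) (s := s)
    (MvPolynomial.aeval (R := ℂ) fun ipq : Fin s × BelowDiag (4 + b) => x ipq.1 ipq.2).toRingHom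
    (x := x) fun i pq => by simp
  set e := fun i => CompleteFlag.cellBasis (Pi.basisFun k (Fin (4 + b))) (x i) with he
  -- The second vector of a unitriangular basis has zero coordinate at index 0, in contrast to the
  -- axis vectors; this keeps it off both transversals.
  have hvec : ∀ i : Fin 4, firstVec hs (frame e) i 1 ≠ 0 ∧
      LinearMap.proj (R := k) (φ := fun _ => k) (Fin.castAdd b 0) (firstVec hs (frame e) i 1) = 0 := by
    intro i
    refine ⟨(e (Fin.castLE hs i)).ne_zero _, ?_⟩
    rw [he, frame_cellBasis]
    simp [firstVec, unitriangular, Fin.lt_def]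
  have hΘ : ∀ j, LinearMap.proj (R := k) (φ := fun _ => k) (Fin.castAdd b 0)
      (Θ.symm (Pi.single j 1, (0 : Fin b → k))) ≠ 0 := hv
  have hu : ∀ j, (Θ (firstVec hs (frame e) 0 1)).1 j = 0 ∨ j = 0 ∨ j = 1 := by
    have h := (firstVec_mem (hs := hs) (e := e) 0).2
    have h2 : (Θ (firstVec hs (frame e) 0 1)).2 = 0 :=
      (H.mem_lineSpan _).1 ((mem_lineSpan_iff _).2 ⟨0, 1, 0, 0, by simp⟩)
    have h3 := (hE.mem_zero _).1 ((H.mem_lineIdx 0 2 _ h2).1 h)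
    intro j
    fin_cases j <;> simp [h3.1, h3.2]
  have hw : ∀ j, (Θ (firstVec hs (frame e) 1 1)).1 j = 0 ∨ j = 2 ∨ j = 3 := by
    have h := (firstVec_mem (hs := hs) (e := e) 1).2
    have h2 : (Θ (firstVec hs (frame e) 1 1)).2 = 0 :=
      (H.mem_lineSpan _).1 ((mem_lineSpan_iff _).2 ⟨0, 0, 0, 1, by simp⟩)
    have h3 := (hE.mem_one _).1 ((H.mem_lineIdx 1 2 _ h2).1 h)
    intro j
    fin_cases j <;> simp [h3.1, h3.2]
  have hcomm : ∀ a c : Fin 4, coordPlane Θ a c = coordPlane Θ c a := by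
    intro a c
    rw [coordPlane, Set.pair_comm, coordPlane]
  have hne : coordPlane Θ 0 2 ≠ coordPlane Θ 1 3 := by
    intro h
    have h0 : Θ.symm (Pi.single 0 1, (0 : Fin b → k)) ∈ coordPlane Θ 1 3 :=
      h ▸ Submodule.subset_span (Set.mem_insert _ _)
    simpa using ((mem_coordPlane (by decide)).1 h0).2 0 (by decide) (by decide)
  obtain ⟨θ, θ', h1, h2, h3, h4, h5⟩ := genCond_ne_zero H.isTransversal H.isLineSolution
    H.isLineSolution' hne H.eq_or_eq H.isGoodAt H.isGoodAt'
    (notMem_coordPlane (by decide) (hvec 0).1 (hvec 0).2 hΘ ((hu 2).resolve_right (by decide)))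
    (notMem_coordPlane (by decide) (hvec 0).1 (hvec 0).2 hΘ ((hu 3).resolve_right (by decide)))
    (hcomm 0 2 ▸ notMem_coordPlane (by decide) (hvec 1).1 (hvec 1).2 hΘ
      ((hw 0).resolve_right (by decide)))
    (hcomm 1 3 ▸ notMem_coordPlane (by decide) (hvec 1).1 (hvec 1).2 hΘ
      ((hw 1).resolve_right (by decide)))
  have hc : coeffTwo hs (frame e) ≠ 0 := coeffTwo_ne_zero_of_genCond h5
  have hθ : transversalPoly hs (frame e) θ = 0 := by
    rw [transversalPoly, ← h2]; linear_combination θ * (h1)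
  let ρ : (Fin (4 + b) → k) →ₗ[k] (Fin b → k) := LinearMap.snd k (Fin 4 → k) (Fin b → k) ∘ₗ Θ.toLinearMap
  have hρ : ∀ x, x ∈ lineSpan hs (frameFlags e) ↔ ρ x = 0 := H.mem_lineSpan
  -- The complement is the image of the last b coordinate vectors under γ, and its entries are
  -- complex because those of the matrix are.
  let C : Fin b → Fin (4 + b) → ℂ := fun r j => A j (Fin.natAdd 4 r)
  have hCγ : ∀ r, (fun j => algebraMap ℂ k (C r j)) = γ (Pi.single (Fin.natAdd 4 r) 1) := by
    intro r
    funext j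
    rw [hA]
    simp [C, Pi.single_apply]
  have hC : ∀ r, ρ (fun j => algebraMap ℂ k (C r j)) = Pi.single r 1 := by
    intro r
    rw [hCγ]
    simp only [ρ, Θ, LinearMap.comp_apply, LinearEquiv.coe_coe, LinearEquiv.trans_apply,
      LinearEquiv.symm_apply_apply]
    funext j
    simp [splitEquiv, Pi.single_apply]
  have hdet := det_splitFrame_ne_zero (disj_lines H.isTransversal) (fun x => (hρ x).1) hC
  have hgc : goodCond hs (frame e) (pVec hs (frame e) θ) ≠ 0 := by
    intro h0
    apply h5
    rw [genCond, normCond_eq_mul hs _ h1 h2, h0, zero_mul, mul_zero]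
  refine ⟨fun ipq => x ipq.1 ipq.2, θ, C, ?_⟩
  dsimp only
  rw [hfr]
  refine ⟨h5, hθ, hdet, fun i => ?_⟩
  refine cellMinor_inducedVec_ne_zero H.isTransversal hc hθ hgc hdet ?_
  rw [splitForm_eq_smul hρ hC hdet, ← h3]
  exact (H.isInducedFlag i).smul hdet

end Section

/-! ### Lifting of automorphisms to regular extensions -/

section Lift

variable {K₁ C₁ F L : Type*} [Field K₁] [Field C₁] [Field F] [Field L] [Algebra K₁ C₁]
  [Algebra F L] [Algebra K₁ F] [Algebra C₁ L] [Algebra K₁ L] [IsScalarTower K₁ F L]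
  [IsScalarTower K₁ C₁ L]

variable (K₁ C₁ F L) in
/-- Restriction of automorphisms from `L / F` to the normal extension `C₁ / K₁`. -/
noncomputable def restrictGalois [Normal K₁ C₁] : (L ≃ₐ[F] L) →* (C₁ ≃ₐ[K₁] C₁) :=
  (AlgEquiv.restrictNormalHom (F := K₁) (K₁ := L) C₁).comp (AlgEquiv.restrictScalarsHom K₁)

lemma algebraMap_restrictGalois [Normal K₁ C₁] (σ : L ≃ₐ[F] L) (c : C₁) :
    algebraMap C₁ L (restrictGalois K₁ C₁ F L σ c) = σ (algebraMap C₁ L c) :=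
  AlgEquiv.restrictNormal_commutes (σ.restrictScalars K₁) C₁ c

lemma continuous_restrictGalois [IsGalois F L] [IsGalois K₁ C₁] :
    Continuous (restrictGalois K₁ C₁ F L) := by
  apply continuous_of_continuousAt_one _ (continuousAt_def.mpr _)
  intro N hN
  rw [map_one, krullTopology_mem_nhds_one_iff] at hN
  obtain ⟨E, hE, hEN⟩ := hN
  rw [krullTopology_mem_nhds_one_iff]
  obtain ⟨t, ht⟩ := IntermediateField.essFiniteType_iff.1 (inferInstance : Algebra.EssFiniteType K₁ E)
  refine ⟨IntermediateField.adjoin F (algebraMap C₁ L '' t), ?_, fun σ hσ => hEN ?_⟩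
  · have := (t.finite_toSet.image (algebraMap C₁ L)).to_subtype
    exact IntermediateField.finiteDimensional_adjoin fun x _ => Algebra.IsIntegral.isIntegral x
  · rw [SetLike.mem_coe, ← Subgroup.zpowers_le, ← IntermediateField.le_iff_le, ← ht,
      IntermediateField.adjoin_le_iff]
    intro c hc
    rintro ⟨g, hg⟩
    obtain ⟨n, rfl⟩ := Subgroup.mem_zpowers_iff.1 hg
    have h1 : restrictGalois K₁ C₁ F L σ c = c := by
      apply (algebraMap C₁ L).injective
      rw [algebraMap_restrictGalois]
      exact (IntermediateField.mem_fixingSubgroup_iff _ _).1 hσ _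
        (IntermediateField.subset_adjoin _ _ ⟨c, hc, rfl⟩)
    exact (Subgroup.zpowers_le.2 (show _ ∈ MulAction.stabilizer (C₁ ≃ₐ[K₁] C₁) c from h1) hg :)

/-- Automorphisms lift to extensions in which the base field is algebraically closed. -/
theorem exists_algEquiv_lift [IsGalois F L] [IsGalois K₁ C₁]
    (hreg : ∀ c : C₁, algebraMap C₁ L c ∈ (algebraMap F L).range → c ∈ (algebraMap K₁ C₁).range)
    (τ : C₁ ≃ₐ[K₁] C₁) :
    ∃ σ : L ≃ₐ[F] L, ∀ c, σ (algebraMap C₁ L c) = algebraMap C₁ L (τ c) := by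
  -- The image of restriction is compact, hence closed. By regularity its fixed field is K₁, so by
  -- infinite Galois theory it is the whole group.
  let H : ClosedSubgroup (C₁ ≃ₐ[K₁] C₁) :=
    ⟨(restrictGalois K₁ C₁ F L).range, by
      have := (isCompact_range (continuous_restrictGalois (K₁ := K₁) (C₁ := C₁) (F := F) (L := L))).isClosed
      exact this⟩
  have hbot : IntermediateField.fixedField H.1 = ⊥ := by
    rw [eq_bot_iff]
    intro c hc
    rw [IntermediateField.mem_bot]
    apply hreg
    rw [RingHom.mem_range]
    apply (InfiniteGalois.mem_range_algebraMap_iff_fixed _).2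
    intro σ
    rw [← algebraMap_restrictGalois (K₁ := K₁)]
    congr 1
    exact hc ⟨_, σ, rfl⟩
  have htop := InfiniteGalois.fixingSubgroup_fixedField H
  rw [hbot, IntermediateField.fixingSubgroup_bot] at htop
  have hτ : τ ∈ H.1 := htop ▸ Subgroup.mem_top τ
  obtain ⟨σ, rfl⟩ := hτ
  exact ⟨σ, fun c => (algebraMap_restrictGalois σ c).symm⟩

end Lift

/-! ### Places of quadratic extensions -/

section Regular

variable {R K L : Type*} [CommRing R] [IsDomain R] [IsIntegrallyClosed R] [Field K] [Algebra R K]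
  [IsFractionRing R K] [Field L] [Algebra K L] [Algebra R L] [IsScalarTower R K L] [IsGalois K L]

omit [IsDomain R] [IsIntegrallyClosed R] [IsFractionRing R K] in
-- Every conjugate of θ is a root of the same quadratic polynomial. If none of them were θ', then θ
-- would be fixed by the whole group and lie in K.
lemma exists_algEquiv_swap {c₁ c₀ : R} {θ θ' : L} (hK : θ ∉ (algebraMap K L).range)
    (hsum : θ + θ' = -algebraMap R L c₁) (hprod : θ * θ' = algebraMap R L c₀) :
    (∀ σ : L ≃ₐ[K] L, σ θ = θ ∨ σ θ = θ') ∧ ∃ σ : L ≃ₐ[K] L, σ θ = θ' := by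
  have hc : ∀ (σ : L ≃ₐ[K] L) (r : R), σ (algebraMap R L r) = algebraMap R L r := fun σ r => by
    rw [IsScalarTower.algebraMap_apply R K L, AlgEquiv.commutes]
  have h1 : ∀ σ : L ≃ₐ[K] L, σ θ = θ ∨ σ θ = θ' := by
    intro σ
    have hs := congrArg σ hsum
    have hp := congrArg σ hprod
    rw [map_add, map_neg, hc, ← hsum] at hs
    rw [map_mul, hc, ← hprod] at hp
    have : (σ θ - θ) * (σ θ - θ') = 0 := by linear_combination σ θ * hs - hp
    exact (mul_eq_zero.1 this).imp sub_eq_zero.1 sub_eq_zero.1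
  refine ⟨h1, ?_⟩
  by_contra! h
  exact hK ((InfiniteGalois.mem_range_algebraMap_iff_fixed _).2 fun σ => (h1 σ).resolve_right (h σ))

variable {A : Type*} [CommRing A] [Algebra R A] {α : A →ₐ[R] L} {t : A} {c₁ c₀ : R}
  {K₁ : Type*} [Field K₁] {ψ : A →+* K₁}

omit [IsDomain R] [IsIntegrallyClosed R] [IsGalois K L] in
-- If r + s θ = 0 with s ≠ 0, then θ would lie in K.
lemma injective_of_notMem_range (hgen : ∀ x : A, ∃ r s, x = algebraMap R A r + algebraMap R A s * t)
    (hK : α t ∉ (algebraMap K L).range) : Function.Injective α := by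
  rw [injective_iff_map_eq_zero]
  intro x hx
  obtain ⟨r, s, rfl⟩ := hgen x
  rw [map_add, map_mul, AlgHom.commutes, AlgHom.commutes, IsScalarTower.algebraMap_apply R K L,
    IsScalarTower.algebraMap_apply R K L] at hx
  have hs : s = 0 := by
    by_contra hs
    have hs' : algebraMap K L (algebraMap R K s) ≠ 0 := by
      rw [Ne, FaithfulSMul.algebraMap_eq_zero_iff]
      exact fun h => hs ((IsFractionRing.injective R K) (h.trans (map_zero _).symm))
    refine hK ⟨-(algebraMap R K r) / algebraMap R K s, ?_⟩
    rw [map_div₀, map_neg, div_eq_iff hs']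
    linear_combination -hx
  subst hs
  rw [map_zero, map_zero, zero_mul, add_zero, FaithfulSMul.algebraMap_eq_zero_iff] at hx
  have hr : r = 0 := (IsFractionRing.injective R K) (hx.trans (map_zero _).symm)
  simp [hr]

variable {B : Type*} [CommRing B] [Algebra A B] [IsLocalization ((nonZeroDivisors K₁).comap ψ) B]
  {β : B →+* L} {ψ' : B →+* K₁}

lemma isUnit_of_map_ne_zero (hψ : ∀ a, ψ' (algebraMap A B a) = ψ a) {x : B} (hx : ψ' x ≠ 0) :
    IsUnit x := by
  obtain ⟨a, m, rfl⟩ := IsLocalization.exists_mk'_eq ((nonZeroDivisors K₁).comap ψ) x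
  have ha : a ∈ ((nonZeroDivisors K₁).comap ψ) := by
    refine mem_nonZeroDivisors_of_ne_zero fun h => hx ?_
    have h1 : ψ' (IsLocalization.mk' B a m) * ψ' (algebraMap A B m) = 0 := by
      rw [← map_mul, IsLocalization.mk'_spec, hψ]
      exact h
    refine (mul_eq_zero.1 h1).resolve_right ?_
    rw [hψ]
    exact nonZeroDivisors.ne_zero m.2
  have h2 := IsLocalization.mk'_spec B a m
  exact isUnit_of_mul_isUnit_left (h2 ▸ IsLocalization.map_units B ⟨a, ha⟩)

omit [IsDomain R] [IsIntegrallyClosed R] in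
variable (ψ) in
include ψ in
lemma injective_of_comp (hβ : ∀ a, β (algebraMap A B a) = α a) (hα : Function.Injective α) :
    Function.Injective β := by
  rw [injective_iff_map_eq_zero]
  intro x hx
  obtain ⟨a, m, rfl⟩ := IsLocalization.exists_mk'_eq ((nonZeroDivisors K₁).comap ψ) x
  have h1 := congrArg β (IsLocalization.mk'_spec B a m)
  rw [map_mul, hx, zero_mul, hβ] at h1
  have ha : a = 0 := hα (by rw [← h1, map_zero])
  rw [ha, IsLocalization.mk'_zero]

omit [IsDomain R] [IsIntegrallyClosed R] [IsFractionRing R K] [IsGalois K L] in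
variable (ψ) in
include ψ in
-- The image of B consists of quotients of elements r + s θ, so it is fixed along with θ.
lemma apply_eq_of_comp (hgen : ∀ x : A, ∃ r s, x = algebraMap R A r + algebraMap R A s * t)
    (hβ : ∀ a, β (algebraMap A B a) = α a) (hα : Function.Injective α)
    {σ : L ≃ₐ[K] L} (hσ : σ (α t) = α t) (x : B) : σ (β x) = β x := by
  have hA : ∀ a : A, σ (α a) = α a := by
    intro a
    obtain ⟨r, s, rfl⟩ := hgen a
    simp only [map_add, map_mul, AlgHom.commutes, hσ, IsScalarTower.algebraMap_apply R K L,
      AlgEquiv.commutes]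
  obtain ⟨a, m, rfl⟩ := IsLocalization.exists_mk'_eq ((nonZeroDivisors K₁).comap ψ) x
  have h1 := congrArg β (IsLocalization.mk'_spec B a m)
  rw [map_mul, hβ, hβ] at h1
  have hm : α m ≠ 0 := by
    intro h
    refine nonZeroDivisors.ne_zero m.2 ?_
    rw [show (m : A) = 0 from hα (h.trans (map_zero _).symm), map_zero]
  have h2 := congrArg σ h1
  rw [map_mul, hA, hA, ← h1] at h2
  exact mul_right_cancel₀ hm h2

omit [IsDomain R] in
/-- If a place of a quadratic extension `K(θ)` of the fraction field of an integrally closed ring is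
unramified over this ring, then the residue field is algebraically closed in `K(θ)` for every
section of the residue map. -/
theorem exists_algebraMap_eq_of_fixed [CharZero K₁]
    (hgen : ∀ x : A, ∃ r s, x = algebraMap R A r + algebraMap R A s * t)
    (ht : t ^ 2 + algebraMap R A c₁ * t + algebraMap R A c₀ = 0)
    (hK : α t ∉ (algebraMap K L).range) (hβ : ∀ a, β (algebraMap A B a) = α a)
    (hdisc : ψ (algebraMap R A (c₁ ^ 2 - 4 * c₀)) ≠ 0)
    (s : K₁ →+* B) (hs : ∀ x, ψ' (s x) = x) {C₁ : Type*} [Field C₁] [Algebra K₁ C₁]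
    {κ : C₁ →+* L} (hκ : ∀ x, κ (algebraMap K₁ C₁ x) = β (s x)) {c : C₁} (hc : IsIntegral K₁ c)
    (hfix : ∀ σ : L ≃ₐ[K] L, σ (α t) = α t → σ (κ c) = κ c) : ∃ x, algebraMap K₁ C₁ x = c := by
  have hα := injective_of_notMem_range hgen hK
  have hβi := injective_of_comp ψ hβ hα
  let : Algebra B L := β.toAlgebra
  let : Algebra A L := α.toRingHom.toAlgebra
  have : IsScalarTower A B L := IsScalarTower.of_algebraMap_eq fun a => (hβ a).symm
  have : IsScalarTower R A L := IsScalarTower.of_algebraMap_eq fun r => (α.commutes r).symm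
  have hR : Algebra.IsIntegral R A := by
    have h1 : IsIntegral R t := by
      refine ⟨Polynomial.X ^ 2 + Polynomial.C c₁ * Polynomial.X + Polynomial.C c₀, by monicity!, ?_⟩
      simpa using ht
    refine ⟨fun x => ?_⟩
    obtain ⟨r, s, rfl⟩ := hgen x
    exact isIntegral_algebraMap.add (isIntegral_algebraMap.mul h1)
  have hz : IsIntegral B (κ c) := by
    refine ⟨(minpoly K₁ c).map s, (minpoly.monic hc).map s, ?_⟩
    rw [Polynomial.eval₂_map]
    have : (algebraMap B L).comp s = κ.comp (algebraMap K₁ C₁) := RingHom.ext fun x => (hκ x).symm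
    rw [this, ← Polynomial.hom_eval₂, ← Polynomial.aeval_def, minpoly.aeval, map_zero]
  -- Up to a denominator which is invertible in the local ring, the element is integral over A and
  -- hence over R.
  obtain ⟨m, hm⟩ := hz.exists_multiple_integral_of_isLocalization ((nonZeroDivisors K₁).comap ψ) _
  have hZ : IsIntegral R (α m * κ c) := by
    have := isIntegral_trans (R := R) _ hm
    rwa [Submonoid.smul_def, Algebra.smul_def] at this
  set Z := α m * κ c with hZdef
  clear_value Z
  have hc' : ∀ (σ : L ≃ₐ[K] L) (r : R), σ (algebraMap R L r) = algebraMap R L r := fun σ r => by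
    rw [IsScalarTower.algebraMap_apply R K L, AlgEquiv.commutes]
  have hfixZ : ∀ σ : L ≃ₐ[K] L, σ (α t) = α t → σ Z = Z := by
    intro σ hσ
    have := apply_eq_of_comp ψ (K := K) hgen hβ hα hσ (algebraMap A B m)
    rw [hβ] at this
    rw [hZdef, map_mul, hfix σ hσ, this]
  set θ' := -algebraMap R L c₁ - α t with hθ'
  have htL := congrArg α ht
  simp only [map_add, map_mul, map_pow, AlgHom.commutes, map_zero] at htL
  obtain ⟨hor, σ, hσ⟩ := exists_algEquiv_swap (K := K) (θ := α t) (θ' := θ') (c₁ := c₁) (c₀ := c₀) hK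
    (by rw [hθ']; ring) (by rw [hθ']; linear_combination -htL)
  have hconj : ∀ τ : L ≃ₐ[K] L, τ θ' = -algebraMap R L c₁ - τ (α t) := fun τ => by
    rw [hθ', map_sub, map_neg, hc']
  have hinv : σ.symm θ' = α t := by rw [← hσ, AlgEquiv.symm_apply_apply]
  have hinv' : σ.symm (α t) = θ' := by
    have := hconj σ.symm
    rw [hinv] at this
    rw [hθ']
    linear_combination this
  have hint : IsIntegral R (α t) := (Algebra.IsIntegral.isIntegral t).map α
  have hσZ : IsIntegral R (σ Z) := hZ.map (σ.restrictScalars R)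
  have hinR : ∀ w : L, IsIntegral R w → (∀ τ : L ≃ₐ[K] L, τ w = w) → ∃ r, algebraMap R L r = w := by
    intro w hw hfw
    obtain ⟨u, rfl⟩ := (InfiniteGalois.mem_range_algebraMap_iff_fixed (k := K) w).2 hfw
    have hu : IsIntegral R u := (isIntegral_algebraMap_iff (algebraMap K L).injective).1 hw
    obtain ⟨r, rfl⟩ := IsIntegrallyClosed.isIntegral_iff.1 hu
    exact ⟨r, IsScalarTower.algebraMap_apply R K L r⟩
  -- Since Z is fixed together with θ, every automorphism either fixes θ, Z and σ Z, or exchanges θ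
  -- with θ' and Z with σ Z.
  have hcase : ∀ τ : L ≃ₐ[K] L, (τ (α t) = α t ∧ τ Z = Z ∧ τ (σ Z) = σ Z) ∨
      (τ (α t) = θ' ∧ τ Z = σ Z ∧ τ (σ Z) = Z) := by
    intro τ
    rcases hor τ with h | h
    · refine Or.inl ⟨h, hfixZ τ h, ?_⟩
      have := hfixZ (σ.symm * τ * σ) (by
        simp only [AlgEquiv.mul_apply, hσ, hconj τ, h]
        exact hinv)
      exact (AlgEquiv.symm_apply_eq σ).1 this
    · refine Or.inr ⟨h, ?_, ?_⟩
      · have := hfixZ (σ.symm * τ) (by simp only [AlgEquiv.mul_apply, h]; exact hinv)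
        exact (AlgEquiv.symm_apply_eq σ).1 this
      · refine hfixZ (τ * σ) ?_
        simp only [AlgEquiv.mul_apply, hσ, hconj τ, h]
        rw [hθ']
        ring
  obtain ⟨T, hT⟩ := hinR (Z + σ Z) (hZ.add hσZ) fun τ => by
    rcases hcase τ with ⟨-, h2, h3⟩ | ⟨-, h2, h3⟩ <;> rw [map_add, h2, h3]
    exact add_comm _ _
  -- Both Z - σ Z and 2 θ + c₁ = θ - θ' change sign under the exchange, so their product is rational
  -- and integral.
  obtain ⟨U, hU⟩ := hinR ((Z - σ Z) * (2 * α t + algebraMap R L c₁))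
    ((hZ.sub hσZ).mul (by
      rw [two_mul]
      exact (hint.add hint).add isIntegral_algebraMap)) fun τ => by
    rcases hcase τ with ⟨h1, h2, h3⟩ | ⟨h1, h2, h3⟩ <;>
      rw [map_mul, map_sub, h2, h3, map_add, map_mul, h1, hc', map_ofNat]
    rw [hθ']
    ring
  have hden : 2 * algebraMap R A (c₁ ^ 2 - 4 * c₀) * m ∈ ((nonZeroDivisors K₁).comap ψ) := by
    refine mem_nonZeroDivisors_of_ne_zero ?_
    rw [map_mul, map_mul, map_ofNat]
    exact mul_ne_zero (mul_ne_zero two_ne_zero hdisc) (nonZeroDivisors.ne_zero m.2)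
  set d : ((nonZeroDivisors K₁).comap ψ) := ⟨_, hden⟩ with hd
  -- With T = Z + σ Z and U = (Z - σ Z)(2 θ + c₁), and because (2 θ + c₁)² is the discriminant D,
  -- one gets 2 D Z = T D + U (2 θ + c₁). As 2 D is a unit of the local ring, so is the denominator,
  -- and the element belongs to the local ring.
  let a : A := algebraMap R A T * algebraMap R A (c₁ ^ 2 - 4 * c₀) +
    algebraMap R A U * (2 * t + algebraMap R A c₁)
  have hb : β (IsLocalization.mk' B a d) = κ c := by
    have h1 := congrArg β (IsLocalization.mk'_spec B a d)
    rw [map_mul, hβ, hβ] at h1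
    have hd0 : α d ≠ 0 := by
      intro h
      refine nonZeroDivisors.ne_zero d.2 ?_
      rw [show (d : A) = 0 from hα (h.trans (map_zero _).symm), map_zero]
    apply mul_right_cancel₀ hd0
    rw [h1]
    simp only [a, hd, map_add, map_mul, AlgHom.commutes, hT, hU, map_sub, map_pow, map_ofNat]
    have hZ' : α m * κ c = Z := hZdef.symm
    linear_combination (-2 * (algebraMap R L c₁ ^ 2 - 4 * algebraMap R L c₀)) * hZ' +
      4 * (Z - σ Z) * htL
  -- Reduction along ψ' turns the element of B into a root in K₁ of its minimal polynomial, as the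
  -- section s followed by ψ' is the identity.
  have hroot : (minpoly K₁ c).eval (ψ' (IsLocalization.mk' B a d)) = 0 := by
    have h1 : ((minpoly K₁ c).map s).eval (IsLocalization.mk' B a d) = 0 := by
      apply hβi
      rw [map_zero, ← Polynomial.eval₂_at_apply, Polynomial.eval₂_map, hb]
      have : β.comp s = κ.comp (algebraMap K₁ C₁) := RingHom.ext fun x => (hκ x).symm
      rw [this, ← Polynomial.hom_eval₂, ← Polynomial.aeval_def, minpoly.aeval, map_zero]
    have h2 := congrArg ψ' h1
    rw [map_zero, ← Polynomial.eval₂_at_apply, Polynomial.eval₂_map] at h2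
    have : ψ'.comp s = RingHom.id K₁ := RingHom.ext hs
    rw [this] at h2
    exact h2
  have hdeg := Polynomial.degree_eq_one_of_irreducible_of_root (minpoly.irreducible hc) hroot
  exact minpoly.degree_eq_one_iff.1 hdeg

end Regular

/-! ### The embedding attached to a specialization -/

section Embedding

variable {K L K₁ C₁ : Type*} [Field K] [Field L] [Algebra K L] [IsGalois K L] [Field K₁] [Field C₁]
  [Algebra K₁ C₁] [IsGalois K₁ C₁]

/-- The automorphisms of `L / K` which fix `θ` restrict to automorphisms of `C₁ / K₁`, and every
automorphism of `C₁ / K₁` is obtained, if `K(θ) ∩ C₁ = K₁`. -/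
theorem exists_restrict_and_lift (κ : C₁ →+* L) (θ : L)
    (hfix : ∀ (x : K₁) (σ : L ≃ₐ[K] L), σ θ = θ →
      σ (κ (algebraMap K₁ C₁ x)) = κ (algebraMap K₁ C₁ x))
    (hreg : ∀ c, (∀ σ : L ≃ₐ[K] L, σ θ = θ → σ (κ c) = κ c) → ∃ x, algebraMap K₁ C₁ x = c) :
    (∀ σ : L ≃ₐ[K] L, σ θ = θ → ∃ τ : C₁ ≃ₐ[K₁] C₁, ∀ c, σ (κ c) = κ (τ c)) ∧
    ∀ τ : C₁ ≃ₐ[K₁] C₁, ∃ σ : L ≃ₐ[K] L, σ θ = θ ∧ ∀ c, σ (κ c) = κ (τ c) := by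
  -- By Galois theory membership in K(θ) is invariance under the stabilizer of θ, so the hypotheses
  -- become an embedding of K₁ in F and its algebraic closedness there within C₁.
  let F := IntermediateField.adjoin K {θ}
  have hθF : θ ∈ F := IntermediateField.mem_adjoin_simple_self K θ
  have hmem : ∀ z : L, z ∈ F ↔ ∀ σ : L ≃ₐ[K] L, σ θ = θ → σ z = z := by
    intro z
    constructor
    · intro hz σ hσ
      have h1 : F ≤ IntermediateField.fixedField (MulAction.stabilizer (L ≃ₐ[K] L) θ) := by
        rw [IntermediateField.adjoin_le_iff, Set.singleton_subset_iff]
        exact fun g => g.2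
      exact h1 hz ⟨σ, hσ⟩
    · intro h
      rw [← InfiniteGalois.fixedField_fixingSubgroup F]
      exact fun g => h g.1 ((IntermediateField.mem_fixingSubgroup_iff _ _).1 g.2 θ hθF)
  let j : K₁ →+* F := (κ.comp (algebraMap K₁ C₁)).codRestrict F.toSubfield.toSubring fun x =>
    (hmem _).2 (hfix x)
  let : Algebra K₁ F := j.toAlgebra
  let : Algebra C₁ L := κ.toAlgebra
  let : Algebra K₁ L := (κ.comp (algebraMap K₁ C₁)).toAlgebra
  have : IsScalarTower K₁ F L := IsScalarTower.of_algebraMap_eq fun _ => rfl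
  have : IsScalarTower K₁ C₁ L := IsScalarTower.of_algebraMap_eq fun _ => rfl
  constructor
  · intro σ hσ
    let σ' : L ≃ₐ[F] L := AlgEquiv.ofRingEquiv (f := σ.toRingEquiv) fun x => (hmem _).1 x.2 σ hσ
    exact ⟨restrictGalois K₁ C₁ F L σ', fun c =>
      (algebraMap_restrictGalois (K₁ := K₁) (F := F) σ' c).symm⟩
  · intro τ
    obtain ⟨σ, hσ⟩ := exists_algEquiv_lift (F := F) (L := L) (fun c hc => by
      obtain ⟨z, hz⟩ := hc
      obtain ⟨x, hx⟩ := hreg c ((hmem _).1 (show κ c ∈ F from hz ▸ z.2))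
      exact ⟨x, hx⟩) τ
    exact ⟨σ.restrictScalars K, σ.commutes ⟨θ, hθF⟩, hσ⟩

variable {A ι k : Type*} [CommRing A] [Field k] [Algebra (MvPolynomial ι k) K₁]
  [IsFractionRing (MvPolynomial ι k) K₁] {α : A →+* L} {ψ : A →+* K₁}
  {B : Type*} [CommRing B] [Algebra A B] [IsLocalization ((nonZeroDivisors K₁).comap ψ) B]
  {β : B →+* L} {ψ' : B →+* K₁}

omit [IsGalois K L] [Field K] [Algebra K L] in
/-- A section of the residue map of the local ring of a place. -/
lemma exists_section (hβ : ∀ a, β (algebraMap A B a) = α a)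
    (hψ : ∀ a, ψ' (algebraMap A B a) = ψ a) (c : k →+* A)
    (hc : ∀ z, ψ (c z) = algebraMap (MvPolynomial ι k) K₁ (MvPolynomial.C z)) (nu de : ι → A)
    (hde : ∀ i, ψ (de i) ≠ 0)
    (hnu : ∀ i, ψ (nu i) / ψ (de i) = algebraMap (MvPolynomial ι k) K₁ (MvPolynomial.X i)) :
    ∃ r : K₁ →+* B, (∀ x, ψ' (r x) = x) ∧
      (∀ z, β (r (algebraMap (MvPolynomial ι k) K₁ (MvPolynomial.C z))) = α (c z)) ∧
      ∀ i, β (r (algebraMap (MvPolynomial ι k) K₁ (MvPolynomial.X i))) = α (nu i) / α (de i) := by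
  let d : ι → (nonZeroDivisors K₁).comap ψ := fun i => ⟨de i, mem_nonZeroDivisors_of_ne_zero (hde i)⟩
  let u : ι → B := fun i => IsLocalization.mk' B (nu i) (d i)
  have hu : ∀ i, u i * algebraMap A B (de i) = algebraMap A B (nu i) := fun i =>
    IsLocalization.mk'_spec B (nu i) (d i)
  have hψu : ∀ i, ψ' (u i) = algebraMap (MvPolynomial ι k) K₁ (MvPolynomial.X i) := by
    intro i
    have h := congrArg ψ' (hu i)
    rw [map_mul, hψ, hψ] at h
    rw [← hnu, eq_div_iff (hde i), h]
  have hβu : ∀ i, β (u i) = α (nu i) / α (de i) := by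
    intro i
    have h := congrArg β (hu i)
    rw [map_mul, hβ, hβ] at h
    have h0 : α (de i) ≠ 0 := by
      rw [← hβ]
      exact ((IsLocalization.map_units B (d i)).map β).ne_zero
    rw [eq_div_iff h0, h]
  -- The variables are sent to the given fractions. Composed with ψ' this is the inclusion into the
  -- fraction field, so nonzero polynomials have nonzero residue and become units; the map therefore
  -- extends to K₁.
  let r₀ : MvPolynomial ι k →+* B := MvPolynomial.eval₂Hom ((algebraMap A B).comp c) u
  have hr₀ : ψ'.comp r₀ = algebraMap (MvPolynomial ι k) K₁ := by
    refine MvPolynomial.ringHom_ext (fun z => ?_) fun i => ?_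
    · simp [r₀, hψ, hc]
    · simp [r₀, hψu]
  have hr₀' : ∀ p, ψ' (r₀ p) = algebraMap (MvPolynomial ι k) K₁ p := fun p => RingHom.congr_fun hr₀ p
  have hunit : ∀ p : nonZeroDivisors (MvPolynomial ι k), IsUnit (r₀ p) := fun p => by
    refine isUnit_of_map_ne_zero (ψ := ψ) hψ (x := r₀ p) ?_
    rw [hr₀']
    exact IsFractionRing.to_map_ne_zero_of_mem_nonZeroDivisors p.2
  let r : K₁ →+* B := IsLocalization.lift hunit
  have hr : ∀ p, r (algebraMap (MvPolynomial ι k) K₁ p) = r₀ p := fun p =>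
    IsLocalization.lift_eq hunit p
  refine ⟨r, fun x => ?_, fun z => ?_, fun i => ?_⟩
  · have : ψ'.comp r = RingHom.id K₁ := by
      refine IsLocalization.ringHom_ext (nonZeroDivisors (MvPolynomial ι k)) ?_
      ext p
      · simp [hr, hr₀']
      · simp [hr, hr₀']
    exact RingHom.congr_fun this x
  · rw [hr]
    simp [r₀, hβ]
  · rw [hr]
    simp [r₀, hβu]

variable {R : Type*} [CommRing R] [IsIntegrallyClosed R] [Algebra R K] [IsFractionRing R K]
  [Algebra R L] [IsScalarTower R K L] [Algebra R A]

/-- An unramified place of a quadratic extension of the fraction field of `R` whose residue field is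
a rational function field induces an embedding of algebraic closures which is compatible with
the Galois groups. -/
theorem exists_embedding [IsAlgClosed L] [CharZero K₁] {α : A →ₐ[R] L} {ψ : A →+* K₁} {t : A}
    {c₁ c₀ : R} (hgen : ∀ x : A, ∃ r s, x = algebraMap R A r + algebraMap R A s * t)
    (ht : t ^ 2 + algebraMap R A c₁ * t + algebraMap R A c₀ = 0)
    (hK : α t ∉ (algebraMap K L).range) (hdisc : ψ (algebraMap R A (c₁ ^ 2 - 4 * c₀)) ≠ 0)
    (c : k →+* A)
    (hc : ∀ z, ψ (c z) = algebraMap (MvPolynomial ι k) K₁ (MvPolynomial.C z)) (nu de : ι → A)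
    (hde : ∀ i, ψ (de i) ≠ 0)
    (hnu : ∀ i, ψ (nu i) / ψ (de i) = algebraMap (MvPolynomial ι k) K₁ (MvPolynomial.X i)) :
    ∃ κ : C₁ →+* L,
      (∀ z, κ (algebraMap K₁ C₁ (algebraMap (MvPolynomial ι k) K₁ (MvPolynomial.C z))) = α (c z)) ∧
      (∀ i, κ (algebraMap K₁ C₁ (algebraMap (MvPolynomial ι k) K₁ (MvPolynomial.X i))) =
        α (nu i) / α (de i)) ∧
      (∀ σ : L ≃ₐ[K] L, σ (α t) = α t → ∃ τ : C₁ ≃ₐ[K₁] C₁, ∀ c, σ (κ c) = κ (τ c)) ∧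
      ∀ τ : C₁ ≃ₐ[K₁] C₁, ∃ σ : L ≃ₐ[K] L, σ (α t) = α t ∧ ∀ c, σ (κ c) = κ (τ c) := by
  let M := (nonZeroDivisors K₁).comap ψ
  let B := Localization M
  have hα := injective_of_notMem_range hgen hK
  have hM : ∀ m : M, IsUnit (α.toRingHom m) := fun m => by
    refine IsUnit.mk0 _ fun h => nonZeroDivisors.ne_zero m.2 ?_
    rw [show (m : A) = 0 from hα (h.trans (map_zero _).symm), map_zero]
  have hM' : ∀ m : M, IsUnit (ψ m) := fun m => IsUnit.mk0 _ (nonZeroDivisors.ne_zero m.2)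
  let β : B →+* L := IsLocalization.lift hM
  let ψ' : B →+* K₁ := IsLocalization.lift hM'
  have hβ : ∀ a, β (algebraMap A B a) = α a := fun a => IsLocalization.lift_eq hM a
  have hψ : ∀ a, ψ' (algebraMap A B a) = ψ a := fun a => IsLocalization.lift_eq hM' a
  obtain ⟨r, hr, hrc, hrx⟩ := exists_section (α := α.toRingHom) (ψ := ψ) hβ hψ c hc nu de hde hnu
  let : Algebra K₁ L := (β.comp r).toAlgebra
  -- Any extension to the algebraic extension C₁ will do.
  let κ : C₁ →+* L := (IsAlgClosed.lift (R := K₁) (S := C₁) (M := L)).toRingHom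
  have hκ : ∀ x, κ (algebraMap K₁ C₁ x) = β (r x) := fun x =>
    (IsAlgClosed.lift (R := K₁) (S := C₁) (M := L)).commutes x
  obtain ⟨h1, h2⟩ := exists_restrict_and_lift (K := K) κ (α t)
    (fun x σ hσ => by rw [hκ]; exact apply_eq_of_comp ψ hgen hβ hα hσ _)
    (fun c hc => exists_algebraMap_eq_of_fixed (ψ := ψ) hgen ht hK hβ hdisc r hr hκ
      (Algebra.IsIntegral.isIntegral c) hc)
  exact ⟨κ, fun z => by rw [hκ, hrc]; rfl, fun i => by rw [hκ, hrx]; rfl, h1, h2⟩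

end Embedding

/-! ### The embedding for the generic instance -/

section GenericEmbedding

variable {b s : ℕ} {hs : 4 ≤ s}

lemma disc_ne_zero_of_genCond {R : Type*} [CommRing R] {f : Fin s → Fin (4 + b) → Fin (4 + b) → R}
    (h : genCond hs f ≠ 0) :
    coeffOne hs f ^ 2 - 4 * (coeffZero hs f * coeffTwo hs f) ≠ 0 := by
  intro h0
  rw [genCond, staticCond, h0, mul_zero, mul_zero, zero_mul] at h
  exact h rfl

lemma adjoinRoot_quadratic {R : Type*} [CommRing R] [Nontrivial R] {c₁ c₀ : R} {P : Polynomial R}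
    (hP : P = Polynomial.X ^ 2 + Polynomial.C c₁ * Polynomial.X + Polynomial.C c₀)
    (x : AdjoinRoot P) : ∃ r s, x = algebraMap R (AdjoinRoot P) r +
      algebraMap R (AdjoinRoot P) s * AdjoinRoot.root P := by
  have hm : P.Monic := by rw [hP]; monicity!
  have hd : P.natDegree = 2 := by rw [hP]; compute_degree!
  obtain ⟨p, rfl⟩ := AdjoinRoot.mk_surjective x
  have h1 : AdjoinRoot.mk P p = AdjoinRoot.mk P (p %ₘ P) := by
    rw [AdjoinRoot.mk_eq_mk]
    exact ⟨p /ₘ P, by linear_combination (-1 : Polynomial R) * Polynomial.modByMonic_add_div p P⟩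
  have hne : P ≠ 1 := fun h => by simp [h] at hd
  have h2 : (p %ₘ P).natDegree ≤ 1 := by
    have := Polynomial.natDegree_modByMonic_lt p hm hne
    omega
  obtain ⟨a, c, hac⟩ := Polynomial.exists_eq_X_add_C_of_natDegree_le_one h2
  refine ⟨c, a, ?_⟩
  rw [h1, hac, map_add, map_mul, AdjoinRoot.mk_C, AdjoinRoot.mk_C, AdjoinRoot.mk_X,
    AdjoinRoot.algebraMap_eq, add_comm]

lemma map_det_splitFrame {R S : Type*} [CommRing R] [CommRing S] (φ : R →+* S)
    (f : Fin s → Fin (4 + b) → Fin (4 + b) → R) (C : Fin b → Fin (4 + b) → R) :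
    φ (Matrix.of (splitFrame hs f C)).det =
      (Matrix.of (splitFrame hs (mapFrame f φ) fun q r => φ (C q r))).det := by
  rw [RingHom.map_det]
  congr 1
  ext q r
  change φ (splitFrame hs f C q r) = _
  refine Fin.addCases (fun q => ?_) (fun q => ?_) q
  · simp only [splitFrame, Fin.append_left, Matrix.of_apply]
    fin_cases q <;> rfl
  · simp only [splitFrame, Fin.append_right, Matrix.of_apply]

lemma algebraMap_geometricField_injective (n s : ℕ) : Function.Injective
    (algebraMap (MvPolynomial (Fin s × BelowDiag n) ℂ) (GeometricField n s)) := by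
  rw [IsScalarTower.algebraMap_eq _ (FlagFunctionField n s) (GeometricField n s)]
  exact (algebraMap (FlagFunctionField n s) (GeometricField n s)).injective.comp
    (IsFractionRing.injective _ _)

/-- The frame of the generic tuple of flags. -/
noncomputable def geometricFrame (n s : ℕ) :
    Fin s → Fin n → Fin n → GeometricField n s := fun i q r =>
  algebraMap (MvPolynomial (Fin s × BelowDiag n) ℂ) (GeometricField n s) (genericFrame s n i q r)

/-- A polynomial with a nonzero specialization is nonzero. -/
theorem genCond_geometricFrame_ne_zero (hs : 4 ≤ s) (hb : 0 < b) :
    genCond hs (geometricFrame (4 + b) s) ≠ 0 := by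
  obtain ⟨x, -, -, h, -⟩ := exists_specialization (k := ℂ) hs hb fun _ _ => 0
  change genCond hs (mapFrame (genericFrame s (4 + b)) (algebraMap _ _)) ≠ 0
  rw [← map_genCond]
  intro h0
  replace h0 := algebraMap_geometricField_injective _ _ (h0.trans (map_zero _).symm)
  apply h
  rw [← map_genCond, h0, map_zero]

/-- The induced flags at a transversal of the generic lines have algebraically independent
coordinates, and the embedding of the function field which they define is compatible with the
Galois groups. -/
theorem exists_generic_embedding (hs : 4 ≤ s) (hb : 0 < b) {θ : GeometricField (4 + b) s}
    (hθ : transversalPoly hs (geometricFrame (4 + b) s) θ = 0) :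
    ∃ (C : Fin b → Fin (4 + b) → ℂ) (κ : GeometricField b s →+* GeometricField (4 + b) s),
      let f := geometricFrame (4 + b) s
      let C' := fun r j => algebraMap ℂ (GeometricField (4 + b) s) (C r j)
      let g := inducedVec hs f C' (pVec hs f θ)
      (Matrix.of (splitFrame hs f C')).det ≠ 0 ∧
      (∀ z, κ (algebraMap ℂ _ z) = algebraMap ℂ _ z) ∧
      (∀ i, ∀ q : Fin b, q.val + 1 < b → cellMinor (g i) q q ≠ 0) ∧
      (∀ i pq, κ (algebraMap (FlagFunctionField b s) (GeometricField b s)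
        (algebraMap (MvPolynomial (Fin s × BelowDiag b) ℂ) (FlagFunctionField b s)
          (MvPolynomial.X (i, pq)))) =
        cellMinor (g i) pq.1.2 pq.1.1 / cellMinor (g i) pq.1.2 pq.1.2) ∧
      (∀ σ : GeometricField (4 + b) s ≃ₐ[FlagFunctionField (4 + b) s] GeometricField (4 + b) s,
        σ θ = θ → ∃ τ : GeometricField b s ≃ₐ[FlagFunctionField b s] GeometricField b s,
          ∀ c, σ (κ c) = κ (τ c)) ∧
      ∀ τ : GeometricField b s ≃ₐ[FlagFunctionField b s] GeometricField b s,
        ∃ σ : GeometricField (4 + b) s ≃ₐ[FlagFunctionField (4 + b) s] GeometricField (4 + b) s,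
          σ θ = θ ∧ ∀ c, σ (κ c) = κ (τ c) := by
  let R := MvPolynomial (Fin s × BelowDiag (4 + b)) ℂ
  let K := FlagFunctionField (4 + b) s
  let L := GeometricField (4 + b) s
  let K₁ := FlagFunctionField b s
  let R₁ := MvPolynomial (Fin s × BelowDiag b) ℂ
  -- The flags to be induced are the generic flags of the small problem, with coordinates in K₁.
  obtain ⟨x, t₀, C, hgen, ht₀, hdet, hy⟩ := exists_specialization (k := K₁) hs hb fun i pq =>
    algebraMap R₁ K₁ (MvPolynomial.X (i, pq))
  set φ : R →+* K₁ := (MvPolynomial.aeval (R := ℂ) x).toRingHom with hφ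
  let f₀ := genericFrame s (4 + b)
  let c₁ : R := coeffOne hs f₀
  let c₀ : R := coeffZero hs f₀ * coeffTwo hs f₀
  let P : Polynomial R := Polynomial.X ^ 2 + Polynomial.C c₁ * Polynomial.X + Polynomial.C c₀
  have hPe : ∀ {S : Type} [CommRing S] (i : R →+* S) (y : S),
      P.eval₂ i y = y ^ 2 + i c₁ * y + i c₀ := fun i y => by
    simp only [P, Polynomial.eval₂_add, Polynomial.eval₂_mul, Polynomial.eval₂_pow,
      Polynomial.eval₂_X, Polynomial.eval₂_C]
  have hPφ : P.eval₂ φ t₀ = 0 := by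
    rw [hPe, map_coeffOne, map_mul, map_coeffZero, map_coeffTwo]
    exact ht₀
  have hPL : P.eval₂ (algebraMap R L) θ = 0 := by
    rw [hPe, map_coeffOne, map_mul, map_coeffZero, map_coeffTwo]
    exact hθ
  -- Over R[t] / (P) the frame, the transversal and the minors are defined once; α evaluates them at
  -- the generic transversal and ψ at the special one.
  let A := AdjoinRoot P
  let t : A := AdjoinRoot.root P
  let α : A →ₐ[R] L := AdjoinRoot.liftAlgHom P (Algebra.ofId R L) θ hPL
  let ψ : A →+* K₁ := AdjoinRoot.lift φ t₀ hPφ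
  have hαt : α t = θ := AdjoinRoot.liftAlgHom_root ..
  have hψt : ψ t = t₀ := AdjoinRoot.lift_root hPφ
  have hψr : ∀ r, ψ (algebraMap R A r) = φ r := fun r => AdjoinRoot.lift_of hPφ
  have ht : t ^ 2 + algebraMap R A c₁ * t + algebraMap R A c₀ = 0 :=
    (hPe _ _).symm.trans (AdjoinRoot.eval₂_root P)
  have hK : α t ∉ (algebraMap K L).range := by
    rintro ⟨u, hu⟩
    apply transversalPoly_generic_ne_zero (b := b) hs (FlagFunctionField (4 + b) s) u
    apply (algebraMap K L).injective
    rw [map_transversalPoly, hu, hαt, map_zero]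
    exact hθ
  let fA := mapFrame f₀ (algebraMap R A)
  let CA : Fin b → Fin (4 + b) → A := fun r j => algebraMap R A (MvPolynomial.C (C r j))
  let gA := inducedVec hs fA CA (pVec hs fA t)
  have hgψ : ∀ i q, ψ ∘ gA i q = inducedVec hs (mapFrame f₀ φ)
      (fun r j => algebraMap ℂ K₁ (C r j)) (pVec hs (mapFrame f₀ φ) t₀) i q := by
    intro i q
    have h1 : mapFrame fA ψ = mapFrame f₀ φ := by
      funext i q r
      exact hψr _
    have h2 : (fun r j => ψ (CA r j)) = fun r j => algebraMap ℂ K₁ (C r j) := by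
      funext r j
      simp only [CA, hψr, hφ]
      exact MvPolynomial.aeval_C ..
    rw [comp_inducedVec, comp_pVec, h1, h2, hψt]
  have hgα : ∀ i q, α ∘ gA i q = inducedVec hs (geometricFrame (4 + b) s)
      (fun r j => algebraMap ℂ L (C r j)) (pVec hs (geometricFrame (4 + b) s) θ) i q := by
    intro i q
    have h1 : mapFrame fA α.toRingHom = geometricFrame (4 + b) s := by
      funext i q r
      exact α.commutes _
    have h2 : (fun r j => α.toRingHom (CA r j)) = fun r j => algebraMap ℂ L (C r j) := by
      funext r j
      exact α.commutes _
    have h3 := comp_inducedVec hs fA α.toRingHom CA (pVec hs fA t) i q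
    rw [comp_pVec, h1, h2] at h3
    rw [← hαt]
    exact h3
  have hmψ : ∀ i q p, ψ (cellMinor (gA i) q p) = cellMinor (inducedVec hs (mapFrame f₀ φ)
      (fun r j => algebraMap ℂ K₁ (C r j)) (pVec hs (mapFrame f₀ φ) t₀) i) q p := by
    intro i q p
    rw [map_cellMinor]
    congr 1
    funext q
    exact hgψ i q
  have hmα : ∀ i q p, α (cellMinor (gA i) q p) = cellMinor (inducedVec hs
      (geometricFrame (4 + b) s) (fun r j => algebraMap ℂ L (C r j))
      (pVec hs (geometricFrame (4 + b) s) θ) i) q p := by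
    intro i q p
    refine (map_cellMinor α.toRingHom _ q p).trans ?_
    congr 1
    funext q
    exact hgα i q
  have hlt : ∀ pq : BelowDiag b, pq.1.2.val + 1 < b := fun pq => by
    have := pq.2
    rw [Fin.lt_def] at this
    omega
  obtain ⟨κ, h1, h2, h3, h4⟩ := exists_embedding (C₁ := GeometricField b s) (α := α) (ψ := ψ)
    (ι := Fin s × BelowDiag b) (k := ℂ) (K := K) (adjoinRoot_quadratic rfl) ht hK
    (by
      rw [hψr, map_sub, map_pow, map_mul, map_ofNat, map_coeffOne, map_mul, map_coeffZero,
        map_coeffTwo]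
      exact disc_ne_zero_of_genCond hgen)
    ((algebraMap R A).comp MvPolynomial.C)
    (fun z => by
      rw [RingHom.comp_apply, hψr]
      exact MvPolynomial.aeval_C ..)
    (fun ipq => cellMinor (gA ipq.1) ipq.2.1.2 ipq.2.1.1)
    (fun ipq => cellMinor (gA ipq.1) ipq.2.1.2 ipq.2.1.2)
    (fun ipq => by
      rw [hmψ]
      exact (hy ipq.1).1 _ (hlt _))
    (fun ipq => by
      rw [hmψ, hmψ]
      exact (congrFun (hy ipq.1).2 ipq.2).symm)
  rw [hαt] at h3 h4
  have hα := injective_of_notMem_range (adjoinRoot_quadratic rfl) hK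
  refine ⟨C, κ, ?_, fun z => ?_, fun i q hq => ?_, fun i pq => ?_, h3, h4⟩
  · intro h0
    have h1 := map_det_splitFrame (hs := hs) (algebraMap R L) f₀ fun r j => MvPolynomial.C (C r j)
    have h2 := map_det_splitFrame (hs := hs) φ f₀ fun r j => MvPolynomial.C (C r j)
    -- A determinant which vanished for the generic frame would vanish for the special one.
    apply hdet
    refine Eq.trans ?_ (h2.symm.trans ((congrArg φ (algebraMap_geometricField_injective _ _
      ((h1.trans h0).trans (map_zero _).symm))).trans (map_zero _)))
    congr 3
    funext q r
    exact (MvPolynomial.aeval_C ..).symm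
  · exact (h1 z).trans (α.commutes _)
  · rw [← hmα]
    intro h0
    refine (hy i).1 q hq ?_
    rw [← hmψ, hα (h0.trans (map_zero _).symm), map_zero]
  · rw [← hmα, ← hmα]
    exact h2 (i, pq)

end GenericEmbedding

/-! ### Imprimitive actions with two blocks -/

section Blocks

variable {Γ Δ X Y T : Type*} [Group Γ] [Group Δ] [MulAction Γ X] [MulAction Δ Y] [MulAction Γ T]

/-- A group action with two blocks which are exchanged is a subaction of a wreath product. -/
theorem exists_equiv_of_blocks (p : X → T) (hp : ∀ (σ : Γ) x, p (σ • x) = σ • p x) {u u' : T}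
    (hne : u ≠ u') (hpu : ∀ x, p x = u ∨ p x = u') (Ψ : Y → X) (hΨ : Function.Injective Ψ)
    (hrange : ∀ x, p x = u ↔ ∃ y, Ψ y = x) (horb : ∀ σ : Γ, σ • u = u ∨ σ • u = u')
    (hswap : ∃ σ : Γ, σ • u = u')
    (hres : ∀ σ : Γ, σ • u = u → ∃ τ : Δ, ∀ y, σ • Ψ y = Ψ (τ • y))
    (hlift : ∀ τ : Δ, ∃ σ : Γ, σ • u = u ∧ ∀ y, σ • Ψ y = Ψ (τ • y)) :
    ∃ e : X ≃ Y × Fin 2,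
      (∀ σ : Γ, ∃ (h : Equiv.Perm (Fin 2)) (t : Fin 2 → Δ),
        ∀ y j, e (σ • e.symm (y, j)) = (t (h j) • y, h j)) ∧
      (∀ h : Equiv.Perm (Fin 2), ∃ σ : Γ, ∀ x, (e (σ • x)).2 = h (e x).2) ∧
      ∀ (j : Fin 2) (τ : Δ), ∃ σ : Γ, (∀ x, (e (σ • x)).2 = (e x).2) ∧
        ∀ y, e (σ • e.symm (y, j)) = (τ • y, j) := by
  obtain ⟨ρ, hρ⟩ := hswap
  -- Elements of the group carry the first block to each block, and Y is transported along them.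
  let g : Fin 2 → Γ := ![1, ρ]
  have hg : ∀ j, g j • u = ![u, u'] j := by
    intro j
    fin_cases j
    · exact one_smul _ _
    · exact hρ
  have hginj : ∀ i j, g i • u = g j • u → i = j := by
    intro i j h
    rw [hg, hg] at h
    fin_cases i <;> fin_cases j <;> first | rfl | exact absurd h hne | exact absurd h.symm hne
  have hgex : ∀ v, v = u ∨ v = u' → ∃ j, v = g j • u := by
    rintro v (rfl | rfl)
    · exact ⟨0, (hg 0).symm⟩
    · exact ⟨1, (hg 1).symm⟩
  have hpΨ : ∀ y, p (Ψ y) = u := fun y => (hrange _).2 ⟨y, rfl⟩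
  let E : Y × Fin 2 → X := fun q => g q.2 • Ψ q.1
  have hpE : ∀ q, p (E q) = g q.2 • u := fun q => by rw [hp, hpΨ]
  have hE : Function.Bijective E := by
    constructor
    · rintro ⟨y, i⟩ ⟨y', j⟩ h
      have hij : i = j := hginj _ _ (by rw [← hpE (y, i), ← hpE (y', j), h])
      subst hij
      exact Prod.ext (hΨ (smul_left_cancel _ h)) rfl
    · intro x
      obtain ⟨j, hj⟩ := hgex _ (hpu x)
      obtain ⟨y, hy⟩ := (hrange ((g j)⁻¹ • x)).1 (by rw [hp, hj, inv_smul_smul])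
      exact ⟨(y, j), by simp only [E, hy, smul_inv_smul]⟩
  let e : X ≃ Y × Fin 2 := (Equiv.ofBijective E hE).symm
  have hes : ∀ q, e.symm q = E q := fun q => rfl
  have he2 : ∀ x, p x = g (e x).2 • u := fun x => by
    rw [← hpE, ← hes, Equiv.symm_apply_apply]
  have hgΓ : ∀ (σ : Γ) (j : Fin 2), ∃ i, σ • g j • u = g i • u := by
    intro σ j
    obtain ⟨i, hi⟩ := hgex _ (horb (σ * g j))
    exact ⟨i, by rw [← hi, mul_smul]⟩
  have hperm : ∀ σ : Γ, ∃ h : Equiv.Perm (Fin 2), ∀ j, σ • g j • u = g (h j) • u := by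
    intro σ
    choose h hh using hgΓ σ
    have hinj : Function.Injective h := fun i j hij =>
      hginj i j (smul_left_cancel σ (by rw [hh, hh, hij]))
    exact ⟨Equiv.ofBijective h (Finite.injective_iff_bijective.1 hinj), hh⟩
  have hsnd : ∀ (σ : Γ) (h : Equiv.Perm (Fin 2)), (∀ j, σ • g j • u = g (h j) • u) →
      ∀ x, (e (σ • x)).2 = h (e x).2 := fun σ h hh x =>
    hginj _ _ (by rw [← he2, hp, he2, hh])
  have hfin : ∀ (h h' : Equiv.Perm (Fin 2)) (j : Fin 2), h j = h' j → h = h' := by decide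
  refine ⟨e, fun σ => ?_, fun h => ?_, fun j τ => ?_⟩
  · obtain ⟨h, hh⟩ := hperm σ
    -- The composite of g_j, σ and the inverse of g_{h(j)} stabilizes the first block, so it acts
    -- there through Δ.
    choose t ht using fun j => hres ((g (h j))⁻¹ * σ * g j) (by
      rw [mul_smul, mul_smul, hh, inv_smul_smul])
    refine ⟨h, fun k => t (h.symm k), fun y j => ?_⟩
    rw [← Equiv.eq_symm_apply, hes, hes]
    simp only [E, Equiv.symm_apply_apply]
    rw [← ht, ← mul_smul, ← mul_smul]
    congr 1
    group
  · obtain ⟨h', hh'⟩ := hperm (g (h 0))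
    have : h' = h := hfin _ _ 0 (hginj _ _ (by
      rw [← hh', ← mul_smul, show g 0 = 1 from rfl, mul_one]))
    exact ⟨g (h 0), hsnd _ _ (this ▸ hh')⟩
  · obtain ⟨σ, hσ, hστ⟩ := hlift τ
    obtain ⟨h, hh⟩ := hperm (g j * σ * (g j)⁻¹)
    have h1 : h = 1 := hfin _ _ j (hginj _ _ (by
      rw [← hh, mul_smul, mul_smul, inv_smul_smul, hσ]
      rfl))
    refine ⟨g j * σ * (g j)⁻¹, fun x => by rw [hsnd _ _ hh, h1]; rfl, fun y => ?_⟩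
    rw [← Equiv.eq_symm_apply, hes, hes]
    simp only [E]
    rw [mul_smul, mul_smul, inv_smul_smul, hστ]

end Blocks

/-! ### The Galois action on the solutions of the generic instance -/

section Action

variable {n s k : ℕ} {lam : Fin s → ℕ → ℕ}

lemma genericFlags_space (σ : GeometricField n s ≃ₐ[FlagFunctionField n s] GeometricField n s)
    (i : Fin s) (j : ℕ) : (genericFlags n s i).space j =
      extendCoords (σ : GeometricField n s →+* GeometricField n s) ((genericFlags n s i).space j) := by
  conv_rhs => rw [genericFlags, ← cellFlag_map_space]
  rw [genericFlags]
  congr 2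
  funext pq
  exact (σ.commutes _).symm

lemma conjSubspace_mem (σ : GeometricField n s ≃ₐ[FlagFunctionField n s] GeometricField n s)
    {H : Submodule (GeometricField n s) (Fin n → GeometricField n s)}
    (hH : H ∈ schubertInstance k lam (genericFlags n s)) :
    conjSubspace σ H ∈ schubertInstance k lam (genericFlags n s) := by
  rw [conjSubspace_eq_extendCoords]
  exact (extendCoords_mem_schubertInstance_iff (genericFlags_space σ)).2 hH

/-- The action of the Galois group on the solutions of the generic instance. -/
noncomputable instance : MulAction (GeometricField n s ≃ₐ[FlagFunctionField n s] GeometricField n s)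
    (GenericSolution k n lam) where
  smul σ H := ⟨conjSubspace σ H.1, conjSubspace_mem σ H.2⟩
  one_smul _ := rfl
  mul_smul _ _ _ := rfl

lemma coe_smul (σ : GeometricField n s ≃ₐ[FlagFunctionField n s] GeometricField n s)
    (H : GenericSolution k n lam) : (σ • H).1 = conjSubspace σ H.1 := rfl

lemma toPerm_mem_schubertGaloisGroup
    (σ : GeometricField n s ≃ₐ[FlagFunctionField n s] GeometricField n s) :
    MulAction.toPerm σ ∈ schubertGaloisGroup k n lam := ⟨σ, fun _ => rfl⟩

lemma exists_eq_toPerm {g : Equiv.Perm (GenericSolution k n lam)}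
    (hg : g ∈ schubertGaloisGroup k n lam) :
    ∃ σ : GeometricField n s ≃ₐ[FlagFunctionField n s] GeometricField n s, ∀ H, g H = σ • H := by
  obtain ⟨σ, hσ⟩ := hg
  exact ⟨σ, fun H => Subtype.ext (hσ H)⟩

end Action

/-! ### The Galois group of the fibered problem -/

section FirstFamily

variable {a b s : ℕ} {hs : 4 ≤ s} {ν : Fin s → ℕ → ℕ}

lemma extendCoords_lineSol {k : Type*} [Field k] (σ : k →+* k)
    {f : Fin s → Fin (4 + b) → Fin (4 + b) → k} (hf : mapFrame f σ = f) (θ : k) :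
    extendCoords σ (lineSol hs f θ) = lineSol hs f (σ θ) := by
  rw [lineSol, extendCoords_span, Set.image_pair, comp_qVec, comp_pVec, hf, lineSol]

lemma extendCoords_lineSpan {k : Type*} [Field k] (σ : k →+* k)
    {F : Fin s → CompleteFlag k (Fin (4 + b) → k)}
    (hF : ∀ i j, (F i).space j = extendCoords σ ((F i).space j)) :
    extendCoords σ (lineSpan hs F) = lineSpan hs F := by
  rw [lineSpan, extendCoords_sup, ← hF, ← hF]

/-- An equation over A becomes an equation over C, which is algebraically closed. -/
lemma mem_range_of_isAlgebraic {C L A : Type*} [Field C] [IsAlgClosed C] [Field L] [CommRing A]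
    [Algebra A L] (κ : C →+* L) (hA : ∀ x : A, algebraMap A L x ∈ κ.range)
    (hinj : Function.Injective (algebraMap A L)) {z : L} (hz : IsAlgebraic A z) : z ∈ κ.range := by
  let g : A →+* C := (RingEquiv.ofLeftInverse
    (Function.leftInverse_invFun κ.injective)).symm.toRingHom.comp
      ((algebraMap A L).codRestrict κ.range hA)
  have hg : ∀ x, κ (g x) = algebraMap A L x := fun x =>
    congrArg Subtype.val ((RingEquiv.ofLeftInverse
      (Function.leftInverse_invFun κ.injective)).apply_symm_apply ⟨algebraMap A L x, hA x⟩)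
  have hgi : Function.Injective g := fun x y h => hinj (by rw [← hg, ← hg, h])
  obtain ⟨q, hq0, hq⟩ := hz
  let : Algebra C L := κ.toAlgebra
  have hzC : IsAlgebraic C z := by
    refine ⟨q.map g, (Polynomial.map_ne_zero_iff hgi).2 hq0, ?_⟩
    rw [Polynomial.aeval_def, Polynomial.eval₂_map]
    have : (algebraMap C L).comp g = algebraMap A L := RingHom.ext hg
    rw [this]
    exact hq
  have h1 := IsAlgClosed.degree_eq_one_of_irreducible C (minpoly.irreducible hzC.isIntegral)
  exact minpoly.mem_range_of_degree_eq_one C z h1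

/-- A basis adapted to the generic tuple of flags. -/
noncomputable def geometricBasis (n s : ℕ) :
    Fin s → Basis (Fin n) (GeometricField n s) (Fin n → GeometricField n s) := fun i =>
  CompleteFlag.cellBasis (Pi.basisFun _ _) fun pq =>
    algebraMap (FlagFunctionField n s) (GeometricField n s)
      (algebraMap (MvPolynomial (Fin s × BelowDiag n) ℂ) (FlagFunctionField n s)
        (MvPolynomial.X (i, pq)))

lemma frame_geometricBasis :
    frame (geometricBasis (4 + b) s) = geometricFrame (4 + b) s :=
  (mapFrame_genericFrame (algebraMap (MvPolynomial (Fin s × BelowDiag (4 + b)) ℂ)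
    (GeometricField (4 + b) s)) fun _ _ => IsScalarTower.algebraMap_apply ..).symm

lemma frameFlags_geometricBasis :
    frameFlags (geometricBasis (4 + b) s) = genericFlags (4 + b) s :=
  frameFlags_cellBasis _

lemma algEquiv_algebraMap {n : ℕ}
    (σ : GeometricField n s ≃ₐ[FlagFunctionField n s] GeometricField n s)
    (r : MvPolynomial (Fin s × BelowDiag n) ℂ) :
    σ (algebraMap _ (GeometricField n s) r) = algebraMap _ (GeometricField n s) r := by
  rw [IsScalarTower.algebraMap_apply _ (FlagFunctionField n s) (GeometricField n s),
    AlgEquiv.commutes]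

lemma mapFrame_geometricFrame
    (σ : GeometricField (4 + b) s ≃ₐ[FlagFunctionField (4 + b) s] GeometricField (4 + b) s) :
    mapFrame (geometricFrame (4 + b) s)
      (σ : GeometricField (4 + b) s →+* GeometricField (4 + b) s) = geometricFrame (4 + b) s := by
  funext i q r
  exact algEquiv_algebraMap σ _

set_option maxHeartbeats 1000000 in
/-- The Galois group of the first family is contained in the wreath product of the Galois group of
the fibre with the symmetric group, and contains enough elements. -/
theorem exists_equiv_genericSolution (hab : a < b) (hs : 4 ≤ s) (hν : IsSchubertProblem a b ν) :
    ∃ e : GenericSolution (2 + a) (4 + b) (firstFamily a b ν) ≃ GenericSolution a b ν × Fin 2,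
      (∀ σ ∈ schubertGaloisGroup (2 + a) (4 + b) (firstFamily a b ν),
        e.permCongr σ ∈
          wreathProduct (schubertGaloisGroup a b ν) (⊤ : Subgroup (Equiv.Perm (Fin 2)))) ∧
      (∀ τ : Equiv.Perm (Fin 2),
        ∃ σ ∈ schubertGaloisGroup (2 + a) (4 + b) (firstFamily a b ν),
          ∀ H, (e (σ H)).2 = τ (e H).2) ∧
      (∀ y : Fin 2, ∀ g ∈ schubertGaloisGroup a b ν,
        ∃ σ ∈ schubertGaloisGroup (2 + a) (4 + b) (firstFamily a b ν),
          (∀ H, (e (σ H)).2 = (e H).2) ∧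
          ∀ x, e (σ (e.symm (x, y))) = (g x, y)) := by
  have hb : 0 < b := by omega
  let L := GeometricField (4 + b) s
  let C₁ := GeometricField b s
  have hA : finrank L (Fin (4 + b) → L) = 4 + b := finrank_fin_fun L
  have hQ : finrank L (Fin b → L) = b := finrank_fin_fun L
  have hgen := genCond_geometricFrame_ne_zero hs hb
  rw [← frame_geometricBasis] at hgen
  obtain ⟨hF, hgood⟩ := isTransversal_and_isGoodAt_of_genCond hgen
  have hc := coeffTwo_ne_zero_of_genCond hgen
  obtain ⟨θ, θ', hne, hsum, hprod, hroots⟩ := exists_two_roots (hs := hs) (e := geometricBasis (4 + b) s)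
    (left_ne_zero_of_mul hgen)
  have hθ : transversalPoly hs (frame (geometricBasis (4 + b) s)) θ = 0 := (hroots θ).2 (Or.inl rfl)
  have hgc : goodCond hs (frame (geometricBasis (4 + b) s))
      (pVec hs (frame (geometricBasis (4 + b) s)) θ) ≠ 0 := by
    intro h0
    rw [genCond, normCond_eq_mul hs _ hsum hprod, h0, zero_mul, mul_zero] at hgen
    exact hgen rfl
  obtain ⟨C, κ, hdet, hκC, hmin, hκX, hres, hlift⟩ := exists_generic_embedding hs hb
    (frame_geometricBasis (b := b) ▸ hθ)
  rw [← frame_geometricBasis] at hdet hmin hκX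
  set f := frame (geometricBasis (4 + b) s) with hf
  set F := frameFlags (geometricBasis (4 + b) s) with hFdef
  have hFgen : F = genericFlags (4 + b) s := frameFlags_geometricBasis
  set C' : Fin b → Fin (4 + b) → L := fun r j => algebraMap ℂ L (C r j) with hC'
  set π := splitForm hs f C' with hπdef
  have hπ : LinearMap.ker π = lineSpan hs F := ker_splitForm hdet
  set h := lineSol hs f θ with hh'
  have hh : IsLineSolution b hs F h := isLineSolution_lineSol hF hc hθ
  have hg := hgood h hh
  let Y : Fin s × BelowDiag b → L := fun ipq => κ (algebraMap (FlagFunctionField b s) C₁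
    (algebraMap (MvPolynomial (Fin s × BelowDiag b) ℂ) (FlagFunctionField b s) (MvPolynomial.X ipq)))
  let G : Fin s → CompleteFlag L (Fin b → L) := fun i =>
    cellFlag (Pi.basisFun L (Fin b)) fun pq => Y (i, pq)
  have hG : ∀ i, IsInducedFlag b hs F π h i (G i) := by
    intro i
    have h1 := isInducedFlag_cellFlag hF hc hθ hgc hdet (hmin i)
    have h2 : (fun pq => Y (i, pq)) = _ := funext fun pq => hκX i pq
    simp only [G]
    rw [h2]
    exact h1
  have hGκ : ∀ i j, (G i).space j = extendCoords κ ((genericFlags b s i).space j) := fun i j =>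
    cellFlag_map_space _ j
  have hνp := hν.2.1
  have hYκ : ∀ q : MvPolynomial (Fin s × BelowDiag b) ℂ, MvPolynomial.aeval Y q =
      κ (algebraMap (FlagFunctionField b s) C₁ (algebraMap _ (FlagFunctionField b s) q)) := fun q => by
    let κ' : MvPolynomial (Fin s × BelowDiag b) ℂ →+* L := κ.comp
      ((algebraMap (FlagFunctionField b s) C₁).comp (algebraMap _ (FlagFunctionField b s)))
    have h1 : (MvPolynomial.aeval (R := ℂ) Y).toRingHom = κ' := by
      refine MvPolynomial.ringHom_ext (fun z => ?_) fun ipq => ?_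
      · refine (MvPolynomial.aeval_C ..).trans ((hκC z).symm.trans ?_)
        rfl
      · exact MvPolynomial.aeval_X ..
    exact RingHom.congr_fun h1 q
  have hY : AlgebraicIndependent ℂ Y := by
    intro q q' hqq
    rw [hYκ, hYκ] at hqq
    exact IsFractionRing.injective _ _ ((algebraMap (FlagFunctionField b s) C₁).injective
      (κ.injective hqq))
  -- The solutions lying over θ are parametrized by the solutions of the generic instance of ν,
  -- extended along κ and pulled back into the hull.
  let Ψ₀ : Submodule C₁ (Fin b → C₁) → Submodule L (Fin (4 + b) → L) := fun S =>
    (extendCoords κ S).comap π ⊓ hull b hs F h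
  have hΨmem : ∀ S ∈ schubertInstance a ν (genericFlags b s),
      Ψ₀ S ∈ schubertInstance (2 + a) (firstFamily a b ν) (genericFlags (4 + b) s) := fun S hS => by
    rw [← hFgen]
    exact comap_inf_hull_mem_schubertInstance hπ hab hA hQ hνp hF hh hg hG
      ((extendCoords_mem_schubertInstance_iff hGκ).2 hS)
  let Ψ : GenericSolution a b ν → GenericSolution (2 + a) (4 + b) (firstFamily a b ν) := fun S =>
    ⟨Ψ₀ S.1, hΨmem S.1 S.2⟩
  have hΨV : ∀ S, Ψ₀ S ⊓ lineSpan hs F = h := fun S => comap_inf_hull_inf hπ hh hg _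
  have hΨπ : ∀ S, (Ψ₀ S).map π = extendCoords κ S := fun S =>
    map_comap_inf_hull hπ hA hQ hF hh hg _
  have hΨinj : Function.Injective Ψ := fun S S' hSS => Subtype.ext (extendCoords_injective (κ := κ) (by
    rw [← hΨπ, ← hΨπ]
    exact congrArg (fun H => H.1.map π) hSS))
  have hmemF : ∀ H : GenericSolution (2 + a) (4 + b) (firstFamily a b ν),
      H.1 ∈ schubertInstance (2 + a) (firstFamily a b ν) F := fun H => by
    rw [hFgen]
    exact H.2
  have hsol : ∀ H : GenericSolution (2 + a) (4 + b) (firstFamily a b ν),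
      IsLineSolution b hs F (H.1 ⊓ lineSpan hs F) ∧ H.1 ≤ hull b hs F (H.1 ⊓ lineSpan hs F) :=
    fun H => isLineSolution_of_mem hab hA hνp hF hgood (hmemF H)
  have heq : ∀ (H : GenericSolution (2 + a) (4 + b) (firstFamily a b ν)) (S : GenericSolution a b ν),
      H.1 ⊓ lineSpan hs F = h → H.1.map π = extendCoords κ S.1 → Ψ S = H := fun H S h1 h2 => by
    apply Subtype.ext
    change (extendCoords κ S.1).comap π ⊓ hull b hs F h = H.1
    rw [← h2]
    exact inf_hull_eq_of_map_eq hπ hh hg h1 (h1 ▸ (hsol H).2)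
  -- The block of a solution is the parameter of its transversal.
  choose p hp hpH using fun H => (hsol H).1.exists_eq_lineSol hF hc
  have huniq : ∀ H x, H.1 ⊓ lineSpan hs F = lineSol hs f x → p H = x := fun H x hx =>
    lineSol_injective hF hc (hp H) ((hpH H).symm.trans hx)
  have hσF : ∀ (σ : L ≃ₐ[FlagFunctionField (4 + b) s] L) i j,
      (F i).space j = extendCoords (σ : L →+* L) ((F i).space j) := fun σ i j => by
    rw [hFgen]; exact genericFlags_space σ i j
  have hσf : ∀ σ : L ≃ₐ[FlagFunctionField (4 + b) s] L, mapFrame f (σ : L →+* L) = f := fun σ => by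
    rw [hf, frame_geometricBasis]; exact mapFrame_geometricFrame σ
  have hpσ : ∀ (σ : L ≃ₐ[FlagFunctionField (4 + b) s] L) H, p (σ • H) = σ • p H := fun σ H => by
    apply huniq
    rw [coe_smul, conjSubspace_eq_extendCoords, ← extendCoords_lineSpan (σ : L →+* L) (hσF σ),
      ← extendCoords_inf, hpH H, extendCoords_lineSol _ (hσf σ)]
    rfl
  -- The projection has coefficients in the ring of coordinates, since the complement is complex; so
  -- it commutes with the Galois action.
  have hσπ : ∀ (σ : L ≃ₐ[FlagFunctionField (4 + b) s] L) v, π ((σ : L →+* L) ∘ v) =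
      (σ : L →+* L) ∘ π v := fun σ v => by
    rw [hπdef, comp_splitForm, hσf]
    congr 3
    funext r j
    exact (algEquiv_algebraMap σ (MvPolynomial.C (C r j))).symm
  have htrans : ∀ (σ : L ≃ₐ[FlagFunctionField (4 + b) s] L)
      (τ : C₁ ≃ₐ[FlagFunctionField b s] C₁), σ θ = θ → (∀ c, σ (κ c) = κ (τ c)) →
      ∀ S : GenericSolution a b ν, σ • Ψ S = Ψ (τ • S) := fun σ τ hσ hστ S => by
    refine (heq _ _ ?_ ?_).symm
    · have h1 := hpσ σ (Ψ S)
      rw [huniq (Ψ S) θ (hΨV S.1)] at h1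
      rw [hpH, h1, AlgEquiv.smul_def, hσ]
    · rw [coe_smul, conjSubspace_eq_extendCoords, map_extendCoords (hσπ σ)]
      change extendCoords _ ((Ψ₀ S.1).map π) = _
      rw [hΨπ, coe_smul, conjSubspace_eq_extendCoords, ← extendCoords_comp, ← extendCoords_comp]
      congr 1
      exact RingHom.ext hστ
  -- The image of H solves the instance of the induced flags, whose coordinates Y are algebraically
  -- independent. So it is algebraic over the field they generate and comes from the algebraically
  -- closed field C₁.
  have hsurj : ∀ H : GenericSolution (2 + a) (4 + b) (firstFamily a b ν),
      H.1 ⊓ lineSpan hs F = h → ∃ S, Ψ S = H := fun H hH => by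
    have h1 := map_mem_schubertInstance hπ hab hA hQ hνp hF hgood (hmemF H) (G := G) (fun i => hH ▸ hG i)
    obtain ⟨T, hT, hHT⟩ := exists_isAlgebraic_of_mem_schubertInstance hν hY h1
    obtain ⟨S, hS⟩ := exists_eq_extendCoords (κ := κ) (T := T) fun v hv i =>
      mem_range_of_isAlgebraic κ (fun x => by
        obtain ⟨q, hq⟩ := (Algebra.adjoin_range_eq_range_aeval ℂ Y).le x.2
        exact ⟨_, (hYκ q).symm.trans hq⟩) Subtype.val_injective (hT v hv i)
    have h2 : S ∈ schubertInstance a ν (genericFlags b s) :=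
      (extendCoords_mem_schubertInstance_iff hGκ).1 (by rw [← hS, ← hHT]; exact h1)
    exact ⟨⟨S, h2⟩, heq _ _ hH (hHT.trans hS)⟩
  have hθK : θ ∉ (algebraMap (FlagFunctionField (4 + b) s) L).range := by
    rintro ⟨u, hu⟩
    apply transversalPoly_generic_ne_zero (b := b) hs (FlagFunctionField (4 + b) s) u
    apply (algebraMap (FlagFunctionField (4 + b) s) L).injective
    rw [map_transversalPoly, hu, map_zero]
    rw [hf, frame_geometricBasis] at hθ
    exact hθ
  obtain ⟨horb, hswap⟩ := exists_algEquiv_swap (R := MvPolynomial (Fin s × BelowDiag (4 + b)) ℂ)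
    (K := FlagFunctionField (4 + b) s) (L := L) (θ := θ) (θ' := θ')
    (c₁ := coeffOne hs (genericFrame s (4 + b)))
    (c₀ := coeffZero hs (genericFrame s (4 + b)) * coeffTwo hs (genericFrame s (4 + b))) hθK
    (by
      rw [hsum, map_coeffOne, hf, frame_geometricBasis]
      rfl)
    (by
      rw [hprod, map_mul, map_coeffZero, map_coeffTwo, hf, frame_geometricBasis]
      rfl)
  obtain ⟨e, he1, he2, he3⟩ := exists_equiv_of_blocks (Γ := L ≃ₐ[FlagFunctionField (4 + b) s] L)
    (Δ := C₁ ≃ₐ[FlagFunctionField b s] C₁) p hpσ hne (fun H => (hroots _).1 (hp H)) Ψ hΨinj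
    (fun H => ⟨fun hu => hsurj H (by rw [hpH, hu]), fun ⟨S, hS⟩ => hS ▸ huniq _ _ (hΨV S.1)⟩)
    horb hswap
    (fun σ hσ => by
      obtain ⟨τ, hτ⟩ := hres σ hσ
      exact ⟨τ, htrans σ τ hσ hτ⟩)
    (fun τ => by
      obtain ⟨σ, hσ, hτ⟩ := hlift τ
      exact ⟨σ, hσ, htrans σ τ hσ hτ⟩)
  refine ⟨e, fun g hg => ?_, fun τ => ?_, fun j g hg => ?_⟩
  · obtain ⟨σ, hσ⟩ := exists_eq_toPerm hg
    obtain ⟨w, t, hwt⟩ := he1 σ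
    refine ⟨w, Subgroup.mem_top _, fun j => MulAction.toPerm (t j), fun j =>
      toPerm_mem_schubertGaloisGroup _, fun x j => ?_⟩
    rw [Equiv.permCongr_apply, hσ]
    exact hwt x j
  · obtain ⟨σ, hσ⟩ := he2 τ
    exact ⟨_, toPerm_mem_schubertGaloisGroup σ, hσ⟩
  · obtain ⟨τ, hτ⟩ := exists_eq_toPerm hg
    obtain ⟨σ, hσ1, hσ2⟩ := he3 j τ
    refine ⟨_, toPerm_mem_schubertGaloisGroup σ, hσ1, fun x => ?_⟩
    rw [hτ]
    exact hσ2 x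

end FirstFamily

theorem theorem3p2 (a b s : ℕ) (hab : a < b) (hs : 4 ≤ s) (ν : Fin s → ℕ → ℕ)
    (hν : IsSchubertProblem a b ν) :
    IsSchubertProblem (2 + a) (4 + b) (firstFamily a b ν) ∧
    IsFiberedOver 2 4 a b (firstFamily a b ν) fourLines ν ∧
    ∃ e : GenericSolution (2 + a) (4 + b) (firstFamily a b ν) ≃ GenericSolution a b ν × Fin 2,
      (∀ σ ∈ schubertGaloisGroup (2 + a) (4 + b) (firstFamily a b ν),
        e.permCongr σ ∈
          wreathProduct (schubertGaloisGroup a b ν) (⊤ : Subgroup (Equiv.Perm (Fin 2)))) ∧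
      (∀ τ : Equiv.Perm (Fin 2),
        ∃ σ ∈ schubertGaloisGroup (2 + a) (4 + b) (firstFamily a b ν),
          ∀ H, (e (σ H)).2 = τ (e H).2) ∧
      (∀ y : Fin 2, ∀ g ∈ schubertGaloisGroup a b ν,
        ∃ σ ∈ schubertGaloisGroup (2 + a) (4 + b) (firstFamily a b ν),
          (∀ H, (e (σ H)).2 = (e H).2) ∧
          ∀ x, e (σ (e.symm (x, y))) = (g x, y)) :=
  ⟨isSchubertProblem_firstFamily hab hs hν, isFiberedOver_fourLines hab hs hν,
    exists_equiv_genericSolution hab hs hν⟩
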